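/- All vector spaces are over $\mathbb{Q}$. A connected graded Lie algebra is a graded vector space $L_*=\bigoplus_{s\ge 0}L_s$ with $L_0=0$ and a bilinear bracket $L_s\otimes L_t\to L_{s+t}$ such that, for $|x|=s$, $|y|=t$, $|z|=v$, one has $[x,y]=(-1)^{st+1}[y,x]$ and $(-1)^{sv}[[x,y],z]+(-1)^{st}[[y,z],x]+(-1)^{tv}[[z,x],y]=0$. Let $s\mathcal{L}_0$ be the category of simplicial objects in connected graded Lie algebras. A connected differential bigraded Lie algebra (DBGL) is a bigraded vector space $L_{*,*}=\bigoplus_{p,s\ge 0}L_{p,s}$ with $L_{p,0}=0$ for all $p$, a differential $\partial:L_{p,s}\to L_{p-1,s}$ with $\partial^2=0$, and a bilinear bracket $L_{p,s}\otimes L_{q,t}\to L_{p+q,s+t}$ that satisfies the two identities above with respect to the total degree (so $|x|=p+s$ for $x\in L_{p,s}$), and $\partial[x,y]=[\partial x,y]+(-1)^{|x|}[x,\partial y]$. Let $\mathrm{db}\mathcal{L}_0$ be the category of connected DBGLs. Weak equivalences in $\mathrm{db}\mathcal{L}_0$ are the morphisms inducing isomorphisms in $\partial$-homology; weak equivalences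 in $s\mathcal{L}_0$ are the morphisms inducing isomorphisms on the homotopy groups of the underlying simplicial graded vector spaces, i.e. on the homology of the Moore complexes. The homotopy categories $\mathrm{ho}(s\mathcal{L}_0)$ and $\mathrm{ho}(\mathrm{db}\mathcal{L}_0)$ are the localizations at the weak equivalences. A DBGL is free if, disregarding $\partial$, it is the free bigraded Lie algebra on some bigraded set of generators. A simplicial graded Lie algebra $L_\bullet$ is free if there are graded sets $T^n\subseteq L_n$ such that $L_n$ is the free graded Lie algebra on $T^n$ for each $n\ge 0$, and every degeneracy $s_i:L_n\to L_{n+1}$ maps $T^n$ into $T^{n+1}$. **Proposition.** There are a functor $N:s\mathcal{L}_0\to\mathrm{db}\mathcal{L}_0$ and a left adjoint $N^*:\mathrm{db}\mathcal{L}_0\to s\mathcal{L}_0$ of $N$ such that: 1. $N$ is the Moore complex: for $L_\bullet\in s\mathcal{L}_0$, $$(NL)_{p,s}=\bigcap_{i=1}^{p}\ker\bigl(d_i:L_{p,s}\to L_{p-1,s}\bigr),\qquad \partial=(-1)^s d_0 ,$$ and the bracket of $x\in (NL)_{p,s}$ and $y\in (NL)_{q,t}$ is given by the Eilenberg–Zilber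 shuffle formula $$[\![x,y]\!]=\sum_{(\sigma,\tau)}(-1)^{\varepsilon(\sigma)+pt}\,[s_{\tau_q}\cdots s_{\tau_1}x,\;s_{\sigma_p}\cdots s_{\sigma_1}y],$$ where the sum is over all partitions of $\{0,\dots,p+q-1\}$ into $\sigma=\{\sigma_1<\dots<\sigma_p\}$ and $\tau=\{\tau_1<\dots<\tau_q\}$, and $\varepsilon(\sigma)=p+\sum_{i=1}^{p}(\sigma_i-i)$. On morphisms, $N$ is given by restriction. 2. $N$ and $N^*$ induce equivalences of homotopy categories $\mathrm{ho}(s\mathcal{L}_0)\approx\mathrm{ho}(\mathrm{db}\mathcal{L}_0)$: $N$ preserves weak equivalences, $N^*$ has a total left derived functor, the adjunction between $N^*$ and $N$ induces an adjunction between this derived functor and the functor induced by $N$ on homotopy categories, and both of these functors are equivalences. 3. $N^*$ takes free DBGLs to free simplicial graded Lie algebras. -/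

import Mathlib

open CategoryTheory Opposite Simplicial

universe u

noncomputable section

/-! ### Connected graded Lie algebras over `ℚ` -/

/-- A connected (`V 0 = 0`) non-negatively graded Lie algebra over `ℚ`.  The bracket
`V p ⊗ V q → V (p + q)` is recorded as a bilinear map into `V n` for every `n` with `p + q = n`. -/
structure ConnGrLie where
  V : ℕ → Type u
  [addCommGroup : ∀ s, AddCommGroup (V s)]
  [module : ∀ s, Module ℚ (V s)]
  br : ∀ {p q n : ℕ}, p + q = n → V p →ₗ[ℚ] V q →ₗ[ℚ] V n
  skew : ∀ {p q n : ℕ} (h : p + q = n) (h' : q + p = n) (x : V p) (y : V q),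
    br h x y = (-1 : ℚ) ^ (p * q + 1) • br h' y x
  jacobi : ∀ {p q r n : ℕ} (h₁ : p + q + r = n) (h₂ : q + r + p = n) (h₃ : r + p + q = n)
    (x : V p) (y : V q) (z : V r),
    (-1 : ℚ) ^ (p * r) • br h₁ (br rfl x y) z
      + (-1 : ℚ) ^ (q * p) • br h₂ (br rfl y z) x
      + (-1 : ℚ) ^ (r * q) • br h₃ (br rfl z x) y = 0
  connected : ∀ x : V 0, x = 0

attribute [instance] ConnGrLie.addCommGroup ConnGrLie.module

namespace ConnGrLie

/-- Morphisms of graded Lie algebras: degree-preserving linear maps commuting with the bracket. -/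
@[ext]
structure Hom (L M : ConnGrLie.{u}) where
  map : ∀ s, L.V s →ₗ[ℚ] M.V s
  map_br : ∀ {p q n : ℕ} (h : p + q = n) (x : L.V p) (y : L.V q),
    map n (L.br h x y) = M.br h (map p x) (map q y)

instance : Category.{u} ConnGrLie.{u} where
  Hom L M := Hom L M
  id L := { map := fun _ => LinearMap.id, map_br := fun _ _ _ => rfl }
  comp f g :=
    { map := fun s => g.map s ∘ₗ f.map s
      map_br := fun h x y => by simp [f.map_br, g.map_br] }

/-- The functor taking a graded Lie algebra to its component of degree `s`. -/
def degree (s : ℕ) : ConnGrLie.{u} ⥤ ModuleCat.{u} ℚ where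
  obj L := ModuleCat.of ℚ (L.V s)
  map f := ModuleCat.ofHom (Hom.map f s)

/-- `L` is the free graded Lie algebra on its graded subset `T`: every degree-preserving function
on `T` extends uniquely to a morphism of graded Lie algebras. -/
def IsFreeOn (L : ConnGrLie.{u}) (T : ∀ s, Set (L.V s)) : Prop :=
  ∀ (M : ConnGrLie.{u}) (f : ∀ s, T s → M.V s),
    ∃! φ : L ⟶ M, ∀ (s : ℕ) (x : T s), Hom.map φ s x = f s x

end ConnGrLie

/-! ### Connected bigraded and differential bigraded Lie algebras over `ℚ` -/

/-- A connected (`V p 0 = 0` for all `p`) bigraded Lie algebra over `ℚ`: the signs are those of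
the total degree, and the bracket `V p s ⊗ V q t → V (p + q) (s + t)` is recorded as for
`ConnGrLie`. -/
structure ConnBigrLie where
  V : ℕ → ℕ → Type u
  [addCommGroup : ∀ p s, AddCommGroup (V p s)]
  [module : ∀ p s, Module ℚ (V p s)]
  br : ∀ {p q n s t m : ℕ}, p + q = n → s + t = m → V p s →ₗ[ℚ] V q t →ₗ[ℚ] V n m
  skew : ∀ {p q n s t m : ℕ} (h : p + q = n) (h' : q + p = n) (k : s + t = m) (k' : t + s = m)
    (x : V p s) (y : V q t),
    br h k x y = (-1 : ℚ) ^ ((p + s) * (q + t) + 1) • br h' k' y x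
  jacobi : ∀ {p q r n s t v m : ℕ}
    (h₁ : p + q + r = n) (h₂ : q + r + p = n) (h₃ : r + p + q = n)
    (k₁ : s + t + v = m) (k₂ : t + v + s = m) (k₃ : v + s + t = m)
    (x : V p s) (y : V q t) (z : V r v),
    (-1 : ℚ) ^ ((p + s) * (r + v)) • br h₁ k₁ (br rfl rfl x y) z
      + (-1 : ℚ) ^ ((p + s) * (q + t)) • br h₂ k₂ (br rfl rfl y z) x
      + (-1 : ℚ) ^ ((q + t) * (r + v)) • br h₃ k₃ (br rfl rfl z x) y = 0
  connected : ∀ (p : ℕ) (x : V p 0), x = 0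

attribute [instance] ConnBigrLie.addCommGroup ConnBigrLie.module

/-- Morphisms of bigraded Lie algebras. -/
@[ext]
structure ConnBigrLie.Hom (L M : ConnBigrLie.{u}) where
  map : ∀ p s, L.V p s →ₗ[ℚ] M.V p s
  map_br : ∀ {p q n s t m : ℕ} (h : p + q = n) (k : s + t = m) (x : L.V p s) (y : L.V q t),
    map n m (L.br h k x y) = M.br h k (map p s x) (map q t y)

/-- A connected differential bigraded Lie algebra (DBGL): the differential has bidegree `(-1, 0)`
(it is understood to be zero on `V 0 s`), squares to zero and satisfies
`∂[x,y] = [∂x,y] + (-1)^(p+s) [x,∂y]` for `x` of bidegree `(p, s)`.  The Leibniz rule is split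
according to whether the homological degrees of `x` and `y` are positive. -/
structure ConnDBGL extends ConnBigrLie.{u} where
  d : ∀ p s : ℕ, V (p + 1) s →ₗ[ℚ] V p s
  d_d : ∀ (p s : ℕ) (x : V (p + 1 + 1) s), d p s (d (p + 1) s x) = 0
  leibniz : ∀ {p q n s t m : ℕ} (h : (p + 1) + (q + 1) = n + 1)
    (h₁ : p + (q + 1) = n) (h₂ : (p + 1) + q = n) (k : s + t = m)
    (x : V (p + 1) s) (y : V (q + 1) t),
    d n m (br h k x y) =
      br h₁ k (d p s x) y + (-1 : ℚ) ^ (p + 1 + s) • br h₂ k x (d q t y)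
  leibniz_right_zero : ∀ {p n s t m : ℕ} (h : (p + 1) + 0 = n + 1) (h₁ : p + 0 = n)
    (k : s + t = m) (x : V (p + 1) s) (y : V 0 t),
    d n m (br h k x y) = br h₁ k (d p s x) y
  leibniz_left_zero : ∀ {q n s t m : ℕ} (h : 0 + (q + 1) = n + 1) (h₂ : 0 + q = n)
    (k : s + t = m) (x : V 0 s) (y : V (q + 1) t),
    d n m (br h k x y) = (-1 : ℚ) ^ s • br h₂ k x (d q t y)

namespace ConnDBGL

/-- Morphisms of DBGLs. -/
@[ext]
structure Hom (L M : ConnDBGL.{u}) extends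
    ConnBigrLie.Hom L.toConnBigrLie M.toConnBigrLie where
  map_d : ∀ (p s : ℕ) (x : L.V (p + 1) s), map p s (L.d p s x) = M.d p s (map (p + 1) s x)

instance : Category.{u} ConnDBGL.{u} where
  Hom L M := Hom L M
  id L :=
    { map := fun _ _ => LinearMap.id
      map_br := fun _ _ _ _ => rfl
      map_d := fun _ _ _ => rfl }
  comp f g :=
    { map := fun p s => g.map p s ∘ₗ f.map p s
      map_br := fun h k x y => by simp [f.map_br, g.map_br]
      map_d := fun p s x => by simp [f.map_d, g.map_d] }

/-- The chain complex `L_{*,s}` of a DBGL `L`. -/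
def complex (L : ConnDBGL.{u}) (s : ℕ) : ChainComplex (ModuleCat.{u} ℚ) ℕ :=
  ChainComplex.of (fun p => ModuleCat.of ℚ (L.V p s)) (fun p => ModuleCat.ofHom (L.d p s))
    (fun p => by ext x; exact L.d_d p s x)

/-- The chain map `L_{*,s} → M_{*,s}` underlying a morphism of DBGLs. -/
def complexMap {L M : ConnDBGL.{u}} (f : L ⟶ M) (s : ℕ) : L.complex s ⟶ M.complex s :=
  ChainComplex.ofHom (fun p => ModuleCat.ofHom ((Hom.toHom f).map p s))
    (fun p => by
      simp only [complex, ChainComplex.of_d]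
      ext x
      exact (Hom.map_d f p s x).symm)

/-- The weak equivalences of DBGLs: morphisms inducing isomorphisms in homology. -/
def weakEquivalences : MorphismProperty ConnDBGL.{u} :=
  fun _ _ f => ∀ s : ℕ, QuasiIso (complexMap f s)

/-- A DBGL is free if, forgetting the differential, it is the free bigraded Lie algebra on some
bigraded set of generators `X`. -/
def IsFree (L : ConnDBGL.{u}) : Prop :=
  ∃ X : ∀ p s, Set (L.V p s), ∀ (M : ConnBigrLie.{u}) (f : ∀ p s, X p s → M.V p s),
    ∃! φ : ConnBigrLie.Hom L.toConnBigrLie M, ∀ (p s : ℕ) (x : X p s), φ.map p s x = f p s x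

end ConnDBGL

/-! ### Simplicial connected graded Lie algebras -/

/-- The category of simplicial connected graded Lie algebras. -/
abbrev SConnGrLie := SimplicialObject ConnGrLie.{u}

namespace SConnGrLie

/-- The map `L_{p,s} → L_{n,s}` induced by a morphism `[n] → [p]` of the simplex category. -/
def act (L : SConnGrLie.{u}) {p n : ℕ} (θ : ⦋n⦌ ⟶ ⦋p⦌) (s : ℕ) :
    (L _⦋p⦌).V s →ₗ[ℚ] (L _⦋n⦌).V s :=
  ConnGrLie.Hom.map (L.map θ.op) s

/-- The face map `d_i : L_{p+1,s} → L_{p,s}`. -/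
def face (L : SConnGrLie.{u}) {p : ℕ} (i : Fin (p + 2)) (s : ℕ) :
    (L _⦋p + 1⦌).V s →ₗ[ℚ] (L _⦋p⦌).V s :=
  ConnGrLie.Hom.map (L.δ i) s

/-- The degeneracy map `s_i : L_{p,s} → L_{p+1,s}`. -/
def degen (L : SConnGrLie.{u}) {p : ℕ} (i : Fin (p + 1)) (s : ℕ) :
    (L _⦋p⦌).V s →ₗ[ℚ] (L _⦋p + 1⦌).V s :=
  ConnGrLie.Hom.map (L.σ i) s

/-- For a subset `A` of `{0, ..., n-1}` with `p` elements and complement `{τ_1 < ... < τ_q}`, the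
monotone surjection `[n] → [p]`, `j ↦ #{a ∈ A | a < j}`.  It identifies `τ_k` with `τ_k + 1` for
each `k`, so that the operator it induces on a simplicial object is the iterated degeneracy
`s_{τ_q} ... s_{τ_1}`. -/
def shuffleMap {n p : ℕ} (A : Finset (Fin n)) (hA : A.card = p) : ⦋n⦌ ⟶ ⦋p⦌ :=
  SimplexCategory.Hom.mk
    { toFun := fun j => ⟨(A.filter (fun a : Fin n => (a : ℕ) < (j : ℕ))).card,
        Nat.lt_succ_of_le ((Finset.card_filter_le _ _).trans hA.le)⟩
      monotone' := fun i j hij => Fin.mk_le_mk.2 (Finset.card_le_card (fun a ha => by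
        simp only [Finset.mem_filter] at ha ⊢
        exact ⟨ha.1, lt_of_lt_of_le ha.2 hij⟩)) }

/-- For a shuffle `(σ, τ)` of `{0, ..., n-1}`, with `σ = {σ_1 < ... < σ_p}` and `τ` the complement
of `σ`, the number of pairs `(a, b) ∈ σ × τ` with `b < a`; it equals
`∑ i, (σ_i - (i - 1)) = p + ∑ i, (σ_i - i)`. -/
def shuffleExponent {n : ℕ} (σ : Finset (Fin n)) : ℕ :=
  ∑ a ∈ σ, (σᶜ.filter (fun b => b < a)).card

/-- The simplicial Lie bracket, for `x ∈ L_{p,s}` and `y ∈ L_{q,t}`: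
`∑ (-1)^(ε(σ) + p t) [s_{τ_q} ... s_{τ_1} x, s_{σ_p} ... s_{σ_1} y]`, the sum being taken over all
`(p, q)`-shuffles `(σ, τ)`, where `τ = σᶜ`. -/
def bracket (L : SConnGrLie.{u}) {p q n s t m : ℕ} (h : p + q = n) (k : s + t = m)
    (x : (L _⦋p⦌).V s) (y : (L _⦋q⦌).V t) : (L _⦋n⦌).V m :=
  ∑ σ : {σ : Finset (Fin n) // σ.card = p},
    (-1 : ℚ) ^ (shuffleExponent σ.1 + p * t) •
      (L _⦋n⦌).br k (L.act (shuffleMap σ.1 σ.2) s x)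
        (L.act (shuffleMap (p := q) σ.1ᶜ
          (by rw [Finset.card_compl, Fintype.card_fin, σ.2]; omega)) t y)

/-- The Moore chains `C_{p,s} = ⋂_{i=1}^{p} ker d_i ⊆ L_{p,s}`. -/
def moore (L : SConnGrLie.{u}) (p s : ℕ) : Submodule ℚ ((L _⦋p⦌).V s) :=
  match p with
  | 0 => ⊤
  | p + 1 => ⨅ i : Fin (p + 1), LinearMap.ker (L.face (p := p) i.succ s)

/-- The weak equivalences of simplicial connected graded Lie algebras: morphisms inducing
isomorphisms on all homotopy groups, i.e. in each degree `s` a quasi-isomorphism between the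
(normalized) Moore complexes of the underlying simplicial vector spaces. -/
def weakEquivalences : MorphismProperty SConnGrLie.{u} :=
  fun _ _ f => ∀ s : ℕ, QuasiIso
    ((AlgebraicTopology.normalizedMooreComplex (ModuleCat.{u} ℚ)).map
      (((SimplicialObject.whiskering _ _).obj (ConnGrLie.degree s)).map f))

/-- A simplicial graded Lie algebra is free if there are graded sets `T n` such that each `L_n` is
the free graded Lie algebra on `T n`, and the degeneracies take `T n` to `T (n + 1)`. -/
def IsFree (L : SConnGrLie.{u}) : Prop :=
  ∃ T : ∀ n s, Set ((L _⦋n⦌).V s),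
    (∀ n, (L _⦋n⦌).IsFreeOn (T n)) ∧
    ∀ (n s : ℕ) (i : Fin (n + 1)), ∀ x ∈ T n s, L.degen i s x ∈ T (n + 1) s

end SConnGrLie

/-- A realization of a functor `N` from simplicial connected graded Lie algebras to connected DBGLs
as the Moore complex functor: a natural identification of `(N L)_{p,s}` with the Moore chains
`C_{p,s} ⊆ L_{p,s}`, under which the differential is `(-1)^s d_0` and the bracket is the simplicial
Lie bracket.  Such an `N` is unique up to a unique compatible natural isomorphism. -/
structure MooreRealization (N : SConnGrLie.{u} ⥤ ConnDBGL.{u}) where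
  incl : ∀ (L : SConnGrLie.{u}) (p s : ℕ), (N.obj L).V p s →ₗ[ℚ] (L _⦋p⦌).V s
  incl_injective : ∀ (L : SConnGrLie.{u}) (p s : ℕ), Function.Injective (incl L p s)
  range_incl : ∀ (L : SConnGrLie.{u}) (p s : ℕ), LinearMap.range (incl L p s) = L.moore p s
  incl_d : ∀ (L : SConnGrLie.{u}) (p s : ℕ) (x : (N.obj L).V (p + 1) s),
    incl L p s ((N.obj L).d p s x) = (-1 : ℚ) ^ s • L.face (p := p) 0 s (incl L (p + 1) s x)
  incl_br : ∀ (L : SConnGrLie.{u}) {p q n s t m : ℕ} (h : p + q = n) (k : s + t = m)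
    (x : (N.obj L).V p s) (y : (N.obj L).V q t),
    incl L n m ((N.obj L).br h k x y) = L.bracket h k (incl L p s x) (incl L q t y)
  incl_map : ∀ {L M : SConnGrLie.{u}} (f : L ⟶ M) (p s : ℕ) (x : (N.obj L).V p s),
    incl M p s ((ConnDBGL.Hom.toHom (N.map f)).map p s x) =
      ConnGrLie.Hom.map (f.app (op ⦋p⦌)) s (incl L p s x)

/-- The homotopy category of simplicial connected graded Lie algebras. -/
abbrev HoSConnGrLie := SConnGrLie.weakEquivalences.{u}.Localization

/-- The homotopy category of connected DBGLs. -/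
abbrev HoConnDBGL := ConnDBGL.weakEquivalences.{u}.Localization

end

/-! Once `N` is known to preserve and reflect weak equivalences, the equivalence of homotopy
categories is formal. It needs a left adjoint `N^*`, a functorial resolution `Q A → A`, and a unit
that is a weak equivalence on the objects `Q A` (`exists_derived_equivalence`). The work lies in
four constructions.

The Moore complex. A `(p,q)`-shuffle is a `p`-subset `σ` of `{0, …, n-1}`, acting through the
surjection `j ↦ #{a ∈ σ | a < j}`. In the face `d_{i+1}` of a shuffle product, terms cancel in pairs
by exchanging the letters `i` and `i+1` (`isMoore_sh`). Looking at the letter `0` gives the Leibniz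
rule, and the Jacobi identity holds separately for each ordered partition into three blocks
(`bracket_jacobi`).

The left adjoint. In simplicial degree `n`, `N^*A` is the graded Lie algebra on symbols `θ^*x`, with
`θ : [n] → [p]` and `x ∈ A_p`, modulo the relations that hold in every Moore complex. If `A` is free
on `Y`, it is free on the `θ^*y` with `θ` surjective and `y ∈ Y`. Generation is an induction on
dimension. For independence, solutions of the relations in `M` are obtained from morphisms of `A` to
the Moore complex of the coinduced object `M^{Hom(n,-)}`. Its elements have freely prescribable
values on surjections (`exists_moore_coinduced`), so such morphisms are built one dimension at a
time (`exists_rep`).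

The unit on a free `A`. Embed `(N^*A)_n` in the free associative algebra on the letters `θ^*y`. Over
`ℚ`, the Dynkin operator divided by word length is a retraction (`dynkinProj_lie`). Filter by the
total dimension of the generators in a word. Modulo lower filtration, the differential of `A`
disappears and each letter behaves like a simplex of `Δ^p/∂Δ^p`. The words then split by shape, the
list of their generators, and each shape has one-dimensional homology spanned by the shuffle product
of the generators (`Sphere.relK`, `exists_sphere`). Since the unit sends an element of `A`, written
in words on `Y`, to the corresponding combination of shuffle products (`toWords_unit`), it is
injective. An induction on the filtration shows that a chain whose boundary lies in the image of the
unit is itself in that image up to a boundary (`exists_eq_unit_add_d`). This yields both halves of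
the quasi-isomorphism.

The resolution. Adjoin to the bigraded vector space of `A` a free linear operator `h` of bidegree
`(1,0)` and all brackets, and impose `dh + hd = 1 - gen ∘ aug`. The differential is a section of a
square-zero extension, so universality produces it. The operator `h` is a contracting homotopy onto
`A`, and the result is free on a basis of `A` together with the `h`-images of a basis of the
resolution (`isFree_res`). -/

noncomputable section

/-! ### Derived adjunctions from functorial resolutions -/

section Formal

open CategoryTheory.Functor

variable {C D H : Type*} [Category* C] [Category* D] [Category* H]

/-- Given a functorial resolution `q : Q ⟶ 𝟭 C`, a natural transformation `α : L ⋙ LF ⟶ F` which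
is an isomorphism on the objects `Q.obj X` exhibits `LF` as a left derived functor of `F`. -/
theorem isLeftDerivedFunctor_of_resolution {W : MorphismProperty C} {L : C ⥤ D}
    [L.IsLocalization W] {F : C ⥤ H} {Q : C ⥤ C} (q : Q ⟶ 𝟭 C) (hq : ∀ X, W (q.app X))
    (LF : D ⥤ H) (α : L ⋙ LF ⟶ F) (hαQ : ∀ X, IsIso (α.app (Q.obj X))) :
    LF.IsLeftDerivedFunctor α W := by
  have hL : ∀ X, IsIso (L.map (q.app X)) := fun X => Localization.inverts L W _ (hq X)
  -- The factorization at `X` is forced: go back along the isomorphism `G(L(q X))`, apply `β` at `Q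
  -- X`, where `α` can be inverted, and return along `q X`.
  have key : ∀ (G : D ⥤ H) (β : L ⋙ G ⟶ F), ∃ τ : G ⟶ LF, whiskerLeft L τ ≫ α = β := by
    intro G β
    let τ : L ⋙ G ⟶ L ⋙ LF :=
      { app := fun X => inv (G.map (L.map (q.app X))) ≫ β.app (Q.obj X) ≫
          inv (α.app (Q.obj X)) ≫ LF.map (L.map (q.app X))
        naturality := fun X Y f => by
          dsimp
          rw [← cancel_epi (G.map (L.map (q.app X)))]
          have h1 := β.naturality (Q.map f)
          have h2 := α.naturality (Q.map f)
          have h3 := q.naturality f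
          dsimp at h1 h2 h3
          have h4 : inv (α.app (Q.obj X)) ≫ LF.map (L.map (Q.map f)) =
              F.map (Q.map f) ≫ inv (α.app (Q.obj Y)) := by
            rw [IsIso.inv_comp_eq, ← reassoc_of% h2]; simp
          simp only [IsIso.hom_inv_id_assoc, Category.assoc]
          rw [← reassoc_of% (G.map_comp (L.map (q.app X)) (L.map f)), ← L.map_comp, ← h3]
          simp only [L.map_comp, Functor.map_comp, Category.assoc, IsIso.hom_inv_id_assoc]
          rw [reassoc_of% h1, ← reassoc_of% h4, ← LF.map_comp, ← L.map_comp, h3]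
          simp }
    refine ⟨Localization.liftNatTrans L W _ _ G LF τ, ?_⟩
    ext X
    have h1 := β.naturality (q.app X)
    have h2 := α.naturality (q.app X)
    dsimp at h1 h2
    dsimp
    rw [Localization.liftNatTrans_app]
    simp [τ, h2, Localization.Lifting.iso, ← h1]
  -- On `Q X` the map `α` is an isomorphism, so it can be cancelled; naturality along `L(q X)`
  -- carries the equality to `X`.
  have uniq : ∀ (G : D ⥤ H) (τ τ' : G ⟶ LF), whiskerLeft L τ ≫ α = whiskerLeft L τ' ≫ α →
      τ = τ' := by
    intro G τ τ' h
    refine Localization.natTrans_ext L W fun X => ?_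
    have h1 := congr_app h (Q.obj X)
    dsimp at h1
    rw [cancel_mono] at h1
    have h2 := τ.naturality (L.map (q.app X))
    have h3 := τ'.naturality (L.map (q.app X))
    dsimp at h2 h3
    rw [← cancel_epi (G.map (L.map (q.app X))), h2, h3, h1]
  choose lift hlift using key
  refine ⟨⟨⟨Limits.IsTerminal.ofUniqueHom
    (fun G => CostructuredArrow.homMk (lift G.left G.hom) (hlift G.left G.hom)) ?_⟩⟩⟩
  intro G m
  ext1
  exact uniq _ _ _ ((CostructuredArrow.w m).trans (hlift G.left G.hom).symm)

variable {S : Type*} [Category* S] {DL SL : Type*} [Category* DL] [Category* SL]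

/-- An adjunction `G ⊣ N` in which `N` preserves and reflects weak equivalences, and in which the
unit is a weak equivalence on the values of a functorial resolution, induces an equivalence of
localized categories. -/
theorem exists_derived_equivalence {WS : MorphismProperty S} {WC : MorphismProperty C}
    [WC.HasTwoOutOfThreeProperty] {N : S ⥤ C} {G : C ⥤ S} (adj : G ⊣ N)
    (hN : ∀ {X Y : S} (f : X ⟶ Y), WC (N.map f) → WS f)
    {Q : C ⥤ C} (q : Q ⟶ 𝟭 C) (hq : ∀ X, WC (q.app X))
    (hη : ∀ X, WC (adj.unit.app (Q.obj X)))
    (Qs : S ⥤ SL) [Qs.IsLocalization WS] (Qd : C ⥤ DL) [Qd.IsLocalization WC]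
    (RN : SL ⥤ DL) (β : N ⋙ Qd ≅ Qs ⋙ RN) :
    ∃ (LN : DL ⥤ SL) (α : Qd ⋙ LN ⟶ G ⋙ Qs) (hoAdj : LN ⊣ RN),
      LN.IsLeftDerivedFunctor α WC ∧
      (∀ A : C, hoAdj.unit.app (Qd.obj A) ≫ RN.map (α.app A) =
        Qd.map (adj.unit.app A) ≫ β.hom.app (G.obj A)) ∧
      (∀ B : S, LN.map (β.hom.app B) ≫ hoAdj.counit.app (Qs.obj B) =
        α.app (N.obj B) ≫ Qs.map (adj.counit.app B)) ∧
      LN.IsEquivalence ∧ RN.IsEquivalence := by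
  -- Naturality of the unit and two-out-of-three make `N (G f)` a weak equivalence, and `N` reflects
  -- weak equivalences.
  have hNG : ∀ {X Y : C} (f : Q.obj X ⟶ Q.obj Y), WC f → WS (G.map f) := fun {X Y} f hf => by
    apply hN
    have h : f ≫ adj.unit.app (Q.obj Y) = adj.unit.app (Q.obj X) ≫ N.map (G.map f) :=
      adj.unit.naturality f
    have h1 := WC.comp_mem _ _ hf (hη Y)
    rw [h] at h1
    exact WC.of_precomp _ _ (hη X) h1
  have hQ : ∀ {X Y : C} (f : X ⟶ Y), WC f → WC (Q.map f) := fun {X Y} f hf => by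
    have h : Q.map f ≫ q.app Y = q.app X ≫ f := q.naturality f
    have h1 := WC.comp_mem _ _ (hq X) hf
    rw [← h] at h1
    exact WC.of_postcomp _ _ (hq Y) h1
  have hinv : WC.IsInvertedBy (Q ⋙ G ⋙ Qs) := fun X Y f hf =>
    Localization.inverts Qs WS _ (hNG _ (hQ f hf))
  -- The derived functor is `G` evaluated on resolutions; `α` comes from the augmentation.
  let LN : DL ⥤ SL := Localization.lift _ hinv Qd
  let e : Qd ⋙ LN ≅ Q ⋙ G ⋙ Qs := Localization.fac _ hinv Qd
  let α : Qd ⋙ LN ⟶ G ⋙ Qs := e.hom ≫ whiskerRight q (G ⋙ Qs) ≫ (leftUnitor _).hom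
  have hα : ∀ X, α.app X = e.hom.app X ≫ Qs.map (G.map (q.app X)) := fun X => by simp [α]
  have hαQ : ∀ X, IsIso (α.app (Q.obj X)) := fun X => by
    have : IsIso (Qs.map (G.map (q.app (Q.obj X)))) :=
      Localization.inverts Qs WS _ (hNG _ (hq _))
    rw [hα]; infer_instance
  have i1 : LN.IsLeftDerivedFunctor α WC := isLeftDerivedFunctor_of_resolution q hq LN α hαQ
  -- `Adjunction.derived` requires the derived functors to remain derived after composition with
  -- each other. On the left the resolution criterion applies again; on the right, `N` already
  -- descends to the localizations.
  have i2 : (LN ⋙ RN).IsLeftDerivedFunctor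
      ((Functor.associator _ _ _).inv ≫ whiskerRight α RN) WC :=
    isLeftDerivedFunctor_of_resolution q hq _ _ (fun X => by
      dsimp; rw [Category.id_comp]; infer_instance)
  have i3 : RN.IsRightDerivedFunctor β.hom WS :=
    isRightDerivedFunctor_of_inverts WS RN β.symm
  have i4 : (RN ⋙ LN).IsRightDerivedFunctor
      (whiskerRight β.hom LN ≫ (Functor.associator _ _ _).hom) WS :=
    isRightDerivedFunctor_of_inverts WS (RN ⋙ LN)
      (isoWhiskerRight β LN ≪≫ Functor.associator _ _ _).symm
  let hoAdj : LN ⊣ RN := adj.derived WC WS α β.hom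
  have hu : ∀ A : C, hoAdj.unit.app (Qd.obj A) ≫ RN.map (α.app A) =
      Qd.map (adj.unit.app A) ≫ β.hom.app (G.obj A) :=
    fun A => adj.derivedη_fac_app WC α β.hom A
  have hc : ∀ B : S, LN.map (β.hom.app B) ≫ hoAdj.counit.app (Qs.obj B) =
      α.app (N.obj B) ≫ Qs.map (adj.counit.app B) :=
    fun B => adj.derivedε_fac_app WS α β.hom B
  -- At a resolution `Q A`, every other arrow of the compatibility square is invertible. Naturality
  -- along `q A` and essential surjectivity of the localization give the general case.
  have hunit : ∀ A : DL, IsIso (hoAdj.unit.app A) := by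
    have h1 : ∀ A : C, IsIso (hoAdj.unit.app (Qd.obj (Q.obj A))) := fun A => by
      have h2 := hu (Q.obj A)
      have h3 : IsIso (Qd.map (adj.unit.app (Q.obj A))) := Localization.inverts Qd WC _ (hη A)
      have h4 : IsIso (hoAdj.unit.app (Qd.obj (Q.obj A)) ≫ RN.map (α.app (Q.obj A))) := by
        rw [h2]; infer_instance
      exact IsIso.of_isIso_comp_right _ (RN.map (α.app (Q.obj A)))
    have h2 : ∀ A : C, IsIso (hoAdj.unit.app (Qd.obj A)) := fun A => by
      have h3 : IsIso (Qd.map (q.app A)) := Localization.inverts Qd WC _ (hq A)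
      have h4 := hoAdj.unit.naturality (Qd.map (q.app A))
      have := h1 A
      have h5 : IsIso (Qd.map (q.app A) ≫ hoAdj.unit.app (Qd.obj A)) := by
        have h6 : IsIso ((LN ⋙ RN).map (Qd.map (q.app A))) := inferInstance
        exact h4.symm ▸ inferInstance
      exact IsIso.of_isIso_comp_left (Qd.map (q.app A)) _
    have : Qd.EssSurj := Localization.essSurj Qd WC
    exact fun A => (NatTrans.isIso_app_iff_of_iso hoAdj.unit (Qd.objObjPreimageIso A)).1 (h2 _)
  have hcounit : ∀ B : SL, IsIso (hoAdj.counit.app B) := by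
    have h2 : ∀ B : S, IsIso (hoAdj.counit.app (Qs.obj B)) := fun B => by
      -- This is the transpose of `q` at `N B` under the adjunction: applying `N` and precomposing
      -- with the unit gives back `q`, so two-out-of-three applies.
      have h1 : WS (G.map (q.app (N.obj B)) ≫ adj.counit.app B) := hN _ (by
        have h3 := adj.unit.naturality (q.app (N.obj B))
        have h4 : q.app (N.obj B) = adj.unit.app (Q.obj (N.obj B)) ≫
            N.map (G.map (q.app (N.obj B)) ≫ adj.counit.app B) := by
          rw [N.map_comp]
          have := adj.right_triangle_components B
          dsimp at h3
          rw [← reassoc_of% h3, this, Category.comp_id]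
        exact WC.of_precomp _ _ (hη (N.obj B)) (h4 ▸ hq (N.obj B)))
      have h3 : IsIso (Qs.map (G.map (q.app (N.obj B)) ≫ adj.counit.app B)) :=
        Localization.inverts Qs WS _ h1
      have h4 := hc B
      rw [hα, Category.assoc, ← Qs.map_comp] at h4
      have h5 : IsIso (LN.map (β.hom.app B) ≫ hoAdj.counit.app (Qs.obj B)) := by
        rw [h4]; infer_instance
      exact IsIso.of_isIso_comp_left (LN.map (β.hom.app B)) _
    have : Qs.EssSurj := Localization.essSurj Qs WS
    exact fun B => (NatTrans.isIso_app_iff_of_iso hoAdj.counit (Qs.objObjPreimageIso B)).1 (h2 _)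
  have j1 : IsIso hoAdj.unit := NatIso.isIso_of_isIso_app _
  have j2 : IsIso hoAdj.counit := NatIso.isIso_of_isIso_app _
  exact ⟨LN, α, hoAdj, i1, hu, hc, hoAdj.toEquivalence.isEquivalence_functor,
    hoAdj.toEquivalence.isEquivalence_inverse⟩

end Formal

/-! ### Lie algebras graded by a commutative monoid -/

/-- A Lie algebra over `ℚ` graded by a commutative monoid `I`, with signs given by `ε : I →+ ℕ`. -/
structure GrLie (I : Type) [AddCommMonoid I] (ε : I →+ ℕ) where
  V : I → Type u
  [addCommGroup : ∀ i, AddCommGroup (V i)]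
  [module : ∀ i, Module ℚ (V i)]
  br : ∀ {p q n : I}, p + q = n → V p →ₗ[ℚ] V q →ₗ[ℚ] V n
  skew : ∀ {p q n : I} (h : p + q = n) (h' : q + p = n) (x : V p) (y : V q),
    br h x y = (-1 : ℚ) ^ (ε p * ε q + 1) • br h' y x
  jacobi : ∀ {p q r n : I} (h₁ : p + q + r = n) (h₂ : q + r + p = n) (h₃ : r + p + q = n)
    (x : V p) (y : V q) (z : V r),
    (-1 : ℚ) ^ (ε p * ε r) • br h₁ (br rfl x y) z
      + (-1 : ℚ) ^ (ε q * ε p) • br h₂ (br rfl y z) x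
      + (-1 : ℚ) ^ (ε r * ε q) • br h₃ (br rfl z x) y = 0

attribute [instance] GrLie.addCommGroup GrLie.module

/-- The total degree of a bidegree. -/
def totalDegree : ℕ × ℕ →+ ℕ where
  toFun i := i.1 + i.2
  map_zero' := rfl
  map_add' i j := by simp only [Prod.fst_add, Prod.snd_add]; omega

namespace ConnGrLie

/-- A graded Lie algebra, as a Lie algebra graded by `ℕ`. -/
abbrev toGrLie (L : ConnGrLie.{u}) : GrLie.{u} ℕ (AddMonoidHom.id ℕ) where
  V := L.V
  br := L.br
  skew := L.skew
  jacobi := L.jacobi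

end ConnGrLie

namespace ConnBigrLie

/-- A bigraded Lie algebra, as a Lie algebra graded by `ℕ × ℕ`. -/
abbrev toGrLie (L : ConnBigrLie.{u}) : GrLie.{u} (ℕ × ℕ) totalDegree where
  V i := L.V i.1 i.2
  br h := L.br (congrArg Prod.fst h) (congrArg Prod.snd h)
  skew h h' := L.skew _ _ _ _
  jacobi {p q r _} h₁ h₂ h₃ x y z := by
    rw [mul_comm (totalDegree q) (totalDegree p), mul_comm (totalDegree r) (totalDegree q)]
    exact L.jacobi (congrArg Prod.fst h₁) (congrArg Prod.fst h₂) (congrArg Prod.fst h₃)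
      (congrArg Prod.snd h₁) (congrArg Prod.snd h₂) (congrArg Prod.snd h₃) x y z

end ConnBigrLie

namespace GrLie

/-- A Lie algebra graded by `ℕ` which is zero in degree `0`. -/
abbrev toConnGrLie (L : GrLie.{u} ℕ (AddMonoidHom.id ℕ)) (hL : ∀ x : L.V 0, x = 0) :
    ConnGrLie.{u} where
  V := L.V
  br := L.br
  skew := L.skew
  jacobi := L.jacobi
  connected := hL

/-- A Lie algebra graded by `ℕ × ℕ` which is zero in the bidegrees `(p, 0)`. -/
abbrev toConnBigrLie (L : GrLie.{u} (ℕ × ℕ) totalDegree) (hL : ∀ p (x : L.V (p, 0)), x = 0) :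
    ConnBigrLie.{u} where
  V p s := L.V (p, s)
  br h k := L.br (Prod.ext h k)
  skew h h' k k' := L.skew _ _
  jacobi {p q r _ s t v _} h₁ h₂ h₃ k₁ k₂ k₃ x y z := by
    rw [mul_comm (p + s) (q + t), mul_comm (q + t) (r + v)]
    exact L.jacobi (Prod.ext h₁ k₁) (Prod.ext h₂ k₂) (Prod.ext h₃ k₃) x y z
  connected := hL

end GrLie

/-! ### Universal models -/

section Universal

variable {I : Type} [AddCommMonoid I] (ε : I →+ ℕ) (G : I → Type u) (H : I → I → Type)

/-- Formal Lie terms in generators `G` and unary operators `H`. -/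
inductive LieTerm : I → Type u where
  /-- A generator. -/
  | gen : ∀ {i : I}, G i → LieTerm i
  /-- A unary operator. -/
  | op : ∀ {i j : I}, H i j → LieTerm i → LieTerm j
  /-- Zero. -/
  | zero : ∀ i : I, LieTerm i
  /-- A sum. -/
  | add : ∀ {i : I}, LieTerm i → LieTerm i → LieTerm i
  /-- A scalar multiple. -/
  | smul : ∀ {i : I}, ℚ → LieTerm i → LieTerm i
  /-- A bracket. -/
  | br : ∀ {p q n : I}, p + q = n → LieTerm p → LieTerm q → LieTerm n

/-- A graded Lie algebra with elements indexed by `G` and linear operators indexed by `H`. -/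
structure OpLie extends GrLie.{u} I ε where
  gen : ∀ {i}, G i → V i
  op : ∀ {i j}, H i j → V i →ₗ[ℚ] V j

variable {ε G H}

/-- The value of a formal Lie term. -/
def OpLie.eval (M : OpLie.{u} ε G H) {i : I} (t : LieTerm G H i) : M.V i :=
  LieTerm.rec (motive := fun i _ => M.V i) (fun g => M.gen g) (fun h _ x => M.op h x)
    (fun _ => 0) (fun _ _ x y => x + y) (fun c _ x => c • x) (fun h _ _ x y => M.br h x y) t

variable (P : OpLie.{u} ε G H → Prop)

/-- Two formal terms are identified if they have the same value in every model. -/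
def LieTerm.setoid (i : I) : Setoid (LieTerm G H i) where
  r t t' := ∀ M : OpLie.{u} ε G H, P M → M.eval t = M.eval t'
  iseqv := ⟨fun _ _ _ => rfl, fun h M hM => (h M hM).symm,
    fun h h' M hM => (h M hM).trans (h' M hM)⟩

/-- The components of the universal model of `P`. -/
def Universal (i : I) : Type u := Quotient (LieTerm.setoid P i)

namespace Universal

variable {P} {i j : I}

/-- The class of a formal term. -/
def mk (t : LieTerm G H i) : Universal P i := Quotient.mk _ t

/-- The values of an element of the universal model in all models. -/
def evalAll (x : Universal P i) : ∀ M : {M : OpLie.{u} ε G H // P M}, M.1.V i :=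
  Quotient.lift (fun t M => M.1.eval t) (fun t t' (h : ∀ M : OpLie.{u} ε G H, P M → M.eval t = M.eval t') =>
    funext fun M => h M.1 M.2) x

/-- By construction, elements with equal values in all models are equal, so every algebraic law in
the universal model can be checked model by model. The quantification over models takes place in a
proposition, so the quotient stays in the universe of the models. -/
theorem evalAll_injective : Function.Injective (evalAll (P := P) (i := i)) := by
  rintro ⟨t⟩ ⟨t'⟩ h
  exact Quotient.sound fun M hM => congrFun h ⟨M, hM⟩

instance : Zero (Universal P i) := ⟨mk (.zero i)⟩
instance : Add (Universal P i) :=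
  ⟨Quotient.map₂ .add fun _ _ h _ _ h' M hM => congrArg₂ (· + ·) (h M hM) (h' M hM)⟩
instance : SMul ℚ (Universal P i) :=
  ⟨fun c => Quotient.map (.smul c) fun _ _ h M hM => congrArg (c • ·) (h M hM)⟩
instance : Neg (Universal P i) := ⟨fun x => (-1 : ℚ) • x⟩
instance : Sub (Universal P i) := ⟨fun x y => x + -y⟩
instance : SMul ℕ (Universal P i) := ⟨fun n x => (n : ℚ) • x⟩
instance : SMul ℤ (Universal P i) := ⟨fun n x => (n : ℚ) • x⟩

theorem evalAll_add (x y : Universal P i) : evalAll (x + y) = evalAll x + evalAll y := by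
  rcases x with ⟨t⟩; rcases y with ⟨t'⟩; rfl

theorem evalAll_smul (c : ℚ) (x : Universal P i) : evalAll (c • x) = c • evalAll x := by
  rcases x with ⟨t⟩; rfl

theorem evalAll_neg (x : Universal P i) : evalAll (-x) = -evalAll x :=
  (evalAll_smul _ _).trans (neg_one_smul ℚ _)

instance : AddCommGroup (Universal P i) :=
  Function.Injective.addCommGroup evalAll evalAll_injective rfl evalAll_add evalAll_neg
    (fun x y => by rw [sub_eq_add_neg, ← evalAll_neg, ← evalAll_add]; rfl)
    (fun n x => (evalAll_smul _ _).trans (Nat.cast_smul_eq_nsmul ℚ _ _))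
    (fun n x => (evalAll_smul _ _).trans (Int.cast_smul_eq_zsmul ℚ _ _))

instance : Module ℚ (Universal P i) :=
  Function.Injective.module ℚ ⟨⟨evalAll, rfl⟩, evalAll_add⟩ evalAll_injective evalAll_smul

/-- The value of an element of the universal model in a model. -/
def eval (M : OpLie.{u} ε G H) (hM : P M) (i : I) : Universal P i →ₗ[ℚ] M.V i where
  toFun x := evalAll x ⟨M, hM⟩
  map_add' x y := congrFun (evalAll_add x y) _
  map_smul' c x := congrFun (evalAll_smul c x) _

theorem ext {x y : Universal P i} (h : ∀ M hM, eval M hM i x = eval M hM i y) : x = y :=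
  evalAll_injective (funext fun M => h M.1 M.2)

/-- The bracket of the universal model. -/
def br {p q n : I} (h : p + q = n) : Universal P p →ₗ[ℚ] Universal P q →ₗ[ℚ] Universal P n :=
  LinearMap.mk₂ ℚ
    (Quotient.map₂ (.br h) fun _ _ h' _ _ h'' M hM =>
      congrArg₂ (fun x y => M.br h x y) (h' M hM) (h'' M hM))
    (by rintro ⟨t⟩ ⟨t'⟩ ⟨t''⟩; exact ext fun M hM => LinearMap.map_add₂ _ _ _ _)
    (by rintro c ⟨t⟩ ⟨t'⟩; exact ext fun M hM => LinearMap.map_smul₂ _ _ _ _)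
    (by rintro ⟨t⟩ ⟨t'⟩ ⟨t''⟩; exact ext fun M hM => map_add (M.br h (M.eval t)) _ _)
    (by rintro c ⟨t⟩ ⟨t'⟩; exact ext fun M hM => map_smul (M.br h (M.eval t)) _ _)

theorem eval_br (M : OpLie.{u} ε G H) (hM : P M) {p q n : I} (h : p + q = n)
    (x : Universal P p) (y : Universal P q) :
    eval M hM n (br h x y) = M.br h (eval M hM p x) (eval M hM q y) := by
  rcases x with ⟨t⟩; rcases y with ⟨t'⟩; rfl

variable (P) in
/-- The universal model. -/
abbrev opLie : OpLie.{u} ε G H where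
  V := Universal P
  br := br
  skew h h' x y := ext fun M hM => by simp only [eval_br, map_smul, M.skew h h']
  jacobi h₁ h₂ h₃ x y z := ext fun M hM => by
    simp only [eval_br, map_smul, map_add, map_zero, M.jacobi h₁ h₂ h₃]
  gen g := mk (.gen g)
  op h :=
    { toFun := Quotient.map (.op h) fun _ _ h' M hM => congrArg (M.op h) (h' M hM)
      map_add' := by rintro ⟨t⟩ ⟨t'⟩; exact ext fun M hM => map_add (M.op h) _ _
      map_smul' := by rintro c ⟨t⟩; exact ext fun M hM => map_smul (M.op h) _ _ }

theorem eval_gen (M : OpLie.{u} ε G H) (hM : P M) (g : G i) :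
    eval M hM i ((opLie P).gen g) = M.gen g := rfl

theorem eval_op (M : OpLie.{u} ε G H) (hM : P M) (h : H i j) (x : Universal P i) :
    eval M hM j ((opLie P).op h x) = M.op h (eval M hM i x) := by
  rcases x with ⟨t⟩; rfl

theorem induction {C : ∀ i, Universal P i → Prop}
    (gen : ∀ {i} (g : G i), C i ((opLie P).gen g))
    (op : ∀ {i j} (h : H i j) (x : Universal P i), C i x → C j ((opLie P).op h x))
    (zero : ∀ i, C i 0) (add : ∀ {i} (x y : Universal P i), C i x → C i y → C i (x + y))
    (smul : ∀ {i} (c : ℚ) (x : Universal P i), C i x → C i (c • x))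
    (br : ∀ {p q n : I} (h : p + q = n) (x : Universal P p) (y : Universal P q),
      C p x → C q y → C n ((opLie P).br h x y)) {i : I} (x : Universal P i) : C i x := by
  suffices h : ∀ t : LieTerm G H i, C i (mk t) by rcases x with ⟨t⟩; exact h t
  intro t
  clear x
  induction t with
  | gen g => exact gen g
  | op h t ih => exact op h (mk t) ih
  | zero i => exact zero i
  | add t t' ih ih' => exact add (mk t) (mk t') ih ih'
  | smul c t ih => exact smul c (mk t) ih
  | br h t t' ih ih' => exact br h (mk t) (mk t') ih ih'

end Universal

end Universal

/-! ### Combinatorics of shuffles -/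

section Shuffles

variable {n : ℕ}

/-- The number of elements of `σ` which are smaller than `j`. -/
def cnt (σ : Finset (Fin n)) (j : ℕ) : ℕ := (σ.filter (fun a : Fin n => (a : ℕ) < j)).card

theorem cnt_zero (σ : Finset (Fin n)) : cnt σ 0 = 0 := by simp [cnt]

theorem cnt_succ (σ : Finset (Fin n)) (j : Fin n) :
    cnt σ (j + 1) = cnt σ j + if j ∈ σ then 1 else 0 := by
  have h : σ.filter (fun a : Fin n => (a : ℕ) < j + 1) =
      σ.filter (fun a : Fin n => (a : ℕ) < j) ∪ σ.filter (fun a => a = j) := by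
    ext a
    simp only [Finset.mem_filter, Finset.mem_union, Fin.ext_iff]
    rw [← and_or_left, Nat.lt_succ_iff_lt_or_eq]
  rw [cnt, h, Finset.card_union_of_disjoint]
  · congr 1
    split_ifs with hj
    · rw [Finset.card_eq_one]
      exact ⟨j, by ext a; simp only [Finset.mem_filter, Finset.mem_singleton]; grind⟩
    · rw [Finset.card_eq_zero, Finset.filter_eq_empty_iff]
      rintro a ha rfl
      exact hj ha
  · rw [Finset.disjoint_filter]
    rintro a _ h rfl
    exact lt_irrefl _ h

theorem cnt_of_le (σ : Finset (Fin n)) {j : ℕ} (h : n ≤ j) : cnt σ j = σ.card := by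
  rw [cnt, Finset.filter_true_of_mem fun a _ => a.2.trans_le h]

theorem cnt_le_card (σ : Finset (Fin n)) (j : ℕ) : cnt σ j ≤ σ.card := Finset.card_filter_le _ _

theorem cnt_mono (σ : Finset (Fin n)) {i j : ℕ} (h : i ≤ j) : cnt σ i ≤ cnt σ j :=
  Finset.card_le_card fun a ha => by
    simp only [Finset.mem_filter] at ha ⊢
    exact ⟨ha.1, ha.2.trans_le h⟩

theorem cnt_union {σ τ : Finset (Fin n)} (h : Disjoint σ τ) (j : ℕ) :
    cnt (σ ∪ τ) j = cnt σ j + cnt τ j := by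
  rw [cnt, Finset.filter_union, Finset.card_union_of_disjoint (Finset.disjoint_filter_filter h)]
  rfl

theorem cnt_univ {j : ℕ} (h : j ≤ n) : cnt (Finset.univ : Finset (Fin n)) j = j := by
  induction j with
  | zero => exact cnt_zero _
  | succ j ih => exact (cnt_succ _ ⟨j, h⟩).trans (by simp [ih (Nat.le_of_succ_le h)])

theorem cnt_add_cnt_compl (σ : Finset (Fin n)) {j : ℕ} (h : j ≤ n) :
    cnt σ j + cnt σᶜ j = j := by
  rw [← cnt_union disjoint_compl_right, Finset.union_compl, cnt_univ h]

theorem cnt_lt_card {σ : Finset (Fin n)} {a : Fin n} (ha : a ∈ σ) : cnt σ a < σ.card := by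
  have := cnt_succ σ a
  rw [if_pos ha] at this
  have := cnt_le_card σ (a + 1)
  omega

/-- On `σ`, the counting function is strictly increasing; it is the numbering of the elements of
`σ`. -/
theorem cnt_injOn (σ : Finset (Fin n)) : Set.InjOn (fun a : Fin n => cnt σ a) σ := by
  have key : ∀ a ∈ σ, ∀ b : Fin n, a < b → cnt σ a < cnt σ b := fun a ha b h => by
    have := cnt_succ σ a
    rw [if_pos ha] at this
    have := cnt_mono σ (show (a : ℕ) + 1 ≤ b from Fin.lt_def.1 h)
    omega
  intro a ha b hb h
  rcases lt_trichotomy a b with h' | h' | h'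
  · exact absurd h (key a ha b h').ne
  · exact h'
  · exact absurd h (key b hb a h').ne'

/-- The number of pairs `(a, b) ∈ σ × τ` such that `b < a`. -/
def inversions (σ τ : Finset (Fin n)) : ℕ := ∑ a ∈ σ, cnt τ a

theorem shuffleExponent_eq (σ : Finset (Fin n)) :
    SConnGrLie.shuffleExponent σ = inversions σ σᶜ := rfl

theorem cnt_eq_sum (σ : Finset (Fin n)) (j : Fin n) :
    cnt σ j = ∑ a ∈ σ, if a < j then 1 else 0 := by
  rw [cnt, Finset.card_filter]
  simp only [Fin.lt_def]

theorem inversions_add_inversions {σ τ : Finset (Fin n)} (h : Disjoint σ τ) :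
    inversions σ τ + inversions τ σ = σ.card * τ.card := by
  simp only [inversions, cnt_eq_sum]
  rw [Finset.sum_comm (s := τ), ← Finset.sum_add_distrib]
  simp only [← Finset.sum_add_distrib]
  rw [Finset.sum_congr rfl (fun a ha => Finset.sum_congr rfl (g := fun _ => 1) fun b hb => ?_)]
  · simp
  · have : a ≠ b := fun hab => Finset.disjoint_left.1 h ha (hab ▸ hb)
    rcases lt_or_gt_of_ne this with h' | h' <;> simp [h', h'.not_gt]

theorem inversions_self (σ : Finset (Fin n)) :
    2 * inversions σ σ + σ.card = σ.card * σ.card := by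
  have h : inversions σ σ + inversions σ σ + σ.card = ∑ a ∈ σ, ∑ b ∈ σ, 1 := by
    have h1 : inversions σ σ = ∑ a ∈ σ, ∑ b ∈ σ, if a < b then 1 else 0 := by
      simp only [inversions, cnt_eq_sum]
      rw [Finset.sum_comm]
    have h2 : inversions σ σ = ∑ a ∈ σ, ∑ b ∈ σ, if b < a then 1 else 0 := by
      simp only [inversions, cnt_eq_sum]
    have h3 : σ.card = ∑ a ∈ σ, ∑ b ∈ σ, if a = b then 1 else 0 := by
      rw [Finset.card_eq_sum_ones]
      exact Finset.sum_congr rfl fun a ha => by simp [ha]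
    conv_lhs => rw [h3]
    nth_rw 1 [h1]
    rw [h2]
    simp only [← Finset.sum_add_distrib]
    refine Finset.sum_congr rfl fun a _ => Finset.sum_congr rfl fun b _ => ?_
    rcases lt_trichotomy a b with h' | h' | h'
    · simp [h', h'.not_gt, h'.ne]
    · simp [h']
    · simp [h', h'.not_gt, h'.ne']
  simp at h
  omega

theorem inversions_union_left {σ σ' : Finset (Fin n)} (h : Disjoint σ σ') (τ : Finset (Fin n)) :
    inversions (σ ∪ σ') τ = inversions σ τ + inversions σ' τ :=
  Finset.sum_union h

/-- Exactly `a` letters lie below `a`, and each is in `σ` or in its complement. As the inversions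
inside `σ` depend only on its cardinality, shuffle signs can be compared through sums of letters. -/
theorem inversions_compl_add (σ : Finset (Fin n)) :
    inversions σ σᶜ + inversions σ σ = ∑ a ∈ σ, (a : ℕ) := by
  rw [inversions, inversions, ← Finset.sum_add_distrib]
  refine Finset.sum_congr rfl fun a _ => ?_
  rw [add_comm, cnt_add_cnt_compl σ a.2.le]

/-- Exchanging two adjacent letters, exactly one of which lies in `σ`, changes the sign of a
shuffle. -/
theorem neg_one_pow_inversions_swap {σ : Finset (Fin n)} {i j : Fin n} (hij : (j : ℕ) = i + 1)
    (h : ¬ (i ∈ σ ↔ j ∈ σ)) :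
    (-1 : ℚ) ^ inversions (σ.map (Equiv.swap i j).toEmbedding)
      (σ.map (Equiv.swap i j).toEmbedding)ᶜ = -(-1) ^ inversions σ σᶜ := by
  have h1 := inversions_compl_add σ
  have h2 := inversions_compl_add (σ.map (Equiv.swap i j).toEmbedding)
  have h3 := inversions_self σ
  have h4 := inversions_self (σ.map (Equiv.swap i j).toEmbedding)
  rw [Finset.card_map, ← h3] at h4
  rw [Finset.sum_map] at h2
  -- The swap moves one letter of `σ` by one place, so the sum of its letters changes by exactly
  -- one.
  have h5 : ∃ k : ℕ, (∑ a ∈ σ, ((Equiv.swap i j).toEmbedding a : ℕ) = k + 1 ∧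
      ∑ a ∈ σ, (a : ℕ) = k) ∨ (∑ a ∈ σ, ((Equiv.swap i j).toEmbedding a : ℕ) = k ∧
      ∑ a ∈ σ, (a : ℕ) = k + 1) := by
    by_cases hi : i ∈ σ
    · have hj : j ∉ σ := fun hj => h ⟨fun _ => hj, fun _ => hi⟩
      refine ⟨∑ a ∈ σ, (a : ℕ), Or.inl ⟨?_, rfl⟩⟩
      rw [← Finset.add_sum_erase _ _ hi, ← Finset.add_sum_erase _ _ hi]
      rw [Finset.sum_congr rfl (g := fun a : Fin n => (a : ℕ))]
      · simp [hij]; ring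
      · intro a ha
        rw [Finset.mem_erase] at ha
        rw [Equiv.coe_toEmbedding, Equiv.swap_apply_of_ne_of_ne ha.1
          (ne_of_mem_of_not_mem ha.2 hj)]
    · have hj : j ∈ σ := by by_contra hj; exact h ⟨fun h => (hi h).elim, fun h => (hj h).elim⟩
      refine ⟨∑ a ∈ σ, ((Equiv.swap i j).toEmbedding a : ℕ), Or.inr ⟨rfl, ?_⟩⟩
      rw [← Finset.add_sum_erase _ _ hj, ← Finset.add_sum_erase _ _ hj]
      rw [Finset.sum_congr rfl (g := fun a : Fin n => ((Equiv.swap i j).toEmbedding a : ℕ))]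
      · simp [hij]; ring
      · intro a ha
        rw [Finset.mem_erase] at ha
        rw [Equiv.coe_toEmbedding, Equiv.swap_apply_of_ne_of_ne
          (ne_of_mem_of_not_mem ha.2 hi) ha.1]
  obtain ⟨k, ⟨h5, h6⟩ | ⟨h5, h6⟩⟩ := h5
  · rw [show inversions (σ.map (Equiv.swap i j).toEmbedding)
      (σ.map (Equiv.swap i j).toEmbedding)ᶜ = inversions σ σᶜ + 1 by omega, pow_succ]
    ring
  · rw [show inversions σ σᶜ = inversions (σ.map (Equiv.swap i j).toEmbedding)
      (σ.map (Equiv.swap i j).toEmbedding)ᶜ + 1 by omega, pow_succ]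
    ring

theorem map_swap_eq_self {σ : Finset (Fin n)} {i j : Fin n} (h : i ∈ σ ↔ j ∈ σ) :
    σ.map (Equiv.swap i j).toEmbedding = σ := by
  ext a
  simp only [Finset.mem_map_equiv, Equiv.symm_swap]
  by_cases h1 : a = i
  · subst h1; simp [h]
  · by_cases h2 : a = j
    · subst h2; simp [h]
    · rw [Equiv.swap_apply_of_ne_of_ne h1 h2]

theorem map_swap_map_swap (σ : Finset (Fin n)) (i j : Fin n) :
    (σ.map (Equiv.swap i j).toEmbedding).map (Equiv.swap i j).toEmbedding = σ := by
  ext a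
  simp [Finset.mem_map_equiv]

theorem compl_map_swap (σ : Finset (Fin n)) (i j : Fin n) :
    (σ.map (Equiv.swap i j).toEmbedding)ᶜ = σᶜ.map (Equiv.swap i j).toEmbedding := by
  ext a
  simp [Finset.mem_map_equiv]

theorem cnt_map_swap (σ : Finset (Fin n)) {i j : Fin n} (hij : (j : ℕ) = i + 1) {k : ℕ}
    (hk : k ≠ j) : cnt (σ.map (Equiv.swap i j).toEmbedding) k = cnt σ k := by
  rw [cnt, Finset.filter_map, Finset.card_map, cnt]
  congr 1
  refine Finset.filter_congr fun a _ => ?_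
  simp only [Function.comp, Equiv.coe_toEmbedding]
  rw [Equiv.swap_apply_def]
  split_ifs with h1 h2
  · subst h1; omega
  · subst h2; omega
  · rfl

/-! The first letter of a shuffle. -/

/-- A shuffle either leaves its first letter to the complement or takes it. This recursion underlies
all computations of the zeroth face of a shuffle product. -/
theorem sum_powersetCard_succ {M : Type*} [AddCommMonoid M] {m : ℕ} (p : ℕ)
    (F : Finset (Fin (m + 1)) → M) :
    ∑ σ ∈ Finset.powersetCard (p + 1) Finset.univ, F σ =
      ∑ σ ∈ Finset.powersetCard (p + 1) (Finset.univ : Finset (Fin m)),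
        F (σ.map (Fin.succEmb m)) +
      ∑ σ ∈ Finset.powersetCard p (Finset.univ : Finset (Fin m)),
        F (insert 0 (σ.map (Fin.succEmb m))) := by
  have h0 : ∀ σ : Finset (Fin m), (0 : Fin (m + 1)) ∉ σ.map (Fin.succEmb m) := fun σ h => by
    simp [Fin.succ_ne_zero] at h
  have h1 : (Finset.univ : Finset (Fin (m + 1))) =
      insert 0 (Finset.univ.map (Fin.succEmb m)) := by
    rw [Fin.univ_succ, Finset.cons_eq_insert]; rfl
  rw [h1, Finset.powersetCard_succ_insert (h0 _),
    Finset.sum_union, Finset.sum_image, Finset.powersetCard_map, Finset.powersetCard_map,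
    Finset.sum_map, Finset.sum_map]
  · rfl
  · intro σ hσ τ hτ h
    rw [Finset.powersetCard_map] at hσ hτ
    simp only [Finset.coe_map, Set.mem_image] at hσ hτ
    obtain ⟨σ, _, rfl⟩ := hσ
    obtain ⟨τ, _, rfl⟩ := hτ
    have := congrArg (fun s => Finset.erase s 0) h
    simpa [Finset.mapEmbedding_apply, Finset.erase_insert (h0 _)] using this
  · rw [Finset.disjoint_left]
    intro σ hσ hσ'
    rw [Finset.mem_image] at hσ'
    obtain ⟨τ, _, rfl⟩ := hσ'
    exact h0 _ ((Finset.mem_powersetCard.1 hσ).1 (Finset.mem_insert_self _ _))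

theorem cnt_map_succ {m : ℕ} (σ : Finset (Fin m)) (j : ℕ) :
    cnt (σ.map (Fin.succEmb m)) (j + 1) = cnt σ j := by
  rw [cnt, Finset.filter_map, Finset.card_map, cnt]
  congr 1
  refine Finset.filter_congr fun a _ => ?_
  simp

theorem cnt_insert_zero_map_succ {m : ℕ} (σ : Finset (Fin m)) (j : ℕ) :
    cnt (insert 0 (σ.map (Fin.succEmb m))) (j + 1) = cnt σ j + 1 := by
  rw [cnt, Finset.filter_insert, if_pos (by simp), Finset.card_insert_of_notMem, ← cnt,
    cnt_map_succ]
  simp [Fin.succ_ne_zero]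

theorem compl_map_succ {m : ℕ} (σ : Finset (Fin m)) :
    (σ.map (Fin.succEmb m))ᶜ = insert 0 (σᶜ.map (Fin.succEmb m)) := by
  ext a
  refine Fin.cases ?_ (fun a => ?_) a
  · simp [Fin.succ_ne_zero]
  · simp [Fin.succ_ne_zero]

theorem compl_insert_zero_map_succ {m : ℕ} (σ : Finset (Fin m)) :
    (insert 0 (σ.map (Fin.succEmb m)))ᶜ = σᶜ.map (Fin.succEmb m) := by
  rw [← compl_compl σ, ← compl_map_succ, compl_compl, compl_compl]

/-- The new letter `0` of the complement lies below every element of `σ`, adding one inversion for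
each. If `0` joins `σ` instead, nothing lies below it and the count is unchanged. -/
theorem inversions_map_succ {m : ℕ} (σ : Finset (Fin m)) :
    inversions (σ.map (Fin.succEmb m)) (σ.map (Fin.succEmb m))ᶜ =
      inversions σ σᶜ + σ.card := by
  rw [compl_map_succ, inversions, Finset.sum_map]
  simp only [Fin.coe_succEmb, Fin.val_succ, cnt_insert_zero_map_succ, Finset.sum_add_distrib]
  simp [inversions]

theorem inversions_insert_zero_map_succ {m : ℕ} (σ : Finset (Fin m)) :
    inversions (insert 0 (σ.map (Fin.succEmb m))) (insert 0 (σ.map (Fin.succEmb m)))ᶜ =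
      inversions σ σᶜ := by
  rw [compl_insert_zero_map_succ, inversions, Finset.sum_insert (by simp [Fin.succ_ne_zero]),
    Finset.sum_map]
  simp [cnt_zero, cnt_map_succ, inversions]

/-! Iterated shuffles. -/

/-- The subset of `σ` corresponding to a subset `ρ` of `{0, ..., |σ| - 1}`. -/
def pull {k : ℕ} (σ : Finset (Fin n)) (ρ : Finset (Fin k)) : Finset (Fin n) :=
  σ.filter fun a => ∃ b ∈ ρ, (b : ℕ) = cnt σ a

/-- Selecting from `σ` by a subset of its positions corresponds to composing counting functions,
hence to composing degeneracies. -/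
theorem cnt_pull {k : ℕ} (σ : Finset (Fin n)) (hσ : σ.card = k) (ρ : Finset (Fin k)) {j : ℕ}
    (hj : j ≤ n) : cnt (pull σ ρ) j = cnt ρ (cnt σ j) := by
  induction j with
  | zero => simp [cnt_zero]
  | succ j ih =>
    have h1 := cnt_succ σ ⟨j, hj⟩
    have h2 := cnt_succ (pull σ ρ) ⟨j, hj⟩
    have ih := ih (Nat.le_of_succ_le hj)
    dsimp only at h1 h2
    by_cases h : (⟨j, hj⟩ : Fin n) ∈ σ
    · have h3 := cnt_lt_card h
      rw [hσ] at h3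
      have h4 := cnt_succ ρ ⟨_, h3⟩
      dsimp only at h3 h4
      rw [h2, h1, if_pos h, h4, ih]
      congr 1
      refine if_congr ?_ rfl rfl
      simp only [pull, Finset.mem_filter, h, true_and]
      constructor
      · rintro ⟨b, hb, hb'⟩
        rwa [show (⟨cnt σ j, h3⟩ : Fin k) = b from Fin.ext hb'.symm]
      · exact fun h => ⟨_, h, rfl⟩
    · rw [h2, h1, if_neg h, if_neg (show _ ∉ pull σ ρ from fun h' => h (Finset.mem_filter.1 h').1),
        add_zero, add_zero, ih]

theorem card_pull {k : ℕ} (σ : Finset (Fin n)) (hσ : σ.card = k) (ρ : Finset (Fin k)) :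
    (pull σ ρ).card = ρ.card := by
  rw [← cnt_of_le _ le_rfl, cnt_pull σ hσ ρ le_rfl, cnt_of_le σ le_rfl, hσ, cnt_of_le ρ le_rfl]

theorem disjoint_pull {k : ℕ} (σ : Finset (Fin n)) (ρ : Finset (Fin k)) :
    Disjoint (pull σ ρ) (pull σ ρᶜ) := by
  rw [Finset.disjoint_left]
  intro a ha ha'
  obtain ⟨_, b, hb, h⟩ := Finset.mem_filter.1 ha
  obtain ⟨_, c, hc, h'⟩ := Finset.mem_filter.1 ha'
  rw [Fin.ext (h.trans h'.symm) ] at hb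
  exact Finset.mem_compl.1 hc hb

theorem pull_union_pull {k : ℕ} (σ : Finset (Fin n)) (hσ : σ.card = k) (ρ : Finset (Fin k)) :
    pull σ ρ ∪ pull σ ρᶜ = σ := by
  ext a
  simp only [pull, Finset.mem_union, Finset.mem_filter, ← and_or_left, and_iff_left_iff_imp]
  intro ha
  have h3 := cnt_lt_card ha
  rw [hσ] at h3
  by_cases h : (⟨_, h3⟩ : Fin k) ∈ ρ
  · exact Or.inl ⟨_, h, rfl⟩
  · exact Or.inr ⟨_, Finset.mem_compl.2 h, rfl⟩

/-- The numbering of `σ` is an order isomorphism onto `{0, …, k-1}`, so it preserves inversions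
between parts of `σ`. -/
theorem inversions_pull {k : ℕ} (σ : Finset (Fin n)) (hσ : σ.card = k) (ρ : Finset (Fin k)) :
    inversions (pull σ ρ) (pull σ ρᶜ) = inversions ρ ρᶜ := by
  have h3 : ∀ a ∈ pull σ ρ, cnt σ a < k := fun a ha =>
    (cnt_lt_card (Finset.mem_filter.1 ha).1).trans_eq hσ
  refine Finset.sum_bij (fun a ha => ⟨cnt σ a, h3 a ha⟩) ?_ ?_ ?_ ?_
  · intro a ha
    obtain ⟨_, b, hb, h⟩ := Finset.mem_filter.1 ha
    rwa [show (⟨cnt σ a, h3 a ha⟩ : Fin k) = b from Fin.ext h.symm]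
  · intro a ha b hb h
    exact cnt_injOn σ (Finset.mem_filter.1 ha).1 (Finset.mem_filter.1 hb).1 (Fin.ext_iff.1 h)
  · intro b hb
    have hs : Finset.image (fun a : Fin n => cnt σ a) σ = Finset.range k := by
      refine Finset.eq_of_subset_of_card_le ?_ ?_
      · intro c hc
        obtain ⟨a, ha, rfl⟩ := Finset.mem_image.1 hc
        exact Finset.mem_range.2 ((cnt_lt_card ha).trans_eq hσ)
      · rw [Finset.card_image_of_injOn (cnt_injOn σ), Finset.card_range, hσ]
    obtain ⟨a, ha, h⟩ := Finset.mem_image.1 (hs.symm ▸ Finset.mem_range.2 b.2)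
    exact ⟨a, Finset.mem_filter.2 ⟨ha, b, hb, h.symm⟩, Fin.ext h⟩
  · intro a ha
    exact cnt_pull σ hσ _ a.2.le

/-- The ordered pairs of disjoint subsets of cardinalities `p` and `q`. -/
def disjointPairs (n p q : ℕ) : Finset (Finset (Fin n) × Finset (Fin n)) :=
  Finset.univ.filter fun PQ => PQ.1.card = p ∧ PQ.2.card = q ∧ Disjoint PQ.1 PQ.2

/-- A shuffle followed by a shuffle of its first block amounts to two disjoint blocks, the third
being their complement. Iterated shuffle products thereby become sums over triples of blocks. -/
theorem sum_pull {M : Type*} [AddCommMonoid M] {p q k : ℕ} (hk : p + q = k)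
    (F : Finset (Fin n) → Finset (Fin n) → M) :
    ∑ σ ∈ Finset.powersetCard k (Finset.univ : Finset (Fin n)),
      ∑ ρ ∈ Finset.powersetCard p (Finset.univ : Finset (Fin k)), F (pull σ ρ) (pull σ ρᶜ) =
      ∑ PQ ∈ disjointPairs n p q, F PQ.1 PQ.2 := by
  rw [← Finset.sum_product']
  have key : ∀ x ∈ Finset.powersetCard k (Finset.univ : Finset (Fin n)) ×ˢ
      Finset.powersetCard p (Finset.univ : Finset (Fin k)), x.1.card = k ∧ x.2.card = p :=
    fun x hx => by
      rw [Finset.mem_product, Finset.mem_powersetCard, Finset.mem_powersetCard] at hx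
      exact ⟨hx.1.2, hx.2.2⟩
  refine Finset.sum_bij (fun x _ => (pull x.1 x.2, pull x.1 x.2ᶜ)) ?_ ?_ ?_ ?_
  · rintro ⟨σ, ρ⟩ hx
    obtain ⟨h1, h2⟩ := key _ hx
    dsimp only at h1 h2
    simp only [disjointPairs, Finset.mem_filter, Finset.mem_univ, true_and]
    refine ⟨(card_pull σ h1 ρ).trans h2, (card_pull σ h1 ρᶜ).trans ?_, disjoint_pull σ ρ⟩
    rw [Finset.card_compl, Fintype.card_fin, h2]
    omega
  · rintro ⟨σ, ρ⟩ hx ⟨σ', ρ'⟩ hx' h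
    obtain ⟨h1, h2⟩ := key _ hx
    obtain ⟨h1', h2'⟩ := key _ hx'
    dsimp only at h1 h2 h1' h2'
    obtain ⟨h3, h4⟩ := Prod.ext_iff.1 h
    dsimp only at h3 h4
    have h5 : σ = σ' := by
      rw [← pull_union_pull σ h1 ρ, ← pull_union_pull σ' h1' ρ', h3, h4]
    subst h5
    have key2 : ∀ ρ ρ' : Finset (Fin k), pull σ ρ = pull σ ρ' → ρ ⊆ ρ' := fun ρ ρ' h b hb => by
      have hs : Finset.image (fun a : Fin n => cnt σ a) σ = Finset.range k := by
        refine Finset.eq_of_subset_of_card_le ?_ ?_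
        · intro c hc
          obtain ⟨a, ha, rfl⟩ := Finset.mem_image.1 hc
          exact Finset.mem_range.2 ((cnt_lt_card ha).trans_eq h1)
        · rw [Finset.card_image_of_injOn (cnt_injOn σ), Finset.card_range, h1]
      obtain ⟨a, ha, h'⟩ := Finset.mem_image.1 (hs.symm ▸ Finset.mem_range.2 b.2)
      have : a ∈ pull σ ρ := Finset.mem_filter.2 ⟨ha, b, hb, h'.symm⟩
      rw [h] at this
      obtain ⟨_, c, hc, h''⟩ := Finset.mem_filter.1 this
      rwa [show b = c from Fin.ext (h'.symm.trans h''.symm)]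
    exact Prod.ext rfl (Finset.Subset.antisymm (key2 _ _ h3) (key2 _ _ h3.symm))
  · rintro ⟨P, Q⟩ h
    simp only [disjointPairs, Finset.mem_filter, Finset.mem_univ, true_and] at h
    obtain ⟨hP, hQ, hPQ⟩ := h
    have hσ : (P ∪ Q).card = k := by rw [Finset.card_union_of_disjoint hPQ, hP, hQ, hk]
    -- `ρ` consists of the positions occupied by `P` within `P ∪ Q`.
    let ρ : Finset (Fin k) := Finset.univ.filter fun b => ∃ a ∈ P, cnt (P ∪ Q) a = b
    have h1 : pull (P ∪ Q) ρ = P := by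
      ext a
      simp only [pull, ρ, Finset.mem_filter, Finset.mem_univ, true_and]
      constructor
      · rintro ⟨ha, b, ⟨c, hc, hcb⟩, hb⟩
        have := cnt_injOn (P ∪ Q) (Finset.mem_union_left _ hc) ha (hcb.trans hb)
        exact this ▸ hc
      · intro ha
        have ha' := Finset.mem_union_left Q ha
        exact ⟨ha', ⟨_, (cnt_lt_card ha').trans_eq hσ⟩, ⟨a, ha, rfl⟩, rfl⟩
    have h2 : pull (P ∪ Q) ρᶜ = Q := by
      have h3 := disjoint_pull (P ∪ Q) ρ
      have h4 := pull_union_pull (P ∪ Q) hσ ρ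
      rw [h1] at h3 h4
      ext a
      have h5 := Finset.ext_iff.1 h4 a
      have h6 : a ∈ P → a ∉ pull (P ∪ Q) ρᶜ := fun h => Finset.disjoint_left.1 h3 h
      have h7 : a ∈ P → a ∉ Q := fun h => Finset.disjoint_left.1 hPQ h
      simp only [Finset.mem_union] at h5
      tauto
    refine ⟨(P ∪ Q, ρ), ?_, Prod.ext h1 h2⟩
    rw [Finset.mem_product, Finset.mem_powersetCard, Finset.mem_powersetCard]
    refine ⟨⟨Finset.subset_univ _, hσ⟩, Finset.subset_univ _, ?_⟩
    rw [← card_pull _ hσ ρ, h1, hP]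
  · intros; rfl

end Shuffles

/-! ### Simplicial modules and shuffle products -/

theorem SimplexCategory.hom_ext' {m n : ℕ} {f g : ⦋m⦌ ⟶ ⦋n⦌}
    (h : ∀ j : Fin (m + 1), (f.toOrderHom j : ℕ) = g.toOrderHom j) : f = g :=
  SimplexCategory.Hom.ext _ _ (OrderHom.ext _ _ (funext fun j => Fin.ext (h j)))

/-- A simplicial module over `ℚ`. -/
structure SMod where
  X : ℕ → Type u
  [addCommGroup : ∀ n, AddCommGroup (X n)]
  [module : ∀ n, Module ℚ (X n)]
  act : ∀ {m n : ℕ}, (⦋m⦌ ⟶ ⦋n⦌) → X n →ₗ[ℚ] X m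
  act_id : ∀ {n : ℕ} (x : X n), act (𝟙 ⦋n⦌) x = x
  act_comp : ∀ {l m n : ℕ} (f : ⦋l⦌ ⟶ ⦋m⦌) (g : ⦋m⦌ ⟶ ⦋n⦌) (x : X n),
    act (f ≫ g) x = act f (act g x)

attribute [instance] SMod.addCommGroup SMod.module

namespace SMod

/-- Elements annihilated by all operators whose image misses a positive vertex. -/
def IsMoore (B : SMod.{u}) {p : ℕ} (x : B.X p) : Prop :=
  ∀ {m : ℕ} (φ : ⦋m⦌ ⟶ ⦋p⦌) (v : Fin (p + 1)), v ≠ 0 → (∀ j, φ.toOrderHom j ≠ v) → B.act φ x = 0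

theorem isMoore_zero (B : SMod.{u}) (x : B.X 0) : B.IsMoore x :=
  fun _ v hv _ => absurd (Fin.ext (by omega)) hv

/-- An operator whose image misses a positive vertex factors through the face opposite to that
vertex. -/
theorem isMoore_succ_iff (B : SMod.{u}) {p : ℕ} (x : B.X (p + 1)) :
    B.IsMoore x ↔ ∀ i : Fin (p + 1), B.act (SimplexCategory.δ i.succ) x = 0 := by
  constructor
  · intro h i
    exact h _ i.succ (Fin.succ_ne_zero i) fun j => Fin.succAbove_ne _ _
  · intro h m φ v hv hφ
    obtain ⟨i, rfl⟩ := Fin.exists_succ_eq.2 hv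
    obtain ⟨θ, rfl⟩ := SimplexCategory.eq_comp_δ_of_not_surjective' φ i.succ hφ
    rw [act_comp, h, map_zero]

/-- A natural bilinear pairing of simplicial modules. -/
structure Pairing (B C G : SMod.{u}) where
  toFun : ∀ n, B.X n →ₗ[ℚ] C.X n →ₗ[ℚ] G.X n
  nat : ∀ {m n : ℕ} (f : ⦋m⦌ ⟶ ⦋n⦌) (x : B.X n) (y : C.X n),
    G.act f (toFun n x y) = toFun m (B.act f x) (C.act f y)

/-- The pairing with the arguments exchanged. -/
def Pairing.flip {B C G : SMod.{u}} (μ : Pairing B C G) : Pairing C B G where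
  toFun n := (μ.toFun n).flip
  nat f x y := μ.nat f y x

end SMod

/-- The monotone map `j ↦ #{a ∈ σ | a < j}`, truncated at `p`. -/
def cntMap {n : ℕ} (σ : Finset (Fin n)) (p : ℕ) : ⦋n⦌ ⟶ ⦋p⦌ :=
  SimplexCategory.Hom.mk
    { toFun := fun j => ⟨min (cnt σ j) p, Nat.lt_succ_of_le (min_le_right _ _)⟩
      monotone' := fun _ _ hij => Fin.mk_le_mk.2 (min_le_min_right p (cnt_mono σ hij)) }

theorem cntMap_apply {n p : ℕ} {σ : Finset (Fin n)} (h : σ.card = p) (j : Fin (n + 1)) :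
    ((cntMap σ p).toOrderHom j : ℕ) = cnt σ j :=
  min_eq_left ((cnt_le_card σ j).trans h.le)

theorem shuffleMap_eq {n p : ℕ} (σ : Finset (Fin n)) (h : σ.card = p) :
    SConnGrLie.shuffleMap σ h = cntMap σ p :=
  SimplexCategory.hom_ext' fun j => (cntMap_apply h j).symm

theorem cntMap_comp_cntMap {n k p : ℕ} {σ : Finset (Fin n)} (hσ : σ.card = k)
    {ρ : Finset (Fin k)} (hρ : ρ.card = p) :
    cntMap σ k ≫ cntMap ρ p = cntMap (pull σ ρ) p :=
  SimplexCategory.hom_ext' fun j => by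
    rw [cntMap_apply ((card_pull σ hσ ρ).trans hρ), cnt_pull σ hσ ρ (Nat.le_of_lt_succ j.2)]
    refine (cntMap_apply hρ _).trans ?_
    rw [cntMap_apply hσ]

/-- A discrete intermediate value argument: the count starts at `0`, ends at the cardinality and
rises by at most one. -/
theorem cntMap_surjective {n p : ℕ} {σ : Finset (Fin n)} (h : σ.card = p) :
    Function.Surjective (cntMap σ p).toOrderHom := by
  have key : ∀ j : ℕ, j ≤ n → ∀ v ≤ cnt σ j, ∃ i ≤ j, cnt σ i = v := by
    intro j
    induction j with
    | zero => exact fun _ v hv => ⟨0, le_rfl, by rw [cnt_zero] at *; omega⟩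
    | succ j ih =>
      intro hj v hv
      rcases eq_or_lt_of_le hv with rfl | hv
      · exact ⟨_, le_rfl, rfl⟩
      · have h1 := cnt_succ σ ⟨j, hj⟩
        dsimp only at h1
        obtain ⟨i, hi, h⟩ := ih (Nat.le_of_succ_le hj) v (by split_ifs at h1 <;> omega)
        exact ⟨i, Nat.le_succ_of_le hi, h⟩
  intro v
  obtain ⟨i, hi, h'⟩ := key n le_rfl v (by
    rw [cnt_of_le _ le_rfl, h]; exact Nat.le_of_lt_succ v.2)
  exact ⟨⟨i, Nat.lt_succ_of_le hi⟩, Fin.ext ((cntMap_apply h _).trans h')⟩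

theorem cntMap_univ (n : ℕ) : cntMap (Finset.univ : Finset (Fin n)) n = 𝟙 ⦋n⦌ :=
  SimplexCategory.hom_ext' fun j => by
    rw [cntMap_apply (by simp), cnt_univ (Nat.le_of_lt_succ j.2)]; rfl

theorem δ_zero_comp_cntMap_map_succ {m p : ℕ} {σ : Finset (Fin m)} (h : σ.card = p) :
    SimplexCategory.δ 0 ≫ cntMap (σ.map (Fin.succEmb m)) p = cntMap σ p :=
  SimplexCategory.hom_ext' fun j => by
    rw [cntMap_apply h, ← cnt_map_succ]
    exact cntMap_apply (by rw [Finset.card_map, h]) _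

/-- When the first letter belongs to the subset, the surjection jumps at its first step, so omitting
vertex `0` of the source omits vertex `0` of the target as well. -/
theorem δ_zero_comp_cntMap_insert {m p : ℕ} {σ : Finset (Fin m)} (h : σ.card = p) :
    SimplexCategory.δ 0 ≫ cntMap (insert 0 (σ.map (Fin.succEmb m))) (p + 1) =
      cntMap σ p ≫ SimplexCategory.δ 0 :=
  SimplexCategory.hom_ext' fun j => by
    refine (cntMap_apply ?_ _).trans ?_
    · rw [Finset.card_insert_of_notMem (by simp [Fin.succ_ne_zero]), Finset.card_map, h]
    · refine (cnt_insert_zero_map_succ σ j).trans ?_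
      rw [← cntMap_apply h]
      rfl

/-- The sign of the shuffle given by two disjoint subsets and the complement of their union. -/
def tripleSign {n : ℕ} (P Q : Finset (Fin n)) : ℚ :=
  (-1) ^ (inversions P Q + inversions P (P ∪ Q)ᶜ + inversions Q (P ∪ Q)ᶜ)

namespace SMod

variable {B C G D E : SMod.{u}}

/-- The shuffle product of two elements with respect to a pairing. -/
def sh (μ : Pairing B C G) (p q n : ℕ) (x : B.X p) (y : C.X q) : G.X n :=
  ∑ σ ∈ Finset.powersetCard p (Finset.univ : Finset (Fin n)), (-1 : ℚ) ^ inversions σ σᶜ •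
    μ.toFun n (B.act (cntMap σ p) x) (C.act (cntMap σᶜ q) y)

variable {p q n : ℕ}

theorem card_of_mem {σ : Finset (Fin n)}
    (hσ : σ ∈ Finset.powersetCard p (Finset.univ : Finset (Fin n))) : σ.card = p :=
  (Finset.mem_powersetCard.1 hσ).2

theorem card_compl_of_mem (h : p + q = n) {σ : Finset (Fin n)}
    (hσ : σ ∈ Finset.powersetCard p (Finset.univ : Finset (Fin n))) : σᶜ.card = q := by
  rw [Finset.card_compl, Fintype.card_fin, card_of_mem hσ]; omega

/-- Consider the face `d_{i+1}` and the letters `i`, `i+1`. If both lie in the same block, the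
corresponding factor is acted on by an operator missing a positive vertex, and vanishes. Otherwise
exchanging them leaves both operators unchanged after the face map but reverses the sign, so these
terms cancel in pairs. -/
theorem isMoore_sh (μ : Pairing B C G) (h : p + q = n) {x : B.X p} {y : C.X q}
    (hx : B.IsMoore x) (hy : C.IsMoore y) : G.IsMoore (sh μ p q n x y) := by
  rcases n with _ | m
  · exact isMoore_zero _ _
  rw [isMoore_succ_iff]
  intro i
  let F : Finset (Fin (m + 1)) → G.X m := fun σ => (-1 : ℚ) ^ inversions σ σᶜ •
    μ.toFun m (B.act (SimplexCategory.δ i.succ ≫ cntMap σ p) x)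
      (C.act (SimplexCategory.δ i.succ ≫ cntMap σᶜ q) y)
  have hF : G.act (SimplexCategory.δ i.succ) (sh μ p q (m + 1) x y) =
      ∑ σ ∈ Finset.powersetCard p (Finset.univ : Finset (Fin (m + 1))), F σ := by
    rw [sh, map_sum]
    exact Finset.sum_congr rfl fun σ _ => by rw [map_smul, μ.nat, ← act_comp, ← act_comp]
  rw [hF]
  -- the vertex of a letter `i` repeated at `i + 1` is missed by the face
  have miss : ∀ (σ : Finset (Fin (m + 1))) (r : ℕ), σ.card = r → i ∈ σ →
      (∀ h : (i : ℕ) + 1 < m + 1, (⟨i + 1, h⟩ : Fin (m + 1)) ∈ σ) → ∃ v : Fin (r + 1), v ≠ 0 ∧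
      ∀ j, (SimplexCategory.δ i.succ ≫ cntMap σ r).toOrderHom j ≠ v := by
    intro σ r hr hi hi'
    have h1 := cnt_succ σ i
    rw [if_pos hi] at h1
    refine ⟨⟨cnt σ (i + 1), by have := cnt_le_card σ (i + 1); omega⟩, ?_, ?_⟩
    · rw [Ne, Fin.ext_iff]; simp [h1]
    · intro j hj
      have h2 : cnt σ (i.succ.succAbove j) = cnt σ (i + 1) :=
        (cntMap_apply hr (i.succ.succAbove j)).symm.trans (Fin.ext_iff.1 hj)
      rcases lt_or_ge (j.castSucc) i.succ with hlt | hge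
      · rw [Fin.succAbove_of_castSucc_lt _ _ hlt] at h2
        have := cnt_mono σ (show (j.castSucc : ℕ) ≤ i by
          have := Fin.lt_def.1 hlt; simp at this ⊢; omega)
        omega
      · rw [Fin.succAbove_of_le_castSucc _ _ hge] at h2
        have h3 : (i : ℕ) + 1 ≤ j := by have := Fin.le_def.1 hge; simpa using this
        have h4 : (i : ℕ) + 1 < m + 1 := lt_of_le_of_lt h3 j.2
        have h5 := cnt_succ σ ⟨i + 1, h4⟩
        rw [if_pos (hi' h4)] at h5
        have := cnt_mono σ (show (i : ℕ) + 1 + 1 ≤ (j.succ : ℕ) from Nat.succ_le_succ h3)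
        dsimp only at h5
        omega
  have zero1 : ∀ σ ∈ Finset.powersetCard p (Finset.univ : Finset (Fin (m + 1))), i ∈ σ →
      (∀ h : (i : ℕ) + 1 < m + 1, (⟨i + 1, h⟩ : Fin (m + 1)) ∈ σ) → F σ = 0 := by
    intro σ hσ hi hi'
    obtain ⟨v, hv, hv'⟩ := miss σ p (card_of_mem hσ) hi hi'
    simp only [F]
    rw [hx _ v hv hv', map_zero, LinearMap.zero_apply, smul_zero]
  have zero2 : ∀ σ ∈ Finset.powersetCard p (Finset.univ : Finset (Fin (m + 1))), i ∉ σ →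
      (∀ h : (i : ℕ) + 1 < m + 1, (⟨i + 1, h⟩ : Fin (m + 1)) ∉ σ) → F σ = 0 := by
    intro σ hσ hi hi'
    obtain ⟨v, hv, hv'⟩ := miss σᶜ q (card_compl_of_mem h hσ) (Finset.mem_compl.2 hi)
      (fun h => Finset.mem_compl.2 (hi' h))
    simp only [F]
    rw [hy _ v hv hv', map_zero, smul_zero]
  -- For the last face there is no letter `i+1`; then every term vanishes on its own.
  by_cases hi : (i : ℕ) + 1 < m + 1
  · let j : Fin (m + 1) := ⟨i + 1, hi⟩
    have hij : (j : ℕ) = i + 1 := rfl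
    have hmem : ∀ σ ∈ Finset.powersetCard p (Finset.univ : Finset (Fin (m + 1))),
        σ.map (Equiv.swap i j).toEmbedding ∈
          Finset.powersetCard p (Finset.univ : Finset (Fin (m + 1))) := fun σ hσ => by
      rw [Finset.mem_powersetCard, Finset.card_map]
      exact ⟨Finset.subset_univ _, card_of_mem hσ⟩
    have hcnt : ∀ (σ : Finset (Fin (m + 1))) (r : ℕ), σ.card = r →
        SimplexCategory.δ i.succ ≫ cntMap (σ.map (Equiv.swap i j).toEmbedding) r =
          SimplexCategory.δ i.succ ≫ cntMap σ r := fun σ r hr =>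
      SimplexCategory.hom_ext' fun k => by
        refine (cntMap_apply (by rw [Finset.card_map, hr]) (i.succ.succAbove k)).trans
          (Eq.trans ?_ (cntMap_apply hr (i.succ.succAbove k)).symm)
        refine cnt_map_swap σ hij ?_
        have : i.succ.succAbove k ≠ i.succ := Fin.succAbove_ne _ _
        rwa [Ne, Fin.ext_iff] at this
    refine Finset.sum_involution (fun σ _ => σ.map (Equiv.swap i j).toEmbedding) ?_ ?_ hmem ?_
    · intro σ hσ
      by_cases hs : i ∈ σ ↔ j ∈ σ
      · have : F σ = 0 := by
          by_cases hi' : i ∈ σ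
          · exact zero1 σ hσ hi' fun _ => hs.1 hi'
          · exact zero2 σ hσ hi' fun _ => fun h => hi' (hs.2 h)
        rw [map_swap_eq_self hs, this, add_zero]
      · simp only [F]
        rw [neg_one_pow_inversions_swap hij hs, hcnt σ p (card_of_mem hσ), compl_map_swap,
          hcnt σᶜ q (card_compl_of_mem h hσ), neg_smul, add_neg_cancel]
    · intro σ hσ hne heq
      apply hne
      have hs : i ∈ σ ↔ j ∈ σ := by
        conv_lhs => rw [← heq]
        simp [Finset.mem_map_equiv]
      by_cases hi' : i ∈ σ
      · exact zero1 σ hσ hi' fun _ => hs.1 hi'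
      · exact zero2 σ hσ hi' fun _ => fun h => hi' (hs.2 h)
    · intro σ hσ
      exact map_swap_map_swap σ i j
  · refine Finset.sum_eq_zero fun σ hσ => ?_
    by_cases hi' : i ∈ σ
    · exact zero1 σ hσ hi' fun h => absurd h hi
    · exact zero2 σ hσ hi' fun h => absurd h hi

theorem sh_zero_left (μ : Pairing B C G) (n : ℕ) (x : B.X 0) (y : C.X n) :
    sh μ 0 n n x y = μ.toFun n (B.act (cntMap ∅ 0) x) y := by
  rw [sh, Finset.powersetCard_zero, Finset.sum_singleton, Finset.compl_empty, cntMap_univ, act_id]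
  simp [inversions]

/-- The face `d_0` falls on the factor whose block contains the first letter. If this is the block
of `y`, the first letter forms an inversion with each of the `p+1` letters of the other block, which
gives the sign. -/
theorem face_zero_sh_succ_succ (μ : Pairing B C G) (h : p + q + 1 = n)
    (x : B.X (p + 1)) (y : C.X (q + 1)) :
    G.act (SimplexCategory.δ 0) (sh μ (p + 1) (q + 1) (n + 1) x y) =
      sh μ p (q + 1) n (B.act (SimplexCategory.δ 0) x) y +
        (-1 : ℚ) ^ (p + 1) • sh μ (p + 1) q n x (C.act (SimplexCategory.δ 0) y) := by
  rw [sh, sum_powersetCard_succ, map_add, add_comm, map_sum, map_sum]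
  congr 1
  · refine Finset.sum_congr rfl fun σ hσ => ?_
    rw [inversions_insert_zero_map_succ, compl_insert_zero_map_succ, map_smul, μ.nat,
      ← act_comp, ← act_comp, δ_zero_comp_cntMap_insert (card_of_mem hσ),
      δ_zero_comp_cntMap_map_succ (card_compl_of_mem (by omega) hσ), act_comp]
  · rw [sh, Finset.smul_sum]
    refine Finset.sum_congr rfl fun σ hσ => ?_
    rw [inversions_map_succ, compl_map_succ, map_smul, μ.nat,
      ← act_comp, ← act_comp, δ_zero_comp_cntMap_insert (card_compl_of_mem (by omega) hσ),
      δ_zero_comp_cntMap_map_succ (card_of_mem hσ), act_comp, card_of_mem hσ, pow_add, mul_comm,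
      mul_smul]

theorem face_zero_sh_succ_zero (μ : Pairing B C G) (n : ℕ) (x : B.X (n + 1)) (y : C.X 0) :
    G.act (SimplexCategory.δ 0) (sh μ (n + 1) 0 (n + 1) x y) =
      sh μ n 0 n (B.act (SimplexCategory.δ 0) x) y := by
  rw [sh, sum_powersetCard_succ, Finset.powersetCard_eq_empty.2 (by simp), Finset.sum_empty,
    zero_add, map_sum]
  refine Finset.sum_congr rfl fun σ hσ => ?_
  rw [inversions_insert_zero_map_succ, compl_insert_zero_map_succ, map_smul, μ.nat,
    ← act_comp, ← act_comp, δ_zero_comp_cntMap_insert (card_of_mem hσ),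
    δ_zero_comp_cntMap_map_succ (card_compl_of_mem (by omega) hσ), act_comp]

theorem face_zero_sh_zero_succ (μ : Pairing B C G) (n : ℕ) (x : B.X 0) (y : C.X (n + 1)) :
    G.act (SimplexCategory.δ 0) (sh μ 0 (n + 1) (n + 1) x y) =
      sh μ 0 n n x (C.act (SimplexCategory.δ 0) y) := by
  rw [sh_zero_left, sh_zero_left, μ.nat, ← act_comp]
  congr 3

/-- Replace each block by its complement: the two inversion counts add up to the number `p * q` of
pairs. -/
theorem sh_flip (μ : Pairing B C G) (h : p + q = n) (x : B.X p) (y : C.X q) :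
    sh μ p q n x y = (-1 : ℚ) ^ (p * q) • sh μ.flip q p n y x := by
  rw [sh, sh, Finset.smul_sum]
  have hc : ∀ {a b : ℕ}, a + b = n → ∀ σ ∈ Finset.powersetCard a (Finset.univ : Finset (Fin n)),
      σᶜ ∈ Finset.powersetCard b (Finset.univ : Finset (Fin n)) := fun h σ hσ =>
    Finset.mem_powersetCard.2 ⟨Finset.subset_univ _, card_compl_of_mem h hσ⟩
  refine Finset.sum_bij' (fun σ _ => σᶜ) (fun σ _ => σᶜ) (hc h) (hc ((add_comm _ _).trans h))
    (fun _ _ => compl_compl _) (fun _ _ => compl_compl _) fun σ hσ => ?_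
  have h1 := inversions_add_inversions (disjoint_compl_right : Disjoint σ σᶜ)
  rw [card_of_mem hσ, card_compl_of_mem h hσ] at h1
  rw [compl_compl, smul_smul, ← pow_add, ← h1, add_assoc, ← two_mul, pow_add _ _ (2 * _), pow_mul,
    neg_one_sq, one_pow, mul_one]
  rfl

/-- The inner shuffle is transported to a subset of the outer block by `pull`. The inversions of the
outer block with its complement split over the two inner blocks, which produces `tripleSign`. -/
theorem sh_sh {r pq : ℕ} (μ : Pairing B C G) (ν : Pairing G D E) (h : p + q = pq)
    (x : B.X p) (y : C.X q) (z : D.X r) :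
    sh ν pq r n (sh μ p q pq x y) z = ∑ PQ ∈ disjointPairs n p q, tripleSign PQ.1 PQ.2 •
      ν.toFun n (μ.toFun n (B.act (cntMap PQ.1 p) x) (C.act (cntMap PQ.2 q) y))
        (D.act (cntMap (PQ.1 ∪ PQ.2)ᶜ r) z) := by
  rw [← sum_pull h (fun P Q => tripleSign P Q •
      ν.toFun n (μ.toFun n (B.act (cntMap P p) x) (C.act (cntMap Q q) y))
        (D.act (cntMap (P ∪ Q)ᶜ r) z))]
  rw [sh]
  refine Finset.sum_congr rfl fun σ hσ => ?_
  have hσ' := card_of_mem hσ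
  rw [sh, map_sum, map_sum, LinearMap.sum_apply, Finset.smul_sum]
  refine Finset.sum_congr rfl fun ρ hρ => ?_
  rw [pull_union_pull σ hσ', tripleSign, pull_union_pull σ hσ', inversions_pull σ hσ', map_smul,
    μ.nat, ← act_comp, ← act_comp, cntMap_comp_cntMap hσ' (card_of_mem hρ),
    cntMap_comp_cntMap hσ' (card_compl_of_mem h hρ), map_smul, LinearMap.smul_apply, smul_smul,
    ← pow_add]
  congr 2
  conv_lhs => rw [← pull_union_pull σ hσ' ρ, inversions_union_left (disjoint_pull σ ρ),
    pull_union_pull σ hσ']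
  ring

end SMod

/-! ### The Moore complex functor -/

/-- Reduces comparisons of signs to identities in `ZMod 2`, which `linear_combination` can close
with multiples of `2 = 0`. -/
theorem neg_one_pow_eq_of_zmod {a b : ℕ} (h : (a : ZMod 2) = b) : (-1 : ℚ) ^ a = (-1) ^ b := by
  have h' := (ZMod.natCast_eq_natCast_iff' a b 2).1 h
  rw [neg_one_pow_eq_pow_mod_two a, neg_one_pow_eq_pow_mod_two b, h']

theorem sum_disjointPairs_rotate {M : Type*} [AddCommMonoid M] {p q r n : ℕ} (h : p + q + r = n)
    (F : Finset (Fin n) → Finset (Fin n) → Finset (Fin n) → M) :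
    ∑ PQ ∈ disjointPairs n q r, F (PQ.1 ∪ PQ.2)ᶜ PQ.1 PQ.2 =
      ∑ PQ ∈ disjointPairs n p q, F PQ.1 PQ.2 (PQ.1 ∪ PQ.2)ᶜ := by
  have hc : ∀ {a b c : ℕ}, a + b + c = n → ∀ PQ ∈ disjointPairs n a b,
      (PQ.1 ∪ PQ.2)ᶜ.card = c ∧ PQ.1.card = a ∧ PQ.2.card = b ∧
        Disjoint PQ.1 PQ.2 ∧ Disjoint PQ.1 (PQ.1 ∪ PQ.2)ᶜ ∧ Disjoint PQ.2 (PQ.1 ∪ PQ.2)ᶜ ∧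
        (PQ.2 ∪ (PQ.1 ∪ PQ.2)ᶜ)ᶜ = PQ.1 ∧ ((PQ.1 ∪ PQ.2)ᶜ ∪ PQ.1)ᶜ = PQ.2 := by
    rintro a b c hn ⟨P, Q⟩ h
    simp only [disjointPairs, Finset.mem_filter, Finset.mem_univ, true_and] at h
    obtain ⟨hP, hQ, hPQ⟩ := h
    refine ⟨?_, hP, hQ, hPQ, disjoint_compl_right.mono_left Finset.subset_union_left |>.mono_left
      le_rfl, disjoint_compl_right.mono_left Finset.subset_union_right, ?_, ?_⟩
    · rw [Finset.card_compl, Fintype.card_fin, Finset.card_union_of_disjoint hPQ, hP, hQ]; omega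
    · ext a
      have h7 : a ∈ P → a ∉ Q := fun h => Finset.disjoint_left.1 hPQ h
      simp only [Finset.mem_compl, Finset.mem_union]
      tauto
    · ext a
      have h7 : a ∈ P → a ∉ Q := fun h => Finset.disjoint_left.1 hPQ h
      simp only [Finset.mem_compl, Finset.mem_union]
      tauto
  refine Finset.sum_bij' (fun PQ _ => ((PQ.1 ∪ PQ.2)ᶜ, PQ.1))
    (fun PQ _ => (PQ.2, (PQ.1 ∪ PQ.2)ᶜ)) ?_ ?_ ?_ ?_ ?_
  · intro PQ hPQ
    obtain ⟨h1, h2, h3, h4, h5, h6, h7, h8⟩ := hc (c := p) (by omega) PQ hPQ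
    simp only [disjointPairs, Finset.mem_filter, Finset.mem_univ, true_and]
    exact ⟨h1, h2, h5.symm⟩
  · intro PQ hPQ
    obtain ⟨h1, h2, h3, h4, h5, h6, h7, h8⟩ := hc h PQ hPQ
    simp only [disjointPairs, Finset.mem_filter, Finset.mem_univ, true_and]
    exact ⟨h3, h1, h6⟩
  · intro PQ hPQ
    obtain ⟨h1, h2, h3, h4, h5, h6, h7, h8⟩ := hc (c := p) (by omega) PQ hPQ
    exact Prod.ext rfl h8
  · intro PQ hPQ
    obtain ⟨h1, h2, h3, h4, h5, h6, h7, h8⟩ := hc h PQ hPQ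
    exact Prod.ext h7 rfl
  · intro PQ hPQ
    obtain ⟨h1, h2, h3, h4, h5, h6, h7, h8⟩ := hc (c := p) (by omega) PQ hPQ
    rw [h8]

/-- Moving `P` past `Q` and past the third block reverses all pairs between them, `p * q + p * r` in
number; the order of the other two blocks is unchanged. -/
theorem tripleSign_rotate {p q r n : ℕ} (h : p + q + r = n) {P Q : Finset (Fin n)}
    (hPQ : (P, Q) ∈ disjointPairs n p q) :
    tripleSign Q (P ∪ Q)ᶜ = (-1) ^ (p * q + p * r) * tripleSign P Q := by
  simp only [disjointPairs, Finset.mem_filter, Finset.mem_univ, true_and] at hPQ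
  obtain ⟨hP, hQ, hd⟩ := hPQ
  have hR : (P ∪ Q)ᶜ.card = r := by
    rw [Finset.card_compl, Fintype.card_fin, Finset.card_union_of_disjoint hd, hP, hQ]; omega
  have hPR : Disjoint P (P ∪ Q)ᶜ := disjoint_compl_right.mono_left Finset.subset_union_left
  have hP' : (Q ∪ (P ∪ Q)ᶜ)ᶜ = P := by
    ext a
    have h7 : a ∈ P → a ∉ Q := fun h => Finset.disjoint_left.1 hd h
    simp only [Finset.mem_compl, Finset.mem_union]
    tauto
  have h1 := inversions_add_inversions hd
  have h2 := inversions_add_inversions hPR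
  rw [hP, hQ] at h1
  rw [hP, hR] at h2
  rw [tripleSign, tripleSign, hP', ← pow_add]
  apply neg_one_pow_eq_of_zmod
  have h3 := congrArg (Nat.cast : ℕ → ZMod 2) h1
  have h4 := congrArg (Nat.cast : ℕ → ZMod 2) h2
  push_cast at h3 h4 ⊢
  have h2 : (2 : ZMod 2) = 0 := rfl
  linear_combination h3 + h4 - (inversions P Q + inversions P (P ∪ Q)ᶜ : ZMod 2) * h2

namespace SConnGrLie

variable (L : SConnGrLie.{u})

theorem act_id {n s : ℕ} (x : (L _⦋n⦌).V s) : L.act (𝟙 ⦋n⦌) s x = x := by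
  rw [act, op_id, L.map_id]; rfl

theorem act_comp {l m n : ℕ} (f : ⦋l⦌ ⟶ ⦋m⦌) (g : ⦋m⦌ ⟶ ⦋n⦌) {s : ℕ} (x : (L _⦋n⦌).V s) :
    L.act (f ≫ g) s x = L.act f s (L.act g s x) := by
  rw [act, op_comp, L.map_comp]; rfl

theorem act_br {m n : ℕ} (f : ⦋m⦌ ⟶ ⦋n⦌) {s t k : ℕ} (h : s + t = k) (x : (L _⦋n⦌).V s)
    (y : (L _⦋n⦌).V t) :
    L.act f k ((L _⦋n⦌).br h x y) = (L _⦋m⦌).br h (L.act f s x) (L.act f t y) :=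
  ConnGrLie.Hom.map_br _ h x y

/-- The simplicial module of elements of degree `s`. -/
abbrev smod (s : ℕ) : SMod.{u} where
  X n := (L _⦋n⦌).V s
  act f := L.act f s
  act_id := L.act_id
  act_comp f g x := L.act_comp f g x

/-- The levelwise bracket, as a pairing of simplicial modules. -/
abbrev brPairing {s t m : ℕ} (k : s + t = m) : SMod.Pairing (L.smod s) (L.smod t) (L.smod m) where
  toFun n := (L _⦋n⦌).br k
  nat f x y := L.act_br f k x y

theorem bracket_eq {p q n s t m : ℕ} (h : p + q = n) (k : s + t = m)
    (x : (L _⦋p⦌).V s) (y : (L _⦋q⦌).V t) :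
    L.bracket h k x y = (-1 : ℚ) ^ (p * t) • SMod.sh (L.brPairing k) p q n x y := by
  rw [bracket, SMod.sh, Finset.smul_sum,
    Finset.sum_subtype _ (p := fun σ : Finset (Fin n) => σ.card = p)
      (fun σ => by simp [Finset.mem_powersetCard])]
  refine Finset.sum_congr rfl fun σ _ => ?_
  rw [smul_smul, ← pow_add, add_comm, shuffleExponent_eq, shuffleMap_eq, shuffleMap_eq]

theorem mem_moore_iff {p s : ℕ} (x : (L _⦋p⦌).V s) :
    x ∈ L.moore p s ↔ (L.smod s).IsMoore (p := p) x := by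
  rcases p with _ | p
  · exact ⟨fun _ => SMod.isMoore_zero _ _, fun _ => Submodule.mem_top⟩
  · rw [SMod.isMoore_succ_iff]
    simp only [moore, Submodule.mem_iInf, LinearMap.mem_ker]
    rfl

theorem bracket_mem {p q n s t m : ℕ} (h : p + q = n) (k : s + t = m)
    {x : (L _⦋p⦌).V s} {y : (L _⦋q⦌).V t} (hx : x ∈ L.moore p s) (hy : y ∈ L.moore q t) :
    L.bracket h k x y ∈ L.moore n m := by
  rw [bracket_eq]
  exact Submodule.smul_mem _ _ ((L.mem_moore_iff _).2 (SMod.isMoore_sh _ h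
    ((L.mem_moore_iff _).1 hx) ((L.mem_moore_iff _).1 hy)))

theorem face_zero_mem {p s : ℕ} {x : (L _⦋p + 1⦌).V s} (hx : x ∈ L.moore (p + 1) s) :
    L.face (p := p) 0 s x ∈ L.moore p s := by
  rw [mem_moore_iff] at hx ⊢
  intro m φ v hv hφ
  have h1 : (L.smod s).act φ (L.face (p := p) 0 s x) =
      (L.smod s).act (φ ≫ SimplexCategory.δ 0) x := ((L.smod s).act_comp φ _ x).symm
  rw [h1]
  refine hx _ v.succ (Fin.succ_ne_zero v) fun j hj => hφ j ?_
  exact Fin.succ_injective _ (by rw [← hj]; rfl)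

/-- The composite of two zeroth cofaces misses vertex `1`, which is positive, so a Moore chain is
annihilated by it. -/
theorem face_zero_face_zero {p s : ℕ} {x : (L _⦋p + 1 + 1⦌).V s}
    (hx : x ∈ L.moore (p + 1 + 1) s) :
    L.face (p := p) 0 s (L.face (p := p + 1) 0 s x) = 0 := by
  rw [mem_moore_iff] at hx
  have h1 : L.face (p := p) 0 s (L.face (p := p + 1) 0 s x) =
    (L.smod s).act (SimplexCategory.δ (n := p) 0 ≫ SimplexCategory.δ (n := p + 1) 0) x :=
      ((L.smod s).act_comp _ _ x).symm
  rw [h1]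
  refine hx _ 1 (by simp) fun j hj => ?_
  have h2 := Fin.ext_iff.1 hj
  have h3 : (((SimplexCategory.δ (n := p) 0 ≫ SimplexCategory.δ (n := p + 1) 0).toOrderHom j :
    Fin (p + 1 + 1 + 1)) : ℕ) = j + 1 + 1 := rfl
  rw [h3] at h2
  simp at h2

/-- The bracket on Moore chains. -/
def mooreBr {p q n s t m : ℕ} (h : p + q = n) (k : s + t = m) :
    L.moore p s →ₗ[ℚ] L.moore q t →ₗ[ℚ] L.moore n m :=
  LinearMap.mk₂ ℚ (fun x y => ⟨L.bracket h k x y, L.bracket_mem h k x.2 y.2⟩)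
    (fun x x' y => Subtype.ext (by simp [bracket, Finset.sum_add_distrib]))
    (fun c x y => Subtype.ext (by
      simp only [bracket, Submodule.coe_smul, map_smul, LinearMap.smul_apply, Finset.smul_sum]
      exact Finset.sum_congr rfl fun _ _ => smul_comm _ _ _))
    (fun x y y' => Subtype.ext (by simp [bracket, Finset.sum_add_distrib]))
    (fun c x y => Subtype.ext (by
      simp only [bracket, Submodule.coe_smul, map_smul, Finset.smul_sum]
      exact Finset.sum_congr rfl fun _ _ => smul_comm _ _ _))

theorem bracket_skew {p q n s t m : ℕ} (h : p + q = n) (h' : q + p = n) (k : s + t = m)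
    (k' : t + s = m) (x : (L _⦋p⦌).V s) (y : (L _⦋q⦌).V t) :
    L.bracket h k x y = (-1 : ℚ) ^ ((p + s) * (q + t) + 1) • L.bracket h' k' y x := by
  have h1 : SMod.sh (L.brPairing k).flip q p n y x =
      (-1 : ℚ) ^ (s * t + 1) • SMod.sh (L.brPairing k') q p n y x := by
    rw [SMod.sh, SMod.sh, Finset.smul_sum]
    refine Finset.sum_congr rfl fun σ _ => ?_
    rw [smul_comm]
    congr 1
    exact (L _⦋n⦌).skew k k' _ _
  rw [bracket_eq, bracket_eq, SMod.sh_flip _ h, h1, smul_smul, smul_smul, smul_smul]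
  congr 1
  rw [← pow_add, ← pow_add, ← pow_add]
  apply neg_one_pow_eq_of_zmod
  push_cast
  have h2 : (2 : ZMod 2) = 0 := rfl
  linear_combination (-(s * q : ZMod 2)) * h2

theorem bracket_bracket {p q pq r n s t st v m : ℕ} (h : p + q = pq) (h' : pq + r = n)
    (k : s + t = st) (k' : st + v = m)
    (x : (L _⦋p⦌).V s) (y : (L _⦋q⦌).V t) (z : (L _⦋r⦌).V v) :
    L.bracket h' k' (L.bracket h k x y) z = (-1 : ℚ) ^ (p * t + (p + q) * v) •
      ∑ PQ ∈ disjointPairs n p q, tripleSign PQ.1 PQ.2 •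
        (L _⦋n⦌).br k' ((L _⦋n⦌).br k (L.act (cntMap PQ.1 p) s x) (L.act (cntMap PQ.2 q) t y))
          (L.act (cntMap (PQ.1 ∪ PQ.2)ᶜ r) v z) := by
  have h1 := SMod.sh_sh (n := n) (L.brPairing k) (L.brPairing k') h x y z
  have h2 : ∀ (c : ℚ) (w : (L _⦋pq⦌).V st), SMod.sh (L.brPairing k') pq r n (c • w) z =
      c • SMod.sh (L.brPairing k') pq r n w z := fun c w => by
    simp only [SMod.sh, map_smul, LinearMap.smul_apply, Finset.smul_sum]
    exact Finset.sum_congr rfl fun _ _ => smul_comm _ _ _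
  rw [bracket_eq, bracket_eq, h2, h1, smul_smul, ← pow_add, h, add_comm]

/-- After rotation, the three double brackets are sums over the same ordered partitions `(P, Q, R)`.
For each partition the summands form the Jacobi identity of the levelwise Lie algebra, up to one
common sign. -/
theorem bracket_jacobi {p q r n s t v m : ℕ}
    (h₁ : p + q + r = n) (h₂ : q + r + p = n) (h₃ : r + p + q = n)
    (k₁ : s + t + v = m) (k₂ : t + v + s = m) (k₃ : v + s + t = m)
    (x : (L _⦋p⦌).V s) (y : (L _⦋q⦌).V t) (z : (L _⦋r⦌).V v) :
    (-1 : ℚ) ^ ((p + s) * (r + v)) • L.bracket h₁ k₁ (L.bracket rfl rfl x y) z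
      + (-1 : ℚ) ^ ((p + s) * (q + t)) • L.bracket h₂ k₂ (L.bracket rfl rfl y z) x
      + (-1 : ℚ) ^ ((q + t) * (r + v)) • L.bracket h₃ k₃ (L.bracket rfl rfl z x) y = 0 := by
  rw [bracket_bracket, bracket_bracket, bracket_bracket]
  have e2 := sum_disjointPairs_rotate h₁ (fun P Q R => tripleSign Q R •
    (L _⦋n⦌).br k₂ ((L _⦋n⦌).br rfl (L.act (cntMap Q q) t y) (L.act (cntMap R r) v z))
      (L.act (cntMap P p) s x))
  have e3' := sum_disjointPairs_rotate h₂ (fun Q R P => tripleSign R P •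
    (L _⦋n⦌).br k₃ ((L _⦋n⦌).br rfl (L.act (cntMap R r) v z) (L.act (cntMap P p) s x))
      (L.act (cntMap Q q) t y))
  have e3 := sum_disjointPairs_rotate h₁ (fun P Q R => tripleSign R P •
    (L _⦋n⦌).br k₃ ((L _⦋n⦌).br rfl (L.act (cntMap R r) v z) (L.act (cntMap P p) s x))
      (L.act (cntMap Q q) t y))
  try dsimp only at e2 e3 e3'
  rw [e2, e3', e3, smul_smul, smul_smul, smul_smul, Finset.smul_sum, Finset.smul_sum,
    Finset.smul_sum, ← Finset.sum_add_distrib, ← Finset.sum_add_distrib]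
  refine Finset.sum_eq_zero fun PQ hPQ => ?_
  obtain ⟨P, Q⟩ := PQ
  have s2 := tripleSign_rotate h₁ hPQ
  have hQR : (Q, (P ∪ Q)ᶜ) ∈ disjointPairs n q r := by
    simp only [disjointPairs, Finset.mem_filter, Finset.mem_univ, true_and] at hPQ ⊢
    refine ⟨hPQ.2.1, ?_, disjoint_compl_right.mono_left Finset.subset_union_right⟩
    rw [Finset.card_compl, Fintype.card_fin, Finset.card_union_of_disjoint hPQ.2.2, hPQ.1,
      hPQ.2.1]
    omega
  have s3 := tripleSign_rotate h₂ hQR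
  have hP' : (Q ∪ (P ∪ Q)ᶜ)ᶜ = P := by
    simp only [disjointPairs, Finset.mem_filter, Finset.mem_univ, true_and] at hPQ
    ext a
    have h7 : a ∈ P → a ∉ Q := fun h => Finset.disjoint_left.1 hPQ.2.2 h
    simp only [Finset.mem_compl, Finset.mem_union]
    tauto
  rw [hP', s2] at s3
  dsimp only
  rw [s2, s3]
  simp only [smul_smul]
  have J := (L _⦋n⦌).jacobi k₁ k₂ k₃ (L.act (cntMap P p) s x) (L.act (cntMap Q q) t y)
    (L.act (cntMap (P ∪ Q)ᶜ r) v z)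
  -- The factor is the common sign relating the total-degree Jacobi identity to the levelwise one;
  -- the remaining goals compare parities.
  have J' := congrArg (fun w => ((-1 : ℚ) ^ (p * r + s * r + p * t + q * v) * tripleSign P Q) • w) J
  simp only [smul_add, smul_smul, smul_zero] at J'
  rw [← J']
  have h2 : (2 : ZMod 2) = 0 := rfl
  congr 2
  · congr 1
    rw [mul_right_comm (_ ^ _) (tripleSign P Q), ← pow_add, ← pow_add]
    congr 1
    apply neg_one_pow_eq_of_zmod
    push_cast
    linear_combination (p * v : ZMod 2) * h2
  · congr 1
    rw [mul_right_comm (_ ^ _) (tripleSign P Q), ← pow_add, ← pow_add, ← mul_assoc, ← pow_add]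
    congr 1
    apply neg_one_pow_eq_of_zmod
    push_cast
    linear_combination (p * q + s * q : ZMod 2) * h2
  · rw [mul_right_comm (_ ^ _) (tripleSign P Q), ← pow_add, ← pow_add, ← mul_assoc, ← mul_assoc,
      ← pow_add, ← pow_add]
    congr 1
    apply neg_one_pow_eq_of_zmod
    push_cast
    linear_combination (q * r + t * r + p * q: ZMod 2) * h2

/-- The Moore complex of a simplicial graded Lie algebra, as a bigraded Lie algebra. -/
def mooreLie : ConnBigrLie.{u} where
  V p s := L.moore p s
  br h k := L.mooreBr h k
  skew h h' k k' x y := Subtype.ext (L.bracket_skew h h' k k' x y)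
  jacobi h₁ h₂ h₃ k₁ k₂ k₃ x y z := Subtype.ext (L.bracket_jacobi h₁ h₂ h₃ k₁ k₂ k₃ x y z)
  connected p x := Subtype.ext ((L _⦋p⦌).connected _)

/-- The differential `(-1)^s d_0` of the Moore complex. -/
def mooreD (p s : ℕ) : L.moore (p + 1) s →ₗ[ℚ] L.moore p s :=
  (-1 : ℚ) ^ s • (L.face (p := p) 0 s).restrict fun _ hx => L.face_zero_mem hx

theorem coe_mooreD {p s : ℕ} (x : L.moore (p + 1) s) :
    (L.mooreD p s x : (L _⦋p⦌).V s) = (-1 : ℚ) ^ s • L.face (p := p) 0 s x := rfl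

theorem bracket_smul_left {p q n s t m : ℕ} (h : p + q = n) (k : s + t = m) (c : ℚ)
    (x : (L _⦋p⦌).V s) (y : (L _⦋q⦌).V t) : L.bracket h k (c • x) y = c • L.bracket h k x y := by
  simp only [bracket, map_smul, LinearMap.smul_apply, Finset.smul_sum]
  exact Finset.sum_congr rfl fun _ _ => smul_comm _ _ _

theorem bracket_smul_right {p q n s t m : ℕ} (h : p + q = n) (k : s + t = m) (c : ℚ)
    (x : (L _⦋p⦌).V s) (y : (L _⦋q⦌).V t) : L.bracket h k x (c • y) = c • L.bracket h k x y := by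
  simp only [bracket, map_smul, Finset.smul_sum]
  exact Finset.sum_congr rfl fun _ _ => smul_comm _ _ _

/-- The factor `(-1)^t` arises because the sign `(-1)^(p t)` in the bracket notices that the
dimension of `x` drops by one. Together with the sign `(-1)^s` of the differential it gives the
Leibniz rule for the total degree. -/
theorem face_zero_bracket {p q n s t m : ℕ} (h : (p + 1) + (q + 1) = n + 1)
    (h₁ : p + (q + 1) = n) (h₂ : (p + 1) + q = n) (k : s + t = m)
    (x : (L _⦋p + 1⦌).V s) (y : (L _⦋q + 1⦌).V t) :
    L.face (p := n) 0 m (L.bracket h k x y) =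
      (-1 : ℚ) ^ t • L.bracket h₁ k (L.face (p := p) 0 s x) y +
        (-1 : ℚ) ^ (p + 1) • L.bracket h₂ k x (L.face (p := q) 0 t y) := by
  rw [bracket_eq, bracket_eq, bracket_eq, map_smul]
  refine (congrArg (_ • ·) (SMod.face_zero_sh_succ_succ (L.brPairing k) (p := p) (q := q) (n := n)
    (by omega) x y)).trans ?_
  rw [smul_add, smul_smul, smul_smul, smul_smul]
  congr 1
  · congr 1
    ring
  · congr 1
    ring

theorem face_zero_bracket_zero_right {p n s t m : ℕ} (h : (p + 1) + 0 = n + 1) (h₁ : p + 0 = n)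
    (k : s + t = m) (x : (L _⦋p + 1⦌).V s) (y : (L _⦋0⦌).V t) :
    L.face (p := n) 0 m (L.bracket h k x y) =
      (-1 : ℚ) ^ t • L.bracket h₁ k (L.face (p := p) 0 s x) y := by
  obtain rfl : p = n := h₁
  rw [bracket_eq, bracket_eq, map_smul]
  refine (congrArg (_ • ·) (SMod.face_zero_sh_succ_zero (L.brPairing k) p x y)).trans ?_
  rw [smul_smul]
  congr 1
  ring

theorem face_zero_bracket_zero_left {q n s t m : ℕ} (h : 0 + (q + 1) = n + 1) (h₂ : 0 + q = n)
    (k : s + t = m) (x : (L _⦋0⦌).V s) (y : (L _⦋q + 1⦌).V t) :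
    L.face (p := n) 0 m (L.bracket h k x y) = L.bracket h₂ k x (L.face (p := q) 0 t y) := by
  obtain rfl : q = n := by omega
  rw [bracket_eq, bracket_eq, map_smul]
  exact congrArg (_ • ·) (SMod.face_zero_sh_zero_succ (L.brPairing k) q x y)

theorem neg_one_pow_mul_self (t : ℕ) : (-1 : ℚ) ^ t * (-1) ^ t = 1 := by
  rw [← mul_pow]; norm_num

/-- The Moore complex of a simplicial graded Lie algebra. -/
def mooreDBGL : ConnDBGL.{u} where
  toConnBigrLie := L.mooreLie
  d p s := L.mooreD p s
  d_d p s x := Subtype.ext (by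
    refine (congrArg (_ • ·) (map_smul (L.face (p := p) 0 s) _ _)).trans ?_
    refine (congrArg (_ • _ • ·) (L.face_zero_face_zero x.2)).trans ?_
    rw [smul_zero, smul_zero]; rfl)
  leibniz {p q n s t m} h h₁ h₂ k x y := Subtype.ext (by
    refine (congrArg ((-1 : ℚ) ^ m • ·) (L.face_zero_bracket h h₁ h₂ k x.1 y.1)).trans ?_
    refine Eq.trans ?_ (congrArg₂ (fun a b => a + (-1 : ℚ) ^ (p + 1 + s) • b)
      (L.bracket_smul_left h₁ k ((-1) ^ s) _ y.1).symm
      (L.bracket_smul_right h₂ k ((-1) ^ t) x.1 _).symm)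
    subst k
    rw [smul_add, smul_smul, smul_smul, smul_smul]
    congr 1
    · rw [pow_add, mul_assoc, neg_one_pow_mul_self, mul_one]; rfl
    · rw [← pow_add, ← pow_add]
      congr 2
      omega)
  leibniz_right_zero {p n s t m} h h₁ k x y := Subtype.ext (by
    refine (congrArg ((-1 : ℚ) ^ m • ·)
      (L.face_zero_bracket_zero_right h h₁ k x.1 y.1)).trans ?_
    refine Eq.trans ?_ (L.bracket_smul_left h₁ k ((-1) ^ s) _ y.1).symm
    subst k
    rw [smul_smul, pow_add, mul_assoc, neg_one_pow_mul_self, mul_one]; rfl)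
  leibniz_left_zero {q n s t m} h h₂ k x y := Subtype.ext (by
    refine (congrArg ((-1 : ℚ) ^ m • ·)
      (L.face_zero_bracket_zero_left h h₂ k x.1 y.1)).trans ?_
    refine Eq.trans ?_ (congrArg ((-1 : ℚ) ^ s • ·)
      (L.bracket_smul_right h₂ k ((-1) ^ t) x.1 _).symm)
    subst k
    rw [smul_smul, pow_add]; rfl)

variable {L} {M : SConnGrLie.{u}} (f : L ⟶ M)

theorem map_act {m n : ℕ} (θ : ⦋m⦌ ⟶ ⦋n⦌) (s : ℕ) (x : (L _⦋n⦌).V s) :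
    ConnGrLie.Hom.map (f.app (op ⦋m⦌)) s (L.act θ s x) =
      M.act θ s (ConnGrLie.Hom.map (f.app (op ⦋n⦌)) s x) :=
  congrArg (fun g : L _⦋n⦌ ⟶ M _⦋m⦌ => ConnGrLie.Hom.map g s x) (f.naturality θ.op)

theorem map_bracket {p q n s t m : ℕ} (h : p + q = n) (k : s + t = m)
    (x : (L _⦋p⦌).V s) (y : (L _⦋q⦌).V t) :
    ConnGrLie.Hom.map (f.app (op ⦋n⦌)) m (L.bracket h k x y) =
      M.bracket h k (ConnGrLie.Hom.map (f.app (op ⦋p⦌)) s x)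
        (ConnGrLie.Hom.map (f.app (op ⦋q⦌)) t y) := by
  rw [bracket, bracket, map_sum]
  refine Finset.sum_congr rfl fun σ _ => ?_
  rw [map_smul, ConnGrLie.Hom.map_br, map_act, map_act]

theorem map_mem_moore {p s : ℕ} {x : (L _⦋p⦌).V s} (hx : x ∈ L.moore p s) :
    ConnGrLie.Hom.map (f.app (op ⦋p⦌)) s x ∈ M.moore p s := by
  rw [mem_moore_iff] at hx ⊢
  intro m φ v hv hφ
  exact (map_act f φ s x).symm.trans ((congrArg _ (hx φ v hv hφ)).trans (map_zero _))

/-- The restriction of a morphism to the Moore complexes. -/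
def mooreMap : L.mooreDBGL ⟶ M.mooreDBGL :=
  ConnDBGL.Hom.mk
    { map := fun p s =>
        (ConnGrLie.Hom.map (f.app (op ⦋p⦌)) s).restrict fun _ hx => map_mem_moore f hx
      map_br := fun h k x y => Subtype.ext (map_bracket f h k x.1 y.1) }
    (fun p s x => Subtype.ext ((map_smul (ConnGrLie.Hom.map (f.app (op ⦋p⦌)) s) _ _).trans
      (congrArg (_ • ·) (map_act f (SimplexCategory.δ 0) s x.1))))

/-- The Moore complex functor. -/
def mooreFunctor : SConnGrLie.{u} ⥤ ConnDBGL.{u} where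
  obj L := L.mooreDBGL
  map f := mooreMap f

/-- The identification of the Moore complex functor. -/
def mooreRealization : MooreRealization mooreFunctor.{u} where
  incl L p s := (L.moore p s).subtype
  incl_injective _ _ _ := Subtype.val_injective
  range_incl L p s := (L.moore p s).range_subtype
  incl_d _ _ _ _ := rfl
  incl_br _ _ _ _ _ _ _ _ _ _ _ := rfl
  incl_map _ _ _ _ := rfl

end SConnGrLie

/-! ### The left adjoint of the Moore complex functor -/

/-- The relations satisfied by the elements `θ^* x` of degree `n`, for `x` in the image of a
morphism from `A` to the Moore complex of a simplicial graded Lie algebra. -/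
structure ConnDBGL.Rep (A : ConnDBGL.{u}) (n : SimplexCategory)
    (M : GrLie.{u} ℕ (AddMonoidHom.id ℕ)) where
  g : ∀ {p : ℕ} (s : ℕ), (n ⟶ ⦋p⦌) → A.V p s →ₗ[ℚ] M.V s
  g_δ_succ : ∀ {p s : ℕ} (θ : n ⟶ ⦋p⦌) (i : Fin (p + 1)) (x : A.V (p + 1) s),
    g s (θ ≫ SimplexCategory.δ i.succ) x = 0
  g_δ_zero : ∀ {p s : ℕ} (θ : n ⟶ ⦋p⦌) (x : A.V (p + 1) s),
    g s (θ ≫ SimplexCategory.δ 0) x = (-1 : ℚ) ^ s • g s θ (A.d p s x)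
  g_br : ∀ {p q k s t m : ℕ} (h : p + q = k) (h' : s + t = m) (θ : n ⟶ ⦋k⦌)
    (x : A.V p s) (y : A.V q t),
    g m θ (A.br h h' x y) =
      ∑ σ ∈ Finset.powersetCard p (Finset.univ : Finset (Fin k)),
        (-1 : ℚ) ^ (inversions σ σᶜ + p * t) •
          M.br h' (g s (θ ≫ cntMap σ p) x) (g t (θ ≫ cntMap σᶜ q) y)

namespace ConnDBGL

variable {A B : ConnDBGL.{u}} {m n : SimplexCategory} {M : GrLie.{u} ℕ (AddMonoidHom.id ℕ)}

/-- Precomposition of all operators with a fixed one. -/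
def Rep.precomp (R : A.Rep m M) (α : m ⟶ n) : A.Rep n M where
  g s θ := R.g s (α ≫ θ)
  g_δ_succ θ i x := by rw [← Category.assoc]; exact R.g_δ_succ _ i x
  g_δ_zero θ x := by rw [← Category.assoc]; exact R.g_δ_zero _ x
  g_br h h' θ x y := by simp only [R.g_br h h', Category.assoc]

variable (A n)

/-- The generators of the left adjoint. -/
abbrev NstarGen (s : ℕ) : Type u := Σ p : ℕ, (n ⟶ ⦋p⦌) × A.V p s

/-- The models given by the relations. -/
def IsNstarModel (M : OpLie.{u} (AddMonoidHom.id ℕ) (A.NstarGen n) fun _ _ => PEmpty) : Prop :=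
  ∃ R : A.Rep n M.toGrLie, ∀ {p s : ℕ} (θ : n ⟶ ⦋p⦌) (x : A.V p s),
    M.gen (⟨p, θ, x⟩ : A.NstarGen n s) = R.g s θ x

/-- The universal graded Lie algebra with a solution of the relations. -/
abbrev nstarLie : GrLie.{u} ℕ (AddMonoidHom.id ℕ) :=
  (Universal.opLie (A.IsNstarModel n)).toGrLie

/-- The generic solution of the relations. -/
def nstarRep : A.Rep n (A.nstarLie n) where
  g {p} s θ :=
    { toFun := fun x => (Universal.opLie (A.IsNstarModel n)).gen (⟨p, θ, x⟩ : A.NstarGen n s)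
      map_add' := fun x y => Universal.ext fun M hM => by
        obtain ⟨R, hR⟩ := id hM
        rw [map_add, Universal.eval_gen, Universal.eval_gen, Universal.eval_gen, hR, hR, hR,
          map_add]
      map_smul' := fun c x => Universal.ext fun M hM => by
        obtain ⟨R, hR⟩ := id hM
        rw [map_smul, Universal.eval_gen, Universal.eval_gen, hR, hR, map_smul]; rfl }
  g_δ_succ θ i x := Universal.ext fun M hM => by
    obtain ⟨R, hR⟩ := id hM
    exact (hR _ _).trans ((R.g_δ_succ θ i x).trans (map_zero _).symm)
  g_δ_zero θ x := Universal.ext fun M hM => by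
    obtain ⟨R, hR⟩ := id hM
    refine (hR _ _).trans ((R.g_δ_zero θ x).trans (Eq.trans ?_ (map_smul _ _ _).symm))
    exact congrArg _ (hR _ _).symm
  g_br h h' θ x y := Universal.ext fun M hM => by
    obtain ⟨R, hR⟩ := id hM
    refine (hR _ _).trans ((R.g_br h h' θ x y).trans (Eq.trans ?_ (map_sum _ _ _).symm))
    refine Finset.sum_congr rfl fun σ _ => Eq.trans ?_ (map_smul _ _ _).symm
    refine congrArg _ (Eq.trans ?_ (Universal.eval_br M hM _ _ _).symm)
    exact congrArg₂ (fun a b => M.br h' a b) (hR _ _).symm (hR _ _).symm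

theorem nstar_induction {C : ∀ s, (A.nstarLie n).V s → Prop}
    (g : ∀ {p s : ℕ} (θ : n ⟶ ⦋p⦌) (x : A.V p s), C s ((A.nstarRep n).g s θ x))
    (zero : ∀ s, C s 0) (add : ∀ {s} (x y : (A.nstarLie n).V s), C s x → C s y → C s (x + y))
    (smul : ∀ {s} (c : ℚ) (x : (A.nstarLie n).V s), C s x → C s (c • x))
    (br : ∀ {p q k : ℕ} (h : p + q = k) (x : (A.nstarLie n).V p) (y : (A.nstarLie n).V q),
      C p x → C q y → C k ((A.nstarLie n).br h x y)) {s : ℕ} (x : (A.nstarLie n).V s) : C s x :=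
  Universal.induction (P := A.IsNstarModel n) (C := C) (fun x => g x.2.1 x.2.2)
    (fun h => h.elim) zero add smul br x

/-- The degree `n` part of the left adjoint. -/
abbrev nstarConn : ConnGrLie.{u} :=
  (A.nstarLie n).toConnGrLie fun x => by
    refine A.nstar_induction n (C := fun s x => s = 0 → x = 0) ?_ (fun _ _ => rfl) ?_ ?_ ?_ x rfl
    · rintro p s θ x rfl
      rw [A.connected p x, map_zero]
    · intro s x y hx hy hs
      rw [hx hs, hy hs, add_zero]
    · intro s c x hx hs
      rw [hx hs, smul_zero]
    · intro p q k h x y hx hy hk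
      rw [hx (by omega), map_zero, LinearMap.zero_apply]

variable {A n}

/-- The morphism given by a solution of the relations. -/
def nstarLift {M : ConnGrLie.{u}} (R : A.Rep n M.toGrLie) : A.nstarConn n ⟶ M :=
  ConnGrLie.Hom.mk
    (fun s => Universal.eval (P := A.IsNstarModel n)
      { toGrLie := M.toGrLie, gen := fun x => R.g _ x.2.1 x.2.2, op := fun h => h.elim }
      ⟨R, fun _ _ => rfl⟩ s)
    (fun _ _ _ => Universal.eval_br _ _ _ _ _)

theorem nstarLift_g {M : ConnGrLie.{u}} (R : A.Rep n M.toGrLie) {p s : ℕ} (θ : n ⟶ ⦋p⦌)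
    (x : A.V p s) : (nstarLift R).map s ((A.nstarRep n).g s θ x) = R.g s θ x := rfl

theorem nstar_hom_ext {M : ConnGrLie.{u}} {f f' : A.nstarConn n ⟶ M}
    (h : ∀ {p s : ℕ} (θ : n ⟶ ⦋p⦌) (x : A.V p s),
      f.map s ((A.nstarRep n).g s θ x) = f'.map s ((A.nstarRep n).g s θ x)) : f = f' := by
  refine ConnGrLie.Hom.ext (funext fun s => LinearMap.ext fun x => ?_)
  refine A.nstar_induction n (C := fun s x => f.map s x = f'.map s x) h ?_ ?_ ?_ ?_ x
  · intro s
    exact (map_zero _).trans (map_zero _).symm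
  · intro s x y hx hy
    rw [map_add, map_add, hx, hy]
  · intro s c x hx
    rw [map_smul, map_smul, hx]
  · intro p q k h x y hx hy
    exact (f.map_br h x y).trans ((congrArg₂ (fun a b => M.br h a b) hx hy).trans
      (f'.map_br h x y).symm)

/-- The left adjoint of the Moore complex functor, on objects. -/
abbrev nstarObj (A : ConnDBGL.{u}) : SConnGrLie.{u} where
  obj n := A.nstarConn n.unop
  map α := nstarLift ((A.nstarRep _).precomp α.unop)
  map_id n := nstar_hom_ext fun θ x => (nstarLift_g _ _ _).trans
    (congrArg (fun θ => (A.nstarRep _).g _ θ x) (Category.id_comp θ))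
  map_comp α β := nstar_hom_ext fun θ x => (nstarLift_g _ _ _).trans
    (congrArg (fun θ => (A.nstarRep _).g _ θ x) (Category.assoc _ _ θ))

theorem act_nstarRep {p s m n : ℕ} (α : ⦋m⦌ ⟶ ⦋n⦌) (θ : ⦋n⦌ ⟶ ⦋p⦌) (x : A.V p s) :
    A.nstarObj.act α s ((A.nstarRep ⦋n⦌).g s θ x) = (A.nstarRep ⦋m⦌).g s (α ≫ θ) x := rfl

theorem nstarRep_mem_moore {p s : ℕ} (x : A.V p s) :
    (A.nstarRep ⦋p⦌).g s (𝟙 _) x ∈ A.nstarObj.moore p s := by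
  rcases p with _ | p
  · trivial
  · refine (Submodule.mem_iInf _).2 fun i => ?_
    refine (congrArg (fun θ => (A.nstarRep ⦋p⦌).g s θ x) ?_).trans ((A.nstarRep ⦋p⦌).g_δ_succ (𝟙 _) i x)
    exact (Category.comp_id _).trans (Category.id_comp _).symm

/-- The unit of the adjunction. -/
def nstarUnit (A : ConnDBGL.{u}) : A ⟶ A.nstarObj.mooreDBGL :=
  ConnDBGL.Hom.mk
    { map := fun p s => ((A.nstarRep ⦋p⦌).g s (𝟙 _)).codRestrict _ nstarRep_mem_moore
      map_br := fun {p q n s t m} h k x y => Subtype.ext (by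
        refine ((A.nstarRep ⦋n⦌).g_br h k (𝟙 _) x y).trans
          (Eq.trans ?_ (A.nstarObj.bracket_eq h k ((A.nstarRep ⦋p⦌).g s (𝟙 _) x)
            ((A.nstarRep ⦋q⦌).g t (𝟙 _) y)).symm)
        rw [SMod.sh, Finset.smul_sum]
        refine Finset.sum_congr rfl fun σ _ => ?_
        rw [smul_smul, ← pow_add, add_comm]
        refine congrArg (_ • ·) (congrArg₂ (fun a b => (A.nstarLie ⦋n⦌).br k a b) ?_ ?_)
        · exact congrArg (fun θ => (A.nstarRep ⦋n⦌).g s θ x)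
            ((Category.id_comp _).trans (Category.comp_id _).symm)
        · exact congrArg (fun θ => (A.nstarRep ⦋n⦌).g t θ y)
            ((Category.id_comp _).trans (Category.comp_id _).symm)) }
    (fun p s x => Subtype.ext (by
      have h1 := (A.nstarRep ⦋p⦌).g_δ_zero (𝟙 _) x
      refine Eq.trans ?_ (congrArg ((-1 : ℚ) ^ s • ·) (h1.symm.trans
        (congrArg (fun θ => (A.nstarRep ⦋p⦌).g s θ x)
            ((Category.id_comp _).trans (Category.comp_id _).symm))))
      rw [smul_smul, SConnGrLie.neg_one_pow_mul_self, one_smul]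
      rfl))

/-- The solution of the relations given by a morphism to a Moore complex. -/
def repOfHom {L : SConnGrLie.{u}} (φ : A ⟶ L.mooreDBGL) (n : SimplexCategory) :
    A.Rep n (L.obj (op n)).toGrLie where
  g {p} s θ := (ConnGrLie.Hom.map (L.map θ.op) s) ∘ₗ (L.moore p s).subtype ∘ₗ φ.map p s
  g_δ_succ {p s} θ i x := by
    have h1 : (L.smod s).act (SimplexCategory.δ i.succ) (φ.map (p + 1) s x).1 = 0 :=
      (SMod.isMoore_succ_iff _ _).1 ((L.mem_moore_iff _).1 (φ.map (p + 1) s x).2) i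
    rw [op_comp, L.map_comp]
    exact (congrArg (ConnGrLie.Hom.map (L.map θ.op) s) h1).trans (map_zero _)
  g_δ_zero {p s} θ x := by
    have h1 : (φ.map p s (A.d p s x)).1 = (-1 : ℚ) ^ s • L.face (p := p) 0 s (φ.map (p + 1) s x).1 :=
      congrArg Subtype.val (φ.map_d p s x)
    rw [op_comp, L.map_comp]
    refine Eq.trans ?_ (congrArg (fun z => (-1 : ℚ) ^ s • ConnGrLie.Hom.map (L.map θ.op) s z) h1).symm
    dsimp only
    rw [map_smul, smul_smul, SConnGrLie.neg_one_pow_mul_self, one_smul]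
    rfl
  g_br {p q k s t m} h h' θ x y := by
    have h1 : (φ.map k m (A.br h h' x y)).1 = _ :=
      (congrArg Subtype.val (φ.map_br h h' x y)).trans (L.bracket_eq h h' (φ.map p s x).1 (φ.map q t y).1)
    refine (congrArg (ConnGrLie.Hom.map (L.map θ.op) m) h1).trans ?_
    rw [SMod.sh, Finset.smul_sum, map_sum]
    refine Finset.sum_congr rfl fun σ _ => ?_
    rw [smul_smul, ← pow_add, add_comm, map_smul]
    refine congrArg (_ • ·) ((ConnGrLie.Hom.map_br _ h' _ _).trans ?_)
    refine congrArg₂ (fun a b => (L.obj (op n)).br h' a b) ?_ ?_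
    · exact congrArg (fun f : L.obj _ ⟶ L.obj _ => ConnGrLie.Hom.map f s (φ.map p s x).1)
        (L.map_comp (cntMap σ p).op θ.op).symm
    · exact congrArg (fun f : L.obj _ ⟶ L.obj _ => ConnGrLie.Hom.map f t (φ.map q t y).1)
        (L.map_comp (cntMap σᶜ q).op θ.op).symm

/-- The adjunction bijection. -/
def nstarHomEquiv (A : ConnDBGL.{u}) (L : SConnGrLie.{u}) :
    (A.nstarObj ⟶ L) ≃ (A ⟶ SConnGrLie.mooreFunctor.obj L) where
  toFun f := A.nstarUnit ≫ SConnGrLie.mooreFunctor.map f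
  invFun φ :=
    { app := fun n => nstarLift (repOfHom φ n.unop)
      naturality := fun n m α => nstar_hom_ext fun {p s} θ x =>
        congrArg (fun f : L.obj _ ⟶ L.obj _ => ConnGrLie.Hom.map f s ((Hom.toHom φ).map p s x).1)
          (L.map_comp θ.op α) }
  left_inv f := by
    refine NatTrans.ext (funext fun n => nstar_hom_ext fun {p s} θ x => ?_)
    -- Each generator is the `θ`-translate of its value at the identity operator, so naturality
    -- recovers `f` from its composite with the unit.
    refine (congrArg (fun g : A.nstarObj.obj _ ⟶ L.obj n =>
      ConnGrLie.Hom.map g s ((A.nstarRep ⦋p⦌).g s (𝟙 _) x)) (f.naturality θ.op)).symm.trans ?_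
    exact congrArg (fun θ => (f.app n).map s ((A.nstarRep _).g s θ x)) (Category.comp_id θ)
  right_inv φ := by
    refine Hom.ext (funext fun p => funext fun s => LinearMap.ext fun x => Subtype.ext ?_)
    exact L.act_id _

theorem nstarHomEquiv_naturality (A : ConnDBGL.{u}) (L L' : SConnGrLie.{u}) (g : L ⟶ L')
    (f : A.nstarObj ⟶ L) :
    nstarHomEquiv A L' (f ≫ g) = nstarHomEquiv A L f ≫ SConnGrLie.mooreFunctor.map g := rfl

/-- The left adjoint of the Moore complex functor. -/
def nstar : ConnDBGL.{u} ⥤ SConnGrLie.{u} :=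
  Adjunction.leftAdjointOfEquiv (F_obj := nstarObj) nstarHomEquiv nstarHomEquiv_naturality

/-- The adjunction. -/
def nstarAdj : nstar.{u} ⊣ SConnGrLie.mooreFunctor :=
  Adjunction.adjunctionOfEquivLeft nstarHomEquiv nstarHomEquiv_naturality

end ConnDBGL

/-! ### Free bigraded Lie algebras -/

namespace GrLie

variable {I : Type} [AddCommMonoid I] {ε : I →+ ℕ}

/-- A graded Lie subalgebra. -/
abbrev sub (L : GrLie.{u} I ε) (C : ∀ i, Submodule ℚ (L.V i))
    (hC : ∀ {p q n : I} (h : p + q = n), ∀ x ∈ C p, ∀ y ∈ C q, L.br h x y ∈ C n) :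
    GrLie.{u} I ε where
  V i := C i
  br {p q n} h := LinearMap.mk₂ ℚ
    (fun x y => (⟨L.br h x y, hC h x x.2 y y.2⟩ : C n))
    (fun x x' y => Subtype.ext (LinearMap.map_add₂ _ _ _ _))
    (fun c x y => Subtype.ext (LinearMap.map_smul₂ _ _ _ _))
    (fun x y y' => Subtype.ext (map_add (L.br h x.1) _ _))
    (fun c x y => Subtype.ext (map_smul (L.br h x.1) _ _))
  skew h h' x y := Subtype.ext (L.skew h h' x.1 y.1)
  jacobi h₁ h₂ h₃ x y z := Subtype.ext (L.jacobi h₁ h₂ h₃ x.1 y.1 z.1)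

/-- The subalgebra which is zero in the degrees `i` with `δ i = 0`. -/
abbrev posPart (L : GrLie.{u} I ε) (δ : I →+ ℕ) : GrLie.{u} I ε :=
  L.sub (fun i => { carrier := {x | δ i = 0 → x = 0}
                    add_mem' := fun hx hy h => by rw [hx h, hy h, add_zero]
                    zero_mem' := fun _ => rfl
                    smul_mem' := fun c x hx h => by rw [hx h, smul_zero] })
    fun {p q n} h x hx y _ hn => by
      rw [hx (by rw [← h, map_add] at hn; omega), map_zero, LinearMap.zero_apply]

end GrLie

namespace ConnBigrLie

/-- The bigraded Lie algebra `A` is free on the family `ι` of elements of positive degree. -/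
structure FreeOn (A : ConnBigrLie.{u}) {Y : Type u} (dp ds : Y → ℕ)
    (ι : ∀ y, A.V (dp y) (ds y)) : Prop where
  pos : ∀ y, 0 < ds y
  existsUnique : ∀ (M : ConnBigrLie.{u}) (f : ∀ y, M.V (dp y) (ds y)),
    ∃! φ : Hom A M, ∀ y, φ.map (dp y) (ds y) (ι y) = f y

namespace FreeOn

variable {A : ConnBigrLie.{u}} {Y : Type u} {dp ds : Y → ℕ} {ι : ∀ y, A.V (dp y) (ds y)}
  (hA : A.FreeOn dp ds ι)

include hA

theorem hom_ext {M : ConnBigrLie.{u}} {φ φ' : Hom A M}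
    (h : ∀ y, φ.map _ _ (ι y) = φ'.map _ _ (ι y)) : φ = φ' :=
  (hA.existsUnique M fun y => φ'.map _ _ (ι y)).unique h fun _ => rfl

/-- A free Lie algebra is generated by its generators. -/
theorem induction (C : ∀ p s, Submodule ℚ (A.V p s)) (gen : ∀ y, ι y ∈ C (dp y) (ds y))
    (br : ∀ {p q n s t m : ℕ} (h : p + q = n) (k : s + t = m), ∀ x ∈ C p s, ∀ y ∈ C q t,
      A.br h k x y ∈ C n m) {p s : ℕ} (x : A.V p s) : x ∈ C p s := by
  let S : ConnBigrLie.{u} := (A.toGrLie.sub (fun i => C i.1 i.2)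
    fun _ => br _ _).toConnBigrLie fun p x => Subtype.ext (A.connected p x.1)
  obtain ⟨φ, hφ, -⟩ := hA.existsUnique S fun y => ⟨ι y, gen y⟩
  -- Mapping into the subalgebra and back fixes the generators, hence is the identity; so the
  -- subalgebra is everything.
  let ψ : Hom A A :=
    { map := fun p s => (C p s).subtype ∘ₗ φ.map p s
      map_br := fun h k x y => congrArg Subtype.val (φ.map_br h k x y) }
  have h : ψ = { map := fun _ _ => LinearMap.id, map_br := fun _ _ _ _ => rfl } :=
    hA.hom_ext fun y => congrArg Subtype.val (hφ y)
  have h' : ((φ.map p s x : C p s) : A.V p s) = x :=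
    congrArg (fun ψ : Hom A A => ψ.map p s x) h
  exact h' ▸ (φ.map p s x).2

/-- The universal property only concerns connected targets. Since all generators have positive
second degree, passing to the part of the target of positive second degree removes this restriction;
commutator algebras of associative algebras are then allowed. -/
theorem exists_hom (M : GrLie.{u} (ℕ × ℕ) totalDegree) (f : ∀ y, M.V (dp y, ds y)) :
    ∃ φ : ∀ p s, A.V p s →ₗ[ℚ] M.V (p, s),
      (∀ {p q n s t m : ℕ} (h : p + q = n) (k : s + t = m) (x : A.V p s) (y : A.V q t),
        φ n m (A.br h k x y) = M.br (Prod.ext h k) (φ p s x) (φ q t y)) ∧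
      ∀ y, φ _ _ (ι y) = f y := by
  obtain ⟨φ, hφ, -⟩ := hA.existsUnique
    ((M.posPart (AddMonoidHom.snd ℕ ℕ)).toConnBigrLie fun p x => Subtype.ext (x.2 rfl))
    fun y => ⟨f y, fun h => absurd h (hA.pos y).ne'⟩
  exact ⟨fun p s => Submodule.subtype _ ∘ₗ φ.map p s,
    fun h k x y => congrArg Subtype.val (φ.map_br h k x y), fun y => congrArg Subtype.val (hφ y)⟩

end FreeOn

end ConnBigrLie

/-- Generators of bidegree `(p, 0)` are zero and so are their prescribed values, by connectedness on
both sides. They can be discarded. -/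
theorem ConnDBGL.IsFree.exists_freeOn {A : ConnDBGL.{u}} (hA : A.IsFree) :
    ∃ (Y : Type u) (dp ds : Y → ℕ) (ι : ∀ y, A.V (dp y) (ds y)),
      A.toConnBigrLie.FreeOn dp ds ι := by
  obtain ⟨X, hX⟩ := hA
  refine ⟨Σ p s : ℕ, X p (s + 1), fun y => y.1, fun y => y.2.1 + 1, fun y => y.2.2.1,
    fun y => Nat.succ_pos _, fun M f => ?_⟩
  let f' : ∀ p s, X p s → M.V p s := fun p s => match s with
    | 0 => fun _ => 0
    | s + 1 => fun x => f ⟨p, s, x⟩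
  obtain ⟨φ, hφ, huniq⟩ := hX M f'
  refine ⟨φ, fun y => hφ _ _ y.2.2, fun ψ hψ => huniq ψ fun p s x => ?_⟩
  rcases s with _ | s
  · exact M.connected _ _
  · exact hψ ⟨p, s, x⟩

/-! ### Coinduced simplicial Lie algebras -/

namespace ConnGrLie

/-- A power of a graded Lie algebra. -/
abbrev pi (M : ConnGrLie.{u}) (J : Type) : ConnGrLie.{u} where
  V s := J → M.V s
  br h := LinearMap.mk₂ ℚ (fun x y j => M.br h (x j) (y j))
    (fun x x' y => funext fun j => LinearMap.map_add₂ _ _ _ _)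
    (fun c x y => funext fun j => LinearMap.map_smul₂ _ _ _ _)
    (fun x y y' => funext fun j => map_add (M.br h (x j)) _ _)
    (fun c x y => funext fun j => map_smul (M.br h (x j)) _ _)
  skew h h' x y := funext fun j => M.skew h h' (x j) (y j)
  jacobi h₁ h₂ h₃ x y z := funext fun j => M.jacobi h₁ h₂ h₃ (x j) (y j) (z j)
  connected x := funext fun j => M.connected (x j)

/-- The simplicial graded Lie algebra of functions on `Hom(n, -)` with values in `M`. -/
abbrev coinduced (M : ConnGrLie.{u}) (n : SimplexCategory) : SConnGrLie.{u} where
  obj m := M.pi (n ⟶ m.unop)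
  map α := Hom.mk (fun s => LinearMap.funLeft ℚ _ fun θ => θ ≫ α.unop) fun _ _ _ => rfl
  map_id m := Hom.ext (funext fun s => LinearMap.ext fun x => funext fun θ =>
    congrArg x (Category.comp_id θ))
  map_comp α β := Hom.ext (funext fun s => LinearMap.ext fun x => funext fun θ =>
    congrArg x (Category.assoc θ _ _).symm)

variable {M : ConnGrLie.{u}} {n : SimplexCategory}

/-- The value of a function at `θ` is the value of its `θ`-translate at the identity. -/
theorem coinduced_apply_eq_zero {p s : ℕ} {x : (n ⟶ ⦋p⦌) → M.V s}
    (hx : x ∈ (M.coinduced n).moore p s) (θ : n ⟶ ⦋p⦌) (v : Fin (p + 1)) (hv : v ≠ 0)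
    (hθ : ∀ j, θ.toOrderHom j ≠ v) : x θ = 0 := by
  have h := (SConnGrLie.mem_moore_iff _ _).1 hx (m := n.len) θ v hv hθ
  refine Eq.trans ?_ (congrFun h (𝟙 n))
  exact congrArg x (Category.id_comp θ).symm

theorem ne_of_comp_δ_zero {p : ℕ} (θ : n ⟶ ⦋p⦌) (j : Fin (n.len + 1)) :
    (θ ≫ SimplexCategory.δ (n := p) 0).toOrderHom j ≠ 0 := Fin.succ_ne_zero _

open Classical in
/-- An element of the Moore complex of a coinduced simplicial Lie algebra is determined by its
values on surjective maps and its differential, which can be prescribed arbitrarily. -/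
theorem exists_moore_coinduced {p s : ℕ} (y : (M.coinduced n).moore p s)
    (hy : ∀ (q : ℕ) (h : p = q + 1) (θ : n ⟶ ⦋p⦌), (∀ j, θ.toOrderHom j ≠ 0) → y.1 θ = 0)
    (f : ∀ θ : n ⟶ ⦋p + 1⦌, Function.Surjective θ.toOrderHom → M.V s) :
    ∃ e : (M.coinduced n).moore (p + 1) s, (M.coinduced n).mooreD p s e = y ∧
      ∀ θ (h : Function.Surjective θ.toOrderHom), e.1 θ = f θ h := by
  -- Three cases: surjective maps carry the prescribed values; maps missing a positive vertex must
  -- go to zero by the Moore condition; a map missing only vertex `0` comes from `[p]` through `δ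
  -- 0`, and its value is dictated by `y`.
  let e : (n ⟶ ⦋p + 1⦌) → M.V s := fun θ =>
    if h : Function.Surjective θ.toOrderHom then f θ h
    else if ∃ v : Fin (p + 1 + 1), v ≠ 0 ∧ ∀ j, θ.toOrderHom j ≠ v then 0
    else (-1 : ℚ) ^ s • y.1 (θ ≫ SimplexCategory.σ 0)
  have he : e ∈ (M.coinduced n).moore (p + 1) s := by
    refine (Submodule.mem_iInf _).2 fun i => funext fun θ => ?_
    have h1 : ∀ j, (θ ≫ SimplexCategory.δ i.succ).toOrderHom j ≠ i.succ :=
      fun j => Fin.succAbove_ne _ _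
    change e (θ ≫ SimplexCategory.δ i.succ) = 0
    simp only [e]
    rw [dif_neg fun h => by obtain ⟨j, hj⟩ := h i.succ; exact h1 j hj,
      if_pos ⟨i.succ, Fin.succ_ne_zero i, h1⟩]
  refine ⟨⟨e, he⟩, Subtype.ext (funext fun θ => ?_), fun θ h => dif_pos h⟩
  refine (congrArg ((-1 : ℚ) ^ s • ·) (?_ : e (θ ≫ SimplexCategory.δ 0) =
    (-1 : ℚ) ^ s • y.1 θ)).trans ?_
  swap
  · dsimp only
    rw [smul_smul, SConnGrLie.neg_one_pow_mul_self, one_smul]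
  simp only [e]
  rw [dif_neg fun h => by obtain ⟨j, hj⟩ := h 0; exact ne_of_comp_δ_zero θ j hj]
  split_ifs with h
  · obtain ⟨v, hv, hθ⟩ := h
    obtain ⟨w, rfl⟩ := Fin.exists_succ_eq.2 hv
    have hw : ∀ j, θ.toOrderHom j ≠ w := fun j hj => hθ j (congrArg Fin.succ hj)
    -- If the missed vertex of `θ` is `0`, the vanishing of `y` is the hypothesis `hy`; otherwise it
    -- is the Moore condition on `y`.
    by_cases h0 : w = 0
    · subst h0
      rcases p with _ | p
      · exact absurd (Subsingleton.elim (α := Fin 1) _ _) (hw 0)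
      · rw [hy p rfl θ hw, smul_zero]
    · rw [coinduced_apply_eq_zero y.2 θ w h0 hw, smul_zero]
  · rw [Category.assoc]
    have := SimplexCategory.δ_comp_σ_self (i := (0 : Fin (p + 1)))
    rw [Fin.castSucc_zero] at this
    rw [this, Category.comp_id]

end ConnGrLie

/-! ### Constructing morphisms from a free DBGL, one dimension at a time -/

namespace ConnDBGL

variable {A E : ConnDBGL.{u}}

/-- The compatibility of `φ` with the differential at `a`, when the value at `a` is `e`. -/
def DRel (φ : ConnBigrLie.Hom A.toConnBigrLie E.toConnBigrLie) :
    ∀ p s, A.V p s → E.V p s → Prop := fun p => match p with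
  | 0 => fun _ _ _ => True
  | q + 1 => fun s a e => E.d q s e = φ.map q s (A.d q s a)

theorem DRel.br {φ : ConnBigrLie.Hom A.toConnBigrLie E.toConnBigrLie} {p q n s t m : ℕ}
    (h : p + q = n) (k : s + t = m) {x : A.V p s} {y : A.V q t}
    (hx : DRel φ p s x (φ.map p s x)) (hy : DRel φ q t y (φ.map q t y)) :
    DRel φ n m (A.br h k x y) (φ.map n m (A.br h k x y)) := by
  rcases n with _ | n
  · trivial
  change E.d n m _ = φ.map n m (A.d n m _)
  rw [φ.map_br]
  rcases p with _ | p
  · obtain rfl : q = n + 1 := by omega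
    rw [E.leibniz_left_zero h (by omega), A.leibniz_left_zero h (by omega) k, map_smul, φ.map_br,
      show E.d n t _ = _ from hy]
  · rcases q with _ | q
    · rw [E.leibniz_right_zero h (by omega), A.leibniz_right_zero h (by omega) k, φ.map_br,
        show E.d p s _ = _ from hx]
    · rw [E.leibniz h (by omega) (by omega), A.leibniz h (by omega) (by omega) k, map_add, map_smul,
        φ.map_br, φ.map_br, show E.d p s _ = _ from hx, show E.d q t _ = _ from hy]

theorem DRel.linear {φ φ' : ConnBigrLie.Hom A.toConnBigrLie E.toConnBigrLie} {p s : ℕ} :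
    ∃ C : Submodule ℚ (A.V p s), ∀ x, x ∈ C ↔ DRel φ p s x (φ'.map p s x) := by
  rcases p with _ | p
  · exact ⟨⊤, fun _ => iff_of_true trivial trivial⟩
  · exact ⟨LinearMap.eqLocus (E.d p s ∘ₗ φ'.map (p + 1) s) (φ.map p s ∘ₗ A.d p s),
      fun _ => Iff.rfl⟩

section Extend

variable {Y : Type u} {dp ds : Y → ℕ} {ι : ∀ y, A.V (dp y) (ds y)}
  (hA : A.toConnBigrLie.FreeOn dp ds ι) {M : ConnGrLie.{u}} {n : SimplexCategory}
  (f : ∀ y (θ : n ⟶ ⦋dp y⦌), Function.Surjective θ.toOrderHom → M.V (ds y))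

/-- A map missing vertex `0` factors through `δ 0`, and there the value is, up to sign, a value of
the differential. So a cycle satisfies the hypothesis of `exists_moore_coinduced`. -/
theorem coinduced_apply_eq_zero_of_d {p s : ℕ} {y : (M.coinduced n).mooreDBGL.V (p + 1) s}
    (hy : (M.coinduced n).mooreDBGL.d p s y = 0) (θ : n ⟶ ⦋p + 1⦌)
    (hθ : ∀ j, θ.toOrderHom j ≠ 0) : y.1 θ = 0 := by
  obtain ⟨θ, rfl⟩ := SimplexCategory.eq_comp_δ_of_not_surjective' θ 0 hθ
  have h1 : (-1 : ℚ) ^ s • y.1 (θ ≫ SimplexCategory.δ 0) = 0 :=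
    congrFun (congrArg Subtype.val hy) θ
  exact (smul_eq_zero.1 h1).resolve_left (pow_ne_zero _ (by norm_num))

/-- In dimension `k` the boundary of the new value has to be `φ (∂a)`, which is a cycle by
compatibility in lower dimensions. Below `k` the old value is kept; above `k` nothing is required.
-/
theorem exists_coinduced_value {k : ℕ}
    (φ : ConnBigrLie.Hom A.toConnBigrLie (M.coinduced n).mooreDBGL.toConnBigrLie)
    (hφ : ∀ p < k, ∀ s a, DRel (E := (M.coinduced n).mooreDBGL) φ p s a (φ.map p s a))
    {p s : ℕ} (a : A.V p s)
    (f : ∀ θ : n ⟶ ⦋p⦌, Function.Surjective θ.toOrderHom → M.V s) :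
    ∃ e : (M.coinduced n).mooreDBGL.V p s, (p < k → e = φ.map p s a) ∧
      (p = k → (∀ θ h, e.1 θ = f θ h) ∧ DRel (E := (M.coinduced n).mooreDBGL) φ p s a e) := by
  classical
  by_cases hp : p = k
  swap
  · exact ⟨φ.map p s a, fun _ => rfl, fun h => absurd h hp⟩
  subst hp
  rcases p with _ | p
  · exact ⟨⟨fun θ => if h : _ then f θ h else 0, trivial⟩, fun h => absurd h (lt_irrefl _),
      fun _ => ⟨fun θ h => dif_pos h, trivial⟩⟩
  · obtain ⟨e, he, he'⟩ := ConnGrLie.exists_moore_coinduced (φ.map p s (A.d p s a))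
      (fun q hq θ hθ => by
        subst hq
        refine coinduced_apply_eq_zero_of_d ?_ θ hθ
        have := hφ (q + 1) (Nat.lt_succ_self _) s (A.d (q + 1) s a)
        exact this.trans (by rw [A.d_d, map_zero])) f
    exact ⟨e, fun h => absurd h (lt_irrefl _), fun _ => ⟨he', he⟩⟩

include hA

/-- Re-choosing the values on generators of dimension at least `k` does not affect elements of
dimension below `k`, which are brackets of generators of dimension below `k`. Compatibility with the
differential then passes from generators to brackets by `DRel.br`. -/
theorem exists_coinduced_step {k : ℕ}
    (φ : ConnBigrLie.Hom A.toConnBigrLie (M.coinduced n).mooreDBGL.toConnBigrLie)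
    (hφ : ∀ p < k, ∀ s a, DRel (E := (M.coinduced n).mooreDBGL) φ p s a (φ.map p s a))
    (hf : ∀ y, dp y < k → ∀ θ h, (φ.map _ _ (ι y)).1 θ = f y θ h) :
    ∃ φ' : ConnBigrLie.Hom A.toConnBigrLie (M.coinduced n).mooreDBGL.toConnBigrLie,
      ((∀ p < k + 1, ∀ s a, DRel (E := (M.coinduced n).mooreDBGL) φ' p s a (φ'.map p s a)) ∧
        ∀ y, dp y < k + 1 → ∀ θ h, (φ'.map _ _ (ι y)).1 θ = f y θ h) ∧
      ∀ p < k, ∀ s a, φ'.map p s a = φ.map p s a := by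
  choose e he he' using fun y => exists_coinduced_value φ hφ (ι y) (f y)
  obtain ⟨φ', hφ', -⟩ := hA.existsUnique _ e
  have agree : ∀ p < k, ∀ s a, φ'.map p s a = φ.map p s a := by
    intro p hp s a
    refine hA.induction (fun p s => { carrier := {a | p < k → φ'.map p s a = φ.map p s a}
                                      add_mem' := fun h h' hp => ?_
                                      zero_mem' := fun hp => ?_
                                      smul_mem' := fun c x h hp => ?_ }) ?_ ?_ a hp
    · rw [map_add, map_add, h hp, h' hp]
    · rw [map_zero, map_zero]
    · rw [map_smul, map_smul, h hp]
    · intro y hy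
      rw [hφ', he y hy]
    · intro p q n s t m h k' x hx y hy hn
      rw [φ'.map_br, φ.map_br, hx (by omega), hy (by omega)]
  refine ⟨φ', ⟨?_, fun y hy θ h => ?_⟩, agree⟩
  · have hC : ∀ p s, ∃ C : Submodule ℚ (A.V p s), ∀ x, x ∈ C ↔
        DRel (E := (M.coinduced n).mooreDBGL) φ' p s x (φ'.map p s x) := fun p s => DRel.linear
    choose C hC using hC
    intro p hp s a
    refine hA.induction (fun p s => { carrier := {a | p < k + 1 → a ∈ C p s}
                                      add_mem' := fun h h' hp => (C _ _).add_mem (h hp) (h' hp)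
                                      zero_mem' := fun hp => (C _ _).zero_mem
                                      smul_mem' := fun c x h hp => (C _ _).smul_mem c (h hp) })
      ?_ ?_ a hp |> (hC p s a).1
    · intro y hy
      rw [hC, hφ']
      have key : ∀ p s (a : A.V p s) e, p < k + 1 →
          DRel (E := (M.coinduced n).mooreDBGL) φ p s a e →
          DRel (E := (M.coinduced n).mooreDBGL) φ' p s a e := by
        intro p s a e hp h
        rcases p with _ | p
        · trivial
        · exact Eq.trans (b := φ.map p s (A.d p s a)) h (agree p (by omega) _ _).symm
      refine key _ _ _ _ hy ?_
      rcases Nat.lt_succ_iff_lt_or_eq.1 hy with h | h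
      · rw [he y h]; exact hφ _ h _ _
      · exact (he' y h).2
    · intro p q n s t m h k' x hx y hy hn
      exact (hC _ _ _).2 (DRel.br h k' ((hC _ _ _).1 (hx (by omega))) ((hC _ _ _).1 (hy (by omega))))
  · rw [hφ']
    rcases Nat.lt_succ_iff_lt_or_eq.1 hy with h' | h'
    · rw [he y h']; exact hf y h' θ h
    · exact (he' y h').1 θ h

/-- The successive corrections stabilize in each dimension, and their limit commutes with the
differential. -/
theorem exists_coinduced_hom :
    ∃ φ : A ⟶ (M.coinduced n).mooreDBGL,
      ∀ y θ h, ((Hom.toHom φ).map _ _ (ι y)).1 θ = f y θ h := by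
  let P : ℕ → ConnBigrLie.Hom A.toConnBigrLie (M.coinduced n).mooreDBGL.toConnBigrLie → Prop :=
    fun k φ => (∀ p < k, ∀ s a, DRel (E := (M.coinduced n).mooreDBGL) φ p s a (φ.map p s a)) ∧
      ∀ y, dp y < k → ∀ θ h, (φ.map _ _ (ι y)).1 θ = f y θ h
  obtain ⟨φ₀, -, -⟩ := hA.existsUnique (M.coinduced n).mooreDBGL.toConnBigrLie fun _ => 0
  have step : ∀ (k : ℕ) (φ : {φ // P k φ}), ∃ φ' : {φ // P (k + 1) φ},
      ∀ p < k, ∀ s a, φ'.1.map p s a = φ.1.map p s a := fun k φ => by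
    obtain ⟨φ', h, h'⟩ := exists_coinduced_step hA f φ.1 φ.2.1 φ.2.2
    exact ⟨⟨φ', h⟩, h'⟩
  choose next hnext using step
  let F : ∀ k, {φ // P k φ} := fun k =>
    Nat.rec ⟨φ₀, fun p hp => absurd hp (Nat.not_lt_zero p), fun y hy => absurd hy (Nat.not_lt_zero _)⟩
      next k
  have hF : ∀ k p, p < k → ∀ s a, (F (k + 1)).1.map p s a = (F k).1.map p s a :=
    fun k p hp => hnext k (F k) p hp
  have hF' : ∀ k p, p < k → ∀ s a, (F k).1.map p s a = (F (p + 1)).1.map p s a := by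
    intro k p hp s a
    induction k with
    | zero => exact absurd hp (Nat.not_lt_zero _)
    | succ k ih =>
      rcases Nat.lt_succ_iff_lt_or_eq.1 hp with h | h
      · rw [hF k p h, ih h]
      · subst h; rfl
  -- Stage `p + 1` is the first that is correct in dimension `p`; all later stages agree with it
  -- there.
  refine ⟨Hom.mk
    { map := fun p s => (F (p + 1)).1.map p s
      map_br := fun {p q n s t m} h k x y => ?_ } (fun p s x => ?_), fun y θ h => ?_⟩
  · rw [(F (n + 1)).1.map_br, hF' (n + 1) p (by omega), hF' (n + 1) q (by omega)]
  · refine Eq.trans ?_ ((F (p + 1 + 1)).2.1 (p + 1) (Nat.lt_succ_self _) s x).symm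
    exact (hF' (p + 1 + 1) p (by omega) _ _).symm
  · exact (F (dp y + 1)).2.2 y (Nat.lt_succ_self _) θ h

/-- Over a free DBGL, a solution of the relations with prescribed values on the nondegenerate
operators applied to generators. -/
theorem exists_rep (M : GrLie.{u} ℕ (AddMonoidHom.id ℕ))
    (f : ∀ y (θ : n ⟶ ⦋dp y⦌), Function.Surjective θ.toOrderHom → M.V (ds y)) :
    ∃ R : A.Rep n M, ∀ y θ h, R.g _ θ (ι y) = f y θ h := by
  let M' : ConnGrLie.{u} := (M.posPart (AddMonoidHom.id ℕ)).toConnGrLie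
    fun x => Subtype.ext (x.2 rfl)
  obtain ⟨φ, hφ⟩ := exists_coinduced_hom hA (M := M') (n := n)
    fun y θ h => ⟨f y θ h, fun h => absurd h (hA.pos y).ne'⟩
  let R := repOfHom φ n
  have hR : ∀ {p s : ℕ} (θ : n ⟶ ⦋p⦌) (x : A.V p s),
      R.g s θ x (𝟙 n) = ((Hom.toHom φ).map p s x).1 θ := fun θ x =>
    congrArg ((Hom.toHom φ).map _ _ x).1 (Category.id_comp θ)
  -- Evaluation at the identity of `[n]` turns a solution with values in functions on `Hom(n, n)`
  -- into a solution in `M`.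
  let inc : ∀ s, ((n ⟶ n) → M'.V s) →ₗ[ℚ] M.V s := fun s =>
    { toFun := fun x => (x (𝟙 n)).1, map_add' := fun _ _ => rfl, map_smul' := fun _ _ => rfl }
  refine ⟨{ g := fun s θ => inc s ∘ₗ R.g s θ
            g_δ_succ := fun θ i x => congrArg Subtype.val (congrFun (R.g_δ_succ θ i x) (𝟙 n))
            g_δ_zero := fun θ x => congrArg Subtype.val (congrFun (R.g_δ_zero θ x) (𝟙 n))
            g_br := fun h h' θ x y => ?_ }, fun y θ h => ?_⟩
  · refine (congrArg (inc _) (R.g_br h h' θ x y)).trans ((map_sum _ _ _).trans ?_)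
    rfl
  · exact congrArg Subtype.val ((hR θ (ι y)).trans (hφ y θ h))

/-- Over a free DBGL, the left adjoint is generated by the nondegenerate operators applied to
generators. -/
theorem nstar_gen_induction (C : ∀ s, Submodule ℚ ((A.nstarLie n).V s))
    (gen : ∀ y (θ : n ⟶ ⦋dp y⦌), Function.Surjective θ.toOrderHom →
      (A.nstarRep n).g _ θ (ι y) ∈ C (ds y))
    (br : ∀ {p q k : ℕ} (h : p + q = k), ∀ x ∈ C p, ∀ y ∈ C q, (A.nstarLie n).br h x y ∈ C k)
    {s : ℕ} (x : (A.nstarLie n).V s) : x ∈ C s := by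
  refine A.nstar_induction n (C := fun s x => x ∈ C s) ?_ (fun s => (C s).zero_mem)
    (fun x y => (C _).add_mem) (fun c x => (C _).smul_mem c) (fun h x y hx hy => br h x hx y hy) x
  -- Induction on dimension: an operator that is not surjective either gives zero or, through `δ 0`,
  -- replaces the generator by its boundary, an arbitrary element of smaller dimension.
  have key : ∀ k p, p < k → ∀ s (x : A.V p s) (θ : n ⟶ ⦋p⦌), (A.nstarRep n).g s θ x ∈ C s := by
    intro k
    induction k with
    | zero => exact fun p hp => absurd hp (Nat.not_lt_zero p)
    | succ k ih =>
      intro p hp s x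
      refine hA.induction (fun p s =>
        { carrier := {x | p < k + 1 → ∀ θ : n ⟶ ⦋p⦌, (A.nstarRep n).g s θ x ∈ C s}
          add_mem' := fun h h' hp θ => ?_
          zero_mem' := fun hp θ => ?_
          smul_mem' := fun c x h hp θ => ?_ }) ?_ ?_ x hp
      · rw [map_add]; exact (C _).add_mem (h hp θ) (h' hp θ)
      · rw [map_zero]; exact (C _).zero_mem
      · rw [map_smul]; exact (C _).smul_mem c (h hp θ)
      · intro y hy θ
        by_cases hθ : Function.Surjective θ.toOrderHom
        · exact gen y θ hθ
        · generalize ι y = x at *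
          generalize dp y = p at *
          generalize ds y = s at *
          obtain ⟨v, hv⟩ := not_forall.1 hθ
          rcases p with _ | p
          · exact absurd ⟨0, Subsingleton.elim (α := Fin 1) _ _⟩ hv
          · obtain ⟨θ, rfl⟩ := SimplexCategory.eq_comp_δ_of_not_surjective' θ v
              fun j hj => hv ⟨j, hj⟩
            refine Fin.cases ?_ (fun i => ?_) v
            · rw [(A.nstarRep n).g_δ_zero]
              exact (C _).smul_mem _ (ih p (by omega) _ _ _)
            · rw [(A.nstarRep n).g_δ_succ]
              exact (C _).zero_mem
      · intro p q k' s t m h h' x hx y hy hn θ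
        rw [(A.nstarRep n).g_br h h']
        exact Submodule.sum_mem _ fun σ _ => (C _).smul_mem _
          (br h' _ (hx (by omega) _) _ (hy (by omega) _))
  exact fun {p s} θ x => key (p + 1) p (Nat.lt_succ_self p) s x θ

end Extend

/-- The left adjoint takes free DBGLs to free simplicial graded Lie algebras. -/
theorem isFree_nstarObj (hA : A.IsFree) : SConnGrLie.IsFree A.nstarObj := by
  obtain ⟨Y, dp, ds, ι, hA⟩ := hA.exists_freeOn
  -- Membership is an equality in a sigma type because `z` lives in degree `s`, while a generator
  -- lives in degree `ds y`.
  refine ⟨fun n s => {z | ∃ (y : Y) (θ : ⦋n⦌ ⟶ ⦋dp y⦌), Function.Surjective θ.toOrderHom ∧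
    (⟨s, z⟩ : Σ s, (A.nstarLie ⦋n⦌).V s) = ⟨ds y, (A.nstarRep ⦋n⦌).g _ θ (ι y)⟩}, ?_, ?_⟩
  · intro n M f
    obtain ⟨R, hR⟩ := exists_rep hA (n := ⦋n⦌) M.toGrLie
      fun y θ h => f (ds y) ⟨(A.nstarRep ⦋n⦌).g _ θ (ι y), y, θ, h, rfl⟩
    refine ⟨nstarLift R, ?_, fun ψ hψ => ?_⟩
    · rintro s ⟨z, y, θ, h, e⟩
      cases e
      exact hR y θ h
    · refine ConnGrLie.Hom.ext (funext fun s => LinearMap.ext fun x => ?_)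
      refine nstar_gen_induction hA (n := ⦋n⦌)
        (fun s => LinearMap.eqLocus (ψ.map s) ((nstarLift R).map s)) ?_ ?_ x
      · intro y θ h
        exact (hψ (ds y) ⟨(A.nstarRep ⦋n⦌).g _ θ (ι y), y, θ, h, rfl⟩).trans (hR y θ h).symm
      · intro p q k h x hx y hy
        exact (ψ.map_br h x y).trans ((congrArg₂ (fun a b => M.br h a b) hx hy).trans
          ((nstarLift R).map_br h x y).symm)
  · rintro n s i x ⟨y, θ, h, e⟩
    cases e
    refine ⟨y, SimplexCategory.σ i ≫ θ, ?_, rfl⟩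
    exact h.comp (SimplexCategory.epi_iff_surjective.1 inferInstance)

end ConnDBGL

/-! ### The chain complex of a simplicial module -/

namespace SMod

variable (B : SMod.{u})

/-- A simplicial module, as a simplicial object. -/
abbrev toSimplicial : SimplicialObject (ModuleCat.{u} ℚ) where
  obj n := ModuleCat.of ℚ (B.X n.unop.len)
  map {m n} f := ModuleCat.ofHom (B.act (m := n.unop.len) (n := m.unop.len) f.unop)
  map_id n := by ext x; exact B.act_id x
  map_comp f g := by ext x; exact B.act_comp _ _ x

/-- The alternating sum of the face maps. -/
def d (n : ℕ) : B.X (n + 1) →ₗ[ℚ] B.X n :=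
  ∑ i : Fin (n + 2), (-1 : ℚ) ^ (i : ℕ) • B.act (SimplexCategory.δ i)

theorem d_apply {n : ℕ} (x : B.X (n + 1)) :
    B.d n x = ∑ i : Fin (n + 2), (-1 : ℚ) ^ (i : ℕ) • B.act (SimplexCategory.δ i) x := by
  simp [d]

theorem neg_one_pow_zsmul {V : Type*} [AddCommGroup V] [Module ℚ V] (i : ℕ) (x : V) :
    ((-1 : ℤ) ^ i) • x = ((-1 : ℚ) ^ i) • x := by
  rw [← Int.cast_smul_eq_zsmul ℚ]; push_cast; rfl

theorem objD_apply {n : ℕ} (x : B.X (n + 1)) :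
    (AlgebraicTopology.AlternatingFaceMapComplex.objD B.toSimplicial n).hom x = B.d n x := by
  rw [d_apply, AlgebraicTopology.AlternatingFaceMapComplex.objD, ModuleCat.hom_sum,
    LinearMap.sum_apply]
  refine Finset.sum_congr rfl fun i _ => ?_
  rw [ModuleCat.hom_zsmul, LinearMap.smul_apply]
  exact neg_one_pow_zsmul _ _

theorem d_d {n : ℕ} (x : B.X (n + 1 + 1)) : B.d n (B.d (n + 1) x) = 0 := by
  rw [← objD_apply, ← objD_apply, ← ModuleCat.comp_apply,
    AlgebraicTopology.AlternatingFaceMapComplex.d_squared]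
  rfl

/-- The cycles of the unnormalized chain complex. -/
def IsCycle (B : SMod.{u}) : ∀ {n : ℕ}, B.X n → Prop := fun {n} => match n with
  | 0 => fun _ => True
  | n + 1 => fun x => B.d n x = 0

variable {B} {C D K : SMod.{u}}

/-- Maps of simplicial modules. -/
structure Map (B C : SMod.{u}) where
  toFun : ∀ n, B.X n →ₗ[ℚ] C.X n
  nat : ∀ {m n : ℕ} (f : ⦋m⦌ ⟶ ⦋n⦌) (x : B.X n), toFun m (B.act f x) = C.act f (toFun n x)

theorem Map.d (f : Map B C) {n : ℕ} (x : B.X (n + 1)) :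
    f.toFun n (B.d n x) = C.d n (f.toFun (n + 1) x) := by
  rw [d_apply, d_apply, map_sum]
  exact Finset.sum_congr rfl fun i _ => by rw [map_smul, f.nat]

/-- A simplicial module with the homology of a sphere of dimension `r`. -/
structure Sphere (B : SMod.{u}) (r : ℕ) (e : B.X r) (lam : B.X r →ₗ[ℚ] ℚ) : Prop where
  degenerate : ∀ {m : ℕ} (φ : ⦋m⦌ ⟶ ⦋r⦌), ¬ Function.Surjective φ.toOrderHom → B.act φ e = 0
  lam_d : ∀ x : B.X (r + 1), lam (B.d r x) = 0
  lam_e : lam e ≠ 0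
  exact_ne : ∀ {n : ℕ} (z : B.X n), n ≠ r → B.IsCycle z → ∃ u, B.d n u = z
  exact_eq : ∀ z : B.X r, B.IsCycle z → lam z = 0 → ∃ u, B.d r u = z

/-- The connecting homomorphism. -/
theorem Sphere.connecting (inj : Map B D) (q : Map D K)
    (s : ∀ n, K.X n →ₗ[ℚ] D.X n) (κ : ∀ n, D.X n →ₗ[ℚ] B.X n)
    (hqs : ∀ n x, q.toFun n (s n x) = x) (hκ : ∀ n x, κ n (inj.toFun n x) = x)
    (hsplit : ∀ n x, x = s n (q.toFun n x) + inj.toFun n (κ n x))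
    (hD : ∀ {n : ℕ} (z : D.X n), D.IsCycle z → ∃ u, D.d n u = z)
    {r : ℕ} {e : B.X r} {lam : B.X r →ₗ[ℚ] ℚ} (hB : Sphere B r e lam) (e' : K.X (r + 1))
    (he' : ∀ {m : ℕ} (φ : ⦋m⦌ ⟶ ⦋r + 1⦌), ¬ Function.Surjective φ.toOrderHom → K.act φ e' = 0)
    (hee' : κ r (D.d r (s (r + 1) e')) = e) :
    ∃ lam', Sphere K (r + 1) e' lam' := by
  have hqi : ∀ n x, q.toFun n (inj.toFun n x) = 0 := fun n x => by
    have h := congrArg (q.toFun n) (hsplit n (inj.toFun n x))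
    rw [map_add, hqs, hκ] at h
    simpa using h
  -- The diagram chase: lift `z` to `D`, correct the lift by an element of `B` so that it becomes a
  -- cycle, and use that `D` is acyclic. The obstruction is a cycle of `B`, which bounds unless it
  -- lies in dimension `r` with nonzero `lam`. The `HEq` states this condition without fixing `n = r
  -- + 1` in advance.
  have main : ∀ {n : ℕ} (z : K.X n), K.IsCycle z →
      (∀ m (h : n = m + 1), m = r → ∀ z' : K.X (r + 1), HEq z z' →
        lam (κ r (D.d r (s (r + 1) z'))) = 0) → ∃ u, K.d n u = z := by
    intro n z hz hlam
    suffices h : ∃ x, D.IsCycle (s n z - inj.toFun n x) by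
      obtain ⟨x, hx⟩ := h
      obtain ⟨v, hv⟩ := hD _ hx
      exact ⟨q.toFun _ v, by rw [← q.d, hv, map_sub, hqs, hqi, sub_zero]⟩
    rcases n with _ | n
    · exact ⟨0, trivial⟩
    have h1 : D.d n (s (n + 1) z) = inj.toFun n (κ n (D.d n (s (n + 1) z))) := by
      conv_lhs => rw [hsplit n (D.d n (s (n + 1) z)), q.d, hqs, show K.d n z = 0 from hz, map_zero,
        zero_add]
    have hy : B.IsCycle (κ n (D.d n (s (n + 1) z))) := by
      rcases n with _ | n
      · trivial
      · change B.d n _ = 0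
        rw [← hκ n (B.d n _), inj.d, ← h1, D.d_d, map_zero]
    have h2 : ∃ u, B.d n u = κ n (D.d n (s (n + 1) z)) := by
      by_cases hn : n = r
      · subst hn
        exact hB.exact_eq _ hy (hlam n rfl rfl z HEq.rfl)
      · exact hB.exact_ne _ hn hy
    obtain ⟨x, hx⟩ := h2
    refine ⟨x, ?_⟩
    change D.d n _ = 0
    rw [map_sub, ← inj.d, hx, ← h1, sub_self]
  refine ⟨lam ∘ₗ κ r ∘ₗ D.d r ∘ₗ s (r + 1), he', fun x => ?_, ?_, fun {n} z hn hz => ?_,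
    fun z hz hz' => ?_⟩
  · have h1 := hsplit (r + 1) (D.d (r + 1) (s (r + 2) x))
    rw [q.d, hqs] at h1
    have h2 := congrArg (D.d r) h1
    rw [d_d, map_add, ← inj.d] at h2
    have h3 := congrArg (fun w => lam (κ r w)) h2
    simp only [map_zero, map_add, hκ, hB.lam_d, add_zero] at h3
    exact h3.symm
  · have : lam (κ r (D.d r (s (r + 1) e'))) ≠ 0 := by rw [hee']; exact hB.lam_e
    exact this
  · exact main z hz fun m h h' => absurd (h.trans (by rw [h'])) hn
  · refine main z hz fun m h h' z' hzz' => ?_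
    rw [← eq_of_heq hzz']
    exact hz'

/-! ### Contractibility from an action of the interval -/

/-- The map `[n] → [1]` which is `0` on the first `i + 1` vertices. -/
def step {n : ℕ} (i : ℕ) : ⦋n⦌ ⟶ ⦋1⦌ :=
  SimplexCategory.Hom.mk
    { toFun := fun j => if (j : ℕ) < i then 0 else 1
      monotone' := fun a b hab => by
        have : (a : ℕ) ≤ b := hab
        dsimp only
        split_ifs
        · exact le_rfl
        · exact Fin.zero_le _
        · omega
        · exact le_rfl }

theorem step_apply {n : ℕ} (i : ℕ) (j : Fin (n + 1)) :
    (step (n := n) i).toOrderHom j = if (j : ℕ) < i then 0 else 1 := rfl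

theorem comp_step_eq {m n : ℕ} (f : ⦋m⦌ ⟶ ⦋n⦌) (i k : ℕ)
    (h : ∀ j : Fin (m + 1), (f.toOrderHom j : ℕ) < i ↔ (j : ℕ) < k) : f ≫ step i = step k :=
  SimplexCategory.Hom.ext _ _ (OrderHom.ext _ _ (funext fun j => by
    refine (step_apply i (f.toOrderHom j)).trans ?_
    rw [step_apply]
    simp only [h j]))

theorem val_δ {n : ℕ} (i : Fin (n + 2)) (j : Fin (n + 1)) :
    ((SimplexCategory.δ i).toOrderHom j : ℕ) = if (j : ℕ) < i then (j : ℕ) else j + 1 := by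
  change (i.succAbove j : ℕ) = _
  simp only [Fin.succAbove, Fin.lt_def, Fin.val_castSucc]
  split_ifs <;> rfl

theorem val_σ {n : ℕ} (i : Fin (n + 1)) (j : Fin (n + 2)) :
    ((SimplexCategory.σ i).toOrderHom j : ℕ) = if (i : ℕ) < j then (j : ℕ) - 1 else j := by
  change (i.predAbove j : ℕ) = _
  simp only [Fin.predAbove, Fin.lt_def, Fin.val_castSucc]
  split_ifs <;> rfl

/-- A simplicial module on which the interval acts by a contraction is acyclic. -/
theorem exact_of_interval (t : ∀ {n : ℕ}, (⦋n⦌ ⟶ ⦋1⦌) → B.X n →ₗ[ℚ] B.X n)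
    (ht : ∀ {m n : ℕ} (f : ⦋m⦌ ⟶ ⦋n⦌) (ψ : ⦋n⦌ ⟶ ⦋1⦌) (x : B.X n),
      B.act f (t ψ x) = t (f ≫ ψ) (B.act f x))
    (ht0 : ∀ (n : ℕ) (x : B.X n), t (step (n + 1)) x = 0)
    (ht1 : ∀ (n : ℕ) (x : B.X n), t (step 0) x = x) {n : ℕ} (z : B.X n) (hz : B.IsCycle z) :
    ∃ u, B.d n u = z := by
  have key : ∀ {m n : ℕ} (f : ⦋m⦌ ⟶ ⦋n + 1⦌) (i k : ℕ) (g : ⦋m⦌ ⟶ ⦋n⦌) (s : ⦋n + 1⦌ ⟶ ⦋n⦌)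
      (x : B.X n), (∀ j : Fin (m + 1), (f.toOrderHom j : ℕ) < i ↔ (j : ℕ) < k) → f ≫ s = g →
      B.act f (t (step i) (B.act s x)) = t (step k) (B.act g x) := by
    intro m n f i k g s x h hg
    rw [ht, ← act_comp, comp_step_eq f i k h, hg]
  -- The prism operators: `h i` applies the degeneracy `s_i` and then the interval coordinate that
  -- vanishes on the first `i + 1` vertices. They connect the zero map to the identity.
  let H : SimplicialObject.Homotopy (0 : B.toSimplicial ⟶ B.toSimplicial) (𝟙 B.toSimplicial) :=
    { h := fun {n} i => ModuleCat.ofHom (t (step (i + 1)) ∘ₗ B.act (SimplexCategory.σ i))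
      h_zero_comp_δ_zero := fun n => ModuleCat.hom_ext <| LinearMap.ext fun x => by
        refine (key (SimplexCategory.δ 0) _ 0 (𝟙 ⦋n⦌) _ x (fun j => ?_) ?_).trans ?_
        · rw [val_δ]; simp
        · exact SimplexCategory.δ_comp_σ_self (n := n) (i := 0)
        · rw [ht1, act_id]; rfl
      h_last_comp_δ_last := fun n => ModuleCat.hom_ext <| LinearMap.ext fun x => by
        refine (key (SimplexCategory.δ (Fin.last (n + 1))) _ (n + 1) (𝟙 ⦋n⦌) _ x
          (fun j => ?_) ?_).trans ?_
        · rw [val_δ]; simp; split_ifs <;> omega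
        · exact SimplexCategory.δ_comp_σ_succ (n := n) (i := Fin.last n)
        · exact ht0 n _
      h_succ_comp_δ_castSucc_of_lt := fun {n} i j hij =>
        ModuleCat.hom_ext <| LinearMap.ext fun x => by
        refine (key (SimplexCategory.δ i.castSucc) _ (j + 1) _ _ x (fun k => ?_)
          (SimplexCategory.δ_comp_σ_of_le hij)).trans (congrArg _ (B.act_comp _ _ x))
        rw [val_δ]; have := j.2; simp only [Fin.val_succ, Fin.val_castSucc, Fin.le_def, Fin.lt_def] at *; split_ifs <;> omega
      h_succ_comp_δ_castSucc_succ := fun {n} j =>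
        ModuleCat.hom_ext <| LinearMap.ext fun x => by
        refine (key (SimplexCategory.δ j.castSucc.succ) _ (j + 1) (𝟙 _) _ x (fun k => ?_) ?_).trans
          (key (SimplexCategory.δ j.castSucc.succ) _ (j + 1) (𝟙 _) _ x (fun k => ?_) ?_).symm
        · rw [val_δ]; have := j.2; simp only [Fin.val_succ, Fin.val_castSucc, Fin.le_def, Fin.lt_def] at *; split_ifs <;> omega
        · exact SimplexCategory.δ_comp_σ_self (n := n + 1) (i := j.succ)
        · rw [val_δ]; have := j.2; simp only [Fin.val_succ, Fin.val_castSucc, Fin.le_def, Fin.lt_def] at *; split_ifs <;> omega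
        · exact SimplexCategory.δ_comp_σ_succ (n := n + 1) (i := j.castSucc)
      h_castSucc_comp_δ_succ_of_lt := fun {n} i j hij =>
        ModuleCat.hom_ext <| LinearMap.ext fun x => by
        refine (key (SimplexCategory.δ i.succ) _ (j + 1) _ _ x (fun k => ?_)
          (SimplexCategory.δ_comp_σ_of_gt hij)).trans (congrArg _ (B.act_comp _ _ x))
        rw [val_δ]; have := j.2; simp only [Fin.val_succ, Fin.val_castSucc, Fin.le_def, Fin.lt_def] at *; split_ifs <;> omega
      h_comp_σ_castSucc_of_le := fun {n} i j hij =>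
        ModuleCat.hom_ext <| LinearMap.ext fun x => by
        refine (key (SimplexCategory.σ i.castSucc) _ (j + 1 + 1) _ _ x (fun k => ?_)
          (SimplexCategory.σ_comp_σ hij)).trans (congrArg _ (B.act_comp _ _ x))
        rw [val_σ]; have := j.2; simp only [Fin.val_succ, Fin.val_castSucc, Fin.le_def, Fin.lt_def] at *; split_ifs <;> omega
      h_comp_σ_succ_of_lt := fun {n} i j hij =>
        ModuleCat.hom_ext <| LinearMap.ext fun x => by
        refine (key (SimplexCategory.σ i.succ) _ (j + 1) _ _ x (fun k => ?_)
          (SimplexCategory.σ_comp_σ hij).symm).trans (congrArg _ (B.act_comp _ _ x))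
        rw [val_σ]; have := j.2; simp only [Fin.val_succ, Fin.val_castSucc, Fin.le_def, Fin.lt_def] at *; split_ifs <;> omega }
  have hc := H.toChainHomotopy.comm n
  rw [prevD_eq (j' := n + 1) (w := by simp)] at hc
  have h1 := congrArg (fun f => f.hom z) hc
  have h2 : (dNext n H.toChainHomotopy.hom).hom z = 0 := by
    rcases n with _ | n
    · rw [dNext_eq_zero _ _ (by simp)]; rfl
    · rw [dNext_eq (i' := n) (w := by simp), ModuleCat.comp_apply]
      have h3 : (((AlgebraicTopology.alternatingFaceMapComplex (ModuleCat.{u} ℚ)).obj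
          B.toSimplicial).d (n + 1) n).hom z = 0 := by
        rw [AlgebraicTopology.alternatingFaceMapComplex_obj_d]
        exact (B.objD_apply z).trans hz
      rw [h3, map_zero]
  rw [ModuleCat.hom_add, ModuleCat.hom_add, LinearMap.add_apply, LinearMap.add_apply, h2,
    ModuleCat.comp_apply, AlgebraicTopology.alternatingFaceMapComplex_obj_d] at h1
  -- On a cycle the homotopy relation reads `0 = d (h z) + z`, hence the minus sign.
  refine ⟨-(H.toChainHomotopy.hom n (n + 1)).hom z, ?_⟩
  rw [map_neg, ← objD_apply]
  refine neg_eq_of_add_eq_zero_right ?_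
  rw [zero_add] at h1
  exact h1.symm

end SMod

namespace SMod

/-! ### Chains on a simplex relative to some faces, with coefficients in a simplicial module -/

section Tensor

open Classical

variable {p : ℕ} (P : ∀ {n : ℕ}, (⦋n⦌ ⟶ ⦋p⦌) → Prop) (B : SMod.{u})

/-- The element `θ ⊗ b`, which is zero if `θ` does not satisfy `P`. -/
def tensorOf {n : ℕ} (θ : ⦋n⦌ ⟶ ⦋p⦌) : B.X n →ₗ[ℚ] ({θ : ⦋n⦌ ⟶ ⦋p⦌ // P θ} →₀ B.X n) :=
  if h : P θ then Finsupp.lsingle ⟨θ, h⟩ else 0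

/-- The linear map given by its values on the elements `θ ⊗ b`. -/
def tensorLift {n : ℕ} {W : Type*} [AddCommGroup W] [Module ℚ W]
    (F : (⦋n⦌ ⟶ ⦋p⦌) → B.X n →ₗ[ℚ] W) : ({θ : ⦋n⦌ ⟶ ⦋p⦌ // P θ} →₀ B.X n) →ₗ[ℚ] W :=
  Finsupp.lsum ℚ fun θ => F θ.1

variable {P B}

theorem tensorOf_eq_zero {n : ℕ} {θ : ⦋n⦌ ⟶ ⦋p⦌} (h : ¬ P θ) (b : B.X n) :
    tensorOf P B θ b = 0 := by
  rw [tensorOf, dif_neg h]; rfl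

theorem tensorLift_of {n : ℕ} {W : Type*} [AddCommGroup W] [Module ℚ W]
    (F : (⦋n⦌ ⟶ ⦋p⦌) → B.X n →ₗ[ℚ] W) {θ : ⦋n⦌ ⟶ ⦋p⦌} (h : P θ) (b : B.X n) :
    tensorLift P B F (tensorOf P B θ b) = F θ b := by
  rw [tensorOf, dif_pos h]
  exact Finsupp.sum_single_index (map_zero _)

theorem tensorLift_of' {n : ℕ} {W : Type*} [AddCommGroup W] [Module ℚ W]
    (F : (⦋n⦌ ⟶ ⦋p⦌) → B.X n →ₗ[ℚ] W) (θ : ⦋n⦌ ⟶ ⦋p⦌) (b : B.X n) (h : ¬ P θ → F θ b = 0) :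
    tensorLift P B F (tensorOf P B θ b) = F θ b := by
  by_cases hθ : P θ
  · exact tensorLift_of F hθ b
  · rw [tensorOf_eq_zero hθ, map_zero, h hθ]

theorem tensor_hom_ext {n : ℕ} {W : Type*} [AddCommGroup W] [Module ℚ W]
    {F F' : ({θ : ⦋n⦌ ⟶ ⦋p⦌ // P θ} →₀ B.X n) →ₗ[ℚ] W}
    (h : ∀ θ, P θ → ∀ b, F (tensorOf P B θ b) = F' (tensorOf P B θ b)) : F = F' := by
  refine Finsupp.lhom_ext fun θ b => ?_
  have := h θ.1 θ.2 b
  rwa [tensorOf, dif_pos θ.2] at this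

theorem tensor_act_of
    (hP : ∀ {m n : ℕ} (α : ⦋m⦌ ⟶ ⦋n⦌) (θ : ⦋n⦌ ⟶ ⦋p⦌), P (α ≫ θ) → P θ) {m n : ℕ} (α : ⦋m⦌ ⟶ ⦋n⦌) (θ : ⦋n⦌ ⟶ ⦋p⦌) (b : B.X n) :
    tensorLift P B (fun θ => tensorOf P B (α ≫ θ) ∘ₗ B.act α) (tensorOf P B θ b) =
      tensorOf P B (α ≫ θ) (B.act α b) :=
  tensorLift_of' (fun θ => tensorOf P B (α ≫ θ) ∘ₗ B.act α) θ b
    fun h => tensorOf_eq_zero (fun h' => h (hP α θ h')) _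

variable (P B) in
/-- The simplicial module with basis the maps to the simplex satisfying `P`, over `B`. -/
abbrev tensor (hP : ∀ {m n : ℕ} (α : ⦋m⦌ ⟶ ⦋n⦌) (θ : ⦋n⦌ ⟶ ⦋p⦌), P (α ≫ θ) → P θ) :
    SMod.{u} where
  X n := {θ : ⦋n⦌ ⟶ ⦋p⦌ // P θ} →₀ B.X n
  act α := tensorLift P B fun θ => tensorOf P B (α ≫ θ) ∘ₗ B.act α
  act_id x := by
    refine LinearMap.congr_fun (g := LinearMap.id) (tensor_hom_ext fun θ _ b => ?_) x
    rw [tensor_act_of hP, B.act_id, Category.id_comp]; rfl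
  act_comp f g x := by
    refine LinearMap.congr_fun (g := tensorLift P B (fun θ => tensorOf P B (f ≫ θ) ∘ₗ B.act f) ∘ₗ
      tensorLift P B (fun θ => tensorOf P B (g ≫ θ) ∘ₗ B.act g)) (tensor_hom_ext fun θ _ b => ?_) x
    rw [LinearMap.comp_apply, tensor_act_of hP, tensor_act_of hP, tensor_act_of hP, B.act_comp,
      Category.assoc]

end Tensor

/-- The surjective maps to a simplex. -/
def IsSurj {p n : ℕ} (θ : ⦋n⦌ ⟶ ⦋p⦌) : Prop := Function.Surjective θ.toOrderHom

/-- The maps to a simplex whose image contains all vertices but possibly the first one. -/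
def IsSurjPos {p n : ℕ} (θ : ⦋n⦌ ⟶ ⦋p⦌) : Prop := ∀ v : Fin (p + 1), v ≠ 0 → ∃ j, θ.toOrderHom j = v

theorem IsSurj.of_comp {p m n : ℕ} (α : ⦋m⦌ ⟶ ⦋n⦌) (θ : ⦋n⦌ ⟶ ⦋p⦌) (h : IsSurj (α ≫ θ)) :
    IsSurj θ := fun v => (h v).imp' _ fun _ hj => hj

theorem IsSurjPos.of_comp {p m n : ℕ} (α : ⦋m⦌ ⟶ ⦋n⦌) (θ : ⦋n⦌ ⟶ ⦋p⦌) (h : IsSurjPos (α ≫ θ)) :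
    IsSurjPos θ := fun v hv => (h v hv).imp' _ fun _ hj => hj

theorem IsSurj.pos {p n : ℕ} {θ : ⦋n⦌ ⟶ ⦋p⦌} (h : IsSurj θ) : IsSurjPos θ := fun v _ => h v

/-- A map onto all positive vertices either hits vertex `0`, and is surjective, or factors through
`δ 0` by a surjection. This splits `relD (p + 1)` into `relK p` and `relK (p + 1)` in each degree.
-/
theorem isSurjPos_comp_δ {p n : ℕ} {θ : ⦋n⦌ ⟶ ⦋p⦌} :
    IsSurjPos (θ ≫ SimplexCategory.δ 0) ↔ IsSurj θ := by
  constructor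
  · intro h v
    obtain ⟨j, hj⟩ := h v.succ (Fin.succ_ne_zero v)
    exact ⟨j, Fin.succ_injective _ hj⟩
  · intro h v hv
    obtain ⟨w, rfl⟩ := Fin.exists_succ_eq.2 hv
    obtain ⟨j, hj⟩ := h w
    exact ⟨j, congrArg Fin.succ hj⟩

theorem not_isSurj_comp_δ {p n : ℕ} (θ : ⦋n⦌ ⟶ ⦋p⦌) : ¬ IsSurj (θ ≫ SimplexCategory.δ 0) :=
  fun h => by obtain ⟨j, hj⟩ := h 0; exact Fin.succ_ne_zero _ hj

variable (p : ℕ) (B : SMod.{u})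

/-- The chains on a simplex modulo its boundary. -/
abbrev relK : SMod.{u} := tensor (p := p) IsSurj B IsSurj.of_comp

/-- The chains on a simplex modulo the faces which contain the first vertex. -/
abbrev relD : SMod.{u} := tensor (p := p) IsSurjPos B IsSurjPos.of_comp

/-- The element `θ ⊗ b` of the chains modulo the boundary. -/
abbrev ofK {n : ℕ} (θ : ⦋n⦌ ⟶ ⦋p⦌) : B.X n →ₗ[ℚ] (relK p B).X n := tensorOf IsSurj B θ

/-- The element `θ ⊗ b` of the chains modulo the faces containing the first vertex. -/
abbrev ofD {n : ℕ} (θ : ⦋n⦌ ⟶ ⦋p⦌) : B.X n →ₗ[ℚ] (relD p B).X n := tensorOf IsSurjPos B θ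

variable {p B}

theorem act_ofK {m n : ℕ} (α : ⦋m⦌ ⟶ ⦋n⦌) (θ : ⦋n⦌ ⟶ ⦋p⦌) (b : B.X n) :
    (relK p B).act α (ofK p B θ b) = ofK p B (α ≫ θ) (B.act α b) :=
  tensor_act_of IsSurj.of_comp α θ b

theorem act_ofD {m n : ℕ} (α : ⦋m⦌ ⟶ ⦋n⦌) (θ : ⦋n⦌ ⟶ ⦋p⦌) (b : B.X n) :
    (relD p B).act α (ofD p B θ b) = ofD p B (α ≫ θ) (B.act α b) :=
  tensor_act_of IsSurjPos.of_comp α θ b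

variable (p B) in
/-- The projection from the chains modulo some faces to the chains modulo all faces. -/
def projK : Map (relD p B) (relK p B) where
  toFun n := tensorLift IsSurjPos B fun θ => ofK p B θ
  nat {m n} f x := by
    have h : ∀ {n : ℕ} (θ : ⦋n⦌ ⟶ ⦋p⦌) (b : B.X n),
        tensorLift IsSurjPos B (fun θ => ofK p B θ) (ofD p B θ b) = ofK p B θ b := fun θ b =>
      tensorLift_of' (fun θ => ofK p B θ) θ b fun h => tensorOf_eq_zero (fun h' => h h'.pos) b
    refine LinearMap.congr_fun (f := tensorLift IsSurjPos B (fun θ => ofK p B θ) ∘ₗ (relD p B).act f)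
      (g := (relK p B).act f ∘ₗ tensorLift IsSurjPos B (fun θ => ofK p B θ))
      (tensor_hom_ext fun θ _ b => ?_) x
    rw [LinearMap.comp_apply, LinearMap.comp_apply, act_ofD, h, h, act_ofK]

theorem projK_ofD {n : ℕ} (θ : ⦋n⦌ ⟶ ⦋p⦌) (b : B.X n) :
    (projK p B).toFun n (ofD p B θ b) = ofK p B θ b :=
  tensorLift_of' (fun θ => ofK p B θ) θ b fun h => tensorOf_eq_zero (fun h' => h h'.pos) b

variable (p B) in
/-- The inclusion of the chains on the face opposite to the first vertex. -/
def injK : Map (relK p B) (relD (p + 1) B) where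
  toFun n := tensorLift IsSurj B fun θ => ofD (p + 1) B (θ ≫ SimplexCategory.δ 0)
  nat {m n} f x := by
    have h : ∀ {n : ℕ} (θ : ⦋n⦌ ⟶ ⦋p⦌) (b : B.X n),
        tensorLift IsSurj B (fun θ => ofD (p + 1) B (θ ≫ SimplexCategory.δ 0)) (ofK p B θ b) =
          ofD (p + 1) B (θ ≫ SimplexCategory.δ 0) b := fun θ b =>
      tensorLift_of' (fun θ => ofD (p + 1) B (θ ≫ SimplexCategory.δ 0)) θ b
        fun h => tensorOf_eq_zero (fun h' => h (isSurjPos_comp_δ.1 h')) b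
    refine LinearMap.congr_fun
      (f := tensorLift IsSurj B (fun θ => ofD (p + 1) B (θ ≫ SimplexCategory.δ 0)) ∘ₗ
        (relK p B).act f)
      (g := (relD (p + 1) B).act f ∘ₗ
        tensorLift IsSurj B (fun θ => ofD (p + 1) B (θ ≫ SimplexCategory.δ 0)))
      (tensor_hom_ext fun θ _ b => ?_) x
    rw [LinearMap.comp_apply, LinearMap.comp_apply, act_ofK, h, h, act_ofD, Category.assoc]

theorem injK_ofK {n : ℕ} (θ : ⦋n⦌ ⟶ ⦋p⦌) (b : B.X n) :
    (injK p B).toFun n (ofK p B θ b) = ofD (p + 1) B (θ ≫ SimplexCategory.δ 0) b :=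
  tensorLift_of' (fun θ => ofD (p + 1) B (θ ≫ SimplexCategory.δ 0)) θ b
    fun h => tensorOf_eq_zero (fun h' => h (isSurjPos_comp_δ.1 h')) b

variable (p B) in
/-- The linear section of `projK`. -/
def sectK (n : ℕ) : (relK p B).X n →ₗ[ℚ] (relD p B).X n :=
  tensorLift IsSurj B fun θ => ofD p B θ

theorem sectK_ofK {n : ℕ} {θ : ⦋n⦌ ⟶ ⦋p⦌} (h : IsSurj θ) (b : B.X n) :
    sectK p B n (ofK p B θ b) = ofD p B θ b := tensorLift_of _ h b

open Classical in
variable (p B) in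
/-- The linear retraction of `injK`. -/
def retrK (n : ℕ) : (relD (p + 1) B).X n →ₗ[ℚ] (relK p B).X n :=
  tensorLift IsSurjPos B fun θ =>
    if ∃ j, θ.toOrderHom j = 0 then 0 else ofK p B (θ ≫ SimplexCategory.σ 0)

theorem retrK_ofD {n : ℕ} {θ : ⦋n⦌ ⟶ ⦋p + 1⦌} (h : ∃ j, θ.toOrderHom j = 0) (b : B.X n) :
    retrK p B n (ofD (p + 1) B θ b) = 0 := by
  refine (tensorLift_of' _ θ b fun _ => ?_).trans ?_
  all_goals rw [if_pos h]; rfl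

theorem retrK_ofD_comp {n : ℕ} (θ : ⦋n⦌ ⟶ ⦋p⦌) (b : B.X n) :
    retrK p B n (ofD (p + 1) B (θ ≫ SimplexCategory.δ 0) b) = ofK p B θ b := by
  have h0 : ¬ ∃ j, (θ ≫ SimplexCategory.δ 0).toOrderHom j = 0 := fun ⟨j, hj⟩ =>
    Fin.succ_ne_zero _ hj
  have h1 := SimplexCategory.δ_comp_σ_self (i := (0 : Fin (p + 1)))
  rw [Fin.castSucc_zero] at h1
  refine (tensorLift_of' _ _ b fun h => ?_).trans ?_
  all_goals rw [if_neg h0, Category.assoc, h1, Category.comp_id]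
  exact tensorOf_eq_zero (fun h' => h (isSurjPos_comp_δ.2 h')) b

/-- The map `j ↦ 0` if `ψ j = 0` and `j ↦ θ j` otherwise. -/
def contract {n : ℕ} (ψ : ⦋n⦌ ⟶ ⦋1⦌) (θ : ⦋n⦌ ⟶ ⦋p⦌) : ⦋n⦌ ⟶ ⦋p⦌ :=
  SimplexCategory.Hom.mk
    { toFun := fun j => if ψ.toOrderHom j = 0 then 0 else θ.toOrderHom j
      monotone' := fun a b hab => by
        dsimp only
        split_ifs with h1 h2 h2
        · exact le_rfl
        · exact Fin.zero_le _
        · exact absurd (le_antisymm ((ψ.toOrderHom.monotone hab).trans h2.le) (Fin.zero_le _)) h1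
        · exact θ.toOrderHom.monotone hab }

theorem contract_apply {n : ℕ} (ψ : ⦋n⦌ ⟶ ⦋1⦌) (θ : ⦋n⦌ ⟶ ⦋p⦌) (j : Fin (n + 1)) :
    (contract ψ θ).toOrderHom j = if ψ.toOrderHom j = 0 then 0 else θ.toOrderHom j := rfl

theorem comp_contract {m n : ℕ} (α : ⦋m⦌ ⟶ ⦋n⦌) (ψ : ⦋n⦌ ⟶ ⦋1⦌) (θ : ⦋n⦌ ⟶ ⦋p⦌) :
    α ≫ contract ψ θ = contract (α ≫ ψ) (α ≫ θ) := rfl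

theorem IsSurjPos.of_contract {n : ℕ} {ψ : ⦋n⦌ ⟶ ⦋1⦌} {θ : ⦋n⦌ ⟶ ⦋p⦌}
    (h : IsSurjPos (contract ψ θ)) : IsSurjPos θ := fun v hv => by
  obtain ⟨j, hj⟩ := h v hv
  rw [contract_apply] at hj
  split_ifs at hj
  · exact absurd hj.symm hv
  · exact ⟨j, hj⟩

/-- The contraction of the simplex towards its first vertex only loses positive vertices, so it
descends to these relative chains. Its constant end misses the last vertex, which is positive
because the simplex has dimension `p + 1`, and therefore is zero. -/
theorem relD_exact {n : ℕ} (z : (relD (p + 1) B).X n) (hz : (relD (p + 1) B).IsCycle z) :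
    ∃ u, (relD (p + 1) B).d n u = z := by
  have ht : ∀ {n : ℕ} (ψ : ⦋n⦌ ⟶ ⦋1⦌) (θ : ⦋n⦌ ⟶ ⦋p + 1⦌) (b : B.X n),
      tensorLift IsSurjPos B (fun θ => ofD (p + 1) B (contract ψ θ)) (ofD (p + 1) B θ b) =
        ofD (p + 1) B (contract ψ θ) b := fun ψ θ b =>
    tensorLift_of' (fun θ => ofD (p + 1) B (contract ψ θ)) θ b
      fun h => tensorOf_eq_zero (fun h' => h h'.of_contract) b
  refine exact_of_interval
    (fun {n} ψ => tensorLift IsSurjPos B fun θ => ofD (p + 1) B (contract ψ θ)) ?_ ?_ ?_ z hz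
  · intro m n f ψ x
    refine LinearMap.congr_fun
      (f := (relD (p + 1) B).act f ∘ₗ tensorLift IsSurjPos B fun θ => ofD (p + 1) B (contract ψ θ))
      (g := (tensorLift IsSurjPos B fun θ => ofD (p + 1) B (contract (f ≫ ψ) θ)) ∘ₗ
        (relD (p + 1) B).act f) (tensor_hom_ext fun θ _ b => ?_) x
    rw [LinearMap.comp_apply, LinearMap.comp_apply, act_ofD, ht, ht, act_ofD, comp_contract]
  · intro n x
    refine LinearMap.congr_fun (g := 0) (tensor_hom_ext fun θ _ b => ?_) x
    refine (ht _ θ b).trans (tensorOf_eq_zero (fun h => ?_) b)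
    obtain ⟨j, hj⟩ := h (Fin.last (p + 1)) (Fin.last_pos.ne')
    rw [contract_apply, step_apply, if_pos j.2, if_pos rfl] at hj
    exact Fin.last_pos.ne hj
  · intro n x
    refine LinearMap.congr_fun (g := LinearMap.id) (tensor_hom_ext fun θ _ b => ?_) x
    refine (ht _ θ b).trans ?_
    have : contract (step 0) θ = θ :=
      SimplexCategory.Hom.ext _ _ (OrderHom.ext _ _ (funext fun j => by
        rw [contract_apply, step_apply, if_neg (Nat.not_lt_zero _), if_neg (by decide)]))
    rw [this]; rfl

/-- The constant simplicial module. -/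
abbrev const (V : Type u) [AddCommGroup V] [Module ℚ V] : SMod.{u} where
  X _ := V
  act _ := LinearMap.id
  act_id _ := rfl
  act_comp _ _ _ := rfl

variable (p) in
/-- The chains on the simplex modulo its boundary, with constant coefficients. -/
abbrev simplexMod : SMod.{u} := relK p (const (ULift.{u} ℚ))

variable (p) in
/-- The fundamental chain of the simplex. -/
def fundamental : (simplexMod.{u} p).X p := ofK p (const (ULift.{u} ℚ)) (𝟙 ⦋p⦌) ⟨1⟩

variable (p B) in
/-- The external product of chains on the simplex with `B`, in one degree. -/
def simplexPairingFun (n : ℕ) : (simplexMod.{u} p).X n →ₗ[ℚ] B.X n →ₗ[ℚ] (relK p B).X n :=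
  tensorLift IsSurj (const (ULift.{u} ℚ)) fun θ =>
    LinearMap.smulRight (ULift.moduleEquiv.toLinearMap) (ofK p B θ)

theorem simplexPairingFun_ofK {n : ℕ} (θ : ⦋n⦌ ⟶ ⦋p⦌) (c : ULift.{u} ℚ) (y : B.X n) :
    simplexPairingFun p B n (ofK p (const (ULift.{u} ℚ)) θ c) y = c.down • ofK p B θ y := by
  have := tensorLift_of' (P := IsSurj) (B := const (ULift.{u} ℚ)) (fun θ : ⦋n⦌ ⟶ ⦋p⦌ =>
    LinearMap.smulRight (ULift.moduleEquiv (R := ℚ)).toLinearMap (ofK p B θ)) θ c fun h => by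
      refine LinearMap.ext fun y => (congrArg (c.down • ·) (tensorOf_eq_zero h y)).trans ?_
      exact smul_zero _
  exact LinearMap.congr_fun this y

variable (p B) in
/-- The external product of chains on the simplex with `B`. -/
def simplexPairing : Pairing (simplexMod p) B (relK p B) where
  toFun n := simplexPairingFun p B n
  nat {m n} f x y := by
    refine LinearMap.congr_fun
      (f := (relK p B).act f ∘ₗ (simplexPairingFun p B n).flip y)
      (g := (simplexPairingFun p B m).flip (B.act f y) ∘ₗ (simplexMod p).act f)
      (tensor_hom_ext fun θ _ c => ?_) x
    rw [LinearMap.comp_apply, LinearMap.comp_apply, LinearMap.flip_apply, LinearMap.flip_apply,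
      act_ofK, simplexPairingFun_ofK, simplexPairingFun_ofK, map_smul, act_ofK]
    rfl

theorem simplexPairing_act_fundamental {n : ℕ} (θ : ⦋n⦌ ⟶ ⦋p⦌) (y : B.X n) :
    (simplexPairing p B).toFun n ((simplexMod p).act θ (fundamental p)) y = ofK p B θ y := by
  rw [fundamental, act_ofK, Category.comp_id]
  exact (simplexPairingFun_ofK θ _ y).trans (one_smul ℚ _)

/-- The shuffle product of the fundamental chain with an element. -/
def shK (p r n : ℕ) (e : B.X r) : (relK p B).X n :=
  sh (simplexPairing p B) p r n (fundamental p) e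

theorem shK_eq {r n : ℕ} (e : B.X r) : shK p r n e =
    ∑ σ ∈ Finset.powersetCard p (Finset.univ : Finset (Fin n)), (-1 : ℚ) ^ inversions σ σᶜ •
      ofK p B (cntMap σ p) (B.act (cntMap σᶜ r) e) := by
  rw [shK, sh]
  exact Finset.sum_congr rfl fun σ _ => by rw [simplexPairing_act_fundamental]

theorem sh_zero_left' {G : SMod.{u}} {C : SMod.{u}} (μ : Pairing C B G) (p q n : ℕ) (y : B.X q) :
    sh μ p q n 0 y = 0 :=
  Finset.sum_eq_zero fun σ _ => by rw [map_zero, map_zero, LinearMap.zero_apply, smul_zero]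

theorem sh_zero_right' {G : SMod.{u}} {C : SMod.{u}} (μ : Pairing C B G) (p q n : ℕ) (x : C.X p) :
    sh μ p q n x 0 = 0 :=
  Finset.sum_eq_zero fun σ _ => by rw [map_zero, map_zero, smul_zero]

theorem fundamental_degenerate {m : ℕ} (φ : ⦋m⦌ ⟶ ⦋p⦌) (h : ¬ Function.Surjective φ.toOrderHom) :
    (simplexMod.{u} p).act φ (fundamental p) = 0 := by
  rw [fundamental, act_ofK, Category.comp_id]
  exact tensorOf_eq_zero h _

theorem not_surjective_of_ne {m n : ℕ} {φ : ⦋m⦌ ⟶ ⦋n⦌} {v : Fin (n + 1)}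
    (h : ∀ j, φ.toOrderHom j ≠ v) : ¬ Function.Surjective φ.toOrderHom :=
  fun h' => by obtain ⟨j, hj⟩ := h' v; exact h j hj

/-- The shuffle product of elements killed by all degenerate operators has the same property. -/
theorem sh_degenerate {C G : SMod.{u}} (μ : Pairing C B G) {p q n : ℕ} (hn : p + q = n) {x : C.X p}
    {y : B.X q}
    (hx : ∀ {m : ℕ} (φ : ⦋m⦌ ⟶ ⦋p⦌), ¬ Function.Surjective φ.toOrderHom → C.act φ x = 0)
    (hy : ∀ {m : ℕ} (φ : ⦋m⦌ ⟶ ⦋q⦌), ¬ Function.Surjective φ.toOrderHom → B.act φ y = 0)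
    {m : ℕ} (φ : ⦋m⦌ ⟶ ⦋n⦌) (hφ : ¬ Function.Surjective φ.toOrderHom) :
    G.act φ (sh μ p q n x y) = 0 := by
  have hM : G.IsMoore (sh μ p q n x y) := isMoore_sh μ hn
    (fun φ v _ h => hx φ (not_surjective_of_ne h)) (fun φ v _ h => hy φ (not_surjective_of_ne h))
  obtain ⟨v, hv⟩ := not_forall.1 hφ
  have hv' : ∀ j, φ.toOrderHom j ≠ v := fun j hj => hv ⟨j, hj⟩
  by_cases h0 : v ≠ 0
  · exact hM φ v h0 hv'
  rw [not_not] at h0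
  subst h0
  rcases n with _ | n
  · exact absurd (Subsingleton.elim (α := Fin 1) _ _) (hv' 0)
  obtain ⟨φ, rfl⟩ := SimplexCategory.eq_comp_δ_of_not_surjective' φ 0 hv'
  have hδ : ∀ k : ℕ, ¬ Function.Surjective (SimplexCategory.δ (n := k) 0).toOrderHom :=
    fun k => not_surjective_of_ne (v := 0) fun j => Fin.succ_ne_zero j
  rw [act_comp]
  refine (congrArg _ ?_).trans (map_zero _)
  -- Vertex `0` is not covered by the Moore condition; here the Leibniz rule moves `d_0` to the
  -- factors, both of which it annihilates.
  rcases p with _ | p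
  · obtain rfl : q = n + 1 := by omega
    rw [face_zero_sh_zero_succ, hy _ (hδ _), sh_zero_right']
  · rcases q with _ | q
    · obtain rfl : p = n := by omega
      rw [face_zero_sh_succ_zero, hx _ (hδ _), sh_zero_left']
    · rw [face_zero_sh_succ_succ μ (by omega), hx _ (hδ _), hy _ (hδ _), sh_zero_left',
        sh_zero_right', smul_zero, add_zero]

/-- The connecting homomorphism takes the fundamental product for `Δ^(p+1)` to that for `Δ^p`.
Positive faces keep vertex `0` in the image and are annihilated by the retraction; under `d_0`, only
the shuffles whose first letter belongs to the simplex survive. -/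
theorem retrK_d_sectK {r n : ℕ} (e : B.X r) (h : p + r = n) :
    retrK p B n ((relD (p + 1) B).d n (sectK (p + 1) B (n + 1) (shK (p + 1) r (n + 1) e))) =
      shK p r n e := by
  have h1 : ∀ i : Fin (n + 1), ∀ x : (relK (p + 1) B).X (n + 1),
      retrK p B n ((relD (p + 1) B).act (SimplexCategory.δ i.succ) (sectK (p + 1) B (n + 1) x)) =
        0 := by
    intro i x
    refine LinearMap.congr_fun (f := retrK p B n ∘ₗ
      (relD (p + 1) B).act (SimplexCategory.δ i.succ) ∘ₗ sectK (p + 1) B (n + 1)) (g := 0)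
      (tensor_hom_ext fun θ hθ b => ?_) x
    rw [LinearMap.comp_apply, LinearMap.comp_apply, sectK_ofK hθ, act_ofD]
    refine retrK_ofD ⟨0, ?_⟩ _
    -- A monotone surjection sends vertex `0` to vertex `0`, and a positive coface fixes vertex `0`.
    obtain ⟨j, hj⟩ := hθ 0
    refine le_antisymm (hj ▸ θ.toOrderHom.monotone ?_) (Fin.zero_le _)
    exact (Fin.succ_succAbove_zero i).le.trans (Fin.zero_le j)
  rw [d_apply, map_sum, Fin.sum_univ_succ, Finset.sum_eq_zero fun i _ => by
    rw [map_smul, h1, smul_zero], add_zero, Fin.val_zero, pow_zero, one_smul]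
  rw [shK_eq, sum_powersetCard_succ, map_add, map_add, map_add, map_sum, map_sum, map_sum,
    Finset.sum_eq_zero, zero_add, map_sum, map_sum, map_sum, shK_eq]
  · refine Finset.sum_congr rfl fun σ hσ => ?_
    have hc : (insert 0 (σ.map (Fin.succEmb n))).card = p + 1 := by
      rw [Finset.card_insert_of_notMem (by simp [Fin.succ_ne_zero]), Finset.card_map,
        card_of_mem hσ]
    rw [map_smul, map_smul, map_smul, sectK_ofK (cntMap_surjective hc), act_ofD,
      δ_zero_comp_cntMap_insert (card_of_mem hσ), retrK_ofD_comp, ← act_comp,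
      compl_insert_zero_map_succ, δ_zero_comp_cntMap_map_succ (card_compl_of_mem h hσ)]
    rw [← compl_insert_zero_map_succ, inversions_insert_zero_map_succ]
  · intro σ hσ
    have hc : (σ.map (Fin.succEmb n)).card = p + 1 := by rw [Finset.card_map, card_of_mem hσ]
    rw [map_smul, map_smul, map_smul, sectK_ofK (cntMap_surjective hc), act_ofD,
      δ_zero_comp_cntMap_map_succ (card_of_mem hσ), retrK_ofD ⟨0, ?_⟩, smul_zero]
    exact Fin.ext ((cntMap_apply (card_of_mem hσ) 0).trans (cnt_zero σ))

theorem Sphere.of_equiv {C : SMod.{u}} (f : Map B C) (g : ∀ n, C.X n →ₗ[ℚ] B.X n)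
    (hfg : ∀ n x, f.toFun n (g n x) = x) (hgf : ∀ n x, g n (f.toFun n x) = x) {r : ℕ} {e : B.X r}
    {lam : B.X r →ₗ[ℚ] ℚ} (hB : Sphere B r e lam) :
    Sphere C r (f.toFun r e) (lam ∘ₗ g r) := by
  have hd : ∀ n x, B.d n (g (n + 1) x) = g n (C.d n x) := fun n x => by
    rw [← hgf n (B.d n _), f.d, hfg]
  have hc : ∀ n (x : C.X n), C.IsCycle x → B.IsCycle (g n x) := by
    intro n x hx
    rcases n with _ | n
    · trivial
    · exact (hd n x).trans (by rw [show C.d n x = 0 from hx, map_zero])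
  refine ⟨fun φ hφ => ?_, fun x => ?_, ?_, fun z hz hz' => ?_, fun z hz hz' => ?_⟩
  · rw [← f.nat, hB.degenerate φ hφ, map_zero]
  · rw [LinearMap.comp_apply, ← hd, hB.lam_d]
  · rw [LinearMap.comp_apply, hgf]; exact hB.lam_e
  · obtain ⟨u, hu⟩ := hB.exact_ne _ hz (hc _ z hz')
    exact ⟨f.toFun _ u, by rw [← f.d, hu, hfg]⟩
  · obtain ⟨u, hu⟩ := hB.exact_eq _ (hc _ z hz) hz'
    exact ⟨f.toFun _ u, by rw [← f.d, hu, hfg]⟩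

theorem eq_const_zero {n : ℕ} (θ : ⦋n⦌ ⟶ ⦋0⦌) (φ : ⦋n⦌ ⟶ ⦋0⦌) : θ = φ :=
  SimplexCategory.Hom.ext _ _ (OrderHom.ext _ _ (funext fun j =>
    Subsingleton.elim (α := Fin 1) _ _))

theorem isSurj_zero {n : ℕ} (θ : ⦋n⦌ ⟶ ⦋0⦌) : IsSurj θ :=
  fun _ => ⟨0, Subsingleton.elim (α := Fin 1) _ _⟩

/-- Chains on `Δ^p/∂Δ^p` with coefficients shift homology by `p`. This follows by induction on `p`
from the exact sequence `relK p → relD (p + 1) → relK (p + 1)` with acyclic middle term. -/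
theorem Sphere.relK {r : ℕ} {e : B.X r} {lam : B.X r →ₗ[ℚ] ℚ} (hB : Sphere B r e lam) (p n : ℕ)
    (h : p + r = n) : ∃ lam', Sphere (relK p B) n (shK p r n e) lam' := by
  induction p generalizing n with
  | zero =>
    obtain rfl : r = n := by omega
    have h0 : ∀ {n : ℕ} (b : B.X n), tensorLift IsSurj B (fun _ => LinearMap.id)
        (ofK 0 B (cntMap ∅ 0) b) = b := fun b => tensorLift_of _ (isSurj_zero _) b
    have key := hB.of_equiv (C := SMod.relK 0 B) ⟨fun n => ofK 0 B (cntMap ∅ 0), fun f x => by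
      rw [act_ofK, eq_const_zero (f ≫ _)]⟩
      (fun n => tensorLift IsSurj B fun _ => LinearMap.id) (fun n x => by
        refine LinearMap.congr_fun (f := ofK 0 B (cntMap ∅ 0) ∘ₗ
          tensorLift IsSurj B fun _ => LinearMap.id) (g := LinearMap.id)
          (tensor_hom_ext fun θ _ b => ?_) x
        rw [LinearMap.comp_apply, eq_const_zero θ (cntMap ∅ 0), h0]; rfl) (fun n x => h0 x)
    have he : shK 0 r r e = ofK 0 B (cntMap ∅ 0) e := by
      rw [shK, sh_zero_left, simplexPairing_act_fundamental]
    exact ⟨_, he ▸ key⟩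
  | succ p ih =>
    obtain ⟨n, rfl⟩ : ∃ m, n = m + 1 := ⟨p + r, by omega⟩
    obtain ⟨lam', h'⟩ := ih n (by omega)
    refine h'.connecting (injK p B) (projK (p + 1) B) (sectK (p + 1) B) (retrK p B) ?_ ?_ ?_
      (fun z hz => relD_exact z hz) _ ?_ (retrK_d_sectK e (by omega))
    · intro n x
      refine LinearMap.congr_fun (f := (projK (p + 1) B).toFun n ∘ₗ sectK (p + 1) B n)
        (g := LinearMap.id) (tensor_hom_ext fun θ hθ b => ?_) x
      rw [LinearMap.comp_apply, sectK_ofK hθ, projK_ofD]; rfl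
    · intro n x
      refine LinearMap.congr_fun (f := retrK p B n ∘ₗ (injK p B).toFun n)
        (g := LinearMap.id) (tensor_hom_ext fun θ hθ b => ?_) x
      rw [LinearMap.comp_apply, injK_ofK, retrK_ofD_comp]; rfl
    · intro n x
      refine LinearMap.congr_fun (f := LinearMap.id)
        (g := sectK (p + 1) B n ∘ₗ (projK (p + 1) B).toFun n + (injK p B).toFun n ∘ₗ retrK p B n)
        (tensor_hom_ext fun θ hθ b => ?_) x
      rw [LinearMap.add_apply, LinearMap.comp_apply, LinearMap.comp_apply, projK_ofD,
        LinearMap.id_apply]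
      by_cases h0 : ∃ j, θ.toOrderHom j = 0
      · have hs : IsSurj θ := fun v => by
          by_cases hv : v = 0
          · rw [hv]; exact h0
          · exact hθ v hv
        rw [sectK_ofK hs, retrK_ofD h0, map_zero, add_zero]
      · obtain ⟨θ, rfl⟩ := SimplexCategory.eq_comp_δ_of_not_surjective' θ 0
          fun j hj => h0 ⟨j, hj⟩
        rw [tensorOf_eq_zero (not_isSurj_comp_δ θ), map_zero, zero_add, retrK_ofD_comp, injK_ofK]
    · exact sh_degenerate _ (by omega) fundamental_degenerate hB.degenerate

end SMod

/-! ### Words in a free algebra -/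

namespace FreeAlgebra

variable {Λ : Type u}

/-- The product of the letters of a word. -/
def word (w : List Λ) : FreeAlgebra ℚ Λ := (w.map (ι ℚ)).prod

theorem word_nil : word ([] : List Λ) = 1 := rfl

theorem word_cons (l : Λ) (w : List Λ) : word (l :: w) = ι ℚ l * word w := List.prod_cons

theorem word_append (w w' : List Λ) : word (w ++ w') = word w * word w' := by
  rw [word, List.map_append, List.prod_append]; rfl

/-- Elements that multiply the submodule into itself on the left include all letters and are closed
under the algebra operations; apply such an element to `1`. -/
theorem mem_of_mul_mem (C : Submodule ℚ (FreeAlgebra ℚ Λ)) (one : 1 ∈ C)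
    (mul : ∀ l, ∀ t ∈ C, ι ℚ l * t ∈ C) (t : FreeAlgebra ℚ Λ) : t ∈ C := by
  suffices h : ∀ a : FreeAlgebra ℚ Λ, ∀ t ∈ C, a * t ∈ C by
    simpa using h t 1 one
  intro a
  induction a using FreeAlgebra.induction with
  | grade0 c => intro t ht; rw [← Algebra.smul_def]; exact C.smul_mem c ht
  | grade1 l => exact mul l
  | mul a b ha hb => intro t ht; rw [mul_assoc]; exact ha _ (hb _ ht)
  | add a b ha hb => intro t ht; rw [add_mul]; exact C.add_mem (ha _ ht) (hb _ ht)

theorem mem_span_word (t : FreeAlgebra ℚ Λ) : t ∈ Submodule.span ℚ (Set.range (word (Λ := Λ))) := by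
  refine mem_of_mul_mem _ (Submodule.subset_span (Set.mem_range.2 ⟨[], rfl⟩)) (fun l t ht => ?_) t
  induction ht using Submodule.span_induction with
  | mem t ht =>
    obtain ⟨w, rfl⟩ := ht
    exact Submodule.subset_span (Set.mem_range.2 ⟨l :: w, word_cons l w⟩)
  | zero => rw [mul_zero]; exact Submodule.zero_mem _
  | add a b _ _ ha hb => rw [mul_add]; exact Submodule.add_mem _ ha hb
  | smul c a _ ha => rw [mul_smul_comm]; exact Submodule.smul_mem _ c ha

theorem word_hom_ext {W : Type*} [AddCommGroup W] [Module ℚ W] {f g : FreeAlgebra ℚ Λ →ₗ[ℚ] W}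
    (h : ∀ w, f (word w) = g (word w)) : f = g := by
  refine LinearMap.ext fun t => ?_
  have := mem_span_word t
  induction this using Submodule.span_induction with
  | mem t ht => obtain ⟨w, rfl⟩ := ht; exact h w
  | zero => rw [map_zero, map_zero]
  | add a b _ _ ha hb => rw [map_add, map_add, ha, hb]
  | smul c a _ ha => rw [map_smul, map_smul, ha]

/-- The coefficients of the words. -/
def coeffs : FreeAlgebra ℚ Λ →ₗ[ℚ] (List Λ →₀ ℚ) :=
  LinearMap.applyₗ (Finsupp.single [] 1) ∘ₗ
    (lift ℚ fun l => (Finsupp.lmapDomain ℚ ℚ (List.cons l) :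
      Module.End ℚ (List Λ →₀ ℚ))).toLinearMap

theorem coeffs_ι_mul (l : Λ) (t : FreeAlgebra ℚ Λ) :
    coeffs (ι ℚ l * t) = Finsupp.mapDomain (List.cons l) (coeffs t) := by
  simp only [coeffs, LinearMap.comp_apply, AlgHom.toLinearMap_apply, map_mul, lift_ι_apply]
  rfl

theorem coeffs_word (w : List Λ) : coeffs (word w) = Finsupp.single w 1 := by
  induction w with
  | nil => simp [word_nil, coeffs]
  | cons l w ih => rw [word_cons, coeffs_ι_mul, ih, Finsupp.mapDomain_single]

/-- The linear map given by its values on words. -/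
def wordLift {W : Type*} [AddCommGroup W] [Module ℚ W] (F : List Λ → W) :
    FreeAlgebra ℚ Λ →ₗ[ℚ] W :=
  Finsupp.linearCombination ℚ F ∘ₗ coeffs

theorem wordLift_word {W : Type*} [AddCommGroup W] [Module ℚ W] (F : List Λ → W) (w : List Λ) :
    wordLift F (word w) = F w := by
  rw [wordLift, LinearMap.comp_apply, coeffs_word, Finsupp.linearCombination_single, one_smul]

/-- Words are a basis: they span, and rebuilding an element from its coefficients is the identity on
words. -/
theorem eq_zero_of_coeffs {t : FreeAlgebra ℚ Λ} (h : coeffs t = 0) : t = 0 := by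
  have : wordLift word = (LinearMap.id : FreeAlgebra ℚ Λ →ₗ[ℚ] _) :=
    word_hom_ext fun w => wordLift_word _ w
  rw [← LinearMap.id_apply (R := ℚ) t, ← this, wordLift, LinearMap.comp_apply, h, map_zero]

end FreeAlgebra

/-! ### The Dynkin operator -/

namespace GrLie

variable {I : Type} [AddCommMonoid I] (ε : I →+ ℕ)

theorem neg_one_pow_sq (n : ℕ) : (-1 : ℚ) ^ n * (-1) ^ n = 1 := by
  rw [← mul_pow]; norm_num

/-- The graded commutators in an associative algebra. -/
abbrev comm (T : Type u) [Ring T] [Algebra ℚ T] : GrLie.{u} I ε where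
  V _ := T
  br {p q _} _ := LinearMap.mul ℚ T - (-1 : ℚ) ^ (ε p * ε q) • (LinearMap.mul ℚ T).flip
  skew {p q _} _ _ x y := by
    simp only [LinearMap.sub_apply, LinearMap.smul_apply, LinearMap.mul_apply', LinearMap.flip_apply,
      smul_sub, smul_smul, pow_succ, mul_neg, mul_one, neg_mul, neg_smul, mul_comm (ε q),
      neg_one_pow_sq, one_smul]
    abel
  jacobi {p q r _} _ _ _ x y z := by
    simp only [LinearMap.sub_apply, LinearMap.smul_apply, LinearMap.mul_apply', LinearMap.flip_apply,
      smul_sub, mul_sub, sub_mul, smul_mul_assoc, mul_smul_comm, smul_smul, mul_assoc, map_add,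
      add_mul, pow_add, mul_comm (ε q) (ε p), mul_comm (ε r)]
    -- Only three independent signs occur, so the identity is checked for each of their eight
    -- values.
    have h1 := neg_one_pow_eq_or ℚ (ε p * ε q)
    have h2 := neg_one_pow_eq_or ℚ (ε q * ε r)
    have h3 := neg_one_pow_eq_or ℚ (ε p * ε r)
    generalize (-1 : ℚ) ^ (ε p * ε q) = a at *
    generalize (-1 : ℚ) ^ (ε q * ε r) = b at *
    generalize (-1 : ℚ) ^ (ε p * ε r) = c at *
    rcases h1 with rfl | rfl <;> rcases h2 with rfl | rfl <;> rcases h3 with rfl | rfl <;> module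

variable {ε} [DecidableEq I] (L : GrLie.{u} I ε)

/-- The total space of a graded Lie algebra. -/
abbrev Tot : Type u := DirectSum I L.V

variable {L} {p q n : I}

/-- The adjoint action on the total space. -/
def ad (x : L.V p) : L.Tot →ₗ[ℚ] L.Tot :=
  DirectSum.toModule ℚ I L.Tot fun q => DirectSum.lof ℚ I L.V (p + q) ∘ₗ L.br rfl x

theorem ad_lof (h : p + q = n) (x : L.V p) (y : L.V q) :
    ad x (DirectSum.lof ℚ I L.V q y) = DirectSum.lof ℚ I L.V n (L.br h x y) := by
  subst h
  rw [ad, DirectSum.toModule_lof]; rfl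

theorem tot_hom_ext {W : Type*} [AddCommGroup W] [Module ℚ W] {f g : L.Tot →ₗ[ℚ] W}
    (h : ∀ i x, f (DirectSum.lof ℚ I L.V i x) = g (DirectSum.lof ℚ I L.V i x)) : f = g :=
  DirectSum.linearMap_ext ℚ fun i => LinearMap.ext fun x => h i x

theorem ad_add (x y : L.V p) : ad (x + y) = ad x + ad y :=
  tot_hom_ext fun q z => by
    rw [LinearMap.add_apply, ad_lof rfl, ad_lof rfl, ad_lof rfl, map_add, LinearMap.add_apply,
      map_add]

theorem ad_smul (c : ℚ) (x : L.V p) : ad (c • x) = c • ad x :=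
  tot_hom_ext fun q z => by
    rw [LinearMap.smul_apply, ad_lof rfl, ad_lof rfl, map_smul, LinearMap.smul_apply, map_smul]

theorem ad_zero : ad (0 : L.V p) = 0 := by
  rw [← zero_smul ℚ (0 : L.V p), ad_smul, zero_smul]

/-- The Jacobi identity in derivation form, with degree equalities left free so that the
associativity of addition never has to be transported through `V`. -/
theorem br_br {r m : I} (h : p + q = n) (hm : n + r = m) {n' n'' : I} (h' : q + r = n')
    (h'' : p + r = n'') (hm' : p + n' = m) (hm'' : q + n'' = m) (x : L.V p) (y : L.V q)
    (z : L.V r) : L.br hm (L.br h x y) z =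
      L.br hm' x (L.br h' y z) - (-1 : ℚ) ^ (ε p * ε q) • L.br hm'' y (L.br h'' x z) := by
  subst h h' h''
  have hr : r + p = p + r := add_comm _ _
  have J := L.jacobi hm (by rw [add_comm]; exact hm') (n := m) (r := r)
    (by rw [add_comm r p, add_comm]; exact hm'') x y z
  rw [L.skew (by rw [add_comm]; exact hm') hm' (L.br rfl y z) x,
    L.skew (by rw [add_comm r p, add_comm]; exact hm'') (by rw [add_comm r p]; exact hm'')
      (L.br rfl z x) y] at J
  -- The bracket of `z` and `x` lies in degree `r + p`, that of `x` and `z` in `p + r`; generalizing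
  -- this degree allows the substitution.
  have e : L.br (by rw [add_comm r p]; exact hm'') y (L.br rfl z x) =
      (-1 : ℚ) ^ (ε r * ε p + 1) • L.br hm'' y (L.br rfl x z) := by
    have : ∀ (k : I) (hk : r + p = k) (hk' : q + k = m), L.br hk' y (L.br hk z x) =
      (-1 : ℚ) ^ (ε r * ε p + 1) • L.br hm'' y (L.br rfl x z) := by
      intro k hk hk'
      obtain rfl : k = p + r := by rw [← hk, add_comm]
      rw [L.skew hk rfl z x, map_smul]
    exact this _ rfl _
  rw [e] at J
  simp only [smul_smul, map_add, pow_add, pow_one, add_mul, mul_comm (ε q) (ε p),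
    mul_comm (ε r)] at J
  have h1 := neg_one_pow_eq_or ℚ (ε p * ε q)
  have h2 := neg_one_pow_eq_or ℚ (ε q * ε r)
  have h3 := neg_one_pow_eq_or ℚ (ε p * ε r)
  generalize (-1 : ℚ) ^ (ε p * ε q) = a at *
  generalize (-1 : ℚ) ^ (ε q * ε r) = b at *
  generalize (-1 : ℚ) ^ (ε p * ε r) = c at *
  rcases h3 with rfl | rfl
  · rcases h1 with rfl | rfl <;> rcases h2 with rfl | rfl <;> linear_combination (norm := module) J
  · rcases h1 with rfl | rfl <;> rcases h2 with rfl | rfl <;>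
      linear_combination (norm := module) (-1 : ℚ) • J

theorem ad_br (h : p + q = n) (x : L.V p) (y : L.V q) (u : L.Tot) :
    ad (L.br h x y) u = ad x (ad y u) - (-1 : ℚ) ^ (ε p * ε q) • ad y (ad x u) := by
  refine LinearMap.congr_fun (f := ad (L.br h x y))
    (g := ad x ∘ₗ ad y - (-1 : ℚ) ^ (ε p * ε q) • (ad y ∘ₗ ad x))
    (tot_hom_ext fun r z => ?_) u
  have e1 : p + (q + r) = n + r := by rw [← h, add_assoc]
  have e2 : q + (p + r) = n + r := by rw [← h, add_left_comm, add_assoc]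
  rw [LinearMap.sub_apply, LinearMap.smul_apply, LinearMap.comp_apply, LinearMap.comp_apply,
    ad_lof rfl, ad_lof rfl y z, ad_lof e1, ad_lof rfl x z, ad_lof e2, br_br h rfl rfl rfl e1 e2,
    map_sub, map_smul]

section Dynkin

variable {Λ : Type u} {deg : Λ → I} (ℓ : ∀ l, L.V (deg l))

/-- The action of a letter on the total space extended by a unit. -/
def letterAct (l : Λ) : Module.End ℚ (L.Tot × ℚ) :=
  LinearMap.inl ℚ L.Tot ℚ ∘ₗ
    (ad (ℓ l)).coprod (LinearMap.toSpanSingleton ℚ _ (DirectSum.lof ℚ I L.V _ (ℓ l)))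

/-- The action of the free algebra on the total space extended by a unit. -/
def wordAct : FreeAlgebra ℚ Λ →ₐ[ℚ] Module.End ℚ (L.Tot × ℚ) := FreeAlgebra.lift ℚ (letterAct ℓ)

/-- The Dynkin operator, with values the right-normed brackets of letters. -/
def dynkin : FreeAlgebra ℚ Λ →ₗ[ℚ] L.Tot :=
  LinearMap.fst ℚ L.Tot ℚ ∘ₗ LinearMap.applyₗ (0, 1) ∘ₗ (wordAct ℓ).toLinearMap

theorem wordAct_ι_mul (l : Λ) (t : FreeAlgebra ℚ Λ) (v : L.Tot × ℚ) :
    wordAct ℓ (FreeAlgebra.ι ℚ l * t) v =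
      (ad (ℓ l) (wordAct ℓ t v).1 + (wordAct ℓ t v).2 • DirectSum.lof ℚ I L.V _ (ℓ l), 0) := by
  rw [map_mul, wordAct, FreeAlgebra.lift_ι_apply]
  rfl

theorem dynkin_one : dynkin ℓ 1 = 0 := by
  simp [dynkin]

theorem dynkin_ι (l : Λ) : dynkin ℓ (FreeAlgebra.ι ℚ l) = DirectSum.lof ℚ I L.V _ (ℓ l) := by
  rw [← mul_one (FreeAlgebra.ι ℚ l)]
  refine (congrArg Prod.fst (wordAct_ι_mul ℓ l 1 _)).trans ?_
  simp

theorem dynkin_ι_mul_ι_mul (l l' : Λ) (t : FreeAlgebra ℚ Λ) :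
    dynkin ℓ (FreeAlgebra.ι ℚ l * (FreeAlgebra.ι ℚ l' * t)) =
      ad (ℓ l) (dynkin ℓ (FreeAlgebra.ι ℚ l' * t)) := by
  refine (congrArg Prod.fst (wordAct_ι_mul ℓ l _ _)).trans ?_
  have h : (wordAct ℓ (FreeAlgebra.ι ℚ l' * t) (0, 1)).2 = 0 :=
    congrArg Prod.snd (wordAct_ι_mul ℓ l' t _)
  rw [h, zero_smul, add_zero]
  rfl

/-- The Dynkin operator, divided by the length of words. -/
def dynkinProj : FreeAlgebra ℚ Λ →ₗ[ℚ] L.Tot :=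
  FreeAlgebra.wordLift fun w => (w.length : ℚ)⁻¹ • dynkin ℓ (FreeAlgebra.word w)

variable {ℓ} (i : ∀ p, L.V p →ₗ[ℚ] FreeAlgebra ℚ Λ)
  (hi : ∀ {p q n : I} (h : p + q = n) (x : L.V p) (y : L.V q),
    i n (L.br h x y) = i p x * i q y - (-1 : ℚ) ^ (ε p * ε q) • (i q y * i p x))
  (hℓ : ∀ l, i _ (ℓ l) = FreeAlgebra.ι ℚ l)
  (hgen : ∀ C : ∀ p, Submodule ℚ (L.V p), (∀ l, ℓ l ∈ C (deg l)) →
    (∀ {p q n : I} (h : p + q = n), ∀ x ∈ C p, ∀ y ∈ C q, L.br h x y ∈ C n) →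
    ∀ {p : I} (x : L.V p), x ∈ C p)

/-- The words of length `k`. -/
def lengthSpan (Λ : Type u) (k : ℕ) : Submodule ℚ (FreeAlgebra ℚ Λ) :=
  Submodule.span ℚ {t | ∃ w : List Λ, w.length = k ∧ FreeAlgebra.word w = t}

theorem mul_mem_lengthSpan {k k' : ℕ} {t t' : FreeAlgebra ℚ Λ} (h : t ∈ lengthSpan Λ k)
    (h' : t' ∈ lengthSpan Λ k') : t * t' ∈ lengthSpan Λ (k + k') := by
  refine (Submodule.mul_le.2 fun a ha b hb => ?_ :
    lengthSpan Λ k * lengthSpan Λ k' ≤ lengthSpan Λ (k + k')) (Submodule.mul_mem_mul h h')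
  induction ha, hb using Submodule.span_induction₂ with
  | mem_mem a b ha hb =>
    obtain ⟨w, hw, rfl⟩ := ha
    obtain ⟨w', hw', rfl⟩ := hb
    exact Submodule.subset_span ⟨w ++ w', by rw [List.length_append, hw, hw'],
      FreeAlgebra.word_append w w'⟩
  | zero_left b _ => rw [zero_mul]; exact Submodule.zero_mem _
  | zero_right a _ => rw [mul_zero]; exact Submodule.zero_mem _
  | add_left a b c _ _ _ h h' => rw [add_mul]; exact Submodule.add_mem _ h h'
  | add_right a b c _ _ _ h h' => rw [mul_add]; exact Submodule.add_mem _ h h'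
  | smul_left c a b _ _ h => rw [smul_mul_assoc]; exact Submodule.smul_mem _ _ h
  | smul_right c a b _ _ h => rw [mul_smul_comm]; exact Submodule.smul_mem _ _ h

theorem dynkinProj_of_mem {k : ℕ} {t : FreeAlgebra ℚ Λ} (h : t ∈ lengthSpan Λ k) :
    dynkinProj ℓ t = (k : ℚ)⁻¹ • dynkin ℓ t := by
  induction h using Submodule.span_induction with
  | mem t ht =>
    obtain ⟨w, rfl, rfl⟩ := ht
    exact FreeAlgebra.wordLift_word _ w
  | zero => rw [map_zero, map_zero, smul_zero]
  | add a b _ _ ha hb => rw [map_add, map_add, smul_add, ha, hb]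
  | smul c a _ ha => rw [map_smul, map_smul, ha, smul_comm]

include hi hℓ hgen

/-- Letters act on the total space by the adjoint action, and brackets go to commutators on both
sides, so all Lie elements act by `ad`. The component on the unit records the Dynkin operator. -/
theorem wordAct_lie {p : I} (x : L.V p) (u : L.Tot) (c : ℚ) :
    wordAct ℓ (i p x) (u, c) = (ad x u + c • dynkin ℓ (i p x), 0) := by
  have key : ∀ {p : I} (x : L.V p), ∀ u c,
      wordAct ℓ (i p x) (u, c) = (ad x u + c • dynkin ℓ (i p x), 0) := by
    intro p x
    refine hgen (fun p =>
      { carrier := {x | ∀ u c, wordAct ℓ (i p x) (u, c) = (ad x u + c • dynkin ℓ (i p x), 0)}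
        add_mem' := fun {x y} hx hy u c => ?_
        zero_mem' := fun u c => ?_
        smul_mem' := fun a x hx u c => ?_ }) ?_ ?_ x
    · rw [map_add, map_add, LinearMap.add_apply, hx, hy, Prod.mk_add_mk, add_zero, map_add, smul_add,
        ad_add, LinearMap.add_apply, add_add_add_comm]
    · rw [map_zero, map_zero, LinearMap.zero_apply, map_zero, smul_zero, ad_zero,
        LinearMap.zero_apply, add_zero]; rfl
    · rw [map_smul, map_smul, LinearMap.smul_apply, hx, Prod.smul_mk, smul_zero, map_smul, ad_smul,
        LinearMap.smul_apply, smul_add, smul_comm c a]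
    · intro l u c
      have := wordAct_ι_mul ℓ l 1 (u, c)
      rw [mul_one, map_one] at this
      rw [hℓ, this, dynkin_ι]; rfl
    · intro p q n h x hx y hy
      have e : ∀ u c, wordAct ℓ (i n (L.br h x y)) (u, c) =
          (ad (L.br h x y) u + c • (ad x (dynkin ℓ (i q y)) -
            (-1 : ℚ) ^ (ε p * ε q) • ad y (dynkin ℓ (i p x))), 0) := by
        intro u c
        rw [hi, map_sub, map_smul, map_mul, map_mul, LinearMap.sub_apply, LinearMap.smul_apply,
          Module.End.mul_apply, Module.End.mul_apply, hx, hy, hx, hy, ad_br h]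
        simp only [Prod.smul_mk, Prod.mk_sub_mk, map_add, map_smul, zero_smul, smul_zero, sub_zero,
          add_zero, Prod.mk.injEq, and_true]
        module
      intro u c
      rw [e u c]
      have e' : dynkin ℓ (i n (L.br h x y)) = _ := congrArg Prod.fst (e 0 1)
      rw [e', map_zero, zero_add, one_smul]
  exact key x u c

/-- By `wordAct_lie`, a Lie factor on the left acts by `ad`. The Dynkin operator is thus a
derivation on Lie elements, and on those of length `k` it is multiplication by `k`. -/
theorem dynkin_br (h : p + q = n) (x : L.V p) (y : L.V q) :
    dynkin ℓ (i n (L.br h x y)) = ad x (dynkin ℓ (i q y)) -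
      (-1 : ℚ) ^ (ε p * ε q) • ad y (dynkin ℓ (i p x)) := by
  have e := fun {p : I} (x : L.V p) => wordAct_lie i hi hℓ hgen x
  have e' : dynkin ℓ (i n (L.br h x y)) = (wordAct ℓ (i n (L.br h x y)) (0, 1)).1 := rfl
  rw [e', hi, map_sub, map_smul, map_mul, map_mul, LinearMap.sub_apply, LinearMap.smul_apply,
    Module.End.mul_apply, Module.End.mul_apply, e, e, e, e]
  simp only [map_zero, zero_add, one_smul, zero_smul, add_zero]
  rfl

/-- The Dynkin operator, divided by the length of words, is a retraction from the free algebra to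
the Lie algebra. -/
theorem dynkinProj_lie {p : I} (x : L.V p) :
    dynkinProj ℓ (i p x) = DirectSum.lof ℚ I L.V p x := by
  -- The elements homogeneous of some positive length `k` on which the Dynkin operator is
  -- multiplication by `k`: they contain the letters, and a bracket of lengths `k` and `k'` has
  -- length `k + k'`.
  let S : ∀ p, Set (L.V p) := fun p => {x | ∃ k, 0 < k ∧ i p x ∈ lengthSpan Λ k ∧
    dynkin ℓ (i p x) = (k : ℚ) • DirectSum.lof ℚ I L.V p x}
  have h : x ∈ Submodule.span ℚ (S p) := by
    refine hgen (fun p => Submodule.span ℚ (S p)) (fun l => ?_) (fun {p q n} h x hx y hy => ?_) x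
    · refine Submodule.subset_span ⟨1, one_pos, ?_, ?_⟩
      · rw [hℓ]
        exact Submodule.subset_span ⟨[l], rfl, by rw [FreeAlgebra.word_cons, FreeAlgebra.word_nil,
          mul_one]⟩
      · rw [hℓ, dynkin_ι, Nat.cast_one, one_smul]
    · induction hx, hy using Submodule.span_induction₂ with
      | mem_mem x y hx hy =>
        obtain ⟨k, hk, h1, h2⟩ := hx
        obtain ⟨k', hk', h1', h2'⟩ := hy
        refine Submodule.subset_span ⟨k + k', by omega, ?_, ?_⟩
        · rw [hi]
          refine Submodule.sub_mem _ (mul_mem_lengthSpan h1 h1') (Submodule.smul_mem _ _ ?_)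
          rw [add_comm]
          exact mul_mem_lengthSpan h1' h1
        · rw [dynkin_br i hi hℓ hgen h, h2, h2', map_smul, map_smul, ad_lof h, ad_lof (n := n)
            (by rw [add_comm]; exact h), L.skew h (by rw [add_comm]; exact h) x y, pow_succ,
            map_smul]
          push_cast
          module
      | zero_left b _ => rw [map_zero, LinearMap.zero_apply]; exact Submodule.zero_mem _
      | zero_right a _ => rw [map_zero]; exact Submodule.zero_mem _
      | add_left a b c _ _ _ h h' =>
        rw [map_add, LinearMap.add_apply]; exact Submodule.add_mem _ h h'
      | add_right a b c _ _ _ h h' => rw [map_add]; exact Submodule.add_mem _ h h'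
      | smul_left c a b _ _ h =>
        rw [map_smul, LinearMap.smul_apply]; exact Submodule.smul_mem _ _ h
      | smul_right c a b _ _ h => rw [map_smul]; exact Submodule.smul_mem _ _ h
  induction h using Submodule.span_induction with
  | mem x hx =>
    obtain ⟨k, hk, h1, h2⟩ := hx
    rw [dynkinProj_of_mem h1, h2, smul_smul, inv_mul_cancel₀ (by positivity), one_smul]
  | zero => rw [map_zero, map_zero, map_zero]
  | add a b _ _ ha hb => rw [map_add, map_add, map_add, ha, hb]
  | smul c a _ ha => rw [map_smul, map_smul, map_smul, ha]

end Dynkin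

end GrLie

namespace SMod

/-! ### Associativity of the shuffle product -/

/-- Both sides are sums over the same triples of blocks. The right-hand side is brought into the
form of `sh_sh` by a flip, whose sign is cancelled by rotating the triple. -/
theorem sh_assoc {B C D E G G' : SMod.{u}} (μ : Pairing B C G) (ν : Pairing G D E)
    (μ' : Pairing C D G') (ν' : Pairing B G' E)
    (hμ : ∀ n x y z, ν.toFun n (μ.toFun n x y) z = ν'.toFun n x (μ'.toFun n y z))
    {p q r pq qr n : ℕ} (hpq : p + q = pq) (hqr : q + r = qr) (hn : pq + r = n)
    (x : B.X p) (y : C.X q) (z : D.X r) :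
    sh ν pq r n (sh μ p q pq x y) z = sh ν' p qr n x (sh μ' q r qr y z) := by
  rw [sh_flip ν' (by omega), sh_sh μ' ν'.flip hqr, sh_sh μ ν hpq]
  refine Eq.trans ?_ (congrArg (_ • ·) (sum_disjointPairs_rotate (p := p) (q := q) (r := r)
    (n := n) (by omega) (fun P Q R => tripleSign Q R • ν'.toFun n (B.act (cntMap P p) x)
      (μ'.toFun n (C.act (cntMap Q q) y) (D.act (cntMap R r) z)))).symm)
  rw [Finset.smul_sum]
  refine Finset.sum_congr rfl fun PQ hPQ => ?_
  rw [tripleSign_rotate (p := p) (q := q) (r := r) (by omega) hPQ, smul_smul, ← mul_assoc,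
    ← hqr, mul_add, GrLie.neg_one_pow_sq, one_mul, hμ]

theorem sh_smul_right {B C G : SMod.{u}} (μ : Pairing B C G) (p q n : ℕ) (a : ℚ) (x : B.X p)
    (y : C.X q) : sh μ p q n x (a • y) = a • sh μ p q n x y := by
  rw [sh, sh, Finset.smul_sum]
  exact Finset.sum_congr rfl fun σ _ => by rw [map_smul, map_smul, smul_comm]

theorem sh_smul_left {B C G : SMod.{u}} (μ : Pairing B C G) (p q n : ℕ) (a : ℚ) (x : B.X p)
    (y : C.X q) : sh μ p q n (a • x) y = a • sh μ p q n x y := by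
  rw [sh, sh, Finset.smul_sum]
  exact Finset.sum_congr rfl fun σ _ => by
    rw [map_smul, map_smul, LinearMap.smul_apply, smul_comm]

theorem Sphere.smul {B : SMod.{u}} {r : ℕ} {e : B.X r} {lam : B.X r →ₗ[ℚ] ℚ}
    (h : Sphere B r e lam) {a : ℚ} (ha : a ≠ 0) : Sphere B r (a • e) lam where
  degenerate φ hφ := by rw [map_smul, h.degenerate φ hφ, smul_zero]
  lam_d := h.lam_d
  lam_e := by rw [map_smul]; exact mul_ne_zero ha h.lam_e
  exact_ne := h.exact_ne
  exact_eq := h.exact_eq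

theorem const_d (n : ℕ) (x : ULift.{u} ℚ) :
    (const (ULift.{u} ℚ)).d n x = (if Even n then 0 else x : ULift.{u} ℚ) := by
  refine ((const (ULift.{u} ℚ)).d_apply (n := n) x).trans ?_
  refine (Finset.sum_smul (R := ℚ) (f := fun i : Fin (n + 2) => (-1 : ℚ) ^ (i : ℕ))
    (s := Finset.univ) (x := x)).symm.trans ?_
  rw [Fin.sum_univ_eq_sum_range (fun i => (-1 : ℚ) ^ i) (n + 2), neg_one_geom_sum]
  by_cases h : Even n
  · rw [if_pos (h.add (by decide)), if_pos h, zero_smul]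
  · rw [if_neg (by rwa [Nat.even_add, iff_true_right (by decide)]), if_neg h, one_smul]

theorem Sphere.const :
    Sphere (const (ULift.{u} ℚ)) 0 ⟨1⟩ (ULift.moduleEquiv (R := ℚ)).toLinearMap where
  degenerate φ hφ := absurd (isSurj_zero φ) hφ
  lam_d x := (congrArg _ ((const_d 0 x).trans (if_pos (by decide)))).trans (map_zero _)
  lam_e := one_ne_zero
  exact_ne {n} z hn hz := by
    obtain ⟨n, rfl⟩ := Nat.exists_eq_succ_of_ne_zero hn
    have h1 := (const_d n z).symm.trans hz
    by_cases h : Even n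
    · exact ⟨z, (const_d (n + 1) z).trans (if_neg fun h' => Nat.even_add_one.1 h' h)⟩
    · rw [if_neg h] at h1
      exact ⟨0, (map_zero _).trans h1.symm⟩
  exact_eq z _ hz := ⟨0, (map_zero _).trans (ULift.ext _ _ hz).symm⟩

/-! ### Words in degenerate simplices -/

section Words

open Classical FreeAlgebra

variable {Y : Type u} (dp : Y → ℕ)

/-- The letters of dimension `n` are the degeneracies of the elements of `Y`. -/
abbrev Letter (n : ℕ) : Type u := Σ y : Y, {θ : ⦋n⦌ ⟶ ⦋dp y⦌ // IsSurj θ}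

variable {dp}

/-- The letter given by an operator, which is zero if the operator is not surjective. -/
def letter {n : ℕ} (y : Y) (θ : ⦋n⦌ ⟶ ⦋dp y⦌) : FreeAlgebra ℚ (Letter dp n) :=
  if h : IsSurj θ then ι ℚ ⟨y, θ, h⟩ else 0

theorem letter_of_isSurj {n : ℕ} {y : Y} {θ : ⦋n⦌ ⟶ ⦋dp y⦌} (h : IsSurj θ) :
    letter y θ = ι ℚ (⟨y, θ, h⟩ : Letter dp n) := dif_pos h

theorem letter_eq_zero {n : ℕ} {y : Y} {θ : ⦋n⦌ ⟶ ⦋dp y⦌} (h : ¬ IsSurj θ) :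
    letter y θ = 0 := dif_neg h

theorem ι_eq_letter {n : ℕ} (l : Letter dp n) : ι ℚ l = letter l.1 l.2.1 :=
  (letter_of_isSurj l.2.2).symm

/-- The action of simplicial operators on words. -/
def actHom {m n : ℕ} (α : ⦋m⦌ ⟶ ⦋n⦌) :
    FreeAlgebra ℚ (Letter dp n) →ₐ[ℚ] FreeAlgebra ℚ (Letter dp m) :=
  lift ℚ fun l => letter l.1 (α ≫ l.2.1)

theorem actHom_letter {m n : ℕ} (α : ⦋m⦌ ⟶ ⦋n⦌) (y : Y) (θ : ⦋n⦌ ⟶ ⦋dp y⦌) :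
    actHom α (letter y θ) = letter y (α ≫ θ) := by
  by_cases h : IsSurj θ
  · rw [letter_of_isSurj h, actHom, lift_ι_apply]
  · rw [letter_eq_zero h, map_zero, letter_eq_zero fun h' => h (h'.of_comp α θ)]

theorem actHom_ι {m n : ℕ} (α : ⦋m⦌ ⟶ ⦋n⦌) (l : Letter dp n) :
    actHom α (ι ℚ l) = letter l.1 (α ≫ l.2.1) := by
  rw [ι_eq_letter, actHom_letter]

variable (dp) in
/-- The simplicial module of words. -/
abbrev wordMod : SMod.{u} where
  X n := FreeAlgebra ℚ (Letter dp n)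
  act α := (actHom α).toLinearMap
  act_id {n} x := AlgHom.congr_fun (φ₁ := actHom (𝟙 ⦋n⦌)) (φ₂ := AlgHom.id ℚ _)
    (FreeAlgebra.hom_ext (funext fun l => by
      rw [Function.comp_apply, actHom_ι, Category.id_comp]; exact (ι_eq_letter l).symm)) x
  act_comp f g x := AlgHom.congr_fun (φ₁ := actHom (f ≫ g)) (φ₂ := (actHom f).comp (actHom g))
    (FreeAlgebra.hom_ext (funext fun l => by
      rw [Function.comp_apply, Function.comp_apply, actHom_ι, AlgHom.comp_apply, actHom_ι,
        actHom_letter, Category.assoc])) x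

variable (dp) in
/-- The multiplication of words. -/
def wordMul : Pairing (wordMod dp) (wordMod dp) (wordMod dp) where
  toFun n := LinearMap.mul ℚ _
  nat f x y := map_mul (actHom f) x y

/-- The sum of the values of a function at the letters of a word. -/
def degSum (f : Y → ℕ) (c : List Y) : ℕ := c.foldr (fun y k => f y + k) 0

theorem degSum_cons (f : Y → ℕ) (y : Y) (c : List Y) : degSum f (y :: c) = f y + degSum f c := rfl

theorem degSum_append (f : Y → ℕ) (c c' : List Y) :
    degSum f (c ++ c') = degSum f c + degSum f c' := by
  induction c with
  | nil => exact (zero_add _).symm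
  | cons y c ih => rw [List.cons_append, degSum_cons, degSum_cons, ih, add_assoc]

variable (dp) in
/-- The simplicial module of words of a given shape. -/
def shapeMod (c : List Y) : SMod.{u} :=
  c.foldr (fun y B => relK (dp y) B) (const (ULift.{u} ℚ))

/-- The multiples of the empty word. -/
def nilK (n : ℕ) : ℚ →ₗ[ℚ] (shapeMod dp []).X n := ULift.moduleEquiv.symm.toLinearMap

theorem exists_nilK {n : ℕ} (b : (shapeMod dp []).X n) : ∃ q, nilK n q = b :=
  ⟨ULift.down.{u} b, rfl⟩

theorem act_nilK {m n : ℕ} (α : ⦋m⦌ ⟶ ⦋n⦌) (q : ℚ) :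
    (shapeMod dp []).act α (nilK n q) = nilK m q := rfl

/-- Prepending a letter to words of a given shape. -/
def consK {n : ℕ} (y : Y) (c : List Y) (θ : ⦋n⦌ ⟶ ⦋dp y⦌) :
    (shapeMod dp c).X n →ₗ[ℚ] (shapeMod dp (y :: c)).X n :=
  ofK (dp y) (shapeMod dp c) θ

theorem act_consK {m n : ℕ} (α : ⦋m⦌ ⟶ ⦋n⦌) (y : Y) (c : List Y) (θ : ⦋n⦌ ⟶ ⦋dp y⦌)
    (b : (shapeMod dp c).X n) :
    (shapeMod dp (y :: c)).act α (consK y c θ b) =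
      consK y c (α ≫ θ) ((shapeMod dp c).act α b) := act_ofK α θ b

theorem consK_eq_zero {n : ℕ} {y : Y} {c : List Y} {θ : ⦋n⦌ ⟶ ⦋dp y⦌} (h : ¬ IsSurj θ)
    (b : (shapeMod dp c).X n) : consK y c θ b = 0 := tensorOf_eq_zero h b

theorem consK_hom_ext {n : ℕ} {y : Y} {c : List Y} {W : Type*} [AddCommGroup W] [Module ℚ W]
    {F F' : (shapeMod dp (y :: c)).X n →ₗ[ℚ] W}
    (h : ∀ θ, IsSurj θ → ∀ b, F (consK y c θ b) = F' (consK y c θ b)) : F = F' :=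
  tensor_hom_ext h

/-- The inclusion of the words of a given shape. -/
def shapeIncl (c : List Y) (n : ℕ) :
    (shapeMod dp c).X n →ₗ[ℚ] FreeAlgebra ℚ (Letter dp n) := by
  induction c with
  | nil => exact Algebra.linearMap ℚ _ ∘ₗ ULift.moduleEquiv.toLinearMap
  | cons y c ih =>
    exact tensorLift IsSurj (shapeMod dp c) fun θ => LinearMap.mulLeft ℚ (letter y θ) ∘ₗ ih

theorem shapeIncl_nilK {n : ℕ} (q : ℚ) :
    shapeIncl (dp := dp) [] n (nilK n q) = algebraMap ℚ _ q := rfl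

theorem shapeIncl_consK {n : ℕ} (y : Y) (c : List Y) (θ : ⦋n⦌ ⟶ ⦋dp y⦌)
    (b : (shapeMod dp c).X n) :
    shapeIncl (y :: c) n (consK y c θ b) = letter y θ * shapeIncl c n b :=
  tensorLift_of' (P := IsSurj) (B := shapeMod dp c)
    (fun θ => LinearMap.mulLeft ℚ (letter y θ) ∘ₗ shapeIncl c n) θ b fun h => by
      rw [letter_eq_zero h, LinearMap.comp_apply, LinearMap.mulLeft_apply, zero_mul]

variable (dp) in
/-- The inclusion of the words of a given shape. -/
def shapeInclMap (c : List Y) : Map (shapeMod dp c) (wordMod dp) where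
  toFun n := shapeIncl c n
  nat {m n} f x := by
    induction c with
    | nil =>
      obtain ⟨q, rfl⟩ := exists_nilK x
      exact ((actHom f).commutes q).symm
    | cons y c ih =>
      refine LinearMap.congr_fun (f := shapeIncl (y :: c) m ∘ₗ (shapeMod dp (y :: c)).act f)
        (g := (wordMod dp).act f ∘ₗ shapeIncl (y :: c) n) (consK_hom_ext fun θ _ b => ?_) x
      rw [LinearMap.comp_apply, act_consK, shapeIncl_consK, LinearMap.comp_apply, shapeIncl_consK,
        ih]
      exact ((map_mul (actHom f) _ _).trans (by rw [actHom_letter]; rfl)).symm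

/-- Prepending a letter, if its first component is prescribed. -/
def matchK {n : ℕ} (y : Y) (c : List Y) (l : Letter dp n) :
    (shapeMod dp c).X n →ₗ[ℚ] (shapeMod dp (y :: c)).X n :=
  if h : l.1 = y then consK y c (h ▸ l.2.1) else 0

/-- The component of a word of a given shape. -/
def shapeProjWord (c : List Y) {n : ℕ} (w : List (Letter dp n)) : (shapeMod dp c).X n := by
  induction c generalizing w with
  | nil =>
    cases w with
    | nil => exact nilK n 1
    | cons l w => exact 0
  | cons y c ih =>
    cases w with
    | nil => exact 0
    | cons l w => exact matchK y c l (ih w)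

theorem shapeProjWord_nil_nil {n : ℕ} : shapeProjWord (dp := dp) (n := n) [] [] = nilK n 1 := rfl

theorem shapeProjWord_nil_cons {n : ℕ} (l : Letter dp n) (w : List (Letter dp n)) :
    shapeProjWord [] (l :: w) = 0 := rfl

theorem shapeProjWord_cons_nil {n : ℕ} (y : Y) (c : List Y) :
    shapeProjWord (dp := dp) (n := n) (y :: c) [] = 0 := rfl

/-- The projection to the words of a given shape. -/
def shapeProj (c : List Y) (n : ℕ) :
    FreeAlgebra ℚ (Letter dp n) →ₗ[ℚ] (shapeMod dp c).X n := wordLift (shapeProjWord c)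

theorem shapeProj_nil_one {n : ℕ} : shapeProj (dp := dp) [] n 1 = nilK n 1 :=
  (wordLift_word (shapeProjWord []) []).trans shapeProjWord_nil_nil

theorem shapeProj_cons_one {n : ℕ} (y : Y) (c : List Y) :
    shapeProj (dp := dp) (y :: c) n 1 = 0 :=
  (wordLift_word (shapeProjWord (y :: c)) []).trans (shapeProjWord_cons_nil y c)

theorem shapeProj_nil_mul {n : ℕ} (y : Y) (θ : ⦋n⦌ ⟶ ⦋dp y⦌) (t : FreeAlgebra ℚ (Letter dp n)) :
    shapeProj (dp := dp) [] n (letter y θ * t) = 0 := by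
  by_cases h : IsSurj θ
  · rw [letter_of_isSurj h]
    refine LinearMap.congr_fun (f := shapeProj [] n ∘ₗ LinearMap.mulLeft ℚ (ι ℚ (⟨y, θ, h⟩ : Letter dp n))) (g := 0)
      (word_hom_ext fun w => ?_) t
    rw [LinearMap.comp_apply, LinearMap.mulLeft_apply, ← word_cons]
    exact (wordLift_word (shapeProjWord []) _).trans (shapeProjWord_nil_cons _ _)
  · rw [letter_eq_zero h, zero_mul, map_zero]

theorem shapeProj_cons_ι_mul {n : ℕ} (y : Y) (c : List Y) (l : Letter dp n)
    (t : FreeAlgebra ℚ (Letter dp n)) :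
    shapeProj (y :: c) n (ι ℚ l * t) = matchK y c l (shapeProj c n t) := by
  refine LinearMap.congr_fun (f := shapeProj (y :: c) n ∘ₗ LinearMap.mulLeft ℚ (ι ℚ l))
    (g := matchK y c l ∘ₗ shapeProj c n) (word_hom_ext fun w => ?_) t
  rw [LinearMap.comp_apply, LinearMap.comp_apply, LinearMap.mulLeft_apply, ← word_cons]
  exact (wordLift_word (shapeProjWord (y :: c)) (l :: w)).trans
    (congrArg (matchK y c l) (wordLift_word (shapeProjWord c) w)).symm

theorem shapeProj_cons_mul {n : ℕ} (y : Y) (c : List Y) (θ : ⦋n⦌ ⟶ ⦋dp y⦌)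
    (t : FreeAlgebra ℚ (Letter dp n)) :
    shapeProj (y :: c) n (letter y θ * t) = consK y c θ (shapeProj c n t) := by
  by_cases h : IsSurj θ
  · rw [letter_of_isSurj h, shapeProj_cons_ι_mul, matchK, dif_pos rfl]
  · rw [letter_eq_zero h, zero_mul, map_zero, consK_eq_zero h]

theorem shapeProj_cons_mul_of_ne {n : ℕ} {y y' : Y} (hy : y' ≠ y) (c : List Y)
    (θ : ⦋n⦌ ⟶ ⦋dp y'⦌) (t : FreeAlgebra ℚ (Letter dp n)) :
    shapeProj (y :: c) n (letter y' θ * t) = 0 := by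
  by_cases h : IsSurj θ
  · rw [letter_of_isSurj h, shapeProj_cons_ι_mul, matchK, dif_neg hy, LinearMap.zero_apply]
  · rw [letter_eq_zero h, zero_mul, map_zero]

variable (dp) in
/-- The projection to the words of a given shape. -/
def shapeProjMap (c : List Y) : Map (wordMod dp) (shapeMod dp c) where
  toFun n := shapeProj c n
  nat {m n} f x := by
    refine LinearMap.congr_fun (f := shapeProj c m ∘ₗ (wordMod dp).act f)
        (g := (shapeMod dp c).act f ∘ₗ shapeProj c n) (word_hom_ext fun w => ?_) x
    rw [LinearMap.comp_apply, LinearMap.comp_apply]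
    induction c generalizing w with
    | nil =>
      rcases w with _ | ⟨l, w⟩
      · rw [word_nil, shapeProj_nil_one, act_nilK]
        exact (congrArg _ (map_one (actHom f))).trans shapeProj_nil_one
      · rw [word_cons, ι_eq_letter, shapeProj_nil_mul]
        refine (congrArg _ ((map_mul (actHom f) _ _).trans ?_)).trans
          (shapeProj_nil_mul l.1 (f ≫ l.2.1) (actHom f (word w)))
        rw [actHom_letter]
    | cons y c ih =>
      rcases w with _ | ⟨l, w⟩
      · rw [word_nil, shapeProj_cons_one, map_zero]
        exact (congrArg _ (map_one (actHom f))).trans (shapeProj_cons_one _ _)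
      · have e : (wordMod dp).act f (word (l :: w)) =
            letter l.1 (f ≫ l.2.1) * actHom f (word w) := by
          rw [word_cons, ι_eq_letter, ← actHom_letter]
          exact map_mul (actHom f) _ _
        rw [e, word_cons, ι_eq_letter]
        by_cases hl : l.1 = y
        · subst hl
          rw [shapeProj_cons_mul, shapeProj_cons_mul, act_consK]
          exact congrArg _ (ih w)
        · rw [shapeProj_cons_mul_of_ne hl, shapeProj_cons_mul_of_ne hl, map_zero]

/-- With `shapeIncl_shapeProj` and `shapeProj_of_ne`, this gives the decomposition of the simplicial
module of words into the direct sum of its shape modules. -/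
theorem shapeProj_shapeIncl {n : ℕ} (c : List Y) (b : (shapeMod dp c).X n) :
    shapeProj c n (shapeIncl c n b) = b := by
  induction c with
  | nil =>
    obtain ⟨q, rfl⟩ := exists_nilK b
    rw [shapeIncl_nilK, Algebra.algebraMap_eq_smul_one, map_smul, shapeProj_nil_one, ← map_smul,
      smul_eq_mul, mul_one]
  | cons y c ih =>
    refine LinearMap.congr_fun (f := shapeProj (y :: c) n ∘ₗ shapeIncl (y :: c) n)
      (g := LinearMap.id) (consK_hom_ext fun θ _ b => ?_) b
    rw [LinearMap.comp_apply, shapeIncl_consK, shapeProj_cons_mul, ih, LinearMap.id_apply]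

/-- The shape of a word. -/
def shape {n : ℕ} (w : List (Letter dp n)) : List Y := w.map Sigma.fst

theorem shapeIncl_shapeProj {n : ℕ} (w : List (Letter dp n)) :
    shapeIncl (shape w) n (shapeProj (shape w) n (word w)) = word w := by
  induction w with
  | nil =>
    refine (congrArg (shapeIncl [] n) shapeProj_nil_one).trans ?_
    rw [shapeIncl_nilK, map_one]; rfl
  | cons l w ih =>
    rw [word_cons, ι_eq_letter]
    refine (congrArg (shapeIncl (l.1 :: shape w) n) (shapeProj_cons_mul l.1 (shape w) l.2.1
      (word w))).trans ?_
    rw [shapeIncl_consK, ih]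

theorem shapeProj_of_ne {n : ℕ} {c : List Y} {w : List (Letter dp n)} (h : shape w ≠ c) :
    shapeProj c n (word w) = 0 := by
  induction c generalizing w with
  | nil =>
    rcases w with _ | ⟨l, w⟩
    · exact absurd rfl h
    · rw [word_cons, ι_eq_letter, shapeProj_nil_mul]
  | cons y c ih =>
    rcases w with _ | ⟨l, w⟩
    · rw [word_nil, shapeProj_cons_one]
    · rw [word_cons, ι_eq_letter]
      by_cases hl : l.1 = y
      · subst hl
        rw [shapeProj_cons_mul, ih fun h' => h (by rw [← h']; rfl), map_zero]
      · rw [shapeProj_cons_mul_of_ne hl]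

theorem shapeIncl_mem {n : ℕ} (c : List Y) (b : (shapeMod dp c).X n) :
    shapeIncl c n b ∈ Submodule.span ℚ {t | ∃ w : List (Letter dp n), shape w = c ∧ word w = t} := by
  have h : shapeIncl c n (shapeProj c n (shapeIncl c n b)) = shapeIncl c n b := by
    rw [shapeProj_shapeIncl]
  rw [← h]
  generalize shapeIncl c n b = t
  have ht := mem_span_word t
  induction ht using Submodule.span_induction with
  | mem t ht =>
    obtain ⟨w, rfl⟩ := ht
    by_cases hw : shape w = c
    · subst hw
      rw [shapeIncl_shapeProj]
      exact Submodule.subset_span ⟨w, rfl, rfl⟩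
    · rw [shapeProj_of_ne hw, map_zero]; exact Submodule.zero_mem _
  | zero => rw [map_zero, map_zero]; exact Submodule.zero_mem _
  | add a b _ _ ha hb => rw [map_add, map_add]; exact Submodule.add_mem _ ha hb
  | smul c a _ ha => rw [map_smul, map_smul]; exact Submodule.smul_mem _ _ ha

theorem shapeProj_shapeIncl_of_ne {n : ℕ} {c c' : List Y} (hc : c' ≠ c)
    (b : (shapeMod dp c').X n) : shapeProj c n (shapeIncl c' n b) = 0 := by
  have h := shapeIncl_mem c' b
  generalize shapeIncl c' n b = t at h
  induction h using Submodule.span_induction with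
  | mem t ht => obtain ⟨w, rfl, rfl⟩ := ht; exact shapeProj_of_ne hc
  | zero => rw [map_zero]
  | add a b _ _ ha hb => rw [map_add, ha, hb, add_zero]
  | smul c a _ ha => rw [map_smul, ha, smul_zero]

end Words

end SMod

namespace SMod

open Classical FreeAlgebra

variable {Y : Type u} {dp : Y → ℕ} (ds : Y → ℕ)

/-! ### Fundamental classes of shapes -/

theorem shapeIncl_shK {y : Y} {c : List Y} (r n : ℕ) (e : (shapeMod dp c).X r) :
    shapeIncl (y :: c) n (shK (dp y) r n e) =
      sh (wordMul dp) (dp y) r n (letter y (𝟙 _) : (wordMod dp).X (dp y)) (shapeIncl c r e) := by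
  refine (congrArg (shapeIncl (y :: c) n) (shK_eq e)).trans ?_
  refine (map_sum (shapeIncl (y :: c) n) _ _).trans (Finset.sum_congr rfl fun σ _ =>
    (map_smul (shapeIncl (y :: c) n) _ _).trans (congrArg (_ • ·) ?_))
  refine (shapeIncl_consK y c (cntMap σ (dp y)) ((shapeMod dp c).act (cntMap σᶜ r) e)).trans ?_
  refine congrArg₂ (· * ·) ?_ ((shapeInclMap dp c).nat (cntMap σᶜ r) e)
  refine Eq.trans ?_ (actHom_letter (cntMap σ (dp y)) y (𝟙 _)).symm
  rw [Category.comp_id]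

/-- The fundamental class of the words of a given shape. -/
def shapeClass (c : List Y) : (shapeMod dp c).X (degSum dp c) := by
  induction c with
  | nil => exact nilK 0 1
  | cons y c ih =>
    exact (-1 : ℚ) ^ (dp y * degSum ds c) • shK (dp y) (degSum dp c) (degSum dp (y :: c)) ih

/-- Each letter in the shape is one application of `Sphere.relK`, starting from constant
coefficients; the signs do not matter for being a sphere. -/
theorem exists_sphere (c : List Y) :
    ∃ lam, Sphere (shapeMod dp c) (degSum dp c) (shapeClass ds c) lam := by
  induction c with
  | nil => exact ⟨_, Sphere.const⟩
  | cons y c ih =>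
    obtain ⟨lam, h⟩ := ih
    obtain ⟨lam', h'⟩ := h.relK (dp y) (degSum dp (y :: c)) rfl
    exact ⟨lam', h'.smul (pow_ne_zero _ (neg_ne_zero.2 one_ne_zero))⟩

variable (dp) in
/-- The signed shuffle product of generators. -/
def shapeProd (c : List Y) : (wordMod dp).X (degSum dp c) := shapeIncl c _ (shapeClass ds c)

theorem shapeProd_nil : shapeProd dp ds [] = (1 : FreeAlgebra ℚ (Letter dp 0)) :=
  (shapeIncl_nilK (n := 0) 1).trans (map_one _)

theorem shapeProd_cons (y : Y) (c : List Y) : shapeProd dp ds (y :: c) =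
    (-1 : ℚ) ^ (dp y * degSum ds c) • sh (wordMul dp) (dp y) (degSum dp c) (degSum dp (y :: c))
      (letter y (𝟙 _) : (wordMod dp).X (dp y)) (shapeProd dp ds c) :=
  (map_smul (shapeIncl (y :: c) _) _ _).trans (congrArg (_ • ·) (shapeIncl_shK _ _ _))

/-- The sign built into the fundamental classes is the one of the simplicial bracket, so
concatenating shapes multiplies the classes by the signed, associative shuffle product. -/
theorem shapeProd_append (c c' : List Y) : shapeProd dp ds (c ++ c') =
    (-1 : ℚ) ^ (degSum dp c * degSum ds c') •
      sh (wordMul dp) (degSum dp c) (degSum dp c') (degSum dp (c ++ c'))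
        (shapeProd dp ds c) (shapeProd dp ds c') := by
  induction c with
  | nil =>
    refine Eq.trans ?_ (congrArg (_ • ·)
      (sh_zero_left (wordMul dp) (degSum dp c') (shapeProd dp ds []) (shapeProd dp ds c')).symm)
    rw [shapeProd_nil]
    rw [show degSum dp ([] : List Y) = 0 from rfl, zero_mul, pow_zero, one_smul]
    refine Eq.trans ?_ (congrArg (· * shapeProd dp ds c')
      (map_one (actHom (dp := dp) (cntMap (∅ : Finset (Fin (degSum dp c'))) 0)))).symm
    exact (one_mul _).symm
  | cons y c ih =>
    refine (shapeProd_cons ds y (c ++ c')).trans ?_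
    rw [ih, sh_smul_right, shapeProd_cons, sh_smul_left, sh_assoc (wordMul dp) (wordMul dp)
      (wordMul dp) (wordMul dp) (fun n x y z => mul_assoc x y z) (pq := degSum dp (y :: c)) (degSum_cons dp y c).symm
      (degSum_append dp c c').symm (degSum_append dp (y :: c) c').symm, smul_smul,
      smul_smul, ← pow_add, ← pow_add, degSum_append ds, degSum_cons dp y c]
    refine congrArg (fun k => (-1 : ℚ) ^ k • _) ?_
    ring

/-- The span of the words of bidegree `(p, s)`. -/
def homogSpan (dp ds : Y → ℕ) (p s : ℕ) : Submodule ℚ (FreeAlgebra ℚ Y) :=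
  Submodule.span ℚ {t | ∃ c : List Y, degSum dp c = p ∧ degSum ds c = s ∧ word c = t}

theorem mul_mem_homogSpan {dp ds : Y → ℕ} {p s q t n m : ℕ} (h : p + q = n) (k : s + t = m)
    {a b : FreeAlgebra ℚ Y}
    (ha : a ∈ homogSpan dp ds p s) (hb : b ∈ homogSpan dp ds q t) :
    a * b ∈ homogSpan dp ds n m := by
  induction ha, hb using Submodule.span_induction₂ with
  | mem_mem a b ha hb =>
    obtain ⟨c, rfl, rfl, rfl⟩ := ha
    obtain ⟨c', rfl, rfl, rfl⟩ := hb
    exact Submodule.subset_span ⟨c ++ c', by rw [degSum_append, h], by rw [degSum_append, k],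
      word_append c c'⟩
  | zero_left b _ => rw [zero_mul]; exact Submodule.zero_mem _
  | zero_right a _ => rw [mul_zero]; exact Submodule.zero_mem _
  | add_left a b c _ _ _ h h' => rw [add_mul]; exact Submodule.add_mem _ h h'
  | add_right a b c _ _ _ h h' => rw [mul_add]; exact Submodule.add_mem _ h h'
  | smul_left c a b _ _ h => rw [smul_mul_assoc]; exact Submodule.smul_mem _ _ h
  | smul_right c a b _ _ h => rw [mul_smul_comm]; exact Submodule.smul_mem _ _ h

/-- The linear extension of the shuffle products of generators of dimension `n`. -/
def shuffleSum (n : ℕ) : FreeAlgebra ℚ Y →ₗ[ℚ] (wordMod dp).X n :=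
  wordLift fun c => if h : degSum dp c = n then h ▸ shapeProd dp ds c else 0

theorem shuffleSum_word (c : List Y) :
    shuffleSum ds (degSum dp c) (word c) = shapeProd dp ds c :=
  (wordLift_word _ c).trans (dif_pos rfl)

theorem shuffleSum_word_of_ne {n : ℕ} {c : List Y} (h : degSum dp c ≠ n) :
    shuffleSum (dp := dp) ds n (word c) = 0 := (wordLift_word _ c).trans (dif_neg h)

theorem shuffleSum_mul {p s q t n : ℕ} (h : p + q = n) {a b : FreeAlgebra ℚ Y}
    (ha : a ∈ homogSpan dp ds p s) (hb : b ∈ homogSpan dp ds q t) :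
    shuffleSum ds n (a * b) =
      (-1 : ℚ) ^ (p * t) • sh (wordMul dp) p q n (shuffleSum ds p a) (shuffleSum ds q b) := by
  have add_l : ∀ x x' y, sh (wordMul dp) p q n (x + x') y =
      sh (wordMul dp) p q n x y + sh (wordMul dp) p q n x' y := fun x x' y => by
    simp only [sh, map_add, LinearMap.add_apply, smul_add, Finset.sum_add_distrib]
  have add_r : ∀ x y y', sh (wordMul dp) p q n x (y + y') =
      sh (wordMul dp) p q n x y + sh (wordMul dp) p q n x y' := fun x y y' => by
    simp only [sh, map_add, smul_add, Finset.sum_add_distrib]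
  induction ha, hb using Submodule.span_induction₂ with
  | mem_mem a b ha hb =>
    obtain ⟨c, rfl, rfl, rfl⟩ := ha
    obtain ⟨c', rfl, rfl, rfl⟩ := hb
    obtain rfl : degSum dp (c ++ c') = n := by rw [degSum_append, h]
    rw [← word_append, shuffleSum_word, shuffleSum_word, shuffleSum_word, shapeProd_append]
  | zero_left b _ => rw [zero_mul, map_zero, map_zero, sh_zero_left', smul_zero]
  | zero_right a _ => rw [mul_zero, map_zero, map_zero, sh_zero_right', smul_zero]
  | add_left a b c _ _ _ h h' => rw [add_mul, map_add, map_add, h, h', add_l, smul_add]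
  | add_right a b c _ _ _ h h' => rw [mul_add, map_add, map_add, h, h', add_r, smul_add]
  | smul_left c a b _ _ h =>
    rw [smul_mul_assoc, map_smul, map_smul, h, sh_smul_left, smul_comm]
  | smul_right c a b _ _ h =>
    rw [mul_smul_comm, map_smul, map_smul, h, sh_smul_right, smul_comm]

/-- Shuffle products of different lists of generators lie in different shape components, so the
component at `c` only sees the coefficient of `c`. -/
theorem shapeProj_shuffleSum (c : List Y) (n : ℕ) (t : FreeAlgebra ℚ Y) :
    shapeProj c n (shuffleSum (dp := dp) ds n t) =
      coeffs t c • shapeProj c n (shuffleSum (dp := dp) ds n (word c)) := by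
  refine LinearMap.congr_fun (f := shapeProj c n ∘ₗ shuffleSum ds n)
    (g := (Finsupp.lapply c ∘ₗ coeffs).smulRight
      (shapeProj c n (shuffleSum (dp := dp) ds n (word c)))) (word_hom_ext fun c' => ?_) t
  rw [LinearMap.comp_apply, LinearMap.smulRight_apply, LinearMap.comp_apply, coeffs_word,
    Finsupp.lapply_apply]
  by_cases hc : c' = c
  · rw [hc, Finsupp.single_eq_same, one_smul]
  · rw [Finsupp.single_eq_of_ne' hc, zero_smul]
    by_cases hn : degSum dp c' = n
    · subst hn
      rw [shuffleSum_word]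
      exact shapeProj_shapeIncl_of_ne hc _
    · rw [shuffleSum_word_of_ne ds hn, map_zero]

theorem shapeProj_shuffleSum_word (c : List Y) :
    shapeProj c _ (shuffleSum (dp := dp) ds (degSum dp c) (word c)) = shapeClass ds c := by
  rw [shuffleSum_word]
  exact shapeProj_shapeIncl _ _

theorem coeffs_of_mem_homogSpan {dp ds : Y → ℕ} {p s : ℕ} {t : FreeAlgebra ℚ Y}
    (ht : t ∈ homogSpan dp ds p s) {c : List Y} (hc : degSum dp c ≠ p) : coeffs t c = 0 := by
  induction ht using Submodule.span_induction with
  | mem t ht =>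
    obtain ⟨c', rfl, rfl, rfl⟩ := ht
    rw [coeffs_word, Finsupp.single_eq_of_ne]
    rintro rfl
    exact hc rfl
  | zero => rw [map_zero]; rfl
  | add a b _ _ ha hb => rw [map_add, Finsupp.add_apply, ha, hb, add_zero]
  | smul c a _ ha => rw [map_smul, Finsupp.smul_apply, ha, smul_zero]

/-- Each coefficient is detected on its own shape, where it multiplies a class on which `lam` is
nonzero. -/
theorem eq_zero_of_shuffleSum {p s : ℕ} {t : FreeAlgebra ℚ Y} (ht : t ∈ homogSpan dp ds p s)
    (h : shuffleSum (dp := dp) ds p t = 0) : t = 0 := by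
  refine eq_zero_of_coeffs (Finsupp.ext fun c => ?_)
  by_cases hc : degSum dp c = p
  · subst hc
    have h1 := shapeProj_shuffleSum (dp := dp) ds c (degSum dp c) t
    obtain ⟨lam, hlam⟩ := exists_sphere (dp := dp) ds c
    rw [h, map_zero, shapeProj_shuffleSum_word] at h1
    have h2 := congrArg lam h1
    rw [map_zero, map_smul, eq_comm, smul_eq_mul, mul_eq_zero] at h2
    exact h2.resolve_right hlam.lam_e
  · exact coeffs_of_mem_homogSpan ht hc

/-! ### The filtration by dimension -/

variable (dp) in
/-- The span of the words with letters of total dimension less than `r`. -/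
def lowerSpan (n r : ℕ) : Submodule ℚ (FreeAlgebra ℚ (Letter dp n)) :=
  Submodule.span ℚ {t | ∃ w, degSum dp (shape w) < r ∧ word w = t}

theorem word_mem_lowerSpan {n r : ℕ} {w : List (Letter dp n)} (h : degSum dp (shape w) < r) :
    word w ∈ lowerSpan dp n r := Submodule.subset_span ⟨w, h, rfl⟩

theorem lowerSpan_zero {n : ℕ} {t : FreeAlgebra ℚ (Letter dp n)} (h : t ∈ lowerSpan dp n 0) :
    t = 0 := by
  have : {t | ∃ w : List (Letter dp n), degSum dp (shape w) < 0 ∧ word w = t} = ∅ :=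
    Set.eq_empty_iff_forall_notMem.2 fun t ⟨w, hw, _⟩ => Nat.not_lt_zero _ hw
  rwa [lowerSpan, this, Submodule.span_empty, Submodule.mem_bot] at h

theorem lowerSpan_mono {n r r' : ℕ} (h : r ≤ r') : lowerSpan dp n r ≤ lowerSpan dp n r' :=
  Submodule.span_mono fun _ ⟨w, hw, e⟩ => ⟨w, hw.trans_le h, e⟩

theorem exists_mem_lowerSpan {n : ℕ} (t : FreeAlgebra ℚ (Letter dp n)) :
    ∃ r, t ∈ lowerSpan dp n r := by
  have ht := mem_span_word t
  induction ht using Submodule.span_induction with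
  | mem t ht =>
    obtain ⟨w, rfl⟩ := ht
    exact ⟨_, word_mem_lowerSpan (Nat.lt_succ_self _)⟩
  | zero => exact ⟨0, Submodule.zero_mem _⟩
  | add a b _ _ ha hb =>
    obtain ⟨r, ha⟩ := ha
    obtain ⟨r', hb⟩ := hb
    exact ⟨max r r', Submodule.add_mem _ (lowerSpan_mono (le_max_left _ _) ha)
      (lowerSpan_mono (le_max_right _ _) hb)⟩
  | smul c a _ ha => exact ha.imp fun r ha => Submodule.smul_mem _ _ ha

theorem shape_append {n : ℕ} (w w' : List (Letter dp n)) : shape (w ++ w') = shape w ++ shape w' :=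
  List.map_append

theorem mul_mem_lowerSpan {n r r' k : ℕ} (h : ∀ i < r, ∀ j < r', i + j < k)
    {a b : FreeAlgebra ℚ (Letter dp n)} (ha : a ∈ lowerSpan dp n r) (hb : b ∈ lowerSpan dp n r') :
    a * b ∈ lowerSpan dp n k := by
  induction ha, hb using Submodule.span_induction₂ with
  | mem_mem a b ha hb =>
    obtain ⟨w, hw, rfl⟩ := ha
    obtain ⟨w', hw', rfl⟩ := hb
    rw [← word_append]
    exact word_mem_lowerSpan (by rw [shape_append, degSum_append]; exact h _ hw _ hw')
  | zero_left b _ => rw [zero_mul]; exact Submodule.zero_mem _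
  | zero_right a _ => rw [mul_zero]; exact Submodule.zero_mem _
  | add_left a b c _ _ _ h h' => rw [add_mul]; exact Submodule.add_mem _ h h'
  | add_right a b c _ _ _ h h' => rw [mul_add]; exact Submodule.add_mem _ h h'
  | smul_left c a b _ _ h => rw [smul_mul_assoc]; exact Submodule.smul_mem _ _ h
  | smul_right c a b _ _ h => rw [mul_smul_comm]; exact Submodule.smul_mem _ _ h

theorem letter_mem_lowerSpan {n : ℕ} (y : Y) (θ : ⦋n⦌ ⟶ ⦋dp y⦌) :
    letter y θ ∈ lowerSpan dp n (dp y + 1) := by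
  by_cases h : IsSurj θ
  · rw [letter_of_isSurj h, ← mul_one (ι ℚ _), ← word_nil, ← word_cons]
    exact word_mem_lowerSpan (Nat.lt_succ_self _)
  · rw [letter_eq_zero h]; exact Submodule.zero_mem _

/-- The action on words models the associated graded action: nonsurjective composites give zero
instead of words of smaller dimension. So shapes, and hence the filtration, are preserved. -/
theorem actHom_word {m n : ℕ} (α : ⦋m⦌ ⟶ ⦋n⦌) (w : List (Letter dp n)) :
    actHom α (word w) = 0 ∨ ∃ w', shape w' = shape w ∧ actHom α (word w) = word w' := by
  induction w with
  | nil => exact .inr ⟨[], rfl, map_one _⟩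
  | cons l w ih =>
    rw [word_cons, map_mul, actHom_ι]
    by_cases h : IsSurj (α ≫ l.2.1)
    · rcases ih with h' | ⟨w', hw', h'⟩
      · exact .inl (by rw [h', mul_zero])
      · exact .inr ⟨⟨l.1, α ≫ l.2.1, h⟩ :: w', congrArg (l.1 :: ·) hw', by
          rw [h', letter_of_isSurj h, word_cons]⟩
    · exact .inl (by rw [letter_eq_zero h, zero_mul])

theorem actHom_mem_lowerSpan {m n r : ℕ} (α : ⦋m⦌ ⟶ ⦋n⦌) {t : FreeAlgebra ℚ (Letter dp n)}
    (h : t ∈ lowerSpan dp n r) : actHom α t ∈ lowerSpan dp m r := by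
  induction h using Submodule.span_induction with
  | mem t ht =>
    obtain ⟨w, hw, rfl⟩ := ht
    rcases actHom_word α w with h' | ⟨w', hw', h'⟩
    · rw [h']; exact Submodule.zero_mem _
    · rw [h']; exact word_mem_lowerSpan (by rwa [hw'])
  | zero => rw [map_zero]; exact Submodule.zero_mem _
  | add a b _ _ ha hb => rw [map_add]; exact Submodule.add_mem _ ha hb
  | smul c a _ ha => rw [map_smul]; exact Submodule.smul_mem _ _ ha

theorem shapeProj_of_mem_lowerSpan {n r : ℕ} {t : FreeAlgebra ℚ (Letter dp n)}
    (h : t ∈ lowerSpan dp n r) {c : List Y} (hc : r ≤ degSum dp c) : shapeProj c n t = 0 := by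
  induction h using Submodule.span_induction with
  | mem t ht =>
    obtain ⟨w, hw, rfl⟩ := ht
    exact shapeProj_of_ne fun h => by rw [h] at hw; omega
  | zero => rw [map_zero]
  | add a b _ _ ha hb => rw [map_add, ha, hb, add_zero]
  | smul c a _ ha => rw [map_smul, ha, smul_zero]

theorem shapeIncl_mem_lowerSpan {n r : ℕ} {c : List Y} (hc : degSum dp c < r)
    (b : (shapeMod dp c).X n) : shapeIncl c n b ∈ lowerSpan dp n r := by
  refine Submodule.span_mono ?_ (shapeIncl_mem c b)
  rintro t ⟨w, rfl, rfl⟩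
  exact ⟨w, hc, rfl⟩

/-- Up to words of smaller dimension, an element is a sum of components of given shapes. -/
theorem exists_sub_sum_mem_lowerSpan {n r : ℕ} {t : FreeAlgebra ℚ (Letter dp n)}
    (h : t ∈ lowerSpan dp n (r + 1)) : ∃ C : Finset (List Y), (∀ c ∈ C, degSum dp c = r) ∧
      t - ∑ c ∈ C, shapeIncl c n (shapeProj c n t) ∈ lowerSpan dp n r := by
  -- Asking for all `C` containing `C₀` lets the finite sets for two summands be merged.
  suffices key : ∃ C₀ : Finset (List Y), ∀ C, C₀ ⊆ C →
      t - ∑ c ∈ C.filter fun c => degSum dp c = r, shapeIncl c n (shapeProj c n t) ∈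
        lowerSpan dp n r by
    obtain ⟨C, hC⟩ := key
    exact ⟨_, fun c hc => (Finset.mem_filter.1 hc).2, hC C subset_rfl⟩
  induction h using Submodule.span_induction with
  | mem t ht =>
    obtain ⟨w, hw, rfl⟩ := ht
    refine ⟨{shape w}, fun C hC => ?_⟩
    have hC' : shape w ∈ C := hC (Finset.mem_singleton_self _)
    by_cases hr : degSum dp (shape w) = r
    · rw [Finset.sum_eq_single_of_mem (shape w) (Finset.mem_filter.2 ⟨hC', hr⟩) fun c _ hc => by
        rw [shapeProj_of_ne (Ne.symm hc), map_zero], shapeIncl_shapeProj, sub_self]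
      exact Submodule.zero_mem _
    · rw [Finset.sum_eq_zero fun c hc => by
        rw [shapeProj_of_ne (fun h => hr (by rw [h]; exact (Finset.mem_filter.1 hc).2)),
          map_zero], sub_zero]
      exact word_mem_lowerSpan (by omega)
  | zero =>
    refine ⟨∅, fun C _ => ?_⟩
    rw [Finset.sum_eq_zero fun c _ => by rw [map_zero, map_zero], sub_zero]
    exact Submodule.zero_mem _
  | add a b _ _ ha hb =>
    obtain ⟨C₁, h₁⟩ := ha
    obtain ⟨C₂, h₂⟩ := hb
    refine ⟨C₁ ∪ C₂, fun C hC => ?_⟩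
    simp only [map_add, Finset.sum_add_distrib]
    rw [add_sub_add_comm]
    exact Submodule.add_mem _ (h₁ C (Finset.union_subset_left hC))
      (h₂ C (Finset.union_subset_right hC))
  | smul q a _ ha =>
    obtain ⟨C₁, h₁⟩ := ha
    refine ⟨C₁, fun C hC => ?_⟩
    simp only [map_smul]
    rw [← Finset.smul_sum, ← smul_sub]
    exact Submodule.smul_mem _ _ (h₁ C hC)

end SMod

/-! ### Right-normed brackets -/

namespace GrLie

variable {I : Type} [AddCommMonoid I] {ε : I →+ ℕ} [DecidableEq I] {L : GrLie.{u} I ε}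
  {Λ : Type u} {deg : Λ → I} (ℓ : ∀ l, L.V (deg l))

/-- The sum of the degrees of the letters of a word. -/
def wordDeg (deg : Λ → I) (w : List Λ) : I := w.foldr (fun l k => deg l + k) 0

theorem wordDeg_cons (l : Λ) (w : List Λ) : wordDeg deg (l :: w) = deg l + wordDeg deg w := rfl

theorem wordDeg_map {Λ' : Type u} (f : Λ' → Λ) (w : List Λ') :
    wordDeg deg (w.map f) = wordDeg (fun l => deg (f l)) w := by
  induction w with
  | nil => rfl
  | cons l w ih => rw [List.map_cons, wordDeg_cons, wordDeg_cons, ih]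

/-- The right-normed bracket of the letters of a word, starting with a given letter. -/
def rnBr (l : Λ) (w : List Λ) : L.V (wordDeg deg (l :: w)) := by
  induction w generalizing l with
  | nil => exact cast (congrArg L.V (add_zero (deg l)).symm) (ℓ l)
  | cons l' w ih => exact L.br rfl (ℓ l) (ih l')

theorem lof_rnBr_nil (l : Λ) : DirectSum.lof ℚ I L.V _ (rnBr ℓ l []) =
    DirectSum.lof ℚ I L.V _ (ℓ l) := by
  have : ∀ {j : I} (h : L.V (deg l) = L.V j) (hj : deg l = j), DirectSum.lof ℚ I L.V _ (cast h (ℓ l)) =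
      DirectSum.lof ℚ I L.V _ (ℓ l) := by
    rintro _ h rfl; rfl
  exact this _ (add_zero _).symm

theorem rnBr_cons (l l' : Λ) (w : List Λ) :
    rnBr ℓ l (l' :: w) = L.br (wordDeg_cons l (l' :: w)).symm (ℓ l) (rnBr ℓ l' w) := rfl

theorem dynkin_word (l : Λ) (w : List Λ) : dynkin ℓ (FreeAlgebra.word (l :: w)) =
    DirectSum.lof ℚ I L.V _ (rnBr ℓ l w) := by
  induction w generalizing l with
  | nil => rw [lof_rnBr_nil, FreeAlgebra.word_cons, FreeAlgebra.word_nil, mul_one, dynkin_ι]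
  | cons l' w ih =>
    rw [FreeAlgebra.word_cons, FreeAlgebra.word_cons, dynkin_ι_mul_ι_mul, ← FreeAlgebra.word_cons,
      ih, ad_lof (wordDeg_cons l (l' :: w)).symm, rnBr_cons]

/-- The component of the normalized Dynkin operator of a given degree. -/
def dynkinComp (i : I) : FreeAlgebra ℚ Λ →ₗ[ℚ] L.V i :=
  DirectSum.component ℚ I L.V i ∘ₗ dynkinProj ℓ

theorem dynkinProj_word (w : List Λ) : dynkinProj ℓ (FreeAlgebra.word w) =
    (w.length : ℚ)⁻¹ • dynkin ℓ (FreeAlgebra.word w) :=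
  FreeAlgebra.wordLift_word _ w

theorem dynkinComp_one (i : I) : dynkinComp ℓ i 1 = 0 := by
  rw [dynkinComp, LinearMap.comp_apply, ← FreeAlgebra.word_nil, dynkinProj_word,
    FreeAlgebra.word_nil, dynkin_one, smul_zero, map_zero]

theorem dynkinComp_word (l : Λ) (w : List Λ) :
    dynkinComp ℓ (wordDeg deg (l :: w)) (FreeAlgebra.word (l :: w)) =
      (w.length + 1 : ℚ)⁻¹ • rnBr ℓ l w := by
  rw [dynkinComp, LinearMap.comp_apply, dynkinProj_word, dynkin_word, map_smul,
    DirectSum.component.lof_self, List.length_cons, Nat.cast_succ]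

theorem dynkinComp_word_of_ne {w : List Λ} {i : I} (h : wordDeg deg w ≠ i) :
    dynkinComp ℓ i (FreeAlgebra.word w) = 0 := by
  rcases w with _ | ⟨l, w⟩
  · exact dynkinComp_one ℓ i
  · rw [dynkinComp, LinearMap.comp_apply, dynkinProj_word, dynkin_word, map_smul,
      DirectSum.component.of, dif_neg h, smul_zero]

end GrLie

/-! ### The embedding of the left adjoint into the words -/

namespace ConnDBGL

open SMod FreeAlgebra

variable {A : ConnDBGL.{u}} 

/-- The morphism of graded Lie algebras given by a solution of the relations. -/
def nstarEval {n : SimplexCategory} {M : GrLie.{u} ℕ (AddMonoidHom.id ℕ)} (R : A.Rep n M) (s : ℕ) :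
    (A.nstarLie n).V s →ₗ[ℚ] M.V s :=
  Universal.eval (P := A.IsNstarModel n)
    { toGrLie := M, gen := fun x => R.g _ x.2.1 x.2.2, op := fun h => h.elim }
    ⟨R, fun _ _ => rfl⟩ s

theorem nstarEval_g {n : SimplexCategory} {M : GrLie.{u} ℕ (AddMonoidHom.id ℕ)} (R : A.Rep n M)
    {p s : ℕ} (θ : n ⟶ ⦋p⦌) (x : A.V p s) :
    nstarEval R s ((A.nstarRep n).g s θ x) = R.g s θ x := rfl

theorem nstarEval_br {n : SimplexCategory} {M : GrLie.{u} ℕ (AddMonoidHom.id ℕ)} (R : A.Rep n M)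
    {s t k : ℕ} (h : s + t = k) (x : (A.nstarLie n).V s) (y : (A.nstarLie n).V t) :
    nstarEval R k ((A.nstarLie n).br h x y) = M.br h (nstarEval R s x) (nstarEval R t y) :=
  Universal.eval_br _ _ _ _ _

variable {Y : Type u} {dp ds : Y → ℕ} {ι : ∀ y, A.V (dp y) (ds y)}

section

variable (hA : A.toConnBigrLie.FreeOn dp ds ι) (n : ℕ)

/-- The solution of the relations in the algebra of words. -/
def wordRep : A.Rep ⦋n⦌ (GrLie.comm (AddMonoidHom.id ℕ) (FreeAlgebra ℚ (Letter dp n))) :=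
  (exists_rep hA (GrLie.comm (AddMonoidHom.id ℕ) (FreeAlgebra ℚ (Letter dp n)))
    fun y θ _ => letter y θ).choose

theorem wordRep_g {y : Y} {θ : ⦋n⦌ ⟶ ⦋dp y⦌} (h : IsSurj θ) :
    (wordRep hA n).g _ θ (ι y) = letter y θ :=
  (exists_rep hA (GrLie.comm (AddMonoidHom.id ℕ) (FreeAlgebra ℚ (Letter dp n)))
    fun y θ _ => letter y θ).choose_spec y θ h

/-- The embedding of the left adjoint into the words. -/
def toWords (s : ℕ) : (A.nstarLie ⦋n⦌).V s →ₗ[ℚ] FreeAlgebra ℚ (Letter dp n) :=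
  nstarEval (wordRep hA n) s

variable {n}

theorem toWords_br {s t k : ℕ} (h : s + t = k) (x : (A.nstarLie ⦋n⦌).V s)
    (y : (A.nstarLie ⦋n⦌).V t) :
    toWords hA n k ((A.nstarLie ⦋n⦌).br h x y) = toWords hA n s x * toWords hA n t y -
      (-1 : ℚ) ^ (s * t) • (toWords hA n t y * toWords hA n s x) := nstarEval_br _ h x y

/-- The filtration drops for nonsurjective operators because they factor through a face: a positive
face gives zero, and `d_0` replaces `x` by its boundary, of dimension one less. -/
theorem toWords_g_mem {p s : ℕ} (x : A.V p s) (θ : ⦋n⦌ ⟶ ⦋p⦌) :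
    toWords hA n s ((A.nstarRep ⦋n⦌).g s θ x) ∈ lowerSpan dp n (p + 1) ∧
      (¬ IsSurj θ → toWords hA n s ((A.nstarRep ⦋n⦌).g s θ x) ∈ lowerSpan dp n p) := by
  -- The bound in the preceding dimension is taken as a hypothesis, so that this can serve inside
  -- the induction proving `first`.
  have second : ∀ {p s : ℕ} (θ : ⦋n⦌ ⟶ ⦋p⦌) (x : A.V p s), (∀ q, q + 1 = p → ∀ (x : A.V q s)
      (θ : ⦋n⦌ ⟶ ⦋q⦌), toWords hA n s ((A.nstarRep ⦋n⦌).g s θ x) ∈ lowerSpan dp n (q + 1)) →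
      ¬ IsSurj θ → toWords hA n s ((A.nstarRep ⦋n⦌).g s θ x) ∈ lowerSpan dp n p := by
    intro p s θ x ih hθ
    obtain ⟨v, hv⟩ := not_forall.1 hθ
    rcases p with _ | p
    · exact absurd ⟨0, Subsingleton.elim (α := Fin 1) _ _⟩ hv
    · obtain ⟨θ, rfl⟩ := SimplexCategory.eq_comp_δ_of_not_surjective' θ v fun j hj => hv ⟨j, hj⟩
      refine Fin.cases ?_ (fun i => ?_) v
      · rw [(A.nstarRep _).g_δ_zero, map_smul]
        exact Submodule.smul_mem _ _ (ih p rfl _ _)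
      · rw [(A.nstarRep _).g_δ_succ, map_zero]
        exact Submodule.zero_mem _
  have first : ∀ k p, p < k → ∀ s (x : A.V p s) (θ : ⦋n⦌ ⟶ ⦋p⦌),
      toWords hA n s ((A.nstarRep ⦋n⦌).g s θ x) ∈ lowerSpan dp n (p + 1) := by
    intro k
    induction k with
    | zero => exact fun p hp => absurd hp (Nat.not_lt_zero p)
    | succ k ih =>
      intro p hp s x
      refine hA.induction (fun p s =>
        { carrier := {x | p < k + 1 → ∀ θ : ⦋n⦌ ⟶ ⦋p⦌,
            toWords hA n s ((A.nstarRep ⦋n⦌).g s θ x) ∈ lowerSpan dp n (p + 1)}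
          add_mem' := fun h h' hp θ => ?_
          zero_mem' := fun hp θ => ?_
          smul_mem' := fun c x h hp θ => ?_ }) ?_ ?_ x hp
      · rw [map_add, map_add]; exact Submodule.add_mem _ (h hp θ) (h' hp θ)
      · rw [map_zero, map_zero]; exact Submodule.zero_mem _
      · rw [map_smul, map_smul]; exact Submodule.smul_mem _ c (h hp θ)
      · intro y hy θ
        by_cases hθ : IsSurj θ
        · rw [toWords, nstarEval_g, wordRep_g hA n hθ]
          exact letter_mem_lowerSpan y θ
        · exact lowerSpan_mono (Nat.le_succ _)
            (second θ (ι y) (fun q hq x θ => ih q (by omega) _ x θ) hθ)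
      · intro p q k' s t m h h' x hx y hy hn θ
        rw [(A.nstarRep _).g_br h h', map_sum]
        refine Submodule.sum_mem _ fun σ _ => ?_
        rw [map_smul, toWords_br]
        have hx' := hx (by omega) (θ ≫ cntMap σ p)
        have hy' := hy (by omega) (θ ≫ cntMap σᶜ q)
        exact Submodule.smul_mem _ _ (Submodule.sub_mem _
          (mul_mem_lowerSpan (fun i hi j hj => by omega) hx' hy')
          (Submodule.smul_mem _ _ (mul_mem_lowerSpan (fun i hi j hj => by omega) hy' hx')))
  exact ⟨first (p + 1) p (Nat.lt_succ_self p) s x θ,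
    second θ x fun q hq x θ => first (q + 1) q (Nat.lt_succ_self q) s x θ⟩

/-- The generators of the left adjoint of a free DBGL. -/
def genLie (l : Letter dp n) : (A.nstarLie ⦋n⦌).V (ds l.1) := (A.nstarRep ⦋n⦌).g _ l.2.1 (ι l.1)

theorem toWords_genLie (l : Letter dp n) :
    toWords hA n _ (genLie (ι := ι) l) = FreeAlgebra.ι ℚ l := by
  rw [genLie, toWords, nstarEval_g, wordRep_g hA n l.2.2, ι_eq_letter]

variable (ι) in
/-- The retraction of the words onto the left adjoint. -/
def ofWords (n s : ℕ) : FreeAlgebra ℚ (Letter dp n) →ₗ[ℚ] (A.nstarLie ⦋n⦌).V s :=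
  GrLie.dynkinComp (genLie (ι := ι)) s

/-- The normalized Dynkin operator is a retraction because the generators `genLie` generate; in
particular `toWords` is injective. -/
theorem ofWords_toWords {s : ℕ} (x : (A.nstarLie ⦋n⦌).V s) :
    ofWords ι n s (toWords hA n s x) = x := by
  refine (congrArg (DirectSum.component ℚ ℕ (A.nstarLie ⦋n⦌).V s) (GrLie.dynkinProj_lie
    (fun s => toWords hA n s) (toWords_br hA) (toWords_genLie hA) ?_ x)).trans
    (DirectSum.component.lof_self _ _ _)
  intro C hC hbr p x
  exact nstar_gen_induction hA C (fun y θ h => hC ⟨y, θ, h⟩) hbr x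

/-- The degree of a word. -/
abbrev letterDeg (ds : Y → ℕ) (w : List (Letter dp n)) : ℕ :=
  GrLie.wordDeg (fun l : Letter dp n => ds l.1) w

theorem letterDeg_eq (w : List (Letter dp n)) : letterDeg ds w = GrLie.wordDeg ds (shape w) :=
  (GrLie.wordDeg_map Sigma.fst w).symm

theorem toWords_rnBr_mem (l : Letter dp n) (w : List (Letter dp n)) :
    toWords hA n _ (GrLie.rnBr (genLie (ι := ι)) l w) ∈
      lowerSpan dp n (degSum dp (shape (l :: w)) + 1) := by
  induction w generalizing l with
  | nil =>
    refine (congrArg (· ∈ _) (toWords_genLie hA l)).mpr ?_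
    rw [ι_eq_letter]
    exact letter_mem_lowerSpan _ _
  | cons l' w ih =>
    have h := letter_mem_lowerSpan l.1 l.2.1
    rw [← ι_eq_letter] at h
    rw [GrLie.rnBr_cons, toWords_br, toWords_genLie]
    have e : degSum dp (shape (l :: l' :: w)) = dp l.1 + degSum dp (shape (l' :: w)) := rfl
    exact Submodule.sub_mem _ (mul_mem_lowerSpan (fun i hi j hj => by omega) h (ih l'))
      (Submodule.smul_mem _ _ (mul_mem_lowerSpan (fun i hi j hj => by omega) (ih l') h))

/-- The embedding is simplicial only modulo words of smaller dimension: nonsurjective operators on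
generators involve the differential of `A`. The error on generators propagates through brackets. -/
theorem toWords_act_rnBr_sub_mem {m : ℕ} (α : ⦋m⦌ ⟶ ⦋n⦌) (l : Letter dp n)
    (w : List (Letter dp n)) :
    toWords hA m _ (A.nstarObj.act α _ (GrLie.rnBr (genLie (ι := ι)) l w)) -
      actHom α (toWords hA n _ (GrLie.rnBr (genLie (ι := ι)) l w)) ∈
        lowerSpan dp m (degSum dp (shape (l :: w))) := by
  have hl : ∀ l : Letter dp n, toWords hA m _ (A.nstarObj.act α _ (genLie (ι := ι) l)) -
      actHom α (toWords hA n _ (genLie (ι := ι) l)) ∈ lowerSpan dp m (dp l.1) := by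
    intro l
    rw [toWords_genLie, actHom_ι, genLie, act_nstarRep]
    by_cases h : IsSurj (α ≫ l.2.1)
    · rw [toWords, nstarEval_g, wordRep_g hA m h, sub_self]; exact Submodule.zero_mem _
    · rw [letter_eq_zero h, sub_zero]; exact (toWords_g_mem hA _ _).2 h
  induction w generalizing l with
  | nil => exact hl l
  | cons l' w ih =>
    have e : A.nstarObj.act α _ (GrLie.rnBr (genLie (ι := ι)) l (l' :: w)) =
        (A.nstarLie ⦋m⦌).br (GrLie.wordDeg_cons l (l' :: w)).symm
          (A.nstarObj.act α _ (genLie l))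
          (A.nstarObj.act α _ (GrLie.rnBr (genLie (ι := ι)) l' w)) :=
      SConnGrLie.act_br A.nstarObj α (GrLie.wordDeg_cons l (l' :: w)).symm _ _
    have h2 := toWords_rnBr_mem hA l' w
    have h1 : toWords hA n _ (genLie (ι := ι) l) ∈ lowerSpan dp n (dp l.1 + 1) := by
      rw [toWords_genLie, ι_eq_letter]; exact letter_mem_lowerSpan _ _
    have h3 := hl l
    have h4 := ih l'
    rw [e, GrLie.rnBr_cons, toWords_br, toWords_br, map_sub, map_smul, map_mul, map_mul]
    replace h1 := actHom_mem_lowerSpan α h1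
    replace h2 := actHom_mem_lowerSpan α h2
    generalize toWords hA m _ (A.nstarObj.act α _ (genLie (ι := ι) l)) = x at *
    generalize toWords hA m _ (A.nstarObj.act α _ (GrLie.rnBr (genLie (ι := ι)) l' w)) = y at *
    generalize actHom α (toWords hA n _ (genLie (ι := ι) l)) = x' at *
    generalize actHom α (toWords hA n _ (GrLie.rnBr (genLie (ι := ι)) l' w)) = y' at *
    have h5 : y ∈ lowerSpan dp m (degSum dp (shape (l' :: w)) + 1) := by
      rw [← sub_add_cancel y y']
      exact Submodule.add_mem _ (lowerSpan_mono (Nat.le_succ _) h4) h2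
    -- Telescoping: each product contains exactly one difference, and that factor has smaller
    -- filtration.
    have e1 : ∀ a : ℚ, x * y - a • (y * x) - (x' * y' - a • (y' * x')) =
        ((x - x') * y + x' * (y - y')) - a • ((y - y') * x' + y * (x - x')) := by
      intro a
      simp only [sub_mul, mul_sub]
      module
    have e2 : degSum dp (shape (l :: l' :: w)) = dp l.1 + degSum dp (shape (l' :: w)) := rfl
    rw [e1]
    exact Submodule.sub_mem _ (Submodule.add_mem _
      (mul_mem_lowerSpan (fun i hi j hj => by omega) h3 h5)
      (mul_mem_lowerSpan (fun i hi j hj => by omega) h1 h4)) (Submodule.smul_mem _ _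
      (Submodule.add_mem _ (mul_mem_lowerSpan (fun i hi j hj => by omega) h4 h1)
      (mul_mem_lowerSpan (fun i hi j hj => by omega) h5 h3)))

/-- In the associated graded action, each letter goes to a letter with the same generator or to
zero. A right-normed bracket therefore becomes the right-normed bracket of the new letters, or zero,
with unchanged degree signs. -/
theorem actHom_toWords_rnBr {m : ℕ} (α : ⦋m⦌ ⟶ ⦋n⦌) (l : Letter dp n) (w : List (Letter dp n)) :
    (actHom α (word (l :: w)) = 0 ∧
      actHom α (toWords hA n _ (GrLie.rnBr (genLie (ι := ι)) l w)) = 0) ∨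
    ∃ l' w', shape (l' :: w') = shape (l :: w) ∧ actHom α (word (l :: w)) = word (l' :: w') ∧
      actHom α (toWords hA n _ (GrLie.rnBr (genLie (ι := ι)) l w)) =
        toWords hA m _ (GrLie.rnBr (genLie (ι := ι)) l' w') := by
  have hl : ∀ l : Letter dp n, actHom α (FreeAlgebra.ι ℚ l) = 0 ∨ ∃ l' : Letter dp m,
      l'.1 = l.1 ∧ actHom α (FreeAlgebra.ι ℚ l) = FreeAlgebra.ι ℚ l' := by
    intro l
    rw [actHom_ι]
    by_cases h : IsSurj (α ≫ l.2.1)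
    · exact .inr ⟨⟨l.1, _, h⟩, rfl, letter_of_isSurj h⟩
    · exact .inl (letter_eq_zero h)
  induction w generalizing l with
  | nil =>
    have e : ∀ {n : ℕ} (l : Letter dp n), toWords hA n _ (GrLie.rnBr (genLie (ι := ι)) l []) =
        FreeAlgebra.ι ℚ l := fun l => toWords_genLie hA l
    simp only [e, word_cons, word_nil, mul_one]
    rcases hl l with h | ⟨l', h1, h2⟩
    · exact .inl ⟨h, h⟩
    · exact .inr ⟨l', [], congrArg (fun y => [y]) h1, by rw [word_nil, mul_one, h2], h2.trans (e l').symm⟩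
  | cons l₁ w ih =>
    rw [GrLie.rnBr_cons, toWords_br, map_sub, map_smul, map_mul, map_mul, toWords_genLie,
      word_cons, map_mul]
    rcases hl l with h | ⟨l', h1, h2⟩
    · exact .inl ⟨by rw [h, zero_mul], by rw [h, zero_mul, mul_zero, smul_zero, sub_zero]⟩
    · rcases ih l₁ with ⟨h, h'⟩ | ⟨l₁', w', h, h', h''⟩
      · exact .inl ⟨by rw [h, mul_zero], by rw [h', zero_mul, mul_zero, smul_zero, sub_zero]⟩
      · refine .inr ⟨l', l₁' :: w', ?_, ?_, ?_⟩
        · exact congrArg₂ List.cons h1 h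
        · rw [h', h2, word_cons l']
        · rw [GrLie.rnBr_cons, toWords_br, toWords_genLie, h2, h'']
          have : letterDeg ds (l₁' :: w') = letterDeg ds (l₁ :: w) := by
            rw [letterDeg_eq, letterDeg_eq, h]
          refine congrArg (fun k => _ - (-1 : ℚ) ^ k • _) (congrArg₂ (· * ·) ?_ this.symm)
          exact congrArg ds h1.symm

end

end ConnDBGL

/-! ### The Dynkin projection and the simplicial structure -/

namespace ConnDBGL

open SMod FreeAlgebra

variable {A : ConnDBGL.{u}} {Y : Type u} {dp ds : Y → ℕ} {ι : ∀ y, A.V (dp y) (ds y)}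
  (hA : A.toConnBigrLie.FreeOn dp ds ι) {m n : ℕ}

section

theorem toWords_ofWords_one (s : ℕ) : toWords hA n s (ofWords ι n s 1) = 0 :=
  (congrArg _ (GrLie.dynkinComp_one _ s)).trans (map_zero _)

theorem ofWords_word (l : Letter dp n) (w : List (Letter dp n)) :
    ofWords ι n _ (word (l :: w)) = (w.length + 1 : ℚ)⁻¹ • GrLie.rnBr (genLie (ι := ι)) l w :=
  GrLie.dynkinComp_word _ l w

theorem ofWords_word_of_ne {s : ℕ} {w : List (Letter dp n)} (h : letterDeg ds w ≠ s) :
    ofWords ι n s (word w) = 0 := GrLie.dynkinComp_word_of_ne _ h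

theorem toWords_ofWords_mem {r s : ℕ} {t : FreeAlgebra ℚ (Letter dp n)}
    (h : t ∈ lowerSpan dp n r) : toWords hA n s (ofWords ι n s t) ∈ lowerSpan dp n r := by
  induction h using Submodule.span_induction with
  | mem t ht =>
    obtain ⟨w, hw, rfl⟩ := ht
    by_cases hs : letterDeg ds w = s
    · subst hs
      rcases w with _ | ⟨l, w⟩
      · rw [word_nil, toWords_ofWords_one]; exact Submodule.zero_mem _
      · rw [ofWords_word, map_smul]
        exact Submodule.smul_mem _ _ (lowerSpan_mono hw (toWords_rnBr_mem hA l w))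
    · rw [ofWords_word_of_ne hs, map_zero]; exact Submodule.zero_mem _
  | zero => rw [map_zero, map_zero]; exact Submodule.zero_mem _
  | add a b _ _ ha hb => rw [map_add, map_add]; exact Submodule.add_mem _ ha hb
  | smul c a _ ha => rw [map_smul, map_smul]; exact Submodule.smul_mem _ _ ha

theorem toWords_act_ofWords_sub_mem (α : ⦋m⦌ ⟶ ⦋n⦌) {r s : ℕ} {t : FreeAlgebra ℚ (Letter dp n)}
    (h : t ∈ lowerSpan dp n (r + 1)) :
    toWords hA m s (A.nstarObj.act α s (ofWords ι n s t)) -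
      actHom α (toWords hA n s (ofWords ι n s t)) ∈ lowerSpan dp m r := by
  induction h using Submodule.span_induction with
  | mem t ht =>
    obtain ⟨w, hw, rfl⟩ := ht
    by_cases hs : letterDeg ds w = s
    · subst hs
      rcases w with _ | ⟨l, w⟩
      · have h1 : ∀ s, ofWords ι n s (word []) = 0 := fun s => GrLie.dynkinComp_one _ s
        rw [h1]
        simp only [map_zero, sub_zero]
        exact Submodule.zero_mem _
      · rw [ofWords_word]
        simp only [map_smul, ← smul_sub]
        exact Submodule.smul_mem _ _ (lowerSpan_mono (Nat.lt_succ_iff.1 hw)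
          (toWords_act_rnBr_sub_mem hA α l w))
    · rw [ofWords_word_of_ne hs]
      simp only [map_zero, sub_zero]
      exact Submodule.zero_mem _
  | zero => simp only [map_zero, sub_zero]; exact Submodule.zero_mem _
  | add a b _ _ ha hb =>
    simp only [map_add, add_sub_add_comm]; exact Submodule.add_mem _ ha hb
  | smul c a _ ha => simp only [map_smul, ← smul_sub]; exact Submodule.smul_mem _ _ ha

/-- The Dynkin projector commutes strictly with the associated graded operators, since these respect
letters, length and degree. Cycles and boundaries of words can thus be projected to the Lie algebra.
-/
theorem actHom_toWords_ofWords (α : ⦋m⦌ ⟶ ⦋n⦌) (s : ℕ) (t : FreeAlgebra ℚ (Letter dp n)) :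
    actHom α (toWords hA n s (ofWords ι n s t)) =
      toWords hA m s (ofWords ι m s (actHom α t)) := by
  refine LinearMap.congr_fun
    (f := (actHom α).toLinearMap ∘ₗ toWords hA n s ∘ₗ ofWords ι n s)
    (g := toWords hA m s ∘ₗ ofWords ι m s ∘ₗ (actHom α).toLinearMap) (word_hom_ext fun w => ?_) t
  change actHom α (toWords hA n s (ofWords ι n s (word w))) =
      toWords hA m s (ofWords ι m s (actHom α (word w)))
  rcases w with _ | ⟨l, w⟩
  · rw [word_nil, map_one (actHom α), toWords_ofWords_one, toWords_ofWords_one, map_zero]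
  have key := actHom_toWords_rnBr hA α l w
  by_cases hs : letterDeg ds (l :: w) = s
  · subst hs
    rw [ofWords_word, map_smul, map_smul]
    rcases key with ⟨h1, h2⟩ | ⟨l', w', h0, h1, h2⟩
    · rw [h1, h2, map_zero, map_zero, smul_zero]
    · have hd : letterDeg ds (l' :: w') = letterDeg ds (l :: w) := by
        rw [letterDeg_eq, letterDeg_eq, h0]
      have hlen : w'.length = w.length := by
        simpa [shape] using congrArg List.length h0
      rw [h1, h2, ← hlen, ← hd, ofWords_word, map_smul]
  · rw [ofWords_word_of_ne hs, map_zero, map_zero]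
    rcases key with ⟨h1, -⟩ | ⟨l', w', h0, h1, -⟩
    · rw [h1, map_zero, map_zero]
    · rw [h1, ofWords_word_of_ne, map_zero]
      rwa [letterDeg_eq, h0, ← letterDeg_eq]

/-- The boundary is a signed sum of faces, each compatible with the embedding modulo lower
filtration. -/
theorem toWords_d_ofWords_sub_mem {r s : ℕ} {t : FreeAlgebra ℚ (Letter dp (n + 1))}
    (h : t ∈ lowerSpan dp (n + 1) (r + 1)) :
    toWords hA n s ((A.nstarObj.smod s).d n (ofWords ι (n + 1) s t)) -
      (wordMod dp).d n (toWords hA (n + 1) s (ofWords ι (n + 1) s t)) ∈ lowerSpan dp n r := by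
  rw [d_apply, d_apply]
  refine (congrArg (fun a => a - _ ∈ lowerSpan dp n r) (map_sum (toWords hA n s) _ _)).mpr ?_
  rw [← Finset.sum_sub_distrib]
  refine Submodule.sum_mem _ fun i _ => ?_
  refine (congrArg (fun a => a - _ ∈ lowerSpan dp n r) (map_smul (toWords hA n s) _ _)).mpr ?_
  rw [← smul_sub]
  exact Submodule.smul_mem _ _ (toWords_act_ofWords_sub_mem hA _ h)

theorem d_toWords_ofWords (s : ℕ) (t : FreeAlgebra ℚ (Letter dp (n + 1))) :
    (wordMod dp).d n (toWords hA (n + 1) s (ofWords ι (n + 1) s t)) =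
      toWords hA n s (ofWords ι n s ((wordMod dp).d n t)) :=
  (Map.d (B := wordMod dp) (C := wordMod dp)
    ⟨fun n => toWords hA n s ∘ₗ ofWords ι n s, fun α t =>
      (actHom_toWords_ofWords hA α s t).symm⟩ t).symm

/-- For surjective operators there is no error term, since composites of surjections are surjective;
no boundary in `A` ever appears. -/
theorem toWords_act_of_isSurj {α : ⦋m⦌ ⟶ ⦋n⦌} (hα : IsSurj α) {s : ℕ}
    (x : (A.nstarLie ⦋n⦌).V s) :
    toWords hA m s (A.nstarObj.act α s x) = actHom α (toWords hA n s x) := by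
  refine nstar_gen_induction hA (fun s => LinearMap.eqLocus (toWords hA m s ∘ₗ A.nstarObj.act α s)
    ((actHom α).toLinearMap ∘ₗ toWords hA n s)) (fun y θ h => ?_)
    (fun {p q k} h x hx y hy => ?_) x
  · change toWords hA m _ (A.nstarObj.act α _ ((A.nstarRep ⦋n⦌).g _ θ (ι y))) =
      actHom α (toWords hA n _ ((A.nstarRep ⦋n⦌).g _ θ (ι y)))
    have h' : IsSurj (α ≫ θ) := h.comp hα
    rw [act_nstarRep, toWords, nstarEval_g, wordRep_g hA m h', toWords, nstarEval_g,
      wordRep_g hA n h, actHom_letter]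
  · change toWords hA m k (A.nstarObj.act α k ((A.nstarLie ⦋n⦌).br h x y)) =
      actHom α (toWords hA n k ((A.nstarLie ⦋n⦌).br h x y))
    have e : A.nstarObj.act α k ((A.nstarLie ⦋n⦌).br h x y) =
        (A.nstarLie ⦋m⦌).br h (A.nstarObj.act α p x) (A.nstarObj.act α q y) :=
      SConnGrLie.act_br A.nstarObj α h x y
    have hx' : toWords hA m _ (A.nstarObj.act α _ x) = actHom α (toWords hA n _ x) := hx
    have hy' : toWords hA m _ (A.nstarObj.act α _ y) = actHom α (toWords hA n _ y) := hy
    rw [e, toWords_br, toWords_br, hx', hy', map_sub, map_smul, map_mul, map_mul]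

/-! ### The embedding of a free DBGL into the words in its generators -/

include hA in
theorem exists_genWords : ∃ φ : ∀ p s, A.V p s →ₗ[ℚ] FreeAlgebra ℚ Y,
    (∀ {p q n s t m : ℕ} (h : p + q = n) (k : s + t = m) (x : A.V p s) (y : A.V q t),
      φ n m (A.br h k x y) = φ p s x * φ q t y -
        (-1 : ℚ) ^ ((p + s) * (q + t)) • (φ q t y * φ p s x)) ∧
    ∀ y, φ _ _ (ι y) = FreeAlgebra.ι ℚ y :=
  hA.exists_hom (GrLie.comm totalDegree (FreeAlgebra ℚ Y)) fun y => FreeAlgebra.ι ℚ y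

/-- The embedding of a free DBGL into the words in its generators. -/
def genWords (p s : ℕ) : A.V p s →ₗ[ℚ] FreeAlgebra ℚ Y := (exists_genWords hA).choose p s

theorem genWords_br {p q n s t m : ℕ} (h : p + q = n) (k : s + t = m) (x : A.V p s)
    (y : A.V q t) : genWords hA n m (A.br h k x y) = genWords hA p s x * genWords hA q t y -
      (-1 : ℚ) ^ ((p + s) * (q + t)) • (genWords hA q t y * genWords hA p s x) :=
  (exists_genWords hA).choose_spec.1 h k x y

theorem genWords_ι (y : Y) : genWords hA _ _ (ι y) = FreeAlgebra.ι ℚ y :=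
  (exists_genWords hA).choose_spec.2 y

/-- The Dynkin retraction again, now for the bigraded free Lie algebra in the free algebra on its
generators. -/
theorem genWords_injective {p s : ℕ} {a : A.V p s} (h : genWords hA p s a = 0) : a = 0 := by
  have h1 := GrLie.dynkinProj_lie (L := A.toGrLie) (ℓ := ι)
    (deg := fun y => (dp y, ds y)) (fun i => genWords hA i.1 i.2)
    (fun h x y => genWords_br hA _ _ x y) (genWords_ι hA)
    (fun C hC hbr p x => hA.induction (fun p s => C (p, s)) hC
      (fun {p q n s t m} h k => hbr (p := (p, s)) (q := (q, t)) (n := (n, m)) (Prod.ext h k)) x) (p := (p, s)) a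
  rw [h, map_zero] at h1
  have h2 := congrArg (DirectSum.component ℚ (ℕ × ℕ) A.toGrLie.V (p, s)) h1
  rw [map_zero, DirectSum.component.lof_self] at h2
  exact h2.symm

theorem genWords_mem {p s : ℕ} (a : A.V p s) : genWords hA p s a ∈ homogSpan dp ds p s := by
  refine hA.induction (fun p s => (homogSpan dp ds p s).comap (genWords hA p s)) (fun y => ?_)
    (fun {p q n s t m} h k x hx y hy => ?_) a
  · rw [Submodule.mem_comap, genWords_ι]
    exact Submodule.subset_span ⟨[y], rfl, rfl, by rw [word_cons, word_nil, mul_one]⟩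
  · rw [Submodule.mem_comap, genWords_br]
    exact Submodule.sub_mem _ (mul_mem_homogSpan h k hx hy) (Submodule.smul_mem _ _
      (mul_mem_homogSpan (by omega) (by omega) hy hx))

theorem sh_wordMul_zero_right {p : ℕ} (x : (wordMod dp).X p) :
    sh (wordMul dp) p 0 p x (1 : FreeAlgebra ℚ (Letter dp 0)) = x := by
  rw [sh_flip _ (by omega), mul_zero, pow_zero, one_smul, sh_zero_left]
  exact (congrArg (x * ·) (map_one (actHom (dp := dp) (cntMap (∅ : Finset (Fin p)) 0)))).trans
    (mul_one _)

theorem shapeProd_singleton (y : Y) : shapeProd dp ds [y] = letter y (𝟙 ⦋dp y⦌) := by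
  rw [shapeProd_cons, shapeProd_nil]
  refine Eq.trans ?_ (sh_wordMul_zero_right (letter y (𝟙 ⦋dp y⦌)))
  rw [show degSum ds [] = 0 from rfl, mul_zero, pow_zero, one_smul]
  rfl

/-- The image of an element of a free DBGL in the words is the shuffle sum of its expression in
the generators. -/
theorem toWords_unit {p s : ℕ} (a : A.V p s) :
    toWords hA p s ((A.nstarRep ⦋p⦌).g s (𝟙 _) a) = shuffleSum ds p (genWords hA p s a) := by
  refine hA.induction (fun p s => LinearMap.eqLocus
    (toWords hA p s ∘ₗ (A.nstarRep ⦋p⦌).g s (𝟙 _)) (shuffleSum ds p ∘ₗ genWords hA p s))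
    (fun y => ?_) (fun {p q n s t m} h k x hx y hy => ?_) a
  · rw [LinearMap.mem_eqLocus, LinearMap.comp_apply, LinearMap.comp_apply, genWords_ι, toWords,
      nstarEval_g, wordRep_g hA _ fun v => ⟨v, rfl⟩, ← mul_one (FreeAlgebra.ι ℚ y), ← word_nil,
      ← word_cons]
    exact ((shuffleSum_word ds [y]).trans (shapeProd_singleton y)).symm
  · rw [LinearMap.mem_eqLocus, LinearMap.comp_apply, LinearMap.comp_apply] at *
    rw [(A.nstarRep ⦋n⦌).g_br h k, genWords_br, map_sub, map_smul,
      shuffleSum_mul ds h (genWords_mem hA x) (genWords_mem hA y),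
      shuffleSum_mul ds (by omega) (genWords_mem hA y) (genWords_mem hA x), ← hx, ← hy,
      sh_flip _ (show q + p = n by omega), smul_smul, smul_smul, ← pow_add, ← pow_add]
    -- The total-degree sign of the commutator, combined with the signs of the two shuffle products,
    -- equals the levelwise sign up to an even exponent.
    have e1 : (p + s) * (q + t) + q * s + q * p = p * t + s * t + 2 * (p * q + q * s) := by ring
    rw [e1, pow_add _ (p * t + s * t), pow_mul _ 2, neg_one_sq, one_pow, mul_one, pow_add, mul_smul,
      ← smul_sub, sh, sh, Finset.smul_sum, ← Finset.sum_sub_distrib, Finset.smul_sum, map_sum]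
    refine Finset.sum_congr rfl fun σ hσ => ?_
    rw [map_smul, toWords_br, pow_add, mul_smul, smul_comm ((-1 : ℚ) ^ inversions σ σᶜ),
      smul_comm ((-1 : ℚ) ^ (s * t)) ((-1 : ℚ) ^ inversions σ σᶜ), ← smul_sub]
    refine congrArg (fun a => (-1 : ℚ) ^ (p * t) • (-1 : ℚ) ^ inversions σ σᶜ • a) ?_
    have e2 : ∀ {p s : ℕ} (x : A.V p s) (τ : Finset (Fin n)) (_ : τ.card = p),
        toWords hA n s ((A.nstarRep ⦋n⦌).g s (𝟙 _ ≫ cntMap τ p) x) =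
          actHom (cntMap τ p) (toWords hA p s ((A.nstarRep ⦋p⦌).g s (𝟙 _) x)) := by
      intro p s x τ hτ
      rw [← toWords_act_of_isSurj hA (cntMap_surjective hτ), act_nstarRep, Category.id_comp,
        Category.comp_id]
    rw [e2 x σ (card_of_mem hσ), e2 y σᶜ (card_compl_of_mem h hσ)]
    rfl

end

end ConnDBGL

namespace SMod

theorem IsCycle.sub_smul {B : SMod.{u}} {n : ℕ} {x y : B.X n} (hx : B.IsCycle x)
    (hy : B.IsCycle y) (a : ℚ) : B.IsCycle (x - a • y) := by
  rcases n with _ | n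
  · trivial
  · have hx' : B.d n x = 0 := hx
    have hy' : B.d n y = 0 := hy
    exact (map_sub (B.d n) _ _).trans (by rw [map_smul, hx', hy', smul_zero, sub_zero])

theorem Sphere.isCycle {B : SMod.{u}} {r : ℕ} {e : B.X r} {lam : B.X r →ₗ[ℚ] ℚ}
    (h : Sphere B r e lam) : B.IsCycle e := by
  rcases r with _ | r
  · trivial
  · refine (d_apply _ _).trans (Finset.sum_eq_zero fun i _ => ?_)
    rw [h.degenerate _ (not_surjective_of_ne (v := i) (φ := SimplexCategory.δ i)
      fun j => Fin.succAbove_ne _ _), smul_zero]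

end SMod

namespace ConnDBGL

open SMod FreeAlgebra

variable {A : ConnDBGL.{u}} {Y : Type u} {dp ds : Y → ℕ} {ι : ∀ y, A.V (dp y) (ds y)} {m n : ℕ}

/-! ### The Dynkin operator on shuffle products of generators -/

variable (A) in
/-- The action of a simplicial operator on the total space of the left adjoint. -/
def actTot (α : ⦋m⦌ ⟶ ⦋n⦌) : (A.nstarLie ⦋n⦌).Tot →ₗ[ℚ] (A.nstarLie ⦋m⦌).Tot :=
  DirectSum.toModule ℚ ℕ _ fun s =>
    DirectSum.lof ℚ ℕ (A.nstarLie ⦋m⦌).V s ∘ₗ A.nstarObj.act α s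

theorem actTot_lof (α : ⦋m⦌ ⟶ ⦋n⦌) {s : ℕ} (x : (A.nstarLie ⦋n⦌).V s) :
    A.actTot α (DirectSum.lof ℚ ℕ (A.nstarLie ⦋n⦌).V s x) =
      DirectSum.lof ℚ ℕ (A.nstarLie ⦋m⦌).V s (A.nstarObj.act α s x) :=
  DirectSum.toModule_lof ℚ s x

theorem actTot_ad (α : ⦋m⦌ ⟶ ⦋n⦌) {s : ℕ} (x : (A.nstarLie ⦋n⦌).V s)
    (u : (A.nstarLie ⦋n⦌).Tot) :
    A.actTot α (GrLie.ad x u) =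
      GrLie.ad (L := A.nstarLie ⦋m⦌) (A.nstarObj.act α s x) (A.actTot α u) := by
  refine LinearMap.congr_fun (f := A.actTot α ∘ₗ GrLie.ad x)
    (g := GrLie.ad (L := A.nstarLie ⦋m⦌) (A.nstarObj.act α s x) ∘ₗ A.actTot α)
    (GrLie.tot_hom_ext fun t z => ?_) u
  rw [LinearMap.comp_apply, LinearMap.comp_apply, GrLie.ad_lof rfl, actTot_lof, actTot_lof,
    GrLie.ad_lof (L := A.nstarLie ⦋m⦌) rfl]
  exact congrArg _ (SConnGrLie.act_br A.nstarObj α rfl x z)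

/-- Surjective operators send letters to letters, so they commute with forming right-normed
brackets. -/
theorem dynkin_actHom {α : ⦋m⦌ ⟶ ⦋n⦌} (hα : IsSurj α) (t : FreeAlgebra ℚ (Letter dp n)) :
    GrLie.dynkin (genLie (ι := ι)) (actHom α t) =
      A.actTot α (GrLie.dynkin (genLie (ι := ι)) t) := by
  have hl : ∀ l : Letter dp n, actHom α (FreeAlgebra.ι ℚ l) =
      FreeAlgebra.ι ℚ (⟨l.1, α ≫ l.2.1, l.2.2.comp hα⟩ : Letter dp m) := fun l => by
    rw [actHom_ι]; exact letter_of_isSurj _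
  refine LinearMap.congr_fun (f := GrLie.dynkin (genLie (ι := ι)) ∘ₗ (actHom α).toLinearMap)
    (g := A.actTot α ∘ₗ GrLie.dynkin (genLie (ι := ι))) (word_hom_ext fun w => ?_) t
  change GrLie.dynkin (genLie (ι := ι)) (actHom α (word w)) =
    A.actTot α (GrLie.dynkin (genLie (ι := ι)) (word w))
  induction w with
  | nil => rw [word_nil, map_one (actHom α), GrLie.dynkin_one, GrLie.dynkin_one, map_zero]
  | cons l w ih =>
    rcases w with _ | ⟨l', w⟩
    · rw [word_cons, word_nil, mul_one, hl, GrLie.dynkin_ι, GrLie.dynkin_ι, actTot_lof]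
      rfl
    · rw [word_cons l', map_mul (actHom α), hl] at ih
      rw [word_cons, word_cons, map_mul (actHom α), map_mul (actHom α), hl, hl,
        GrLie.dynkin_ι_mul_ι_mul, GrLie.dynkin_ι_mul_ι_mul, ih, actTot_ad]
      rfl

theorem dynkin_letter_mul {y y' : Y} {c : List Y} {θ : ⦋n⦌ ⟶ ⦋dp y⦌} (hθ : IsSurj θ)
    (b : (shapeMod dp (y' :: c)).X n) :
    GrLie.dynkin (genLie (ι := ι)) (letter y θ * shapeIncl (y' :: c) n b) =
      GrLie.ad (L := A.nstarLie ⦋n⦌) ((A.nstarRep ⦋n⦌).g _ θ (ι y))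
        (GrLie.dynkin (genLie (ι := ι)) (shapeIncl (y' :: c) n b)) := by
  have h := shapeIncl_mem (y' :: c) b
  generalize shapeIncl (y' :: c) n b = t at h
  induction h using Submodule.span_induction with
  | mem t ht =>
    obtain ⟨w, hw, rfl⟩ := ht
    rcases w with _ | ⟨l, w⟩
    · exact absurd hw (List.cons_ne_nil _ _).symm
    · rw [word_cons, letter_of_isSurj hθ, GrLie.dynkin_ι_mul_ι_mul]
      rfl
  | zero => rw [mul_zero, map_zero, map_zero]
  | add a b _ _ ha hb => rw [mul_add, map_add, map_add, map_add, ha, hb]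
  | smul c a _ ha => rw [mul_smul_comm, map_smul, map_smul, map_smul, ha]

/-- The Dynkin operator turns the shuffle product of generators into their iterated simplicial
bracket, which is the image under the unit of a right-normed bracket already formed in `A`. -/
theorem exists_dynkin_shapeProd (y : Y) (c : List Y) :
    ∃ a : A.V (degSum dp (y :: c)) (degSum ds (y :: c)),
      GrLie.dynkin (genLie (ι := ι)) (shapeProd dp ds (y :: c)) =
        DirectSum.lof ℚ ℕ (A.nstarLie ⦋degSum dp (y :: c)⦌).V (degSum ds (y :: c))
          ((A.nstarRep _).g _ (𝟙 _) a) := by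
  induction c generalizing y with
  | nil =>
    refine ⟨ι y, (congrArg _ (shapeProd_singleton y)).trans ?_⟩
    rw [letter_of_isSurj fun v => ⟨v, rfl⟩]
    exact GrLie.dynkin_ι _ _
  | cons y' c ih =>
    obtain ⟨a, ha⟩ := ih y'
    refine ⟨A.br (degSum_cons dp y (y' :: c)).symm (degSum_cons ds y (y' :: c)).symm (ι y) a, ?_⟩
    rw [shapeProd_cons, (A.nstarRep _).g_br, map_smul, map_sum, sh, map_sum, Finset.smul_sum]
    refine Finset.sum_congr rfl fun σ hσ => ?_
    have h1 := card_of_mem hσ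
    have h2 := card_compl_of_mem (degSum_cons dp y (y' :: c)).symm hσ
    rw [map_smul, map_smul, smul_smul, ← pow_add, add_comm]
    refine congrArg (_ • ·) ?_
    have e1 : (wordMod dp).act (cntMap σ (dp y)) (letter y (𝟙 ⦋dp y⦌)) =
        letter y (cntMap σ (dp y)) :=
      (actHom_letter _ _ _).trans (by rw [Category.comp_id])
    have e2 := (shapeInclMap dp (y' :: c)).nat (cntMap σᶜ (degSum dp (y' :: c)))
      (shapeClass ds (y' :: c))
    have e3 : GrLie.dynkin (genLie (ι := ι)) ((wordMod dp).act
        (cntMap σᶜ (degSum dp (y' :: c))) (shapeProd dp ds (y' :: c))) = _ :=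
      (dynkin_actHom (cntMap_surjective h2) _).trans (congrArg _ ha)
    have e4 : (wordMod dp).act (cntMap σᶜ (degSum dp (y' :: c))) (shapeProd dp ds (y' :: c)) = _ :=
      e2.symm
    rw [e1]
    refine (congrArg (fun t => GrLie.dynkin (genLie (ι := ι)) (letter y (cntMap σ (dp y)) * t))
      e4).trans ?_
    refine (dynkin_letter_mul (cntMap_surjective h1) _).trans ?_
    refine (congrArg (fun t => GrLie.ad (L := A.nstarLie _) ((A.nstarRep _).g _
      (cntMap σ (dp y)) (ι y)) (GrLie.dynkin (genLie (ι := ι)) t)) e4.symm).trans ?_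
    refine (congrArg (fun t => GrLie.ad (L := A.nstarLie _) ((A.nstarRep _).g _
      (cntMap σ (dp y)) (ι y)) t) e3).trans ?_
    rw [actTot_lof, GrLie.ad_lof (degSum_cons ds y (y' :: c)).symm, act_nstarRep,
      Category.id_comp, Category.id_comp, Category.comp_id]

theorem exists_ofWords_shapeProd (c : List Y) (s : ℕ) : ∃ b : A.V (degSum dp c) s,
    ofWords ι (degSum dp c) s (shapeProd dp ds c) = (A.nstarRep _).g s (𝟙 _) b := by
  rcases c with _ | ⟨y, c⟩
  · refine ⟨0, (congrArg _ (shapeProd_nil ds)).trans ((GrLie.dynkinComp_one _ s).trans ?_)⟩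
    rw [map_zero]
  · obtain ⟨a, ha⟩ := exists_dynkin_shapeProd (ds := ds) (ι := ι) y c
    have hlen : shapeProd dp ds (y :: c) ∈ GrLie.lengthSpan _ (y :: c).length := by
      refine Submodule.span_mono ?_ (shapeIncl_mem (y :: c) (shapeClass ds (y :: c)))
      rintro t ⟨w, hw, rfl⟩
      exact ⟨w, by rw [← congrArg List.length hw, shape, List.length_map], rfl⟩
    have h1 := GrLie.dynkinProj_of_mem (ℓ := genLie (ι := ι)) hlen
    rw [ha] at h1
    have h2 : ofWords ι _ s (shapeProd dp ds (y :: c)) = _ :=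
      congrArg (DirectSum.component ℚ ℕ _ s) h1
    rw [map_smul] at h2
    rw [h2]
    by_cases hs : degSum ds (y :: c) = s
    · subst hs
      exact ⟨((y :: c).length : ℚ)⁻¹ • a, by rw [DirectSum.component.lof_self, map_smul]⟩
    · refine ⟨0, ?_⟩
      rw [DirectSum.component.of, dif_neg hs, smul_zero, map_zero]

/-! ### The homology of the left adjoint on a free DBGL -/

theorem d_nstarRep {s : ℕ} (b : A.V (n + 1) s) :
    (A.nstarObj.smod s).d n ((A.nstarRep ⦋n + 1⦌).g s (𝟙 _) b) =
      (-1 : ℚ) ^ s • (A.nstarRep ⦋n⦌).g s (𝟙 _) (A.d n s b) := by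
  rw [d_apply, Fin.sum_univ_succ]
  refine (congrArg₂ (· + ·) ?_ (Finset.sum_eq_zero fun i _ => ?_)).trans (add_zero _)
  · refine (one_smul ℚ _).trans (Eq.trans ?_ ((A.nstarRep ⦋n⦌).g_δ_zero (𝟙 _) b))
    exact congrArg (fun θ => (A.nstarRep ⦋n⦌).g s θ b)
      ((Category.comp_id _).trans (Category.id_comp _).symm)
  · refine (congrArg (_ • ·) ?_).trans (smul_zero _)
    refine Eq.trans ?_ ((A.nstarRep ⦋n⦌).g_δ_succ (𝟙 _) i b)
    exact congrArg (fun θ => (A.nstarRep ⦋n⦌).g s θ b)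
      ((Category.comp_id _).trans (Category.id_comp _).symm)

/-- The elements whose boundary lies in the image of the unit. -/
def IsUnitCycle (s : ℕ) : ∀ {n : ℕ}, (A.nstarLie ⦋n⦌).V s → Prop := fun {n} => match n with
  | 0 => fun _ => True
  | n + 1 => fun z => ∃ a : A.V n s, (A.nstarObj.smod s).d n z = (A.nstarRep ⦋n⦌).g s (𝟙 _) a

variable (hA : A.toConnBigrLie.FreeOn dp ds ι)

include hA

/-- In words the unit is the shuffle sum of the expression in generators; both steps are injective.
-/
theorem unit_injective {s : ℕ} {a : A.V n s} (h : (A.nstarRep ⦋n⦌).g s (𝟙 _) a = 0) : a = 0 := by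
  have h1 := toWords_unit hA a
  rw [h, map_zero] at h1
  exact genWords_injective hA (eq_zero_of_shuffleSum ds (genWords_mem hA a) h1.symm)

/-- Modulo lower filtration, the boundary of `z` has as component at `c` a multiple of the
fundamental class. This component is also a boundary in the shape module, and the fundamental class
is not one, so the multiple is zero. -/
theorem isCycle_shapeProj {r s : ℕ} {z : (A.nstarLie ⦋n⦌).V s}
    (hz : toWords hA n s z ∈ lowerSpan dp n (r + 1)) (hz' : IsUnitCycle s z) {c : List Y}
    (hc : degSum dp c = r) :
    (shapeMod dp c).IsCycle (shapeProj c n (toWords hA n s z)) := by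
  rcases n with _ | n
  · trivial
  obtain ⟨a, ha⟩ := hz'
  obtain ⟨lam, hlam⟩ := exists_sphere (dp := dp) ds c
  have h1 := toWords_d_ofWords_sub_mem hA (s := s) hz
  rw [ofWords_toWords hA] at h1
  have h2 := shapeProj_of_mem_lowerSpan h1 hc.ge
  rw [map_sub, sub_eq_zero] at h2
  have h3 : (shapeMod dp c).d n (shapeProj c (n + 1) (toWords hA (n + 1) s z)) =
      coeffs (genWords hA n s a) c • shapeProj c n (shuffleSum (dp := dp) ds n (word c)) := by
    refine ((shapeProjMap dp c).d _).symm.trans (h2.symm.trans ?_)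
    rw [ha, toWords_unit, shapeProj_shuffleSum]
  change (shapeMod dp c).d n _ = 0
  -- Only in this dimension can the component be nonzero; `lam` annihilates boundaries but not the
  -- fundamental class.
  by_cases hn : degSum dp c = n
  · subst hn
    rw [shapeProj_shuffleSum_word] at h3
    have h4 := congrArg lam h3
    rw [hlam.lam_d, map_smul, eq_comm, smul_eq_mul, mul_eq_zero] at h4
    rw [h3, h4.resolve_right hlam.lam_e, zero_smul]
  · rw [h3, shuffleSum_word_of_ne ds hn, map_zero, smul_zero]

/-- In a sphere, every cycle is a multiple of the fundamental class plus a boundary. The Dynkin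
projection of that multiple comes from `A`. -/
theorem exists_shapeIncl_eq {r s : ℕ} {z : (A.nstarLie ⦋n⦌).V s}
    (hz : toWords hA n s z ∈ lowerSpan dp n (r + 1)) (hz' : IsUnitCycle s z) {c : List Y}
    (hc : degSum dp c = r) :
    ∃ (x : FreeAlgebra ℚ (Letter dp n)) (u : FreeAlgebra ℚ (Letter dp (n + 1))),
      u ∈ lowerSpan dp (n + 1) (r + 1) ∧
      shapeIncl c n (shapeProj c n (toWords hA n s z)) = x + (wordMod dp).d n u ∧
      ∃ b : A.V n s, ofWords ι n s x = (A.nstarRep ⦋n⦌).g s (𝟙 _) b := by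
  obtain ⟨lam, hlam⟩ := exists_sphere (dp := dp) ds c
  have hw := isCycle_shapeProj hA hz hz' hc
  generalize shapeProj c n (toWords hA n s z) = w at hw
  by_cases hn : n = degSum dp c
  · subst hn
    obtain ⟨u, hu⟩ := hlam.exact_eq (w - (lam w / lam (shapeClass ds c)) • shapeClass ds c)
      (hw.sub_smul hlam.isCycle _) (by
      rw [map_sub, map_smul, smul_eq_mul, div_mul_cancel₀ _ hlam.lam_e, sub_self])
    refine ⟨(lam w / lam (shapeClass ds c)) • shapeProd dp ds c, shapeIncl c _ u,
      shapeIncl_mem_lowerSpan (by omega) u, ?_, ?_⟩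
    · refine Eq.trans ?_ (congrArg (_ + ·) ((shapeInclMap dp c).d u))
      rw [hu, map_sub, map_smul]
      exact (add_sub_cancel _ _).symm
    · obtain ⟨b, hb⟩ := exists_ofWords_shapeProd (ds := ds) (ι := ι) c s
      exact ⟨(lam w / lam (shapeClass ds c)) • b, by rw [map_smul, map_smul, hb]⟩
  · obtain ⟨u, hu⟩ := hlam.exact_ne w hn hw
    refine ⟨0, shapeIncl c _ u, shapeIncl_mem_lowerSpan (by omega) u, ?_, 0, ?_⟩
    · rw [zero_add, ← hu]
      exact (shapeInclMap dp c).d u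
    · rw [map_zero, map_zero]

/-- Induction on the filtration: the components of top dimension are removed by subtracting an
element of `A` and a boundary. Allowing boundaries in the image of the unit, not just cycles, makes
the lemma serve for injectivity in homology as well. -/
theorem exists_eq_unit_add_d {s : ℕ} (r : ℕ) (z : (A.nstarLie ⦋n⦌).V s)
    (hz : toWords hA n s z ∈ lowerSpan dp n r) (hz' : IsUnitCycle s z) :
    ∃ (b : A.V n s) (v : (A.nstarLie ⦋n + 1⦌).V s),
      z = (A.nstarRep ⦋n⦌).g s (𝟙 _) b + (A.nstarObj.smod s).d n v := by
  induction r generalizing z with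
  | zero =>
    have h := lowerSpan_zero hz
    refine ⟨0, 0, ?_⟩
    rw [← ofWords_toWords hA z, h, map_zero, map_zero, map_zero, add_zero]
  | succ r ih =>
    obtain ⟨C, hC, hsub⟩ := exists_sub_sum_mem_lowerSpan hz
    choose! x u hu hxu b hb using fun c (hc : c ∈ C) => exists_shapeIncl_eq hA hz hz' (hC c hc)
    have hU : ∑ c ∈ C, u c ∈ lowerSpan dp (n + 1) (r + 1) := Submodule.sum_mem _ hu
    have hX : ofWords ι n s (∑ c ∈ C, x c) = (A.nstarRep ⦋n⦌).g s (𝟙 _) (∑ c ∈ C, b c) := by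
      rw [map_sum, map_sum]
      exact Finset.sum_congr rfl hb
    rw [Finset.sum_congr rfl hxu, Finset.sum_add_distrib, ← map_sum] at hsub
    generalize ∑ c ∈ C, x c = x' at *
    generalize ∑ c ∈ C, u c = u' at *
    generalize ∑ c ∈ C, b c = b' at *
    -- The correction is found among words, so it is projected to the Lie algebra by `ofWords`. The
    -- true boundary differs from the boundary of words only in lower filtration.
    have k1 : toWords hA n s (z - (A.nstarRep ⦋n⦌).g s (𝟙 _) b' -
        (A.nstarObj.smod s).d n (ofWords ι (n + 1) s u')) ∈ lowerSpan dp n r := by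
      have h1 := toWords_d_ofWords_sub_mem hA (s := s) hU
      have h2 := toWords_ofWords_mem hA (s := s) hsub
      rw [d_toWords_ofWords] at h1
      rw [map_sub, map_add, map_sub, map_add, ofWords_toWords hA, hX] at h2
      have h3 := Submodule.sub_mem _ h2 h1
      refine (congrArg (· ∈ lowerSpan dp n r) ?_).mpr h3
      rw [map_sub, map_sub]
      abel
    have k2 : IsUnitCycle s (z - (A.nstarRep ⦋n⦌).g s (𝟙 _) b' -
        (A.nstarObj.smod s).d n (ofWords ι (n + 1) s u')) := by
      rcases n with _ | n
      · trivial
      · obtain ⟨a, ha⟩ := hz'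
        refine ⟨a - (-1 : ℚ) ^ s • A.d n s b', ?_⟩
        rw [map_sub, map_sub, ha, d_nstarRep, map_sub, map_smul]
        refine (congrArg (_ - ·) (SMod.d_d (A.nstarObj.smod s) _)).trans (sub_zero _)
    obtain ⟨b'', v, hv⟩ := ih _ k1 k2
    refine ⟨b'' + b', v + ofWords ι (n + 1) s u', ?_⟩
    rw [sub_sub, sub_eq_iff_eq_add] at hv
    rw [hv, map_add, map_add, add_add_add_comm]

end ConnDBGL

/-! ### Quasi-isomorphisms of complexes of modules -/

theorem ShortComplex.quasiIso_of_elements {S₁ S₂ : ShortComplex (ModuleCat.{u} ℚ)} (φ : S₁ ⟶ S₂)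
    (hs : ∀ y : S₂.X₂, S₂.g y = 0 → ∃ x w, S₁.g x = 0 ∧ y = φ.τ₂ x + S₂.f w)
    (hi : ∀ (x : S₁.X₂) (w : S₂.X₁), S₁.g x = 0 → φ.τ₂ x = S₂.f w → ∃ v, x = S₁.f v) :
    ShortComplex.QuasiIso φ := by
  let h₁ := S₁.moduleCatLeftHomologyData
  let h₂ := S₂.moduleCatLeftHomologyData
  let γ : ShortComplex.LeftHomologyMapData φ h₁ h₂ := default
  rw [γ.quasiIso_iff, ConcreteCategory.isIso_iff_bijective]
  let k : LinearMap.ker S₁.g.hom →ₗ[ℚ] LinearMap.ker S₂.g.hom := γ.φK.hom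
  let H : (LinearMap.ker S₁.g.hom ⧸ LinearMap.range S₁.moduleCatToCycles) →ₗ[ℚ]
    (LinearMap.ker S₂.g.hom ⧸ LinearMap.range S₂.moduleCatToCycles) := γ.φH.hom
  have hK : ∀ x, (k x).1 = φ.τ₂ x.1 := fun x =>
    LinearMap.congr_fun (congrArg ModuleCat.Hom.hom γ.commi) x
  have hH : ∀ x, H (Submodule.Quotient.mk x) = Submodule.Quotient.mk (k x) := fun x =>
    ConcreteCategory.congr_hom γ.commπ x
  change Function.Bijective H
  constructor
  · refine (injective_iff_map_eq_zero H).2 fun a ha => ?_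
    obtain ⟨x, rfl⟩ := Submodule.Quotient.mk_surjective _ a
    rw [hH, Submodule.Quotient.mk_eq_zero] at ha
    obtain ⟨w, hw⟩ := ha
    obtain ⟨v, hv⟩ := hi x.1 w x.2 ((hK x).symm.trans (congrArg Subtype.val hw).symm)
    exact (Submodule.Quotient.mk_eq_zero _).2 ⟨v, Subtype.ext hv.symm⟩
  · intro b
    obtain ⟨y, rfl⟩ := Submodule.Quotient.mk_surjective _ b
    obtain ⟨x, w, hx, hy⟩ := hs y.1 y.2
    refine ⟨Submodule.Quotient.mk ⟨x, hx⟩, (hH _).trans ?_⟩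
    refine ((Submodule.Quotient.eq _).2 ⟨-w, Subtype.ext ?_⟩)
    refine (map_neg S₂.f.hom w).trans ?_
    refine Eq.trans ?_ (congrArg (· - y.1) (hK ⟨x, hx⟩)).symm
    rw [hy]
    exact (sub_add_cancel_left _ _).symm

namespace ConnDBGL

/-- The cycles of a DBGL. -/
def IsCycle (A : ConnDBGL.{u}) : ∀ {p s : ℕ}, A.V p s → Prop := fun {p s} => match p with
  | 0 => fun _ => True
  | p + 1 => fun x => A.d p s x = 0

theorem complex_d (A : ConnDBGL.{u}) (p s : ℕ) :
    (A.complex s).d (p + 1) p = ModuleCat.ofHom (A.d p s) := by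
  simp only [complex, ChainComplex.of_d]

theorem quasiIso_complexMap {A B : ConnDBGL.{u}} (f : A ⟶ B) (s : ℕ)
    (hs : ∀ (p : ℕ) (y : B.V p s), B.IsCycle y →
      ∃ x w, A.IsCycle x ∧ y = (Hom.toHom f).map p s x + B.d p s w)
    (hi : ∀ (p : ℕ) (x : A.V p s) (w : B.V (p + 1) s), A.IsCycle x →
      (Hom.toHom f).map p s x = B.d p s w → ∃ v, x = A.d p s v) :
    QuasiIso (complexMap f s) := by
  refine ⟨fun p => ?_⟩
  -- The index `k` after `p` is kept abstract: it is `p - 1` for positive `p`, while for `p = 0` it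
  -- is `0` and the differential there is zero.
  have key : ∀ (k : ℕ) (hk : (ComplexShape.down ℕ).next p = k)
      (hA : ∀ x : A.V p s, (A.complex s).d p k x = 0 ↔ A.IsCycle x)
      (hB : ∀ x : B.V p s, (B.complex s).d p k x = 0 ↔ B.IsCycle x),
      QuasiIsoAt (complexMap f s) p := by
    intro k hk hA hB
    rw [quasiIsoAt_iff' _ (p + 1) p k (by simp) hk]
    refine ShortComplex.quasiIso_of_elements _ (fun y hy => ?_) fun x w hx h => ?_
    · obtain ⟨x, w, hx, h⟩ := hs p y ((hB y).1 hy)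
      refine ⟨x, w, (hA x).2 hx, h.trans (congrArg (_ + ·) ?_)⟩
      exact (ConcreteCategory.congr_hom (B.complex_d p s) w).symm
    · obtain ⟨v, hv⟩ := hi p x w ((hA x).1 hx)
        (h.trans (ConcreteCategory.congr_hom (B.complex_d p s) w))
      exact ⟨v, hv.trans (ConcreteCategory.congr_hom (A.complex_d p s) v).symm⟩
  rcases p with _ | p
  · refine key 0 (by simp) (fun x => ?_) fun x => ?_
    all_goals
      refine ⟨fun _ => trivial, fun _ => ?_⟩
      rw [HomologicalComplex.shape _ _ _ (by simp)]
      rfl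
  · refine key p (by simp) (fun x => ?_) fun x => ?_
    all_goals rw [complex_d]; rfl

end ConnDBGL

/-! ### Replacing chains by Moore chains -/

namespace SMod

variable (B : SMod.{u})

/-- The Dold–Kan projector `P` is a chain map with values in Moore chains and fixes those of the
relevant dimensions; apply it to `u`. -/
theorem exists_isMoore_d_eq {n : ℕ} (u : B.X (n + 1)) (hu : B.IsMoore (B.d n u)) :
    ∃ u', B.IsMoore u' ∧ B.d n u' = B.d n u := by
  let P := AlgebraicTopology.DoldKan.P (X := B.toSimplicial) (n + 2)
  have hd : ∀ x : B.X (n + 1),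
      ((AlgebraicTopology.AlternatingFaceMapComplex.obj B.toSimplicial).d (n + 1) n) x =
        B.d n x := fun x => by
    rw [AlgebraicTopology.AlternatingFaceMapComplex.obj_d_eq]
    exact B.objD_apply x
  have hP : P.f n (B.d n u) = B.d n u := by
    rcases n with _ | n
    · exact ConcreteCategory.congr_hom
        (AlgebraicTopology.DoldKan.P_f_0_eq (X := B.toSimplicial) (0 + 2)) _
    · let i : ModuleCat.of ℚ (Submodule.span ℚ {B.d (n + 1) u}) ⟶ B.toSimplicial _⦋n + 1⦌ :=
        ModuleCat.ofHom (Submodule.subtype _)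
      have hv : AlgebraicTopology.DoldKan.HigherFacesVanish (n + 1 + 2) i := fun j _ => by
        ext ⟨x, hx⟩
        obtain ⟨c, rfl⟩ := Submodule.mem_span_singleton.1 hx
        change B.act _ (c • B.d (n + 1) u) = 0
        rw [map_smul]
        exact (congrArg (c • ·) ((B.isMoore_succ_iff _).1 hu j)).trans (smul_zero c)
      exact ConcreteCategory.congr_hom hv.comp_P_eq_self
        (⟨_, Submodule.mem_span_singleton_self _⟩ : Submodule.span ℚ {B.d (n + 1) u})
  refine ⟨P.f (n + 1) u, ?_, ?_⟩
  · refine (B.isMoore_succ_iff _).2 fun j => ?_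
    exact ConcreteCategory.congr_hom
      (AlgebraicTopology.DoldKan.HigherFacesVanish.of_P (X := B.toSimplicial) (n + 2) n j
        (by omega)) u
  · have h := ConcreteCategory.congr_hom (P.comm (n + 1) n) u
    refine (hd _).symm.trans (h.trans ?_)
    exact (congrArg (P.f n) (hd u)).trans hP

theorem IsMoore.d_eq {B : SMod.{u}} {n : ℕ} {x : B.X (n + 1)} (hx : B.IsMoore x) :
    B.d n x = B.act (SimplexCategory.δ 0) x := by
  rw [d_apply, Fin.sum_univ_succ, Finset.sum_eq_zero fun i _ => by
    rw [(B.isMoore_succ_iff x).1 hx i, smul_zero]]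
  simp

end SMod

/-! ### The unit on free DBGLs -/

namespace ConnDBGL

variable {A : ConnDBGL.{u}} {Y : Type u} {dp ds : Y → ℕ} {ι : ∀ y, A.V (dp y) (ds y)} 

theorem coe_mooreDBGL_d {L : SConnGrLie.{u}} {p s : ℕ} (x : L.moore (p + 1) s) :
    (L.smod s).d p x.1 = (-1 : ℚ) ^ s • (L.mooreDBGL.d p s x : L.moore p s).1 := by
  refine (SMod.IsMoore.d_eq ((L.mem_moore_iff _).1 x.2)).trans ?_
  refine Eq.trans ?_ (congrArg (_ • ·) (L.coe_mooreD x)).symm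
  rw [smul_smul, SConnGrLie.neg_one_pow_mul_self, one_smul]
  rfl

/-- A cycle is a unit image plus a boundary, and injectivity of the unit makes the preimage a cycle.
If the image of `x` bounds `u`, then `u` is itself a unit image plus a boundary, and injectivity
shows that `x` bounds in `A`. -/
theorem nstarUnit_quasiIso (hA : A.toConnBigrLie.FreeOn dp ds ι) (s : ℕ) :
    QuasiIso (complexMap A.nstarUnit s) := by
  refine quasiIso_complexMap _ s (fun p y hy => ?_) fun p x w hx h => ?_
  · have hdy : ∀ {q : ℕ} (y : A.nstarObj.moore (q + 1) s), A.nstarObj.mooreDBGL.IsCycle (p := q + 1)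
        y → (A.nstarObj.smod s).d q y.1 = 0 := fun y hy => by
      refine (coe_mooreDBGL_d y).trans ?_
      have : A.nstarObj.mooreDBGL.d _ s y = 0 := hy
      rw [this]
      exact smul_zero _
    have hy' : IsUnitCycle s (A := A) (n := p) y.1 := by
      rcases p with _ | p
      · trivial
      · exact ⟨0, (hdy y hy).trans (map_zero _).symm⟩
    obtain ⟨r, hr⟩ := SMod.exists_mem_lowerSpan (toWords hA p s y.1)
    obtain ⟨b, v, hv⟩ := exists_eq_unit_add_d hA r y.1 hr hy'
    have hv' : (A.nstarObj.smod s).d p v = (y - (Hom.toHom A.nstarUnit).map p s b :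
        A.nstarObj.moore p s).1 :=
      (sub_eq_of_eq_add' hv).symm
    obtain ⟨u, hu, huv⟩ := (A.nstarObj.smod s).exists_isMoore_d_eq v
      (by rw [hv']; exact (A.nstarObj.mem_moore_iff _).1 (Subtype.prop _))
    refine ⟨b, (-1 : ℚ) ^ s • (⟨u, (A.nstarObj.mem_moore_iff _).2 hu⟩ :
      A.nstarObj.moore (p + 1) s), ?_, Subtype.ext ?_⟩
    · rcases p with _ | p
      · trivial
      · refine unit_injective hA ?_
        have h1 := congrArg ((A.nstarObj.smod s).d p) hv
        rw [hdy y hy, map_add, SMod.d_d, add_zero, d_nstarRep] at h1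
        exact (smul_eq_zero.1 h1.symm).resolve_left (pow_ne_zero _ (by norm_num))
    · refine hv.trans ?_
      rw [← huv]
      have h1 := coe_mooreDBGL_d (L := A.nstarObj) (p := p) (s := s)
        ⟨u, (A.nstarObj.mem_moore_iff _).2 hu⟩
      exact congrArg (_ + ·) (h1.trans
        (congrArg Subtype.val (map_smul (A.nstarObj.mooreDBGL.d p s) _ _)).symm)
  · have h1 : (A.nstarRep ⦋p⦌).g s (𝟙 _) x =
        (A.nstarObj.smod s).d p ((-1 : ℚ) ^ s • (w : A.nstarObj.moore (p + 1) s).1) := by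
      refine (congrArg Subtype.val h).trans (Eq.trans ?_
        (map_smul ((A.nstarObj.smod s).d p) _ _).symm)
      refine Eq.trans ?_ (congrArg ((-1 : ℚ) ^ s • ·) (coe_mooreDBGL_d (L := A.nstarObj) w)).symm
      refine Eq.trans ?_ (smul_smul _ _ _).symm
      rw [SConnGrLie.neg_one_pow_mul_self]
      exact (one_smul _ _).symm
    generalize (-1 : ℚ) ^ s • (w : A.nstarObj.moore (p + 1) s).1 = u at h1
    obtain ⟨r, hr⟩ := SMod.exists_mem_lowerSpan (toWords hA (p + 1) s u)
    obtain ⟨b, v, hv⟩ := exists_eq_unit_add_d hA r u hr ⟨x, h1.symm⟩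
    rw [hv, map_add, SMod.d_d, add_zero, d_nstarRep, ← map_smul, ← sub_eq_zero, ← map_sub] at h1
    refine ⟨(-1 : ℚ) ^ s • b, ?_⟩
    rw [map_smul]
    exact sub_eq_zero.1 (unit_injective hA h1)

theorem IsFree.nstarUnit_weakEquivalence (hA : A.IsFree) :
    ConnDBGL.weakEquivalences A.nstarUnit := fun s => by
  obtain ⟨Y, dp, ds, ι, h⟩ := hA.exists_freeOn
  exact nstarUnit_quasiIso h s

end ConnDBGL

/-! ### Comparison of the two normalized complexes -/

section

open AlgebraicTopology AlgebraicTopology.NormalizedMooreComplex Subobject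

variable (X : SimplicialObject (ModuleCat.{u} ℚ))

theorem objX_arrow_injective (p : ℕ) : Function.Injective (objX X p).arrow.hom :=
  (ModuleCat.mono_iff_injective _).1 inferInstance

theorem mem_range_objX_zero_arrow (x : X _⦋0⦌) :
    x ∈ LinearMap.range (objX X 0).arrow.hom :=
  ⟨inv (⊤ : Subobject (X _⦋0⦌)).arrow x,
    ConcreteCategory.congr_hom (IsIso.inv_hom_id (⊤ : Subobject (X _⦋0⦌)).arrow) x⟩

/-- The subobject is a finite infimum of kernels. An element killed by these faces spans a line
whose inclusion factors through each kernel, hence through the infimum. -/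
theorem mem_range_objX_succ_arrow {p : ℕ} (x : X _⦋p + 1⦌) :
    x ∈ LinearMap.range (objX X (p + 1)).arrow.hom ↔
      ∀ i : Fin (p + 1), X.δ i.succ x = 0 := by
  constructor
  · rintro ⟨y, rfl⟩ i
    have h : (objX X (p + 1)).arrow ≫ X.δ i.succ = 0 := by
      dsimp only [objX]
      rw [← factorThru_arrow _ _ (finset_inf_arrow_factors Finset.univ _ i (by simp)),
        Category.assoc, Limits.kernelSubobject_arrow_comp, Limits.comp_zero]
      rfl
    exact ConcreteCategory.congr_hom h y
  · intro h
    let φ : ModuleCat.of ℚ (Submodule.span ℚ {x}) ⟶ X _⦋p + 1⦌ :=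
      ModuleCat.ofHom (Submodule.subtype _)
    have hφ : (objX X (p + 1)).Factors φ := by
      refine (finset_inf_factors _).mpr fun i _ => Limits.kernelSubobject_factors _ _ ?_
      ext ⟨z, hz⟩
      obtain ⟨c, rfl⟩ := Submodule.mem_span_singleton.1 hz
      refine (map_smul (X.δ i.succ).hom c x).trans ?_
      exact (congrArg (c • ·) (h i)).trans (smul_zero c)
    exact ⟨factorThru _ φ hφ ⟨x, Submodule.mem_span_singleton_self _⟩,
      ConcreteCategory.congr_hom (factorThru_arrow _ φ hφ) _⟩

theorem objD_arrow (p : ℕ) :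
    NormalizedMooreComplex.objD X p ≫ (objX X p).arrow = (objX X (p + 1)).arrow ≫ X.δ 0 := by
  rcases p with _ | p
  · simp [NormalizedMooreComplex.objD]
  · rw [NormalizedMooreComplex.objD]
    exact factorThru_arrow _ _ _

theorem normalizedMooreComplex_map_f_arrow {X Y : SimplicialObject (ModuleCat.{u} ℚ)} (f : X ⟶ Y)
    (p : ℕ) : ((normalizedMooreComplex (ModuleCat.{u} ℚ)).map f).f p ≫ (objX Y p).arrow =
      (objX X p).arrow ≫ f.app (op ⦋p⦌) := by
  simp only [normalizedMooreComplex_map, NormalizedMooreComplex.map_f]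
  exact factorThru_arrow _ _ _

end

namespace SConnGrLie

open AlgebraicTopology AlgebraicTopology.NormalizedMooreComplex

/-- The simplicial vector space of elements of degree `s`. -/
abbrev degreeObj (L : SConnGrLie.{u}) (s : ℕ) : SimplicialObject (ModuleCat.{u} ℚ) :=
  ((SimplicialObject.whiskering _ _).obj (ConnGrLie.degree s)).obj L

variable (L : SConnGrLie.{u})

/-- The inclusion of the Moore chains, in terms of subobjects. -/
def objXArrow (p s : ℕ) :
    (objX (L.degreeObj s) p : ModuleCat.{u} ℚ) →ₗ[ℚ] (L _⦋p⦌).V s :=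
  (objX (L.degreeObj s) p).arrow.hom

theorem range_objXArrow (p s : ℕ) : LinearMap.range (L.objXArrow p s) = L.moore p s := by
  ext x
  rcases p with _ | p
  · exact ⟨fun _ => trivial, fun _ => mem_range_objX_zero_arrow (L.degreeObj s) x⟩
  · refine (mem_range_objX_succ_arrow (L.degreeObj s) x).trans ?_
    exact (Submodule.mem_iInf (M := (L _⦋p + 1⦌).V s) (R := ℚ)
      (p := fun i : Fin (p + 1) => LinearMap.ker (L.face (p := p) i.succ s))).symm

/-- The Moore chains, as a subobject. -/
def mooreEquiv (p s : ℕ) : L.moore p s ≃ₗ[ℚ] (objX (L.degreeObj s) p : ModuleCat.{u} ℚ) :=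
  ((LinearEquiv.ofInjective (L.objXArrow p s) (objX_arrow_injective _ p)).trans
    (LinearEquiv.ofEq _ _ (L.range_objXArrow p s))).symm ≪≫ₗ
    LinearEquiv.smulOfNeZero ℚ _ ((-1 : ℚ) ^ (s * p)) (pow_ne_zero _ (by norm_num))

/-- The rescaling by `(-1)^(s p)` absorbs the sign `(-1)^s` by which the two differentials differ.
-/
theorem objXArrow_mooreEquiv {p s : ℕ} (x : L.moore p s) :
    L.objXArrow p s (L.mooreEquiv p s x) = (-1 : ℚ) ^ (s * p) • x.1 := by
  let e : (objX (L.degreeObj s) p : ModuleCat.{u} ℚ) ≃ₗ[ℚ] L.moore p s :=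
    (LinearEquiv.ofInjective (L.objXArrow p s) (objX_arrow_injective _ p)).trans
      (LinearEquiv.ofEq _ _ (L.range_objXArrow p s))
  have h : L.objXArrow p s (e.symm x) = x.1 := congrArg Subtype.val (e.apply_symm_apply x)
  refine (map_smul (L.objXArrow p s) ((-1 : ℚ) ^ (s * p)) (e.symm x)).trans ?_
  rw [h]

/-- The two definitions of the Moore complex agree up to signs. -/
def mooreComplexIso (s : ℕ) :
    L.mooreDBGL.complex s ≅ (normalizedMooreComplex (ModuleCat.{u} ℚ)).obj (L.degreeObj s) :=
  HomologicalComplex.Hom.isoOfComponents (fun p => (L.mooreEquiv p s).toModuleIso) (by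
    rintro _ p rfl
    rw [normalizedMooreComplex_objD, ConnDBGL.complex_d]
    ext x
    refine objX_arrow_injective _ p ?_
    refine (ConcreteCategory.congr_hom (objD_arrow (L.degreeObj s) p) _).trans ?_
    refine Eq.trans ?_ (L.objXArrow_mooreEquiv _).symm
    refine (congrArg (L.face 0 s) (L.objXArrow_mooreEquiv x)).trans ?_
    rw [map_smul]
    refine Eq.trans ?_ (congrArg (_ • ·) (L.coe_mooreD x)).symm
    rw [smul_smul, ← pow_add, mul_add, mul_one])

variable {L}

theorem mooreComplexIso_naturality {M : SConnGrLie.{u}} (f : L ⟶ M) (s : ℕ) :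
    ConnDBGL.complexMap (mooreFunctor.map f) s ≫ (M.mooreComplexIso s).hom =
      (L.mooreComplexIso s).hom ≫ (normalizedMooreComplex (ModuleCat.{u} ℚ)).map
        (((SimplicialObject.whiskering _ _).obj (ConnGrLie.degree s)).map f) := by
  ext p x
  refine objX_arrow_injective _ p ?_
  refine (M.objXArrow_mooreEquiv _).trans ?_
  refine Eq.trans ?_ (ConcreteCategory.congr_hom (normalizedMooreComplex_map_f_arrow
    (((SimplicialObject.whiskering _ _).obj (ConnGrLie.degree s)).map f) p) _).symm
  refine Eq.trans ?_ (congrArg (ConnGrLie.Hom.map (f.app (op ⦋p⦌)) s)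
    (L.objXArrow_mooreEquiv x)).symm
  exact (map_smul (ConnGrLie.Hom.map (f.app (op ⦋p⦌)) s) _ _).symm

theorem weakEquivalences_iff {L M : SConnGrLie.{u}} (f : L ⟶ M) :
    ConnDBGL.weakEquivalences (mooreFunctor.map f) ↔ SConnGrLie.weakEquivalences f :=
  forall_congr' fun s => quasiIso_iff_of_arrow_mk_iso _ _
    (Arrow.isoMk (L.mooreComplexIso s) (M.mooreComplexIso s) (mooreComplexIso_naturality f s).symm)

end SConnGrLie

namespace ConnDBGL

theorem complexMap_comp {A B C : ConnDBGL.{u}} (f : A ⟶ B) (g : B ⟶ C) (s : ℕ) :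
    complexMap (f ≫ g) s = complexMap f s ≫ complexMap g s := by
  ext p : 1
  rfl

instance : ConnDBGL.weakEquivalences.{u}.HasTwoOutOfThreeProperty where
  comp_mem f g hf hg s := by
    have := hf s
    have := hg s
    rw [complexMap_comp]
    infer_instance
  of_postcomp f g hg hfg s := by
    have := hg s
    have := hfg s
    rw [complexMap_comp] at this
    exact quasiIso_of_comp_right (complexMap f s) (complexMap g s)
  of_precomp f g hf hfg s := by
    have := hf s
    have := hfg s
    rw [complexMap_comp] at this
    exact quasiIso_of_comp_left (complexMap f s) (complexMap g s)

end ConnDBGL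

/-! ### The square-zero extension classifying derivations -/

namespace GrLie

variable {I : Type} [AddCommMonoid I] [DecidableEq I] {ε : I →+ ℕ} (L : GrLie.{u} I ε)

/-- The second component of the bracket of `derExt`. -/
def derBr {p q : I} : (L.V p × L.Tot) →ₗ[ℚ] (L.V q × L.Tot) →ₗ[ℚ] L.Tot :=
  LinearMap.mk₂ ℚ
    (fun x y => (-1 : ℚ) ^ ε p • ad x.1 y.2 - (-1 : ℚ) ^ ((ε p + 1) * ε q) • ad y.1 x.2)
    (fun x x' y => by
      simp only [Prod.fst_add, Prod.snd_add, ad_add, LinearMap.add_apply, map_add]; module)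
    (fun c x y => by
      simp only [Prod.smul_fst, Prod.smul_snd, ad_smul, LinearMap.smul_apply, map_smul]; module)
    (fun x y y' => by
      simp only [Prod.fst_add, Prod.snd_add, ad_add, LinearMap.add_apply, map_add]; module)
    (fun c x y => by
      simp only [Prod.smul_fst, Prod.smul_snd, ad_smul, LinearMap.smul_apply, map_smul]; module)

/-- If the second components are values of an operator lowering the degree by one, skew symmetry
rewrites the second summand as the bracket of `∂x` with `y`. The formula is then the Leibniz rule.
-/
theorem derBr_apply {p q : I} (x : L.V p × L.Tot) (y : L.V q × L.Tot) :
    L.derBr x y =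
      (-1 : ℚ) ^ ε p • ad x.1 y.2 - (-1 : ℚ) ^ ((ε p + 1) * ε q) • ad y.1 x.2 := rfl

/-- The square-zero extension of a graded Lie algebra by its total space: its sections are the
derivations of odd degree. -/
abbrev derExt : GrLie.{u} I ε where
  V i := L.V i × L.Tot
  br h := LinearMap.mk₂ ℚ (fun x y => (L.br h x.1 y.1, L.derBr x y))
    (fun x x' y => Prod.ext (LinearMap.map_add₂ _ _ _ _) (LinearMap.map_add₂ _ _ _ _))
    (fun c x y => Prod.ext (LinearMap.map_smul₂ _ _ _ _) (LinearMap.map_smul₂ _ _ _ _))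
    (fun x y y' => Prod.ext (map_add (L.br h x.1) _ _) (map_add (L.derBr x) _ _))
    (fun c x y => Prod.ext (map_smul (L.br h x.1) _ _) (map_smul (L.derBr x) _ _))
  skew {p q n} h h' x y := Prod.ext (L.skew h h' x.1 y.1) (by
    change L.derBr x y = (-1 : ℚ) ^ (ε p * ε q + 1) • L.derBr y x
    rw [derBr_apply, derBr_apply]
    rcases Nat.even_or_odd (ε p) with hp | hp <;> rcases Nat.even_or_odd (ε q) with hq | hq <;>
      simp [pow_add, pow_mul, add_mul, hp.neg_one_pow, hq.neg_one_pow] <;> abel)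
  jacobi {p q r n} h₁ h₂ h₃ x y z := Prod.ext (L.jacobi h₁ h₂ h₃ x.1 y.1 z.1) (by
    change (-1 : ℚ) ^ (ε p * ε r) • L.derBr (L.br rfl x.1 y.1, L.derBr x y) z
      + (-1 : ℚ) ^ (ε q * ε p) • L.derBr (L.br rfl y.1 z.1, L.derBr y z) x
      + (-1 : ℚ) ^ (ε r * ε q) • L.derBr (L.br rfl z.1 x.1, L.derBr z x) y = 0
    simp only [derBr_apply, ad_br, map_sub, map_smul, map_add]
    rcases Nat.even_or_odd (ε p) with hp | hp <;> rcases Nat.even_or_odd (ε q) with hq | hq <;>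
      rcases Nat.even_or_odd (ε r) with hr | hr <;>
      simp [pow_add, pow_mul, add_mul, hp.neg_one_pow, hq.neg_one_pow, hr.neg_one_pow] <;> abel)

end GrLie

/-! ### Differentials on the total space -/

namespace GrLie

variable {L M : GrLie.{u} (ℕ × ℕ) totalDegree}

/-- The map of total spaces induced by a family of linear maps. -/
def totMap (f : ∀ i, L.V i →ₗ[ℚ] M.V i) : L.Tot →ₗ[ℚ] M.Tot :=
  DirectSum.toModule ℚ (ℕ × ℕ) M.Tot fun i => DirectSum.lof ℚ (ℕ × ℕ) M.V i ∘ₗ f i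

theorem totMap_lof (f : ∀ i, L.V i →ₗ[ℚ] M.V i) (i : ℕ × ℕ) (x : L.V i) :
    totMap f (DirectSum.lof ℚ (ℕ × ℕ) L.V i x) = DirectSum.lof ℚ (ℕ × ℕ) M.V i (f i x) :=
  DirectSum.toModule_lof ℚ i x

theorem totMap_ad (f : ∀ i, L.V i →ₗ[ℚ] M.V i)
    (hf : ∀ {p q n : ℕ × ℕ} (h : p + q = n) (x : L.V p) (y : L.V q),
      f n (L.br h x y) = M.br h (f p x) (f q y)) {p : ℕ × ℕ} (x : L.V p) (u : L.Tot) :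
    totMap f (ad x u) = ad (f p x) (totMap f u) := by
  refine LinearMap.congr_fun (f := totMap f ∘ₗ ad x) (g := ad (f p x) ∘ₗ totMap f)
    (tot_hom_ext fun q y => ?_) u
  rw [LinearMap.comp_apply, LinearMap.comp_apply, ad_lof rfl, totMap_lof, totMap_lof,
    ad_lof rfl, hf]

/-- The elements of the total space of bidegree `i - (1, 0)`. -/
def predSub (L : GrLie.{u} (ℕ × ℕ) totalDegree) (i : ℕ × ℕ) : Submodule ℚ L.Tot :=
  ⨆ j : {j : ℕ × ℕ // (j.1 + 1, j.2) = i},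
    LinearMap.range (DirectSum.lof ℚ (ℕ × ℕ) L.V j.1)

theorem lof_mem_predSub (p s : ℕ) (x : L.V (p, s)) :
    DirectSum.lof ℚ (ℕ × ℕ) L.V (p, s) x ∈ L.predSub (p + 1, s) :=
  Submodule.mem_iSup_of_mem ⟨(p, s), rfl⟩ ⟨x, rfl⟩

theorem predSub_induction {i : ℕ × ℕ} {C : Submodule ℚ L.Tot}
    (h : ∀ (p s : ℕ) (_ : (p + 1, s) = i) (x : L.V (p, s)),
      DirectSum.lof ℚ (ℕ × ℕ) L.V (p, s) x ∈ C) : L.predSub i ≤ C :=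
  iSup_le fun j => by
    rintro _ ⟨x, rfl⟩
    exact h j.1.1 j.1.2 j.2 x

theorem eq_zero_of_mem_predSub {s : ℕ} {u : L.Tot} (hu : u ∈ L.predSub (0, s)) : u = 0 :=
  (Submodule.mem_bot ℚ).1 (predSub_induction (C := ⊥)
    (fun _ _ h _ => absurd (congrArg Prod.fst h) (Nat.succ_ne_zero _)) hu)

theorem exists_of_mem_predSub {p s : ℕ} {u : L.Tot} (hu : u ∈ L.predSub (p + 1, s)) :
    ∃ x, DirectSum.lof ℚ (ℕ × ℕ) L.V (p, s) x = u :=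
  predSub_induction (C := LinearMap.range (DirectSum.lof ℚ (ℕ × ℕ) L.V (p, s)))
    (fun q t h x => by
      obtain ⟨h1, rfl⟩ := Prod.ext_iff.1 h
      obtain rfl : q = p := Nat.succ_injective h1
      exact ⟨x, rfl⟩) hu

theorem ad_mem_predSub {p q n : ℕ × ℕ} (h : p + q = n) (x : L.V p) {u : L.Tot}
    (hu : u ∈ L.predSub q) : ad x u ∈ L.predSub n :=
  predSub_induction (C := (L.predSub n).comap (ad x)) (fun k t hk y => by
    have h1 : p + (k, t) = (p.1 + k, p.2 + t) := rfl
    rw [Submodule.mem_comap, ad_lof h1]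
    have h2 : n = (p.1 + k + 1, p.2 + t) := by rw [← h, ← hk]; rfl
    rw [h2]
    exact lof_mem_predSub _ _ _) hu

theorem neg_ad_lof {p s : ℕ} {q n : ℕ × ℕ} (h : (p, s) + q = n) (x : L.V (p, s)) (y : L.V q) :
    -((-1 : ℚ) ^ ((totalDegree (p + 1, s) + 1) * totalDegree q) •
      ad y (DirectSum.lof ℚ (ℕ × ℕ) L.V (p, s) x)) =
    DirectSum.lof ℚ (ℕ × ℕ) L.V n (L.br h x y) := by
  rw [L.skew h ((add_comm _ _).trans h), map_smul, ad_lof ((add_comm _ _).trans h), ← neg_smul]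
  refine congrArg (· • _) ?_
  have e : totalDegree (p + 1, s) + 1 = totalDegree (p, s) + 2 := by
    change p + 1 + s + 1 = p + s + 2
    omega
  rw [e, add_mul, pow_add, pow_mul _ 2, pow_succ]
  norm_num [pow_succ]

theorem derBr_lof {p s q t : ℕ} {n : ℕ × ℕ} (h₁ : (p, s) + (q + 1, t) = n)
    (h₂ : (p + 1, s) + (q, t) = n) (x : L.V (p + 1, s)) (dx : L.V (p, s))
    (y : L.V (q + 1, t)) (dy : L.V (q, t)) :
    L.derBr (x, DirectSum.lof ℚ (ℕ × ℕ) L.V (p, s) dx)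
        (y, DirectSum.lof ℚ (ℕ × ℕ) L.V (q, t) dy) =
      DirectSum.lof ℚ (ℕ × ℕ) L.V n (L.br h₁ dx y + (-1 : ℚ) ^ (p + 1 + s) • L.br h₂ x dy) := by
  rw [derBr_apply, sub_eq_add_neg, neg_ad_lof h₁, ad_lof h₂, map_add, map_smul, add_comm]
  rfl

theorem derBr_zero_right {p s t : ℕ} {n : ℕ × ℕ} (h₁ : (p, s) + (0, t) = n)
    (x : L.V (p + 1, s)) (dx : L.V (p, s)) (y : L.V (0, t)) :
    L.derBr (x, DirectSum.lof ℚ (ℕ × ℕ) L.V (p, s) dx) (y, 0) =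
      DirectSum.lof ℚ (ℕ × ℕ) L.V n (L.br h₁ dx y) := by
  rw [derBr_apply, sub_eq_add_neg, neg_ad_lof h₁, map_zero, smul_zero, zero_add]

theorem derBr_zero_left {s q t : ℕ} {n : ℕ × ℕ} (h₂ : (0, s) + (q, t) = n)
    (x : L.V (0, s)) (y : L.V (q + 1, t)) (dy : L.V (q, t)) :
    L.derBr (x, 0) (y, DirectSum.lof ℚ (ℕ × ℕ) L.V (q, t) dy) =
      DirectSum.lof ℚ (ℕ × ℕ) L.V n ((-1 : ℚ) ^ s • L.br h₂ x dy) := by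
  rw [derBr_apply, map_zero, smul_zero, sub_zero, ad_lof h₂, map_smul]
  exact congrArg (fun a => (-1 : ℚ) ^ a • _) (Nat.zero_add s)

theorem totMap_derBr (f : ∀ i, L.V i →ₗ[ℚ] M.V i)
    (hf : ∀ {p q n : ℕ × ℕ} (h : p + q = n) (x : L.V p) (y : L.V q),
      f n (L.br h x y) = M.br h (f p x) (f q y)) {p q : ℕ × ℕ} (x : L.V p × L.Tot)
    (y : L.V q × L.Tot) :
    totMap f (L.derBr x y) = M.derBr (f p x.1, totMap f x.2) (f q y.1, totMap f y.2) := by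
  rw [derBr_apply, derBr_apply, map_sub, map_smul, map_smul, totMap_ad f hf, totMap_ad f hf]

end GrLie

namespace ConnDBGL

open GrLie

/-- The differential of a DBGL, with values in the total space. -/
def dTot (A : ConnDBGL.{u}) (i : ℕ × ℕ) : A.V i.1 i.2 →ₗ[ℚ] A.toGrLie.Tot :=
  match i with
  | (0, _) => 0
  | (p + 1, s) => DirectSum.lof ℚ (ℕ × ℕ) A.toGrLie.V (p, s) ∘ₗ A.d p s

variable {A B : ConnDBGL.{u}}

theorem dTot_zero (s : ℕ) (a : A.V 0 s) : A.dTot (0, s) a = 0 := rfl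

theorem dTot_succ (p s : ℕ) (a : A.V (p + 1) s) :
    A.dTot (p + 1, s) a = DirectSum.lof ℚ (ℕ × ℕ) A.toGrLie.V (p, s) (A.d p s a) := rfl

/-- With values in the total space, and zero in homological degree `0`, the three forms of the
Leibniz rule become one statement. -/
theorem dTot_br_aux {p q n s t m : ℕ} (h : p + q = n) (k : s + t = m) (x : A.V p s)
    (y : A.V q t) :
    A.dTot (n, m) (A.br h k x y) =
      A.toGrLie.derBr (p := (p, s)) (q := (q, t)) (x, A.dTot (p, s) x) (y, A.dTot (q, t) y) := by
  rcases p with _ | p <;> rcases q with _ | q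
  · obtain rfl : n = 0 := h.symm
    rw [dTot_zero, dTot_zero, dTot_zero, derBr_apply, map_zero, map_zero, smul_zero, smul_zero,
      sub_zero]
  · obtain ⟨n, rfl⟩ : ∃ n', n = n' + 1 := ⟨n - 1, by omega⟩
    rw [dTot_succ, A.leibniz_left_zero h (by omega) k]
    exact (derBr_zero_left (L := A.toGrLie) (Prod.ext (by omega : 0 + q = n) k) _ _ _).symm
  · obtain ⟨n, rfl⟩ : ∃ n', n = n' + 1 := ⟨n - 1, by omega⟩
    rw [dTot_succ, A.leibniz_right_zero h (by omega) k]
    exact (derBr_zero_right (L := A.toGrLie) (Prod.ext (by omega : p + 0 = n) k) _ _ _).symm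
  · obtain ⟨n, rfl⟩ : ∃ n', n = n' + 1 := ⟨n - 1, by omega⟩
    rw [dTot_succ, A.leibniz h (by omega) (by omega) k]
    exact (derBr_lof (L := A.toGrLie) (Prod.ext (by omega : p + (q + 1) = n) k)
      (Prod.ext (by omega : p + 1 + q = n) k) _ _ _ _).symm

theorem dTot_br {p q n : ℕ × ℕ} (h : p + q = n) (x : A.V p.1 p.2) (y : A.V q.1 q.2) :
    A.dTot n (A.toGrLie.br h x y) = A.toGrLie.derBr (x, A.dTot p x) (y, A.dTot q y) :=
  dTot_br_aux (congrArg Prod.fst h) (congrArg Prod.snd h) x y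

theorem totMap_dTot (f : A ⟶ B) {i : ℕ × ℕ} (a : A.V i.1 i.2) :
    totMap (L := A.toGrLie) (M := B.toGrLie) (fun i => (Hom.toHom f).map i.1 i.2) (A.dTot i a) =
      B.dTot i ((Hom.toHom f).map i.1 i.2 a) := by
  obtain ⟨_ | p, s⟩ := i
  · rfl
  · refine (totMap_lof (L := A.toGrLie) (M := B.toGrLie) _ (p, s) _).trans ?_
    exact congrArg _ (Hom.map_d f p s a)

end ConnDBGL

/-! ### A functorial free resolution -/

namespace ConnDBGL

open GrLie

/-- The indexing type of the operator raising the homological degree by one. -/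
abbrev ResOp (i j : ℕ × ℕ) : Type := PLift (j = (i.1 + 1, i.2))

/-- The models in which the generators depend linearly on the elements of `A`. -/
def IsResModel (A : ConnDBGL.{u})
    (M : OpLie.{u} totalDegree (fun i => A.V i.1 i.2) ResOp) : Prop :=
  ∀ i, ∃ g : A.V i.1 i.2 →ₗ[ℚ] M.V i, ∀ a, M.gen a = g a

/-- The bigraded Lie algebra freely generated by `A` and an operator of bidegree `(1, 0)`. -/
abbrev resLie (A : ConnDBGL.{u}) : GrLie.{u} (ℕ × ℕ) totalDegree :=
  (Universal.opLie (IsResModel A)).toGrLie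

variable {A B : ConnDBGL.{u}}

/-- The inclusion of the generators. -/
def resGen (A : ConnDBGL.{u}) (i : ℕ × ℕ) : A.V i.1 i.2 →ₗ[ℚ] A.resLie.V i where
  toFun a := (Universal.opLie (IsResModel A)).gen a
  map_add' a b := Universal.ext fun M hM => by
    obtain ⟨g, hg⟩ := hM i
    rw [map_add]
    exact (hg _).trans ((map_add g _ _).trans (congrArg₂ _ (hg _) (hg _)).symm)
  map_smul' c a := Universal.ext fun M hM => by
    obtain ⟨g, hg⟩ := hM i
    rw [map_smul]
    exact (hg _).trans ((map_smul g _ _).trans (congrArg _ (hg _)).symm)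

/-- The operator raising the homological degree. -/
def resOp (A : ConnDBGL.{u}) (i : ℕ × ℕ) : A.resLie.V i →ₗ[ℚ] A.resLie.V (i.1 + 1, i.2) :=
  (Universal.opLie (IsResModel A)).op ⟨rfl⟩

theorem res_induction {C : ∀ i, A.resLie.V i → Prop}
    (gen : ∀ i (a : A.V i.1 i.2), C i (A.resGen i a))
    (op : ∀ i x, C i x → C _ (A.resOp i x)) (zero : ∀ i, C i 0)
    (add : ∀ {i} (x y : A.resLie.V i), C i x → C i y → C i (x + y))
    (smul : ∀ {i} (c : ℚ) (x : A.resLie.V i), C i x → C i (c • x))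
    (br : ∀ {p q n : ℕ × ℕ} (h : p + q = n) (x : A.resLie.V p) (y : A.resLie.V q),
      C p x → C q y → C n (A.resLie.br h x y)) {i : ℕ × ℕ} (x : A.resLie.V i) : C i x :=
  Universal.induction (C := C) (fun {i} a => gen i a)
    (fun {i j} h x hx => by obtain ⟨rfl⟩ := h; exact op i x hx) zero add smul br x

theorem res_connected (p : ℕ) (x : A.resLie.V (p, 0)) : x = 0 := by
  have key : ∀ {i : ℕ × ℕ} (x : A.resLie.V i), i.2 = 0 → x = 0 := fun {i} x => by
    induction x using res_induction with
    | gen i a =>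
      rintro h
      obtain ⟨p, s⟩ := i
      obtain rfl : s = 0 := h
      rw [A.connected p a, map_zero]
    | op i x hx => exact fun h => by rw [hx h, map_zero]
    | zero i => exact fun _ => rfl
    | add x y hx hy => exact fun h => by rw [hx h, hy h, add_zero]
    | smul c x hx => exact fun h => by rw [hx h, smul_zero]
    | br h x y hx hy =>
      intro hn
      rw [hx (by rw [← h] at hn; exact (Nat.add_eq_zero_iff.1 hn).1), map_zero,
        LinearMap.zero_apply]
  exact key x rfl

/-! #### The augmentation -/

/-- The target of the augmentation, as a model. -/
def augModel (A : ConnDBGL.{u}) : OpLie.{u} totalDegree (fun i => A.V i.1 i.2) ResOp where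
  toGrLie := A.toGrLie
  gen a := a
  op _ := 0

theorem isResModel_augModel : IsResModel A A.augModel := fun _ => ⟨LinearMap.id, fun _ => rfl⟩

/-- The augmentation of the resolution. -/
def aug (A : ConnDBGL.{u}) (i : ℕ × ℕ) : A.resLie.V i →ₗ[ℚ] A.V i.1 i.2 :=
  Universal.eval A.augModel isResModel_augModel i

theorem aug_gen (i : ℕ × ℕ) (a : A.V i.1 i.2) : A.aug i (A.resGen i a) = a := rfl

theorem aug_op (i : ℕ × ℕ) (x : A.resLie.V i) : A.aug _ (A.resOp i x) = 0 :=
  Universal.eval_op _ isResModel_augModel _ x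

theorem aug_br {p q n : ℕ × ℕ} (h : p + q = n) (x : A.resLie.V p) (y : A.resLie.V q) :
    A.aug n (A.resLie.br h x y) = A.toGrLie.br h (A.aug p x) (A.aug q y) :=
  Universal.eval_br _ isResModel_augModel h x y

/-! #### The differential -/

/-- The operator raising the homological degree, on the total space. -/
def resOpTot (A : ConnDBGL.{u}) : A.resLie.Tot →ₗ[ℚ] A.resLie.Tot :=
  DirectSum.toModule ℚ (ℕ × ℕ) _ fun i => DirectSum.lof ℚ (ℕ × ℕ) A.resLie.V _ ∘ₗ A.resOp i

theorem resOpTot_lof (i : ℕ × ℕ) (x : A.resLie.V i) :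
    A.resOpTot (DirectSum.lof ℚ (ℕ × ℕ) A.resLie.V i x) =
      DirectSum.lof ℚ (ℕ × ℕ) A.resLie.V (i.1 + 1, i.2) (A.resOp i x) :=
  DirectSum.toModule_lof ℚ i x

/-- The inclusion of the generators, on the total spaces. -/
abbrev resGenTot (A : ConnDBGL.{u}) : A.toGrLie.Tot →ₗ[ℚ] A.resLie.Tot :=
  totMap (L := A.toGrLie) (M := A.resLie) A.resGen

/-- The augmentation, on the total spaces. -/
abbrev augTot (A : ConnDBGL.{u}) : A.resLie.Tot →ₗ[ℚ] A.toGrLie.Tot :=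
  totMap (L := A.resLie) (M := A.toGrLie) A.aug

/-- The model which determines the differential of the resolution. -/
def resDModel (A : ConnDBGL.{u}) : OpLie.{u} totalDegree (fun i => A.V i.1 i.2) ResOp where
  toGrLie := A.resLie.derExt
  gen {i} a := (A.resGen i a, A.resGenTot (A.dTot i a))
  -- The second component imposes `d (h x) = x - gen (aug x) - h (d x)`.
  op {i _} h := LinearMap.prod ((Universal.opLie (IsResModel A)).op h ∘ₗ LinearMap.fst ℚ _ _)
    ((DirectSum.lof ℚ (ℕ × ℕ) A.resLie.V i ∘ₗ (LinearMap.id - A.resGen i ∘ₗ A.aug i)).coprod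
      (-A.resOpTot))

theorem isResModel_resDModel : IsResModel A A.resDModel := fun i =>
  ⟨(A.resGen i).prod (A.resGenTot ∘ₗ A.dTot i), fun _ => rfl⟩

/-- The value in the model which determines the differential. -/
def resDEval (A : ConnDBGL.{u}) (i : ℕ × ℕ) : A.resLie.V i →ₗ[ℚ] A.resLie.V i × A.resLie.Tot :=
  Universal.eval A.resDModel isResModel_resDModel i

/-- The differential, with values in the total space. -/
def resDTot (A : ConnDBGL.{u}) (i : ℕ × ℕ) : A.resLie.V i →ₗ[ℚ] A.resLie.Tot :=
  LinearMap.snd ℚ _ _ ∘ₗ A.resDEval i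

theorem resDEval_op (i : ℕ × ℕ) (x : A.resLie.V i) :
    A.resDEval _ (A.resOp i x) = (A.resOp i (A.resDEval i x).1,
      DirectSum.lof ℚ (ℕ × ℕ) A.resLie.V i ((A.resDEval i x).1 -
        A.resGen i (A.aug i (A.resDEval i x).1)) + -A.resOpTot (A.resDEval i x).2) :=
  Universal.eval_op A.resDModel isResModel_resDModel _ x

theorem resDEval_br {p q n : ℕ × ℕ} (h : p + q = n) (x : A.resLie.V p) (y : A.resLie.V q) :
    A.resDEval n (A.resLie.br h x y) = (A.resLie.br h (A.resDEval p x).1 (A.resDEval q y).1,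
      A.resLie.derBr (A.resDEval p x) (A.resDEval q y)) :=
  Universal.eval_br A.resDModel isResModel_resDModel h x y

/-- The evaluation is a section of the square-zero extension, so its second component obeys the
Leibniz rule. -/
theorem fst_resDEval {i : ℕ × ℕ} (x : A.resLie.V i) : (A.resDEval i x).1 = x := by
  induction x using res_induction with
  | gen i a => rfl
  | op i x hx => exact (congrArg Prod.fst (resDEval_op i x)).trans (congrArg _ hx)
  | zero i => exact congrArg Prod.fst (map_zero (A.resDEval i))
  | add x y hx hy => rw [map_add, Prod.fst_add, hx, hy]
  | smul c x hx => rw [map_smul, Prod.smul_fst, hx]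
  | br h x y hx hy =>
    exact (congrArg Prod.fst (resDEval_br h x y)).trans
      (congrArg₂ (fun a b => A.resLie.br h a b) hx hy)

theorem resDTot_gen (i : ℕ × ℕ) (a : A.V i.1 i.2) :
    A.resDTot i (A.resGen i a) = A.resGenTot (A.dTot i a) := rfl

theorem resDTot_op (i : ℕ × ℕ) (x : A.resLie.V i) :
    A.resDTot _ (A.resOp i x) =
      DirectSum.lof ℚ (ℕ × ℕ) A.resLie.V i (x - A.resGen i (A.aug i x)) -
        A.resOpTot (A.resDTot i x) := by
  refine (congrArg Prod.snd (resDEval_op i x)).trans ?_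
  rw [fst_resDEval, ← sub_eq_add_neg]
  rfl

theorem resDTot_br {p q n : ℕ × ℕ} (h : p + q = n) (x : A.resLie.V p) (y : A.resLie.V q) :
    A.resDTot n (A.resLie.br h x y) = A.resLie.derBr (x, A.resDTot p x) (y, A.resDTot q y) := by
  refine (congrArg Prod.snd (resDEval_br h x y)).trans ?_
  exact congrArg₂ (fun a b => A.resLie.derBr a b) (Prod.ext (fst_resDEval x) rfl)
    (Prod.ext (fst_resDEval y) rfl)

/-- The extension contains the whole total space; this recovers the fact that the differential has
bidegree `(-1, 0)`. -/
theorem resDTot_mem_predSub {i : ℕ × ℕ} (x : A.resLie.V i) :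
    A.resDTot i x ∈ A.resLie.predSub i := by
  induction x using res_induction with
  | gen i a =>
    rw [resDTot_gen]
    obtain ⟨_ | p, s⟩ := i
    · rw [dTot_zero, map_zero]
      exact Submodule.zero_mem _
    · rw [dTot_succ, totMap_lof]
      exact lof_mem_predSub _ _ _
  | op i x hx =>
    rw [resDTot_op]
    refine Submodule.sub_mem _ (lof_mem_predSub _ _ _) ?_
    refine predSub_induction (C := (A.resLie.predSub _).comap A.resOpTot) (fun p s h z => ?_) hx
    subst h
    rw [Submodule.mem_comap, resOpTot_lof]
    exact lof_mem_predSub _ _ _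
  | zero i => rw [map_zero]; exact Submodule.zero_mem _
  | add x y hx hy => rw [map_add]; exact Submodule.add_mem _ hx hy
  | smul c x hx => rw [map_smul]; exact Submodule.smul_mem _ _ hx
  | br h x y hx hy =>
    rw [resDTot_br, derBr_apply]
    exact Submodule.sub_mem _ (Submodule.smul_mem _ _ (ad_mem_predSub h _ hy))
      (Submodule.smul_mem _ _ (ad_mem_predSub ((add_comm _ _).trans h) _ hx))

end ConnDBGL

/-! ### The differential of the resolution squares to zero -/

namespace ConnDBGL

open GrLie

variable {A B C : ConnDBGL.{u}}

theorem augTot_resGenTot (u : A.toGrLie.Tot) : A.augTot (A.resGenTot u) = u :=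
  LinearMap.congr_fun (f := A.augTot ∘ₗ A.resGenTot) (g := LinearMap.id)
    (tot_hom_ext fun i x => by
      rw [LinearMap.comp_apply, totMap_lof, totMap_lof, aug_gen]; rfl) u

theorem augTot_resOpTot (u : A.resLie.Tot) : A.augTot (A.resOpTot u) = 0 :=
  LinearMap.congr_fun (f := A.augTot ∘ₗ A.resOpTot) (g := 0)
    (tot_hom_ext fun i x => by
      rw [LinearMap.comp_apply, resOpTot_lof, totMap_lof, aug_op, map_zero]; rfl) u

theorem augTot_resDTot {i : ℕ × ℕ} (x : A.resLie.V i) :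
    A.augTot (A.resDTot i x) = A.dTot i (A.aug i x) := by
  induction x using res_induction with
  | gen i a => exact augTot_resGenTot _
  | op i x hx =>
    rw [resDTot_op, map_sub, augTot_resOpTot, aug_op, totMap_lof, map_sub, aug_gen, sub_self,
      map_zero, map_zero, sub_zero]
  | zero i => simp only [map_zero]
  | add x y hx hy => simp only [map_add, hx, hy]
  | smul c x hx => simp only [map_smul, hx]
  | br h x y hx hy =>
    rw [resDTot_br, aug_br, dTot_br, ← hx, ← hy]
    exact totMap_derBr (L := A.resLie) (M := A.toGrLie) A.aug aug_br _ _

/-- The differential on the total space. -/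
def resDDTot (A : ConnDBGL.{u}) : A.resLie.Tot →ₗ[ℚ] A.resLie.Tot :=
  DirectSum.toModule ℚ (ℕ × ℕ) _ A.resDTot

theorem resDDTot_lof {i : ℕ × ℕ} (x : A.resLie.V i) :
    A.resDDTot (DirectSum.lof ℚ (ℕ × ℕ) A.resLie.V i x) = A.resDTot i x :=
  DirectSum.toModule_lof ℚ i x

theorem resDDTot_resGenTot_dTot (i : ℕ × ℕ) (a : A.V i.1 i.2) :
    A.resDDTot (A.resGenTot (A.dTot i a)) = 0 := by
  obtain ⟨_ | _ | p, s⟩ := i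
  · rw [dTot_zero, map_zero, map_zero]
  · rw [dTot_succ, totMap_lof, resDDTot_lof, resDTot_gen, dTot_zero, map_zero]
  · rw [dTot_succ, totMap_lof, resDDTot_lof, resDTot_gen, dTot_succ, A.d_d, map_zero, map_zero]

theorem resDDTot_resOpTot (u : A.resLie.Tot) :
    A.resDDTot (A.resOpTot u) =
      u - A.resGenTot (A.augTot u) - A.resOpTot (A.resDDTot u) :=
  LinearMap.congr_fun (f := A.resDDTot ∘ₗ A.resOpTot)
    (g := LinearMap.id - A.resGenTot ∘ₗ A.augTot - A.resOpTot ∘ₗ A.resDDTot)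
    (tot_hom_ext fun i x => by
      simp only [LinearMap.comp_apply, LinearMap.sub_apply, LinearMap.id_apply]
      rw [resOpTot_lof, resDDTot_lof, resDDTot_lof, resDTot_op, totMap_lof, totMap_lof,
        map_sub]) u

/-- The square of an odd derivation: the two mixed terms cancel, and the others contain a second
differential. Homological degree `0` is separated because there the differential is zero by
bidegree. -/
theorem resDDTot_derBr {p q : ℕ × ℕ} (x : A.resLie.V p) (y : A.resLie.V q)
    (hx : A.resDDTot (A.resDTot p x) = 0) (hy : A.resDDTot (A.resDTot q y) = 0) :
    A.resDDTot (A.resLie.derBr (x, A.resDTot p x) (y, A.resDTot q y)) = 0 := by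
  have mx := resDTot_mem_predSub x
  have my := resDTot_mem_predSub y
  obtain ⟨_ | p, s⟩ := p <;> obtain ⟨_ | q, t⟩ := q
  · rw [eq_zero_of_mem_predSub mx, eq_zero_of_mem_predSub my, derBr_apply]
    simp only [map_zero, smul_zero, sub_zero]
  · obtain ⟨dy, hdy⟩ := exists_of_mem_predSub my
    have hx0 := eq_zero_of_mem_predSub mx
    rw [← hdy, resDDTot_lof] at hy
    rw [← hdy, hx0, derBr_zero_left rfl, resDDTot_lof, map_smul, resDTot_br, hx0, hy, derBr_apply]
    simp only [map_zero, smul_zero, sub_zero]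
  · obtain ⟨dx, hdx⟩ := exists_of_mem_predSub mx
    have hy0 := eq_zero_of_mem_predSub my
    rw [← hdx, resDDTot_lof] at hx
    rw [← hdx, hy0, derBr_zero_right rfl, resDDTot_lof, resDTot_br, hy0, hx, derBr_apply]
    simp only [map_zero, smul_zero, sub_zero]
  · obtain ⟨dx, hdx⟩ := exists_of_mem_predSub mx
    obtain ⟨dy, hdy⟩ := exists_of_mem_predSub my
    rw [← hdy, resDDTot_lof] at hy
    rw [← hdx, resDDTot_lof] at hx
    rw [← hdx, ← hdy, derBr_lof (n := (p + (q + 1), s + t)) rfl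
      (Prod.ext (by change p + 1 + q = p + (q + 1); omega) rfl), resDDTot_lof, map_add, map_smul,
      resDTot_br, resDTot_br, hx, hy, ← hdx, ← hdy, derBr_apply, derBr_apply]
    simp only [map_zero, smul_zero, sub_zero, zero_sub]
    rw [neg_ad_lof rfl, ad_lof rfl, ← add_smul]
    have e : totalDegree (p, s) = p + s := rfl
    rw [e, add_right_comm p 1 s, pow_succ, mul_neg_one, add_neg_cancel, zero_smul]

/-- On `h x` the homotopy relation gives `d d h x = h d d x`, because `gen ∘ aug` commutes with `d`;
the remaining terms cancel. -/
theorem resDDTot_resDTot {i : ℕ × ℕ} (x : A.resLie.V i) : A.resDDTot (A.resDTot i x) = 0 := by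
  induction x using res_induction with
  | gen i a => rw [resDTot_gen, resDDTot_resGenTot_dTot]
  | op i x hx =>
    rw [resDTot_op, map_sub, resDDTot_lof, map_sub, resDTot_gen, resDDTot_resOpTot, hx,
      augTot_resDTot, map_zero, sub_zero, sub_self]
  | zero i => simp only [map_zero]
  | add x y hx hy => simp only [map_add, hx, hy, add_zero]
  | smul c x hx => simp only [map_smul, hx, smul_zero]
  | br h x y hx hy => rw [resDTot_br, resDDTot_derBr x y hx hy]

/-- The differential of the resolution. -/
def resD (A : ConnDBGL.{u}) (p s : ℕ) : A.resLie.V (p + 1, s) →ₗ[ℚ] A.resLie.V (p, s) :=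
  DirectSum.component ℚ (ℕ × ℕ) A.resLie.V (p, s) ∘ₗ A.resDTot (p + 1, s)

theorem lof_resD {p s : ℕ} (x : A.resLie.V (p + 1, s)) :
    DirectSum.lof ℚ (ℕ × ℕ) A.resLie.V (p, s) (A.resD p s x) = A.resDTot (p + 1, s) x := by
  obtain ⟨y, hy⟩ := exists_of_mem_predSub (resDTot_mem_predSub x)
  rw [resD, LinearMap.comp_apply, ← hy, DirectSum.component.lof_self]

theorem resDTot_zero {s : ℕ} (x : A.resLie.V (0, s)) : A.resDTot (0, s) x = 0 :=
  eq_zero_of_mem_predSub (resDTot_mem_predSub x)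

theorem lof_injective (L : GrLie.{u} (ℕ × ℕ) totalDegree) (i : ℕ × ℕ) :
    Function.Injective (DirectSum.lof ℚ (ℕ × ℕ) L.V i) :=
  DirectSum.of_injective i

/-- The free resolution of a DBGL. -/
def res (A : ConnDBGL.{u}) : ConnDBGL.{u} where
  toConnBigrLie := A.resLie.toConnBigrLie res_connected
  d := A.resD
  d_d p s x := lof_injective A.resLie _ (by
    rw [map_zero, lof_resD, ← resDDTot_lof, lof_resD, resDDTot_resDTot])
  leibniz {p q n s t m} h h₁ h₂ k x y := lof_injective A.resLie _ (by
    rw [lof_resD]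
    refine (resDTot_br (p := (p + 1, s)) (q := (q + 1, t)) (Prod.ext h k) x y).trans ?_
    rw [← lof_resD, ← lof_resD, derBr_lof (n := (n, m)) (Prod.ext h₁ k) (Prod.ext h₂ k)])
  leibniz_right_zero {p n s t m} h h₁ k x y := lof_injective A.resLie _ (by
    rw [lof_resD]
    refine (resDTot_br (p := (p + 1, s)) (q := (0, t)) (Prod.ext h k) x y).trans ?_
    rw [← lof_resD, resDTot_zero, derBr_zero_right (n := (n, m)) (Prod.ext h₁ k)])
  leibniz_left_zero {q n s t m} h h₂ k x y := lof_injective A.resLie _ (by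
    rw [lof_resD]
    refine (resDTot_br (p := (0, s)) (q := (q + 1, t)) (Prod.ext h k) x y).trans ?_
    rw [← lof_resD, resDTot_zero, derBr_zero_left (n := (n, m)) (Prod.ext h₂ k)])

theorem aug_resD {p s : ℕ} (x : A.resLie.V (p + 1, s)) :
    A.aug (p, s) (A.resD p s x) = A.d p s (A.aug (p + 1, s) x) :=
  lof_injective A.toGrLie (p, s) (by
    refine (totMap_lof (L := A.resLie) (M := A.toGrLie) A.aug (p, s) _).symm.trans ?_
    rw [lof_resD]
    exact augTot_resDTot x)

/-- The augmentation of the free resolution. -/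
def resAug (A : ConnDBGL.{u}) : A.res ⟶ A :=
  Hom.mk { map := fun p s => A.aug (p, s)
           map_br := fun h k x y => aug_br (Prod.ext h k) x y } fun _ _ x => aug_resD x

theorem resD_resGen {p s : ℕ} (a : A.V (p + 1) s) :
    A.resD p s (A.resGen (p + 1, s) a) = A.resGen (p, s) (A.d p s a) :=
  lof_injective A.resLie (p, s) (by
    rw [lof_resD, resDTot_gen, dTot_succ, totMap_lof])

theorem resD_resOp {p s : ℕ} (x : A.resLie.V (p, s)) (hx : A.resDTot (p, s) x = 0) :
    A.resD p s (A.resOp (p, s) x) = x - A.resGen (p, s) (A.aug (p, s) x) :=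
  lof_injective A.resLie (p, s) (by
    rw [lof_resD]
    exact (resDTot_op (p, s) x).trans (by rw [hx, map_zero, sub_zero]))

theorem resDTot_eq_zero_of_isCycle {p s : ℕ} (x : A.res.V p s) (hx : A.res.IsCycle x) :
    A.resDTot (p, s) x = 0 := by
  rcases p with _ | p
  · exact resDTot_zero x
  · have hx' : A.resD p s x = 0 := hx
    refine (lof_resD (A := A) x).symm.trans ?_
    rw [hx', map_zero]

/-- Including generators is a linear chain section of the augmentation, and `h` is a homotopy from
the other composite to the identity: a cycle `x` satisfies `d (h x) = x - gen (aug x)`. -/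
theorem resAug_weakEquivalence (A : ConnDBGL.{u}) : ConnDBGL.weakEquivalences A.resAug := fun s => by
  refine quasiIso_complexMap _ s (fun p a ha => ⟨A.resGen (p, s) a, 0, ?_, ?_⟩)
    fun p x w hx h => ⟨A.resOp (p, s) x + A.resGen (p + 1, s) w, ?_⟩
  · rcases p with _ | p
    · trivial
    · have ha' : A.d p s a = 0 := ha
      exact (resD_resGen a).trans (by rw [ha', map_zero]; rfl)
  · rw [map_zero, add_zero]
    rfl
  · have h1 := resD_resOp (A := A) x (resDTot_eq_zero_of_isCycle x hx)
    have h2 : A.aug (p, s) x = A.d p s w := h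
    refine Eq.symm ((map_add (A.resD p s) _ _).trans ?_)
    rw [h1, resD_resGen, h2]
    exact sub_add_cancel (G := A.resLie.V (p, s)) x _

end ConnDBGL

namespace ConnDBGL

open GrLie

variable {A B C : ConnDBGL.{u}}

/-! #### Functoriality -/

/-- The target of the map induced by a morphism, as a model. -/
def resMapModel (f : A ⟶ B) : OpLie.{u} totalDegree (fun i => A.V i.1 i.2) ResOp where
  toGrLie := B.resLie
  gen {i} a := B.resGen i ((Hom.toHom f).map i.1 i.2 a)
  op h := (Universal.opLie (IsResModel B)).op h

theorem isResModel_resMapModel (f : A ⟶ B) : IsResModel A (resMapModel f) := fun i =>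
  ⟨B.resGen i ∘ₗ (Hom.toHom f).map i.1 i.2, fun _ => rfl⟩

/-- The map of resolutions induced by a morphism. -/
def resMap (f : A ⟶ B) (i : ℕ × ℕ) : A.resLie.V i →ₗ[ℚ] B.resLie.V i :=
  Universal.eval (resMapModel f) (isResModel_resMapModel f) i

variable (f : A ⟶ B)

theorem resMap_gen (i : ℕ × ℕ) (a : A.V i.1 i.2) :
    resMap f i (A.resGen i a) = B.resGen i ((Hom.toHom f).map i.1 i.2 a) := rfl

theorem resMap_op (i : ℕ × ℕ) (x : A.resLie.V i) :
    resMap f _ (A.resOp i x) = B.resOp i (resMap f i x) :=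
  Universal.eval_op _ (isResModel_resMapModel f) _ x

theorem resMap_br {p q n : ℕ × ℕ} (h : p + q = n) (x : A.resLie.V p) (y : A.resLie.V q) :
    resMap f n (A.resLie.br h x y) = B.resLie.br h (resMap f p x) (resMap f q y) :=
  Universal.eval_br _ (isResModel_resMapModel f) h x y

theorem aug_resMap {i : ℕ × ℕ} (x : A.resLie.V i) :
    B.aug i (resMap f i x) = (Hom.toHom f).map i.1 i.2 (A.aug i x) := by
  induction x using res_induction with
  | gen i a => rfl
  | op i x hx => rw [resMap_op, aug_op, aug_op, map_zero]
  | zero i => simp only [map_zero]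
  | add x y hx hy => simp only [map_add, hx, hy]
  | smul c x hx => simp only [map_smul, hx]
  | br h x y hx hy =>
    rw [resMap_br, aug_br, aug_br, hx, hy]
    exact ((Hom.toHom f).map_br _ _ _ _).symm

theorem totMap_resMap_resGenTot (u : A.toGrLie.Tot) :
    totMap (resMap f) (A.resGenTot u) =
      B.resGenTot (totMap (L := A.toGrLie) (M := B.toGrLie)
        (fun i => (Hom.toHom f).map i.1 i.2) u) :=
  LinearMap.congr_fun (f := totMap (resMap f) ∘ₗ A.resGenTot)
    (g := B.resGenTot ∘ₗ totMap (L := A.toGrLie) (M := B.toGrLie)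
      (fun i => (Hom.toHom f).map i.1 i.2))
    (tot_hom_ext fun i x => by
      rw [LinearMap.comp_apply, LinearMap.comp_apply, totMap_lof, totMap_lof, totMap_lof,
        totMap_lof, resMap_gen]) u

theorem totMap_resMap_resOpTot (u : A.resLie.Tot) :
    totMap (resMap f) (A.resOpTot u) = B.resOpTot (totMap (resMap f) u) :=
  LinearMap.congr_fun (f := totMap (resMap f) ∘ₗ A.resOpTot)
    (g := B.resOpTot ∘ₗ totMap (resMap f))
    (tot_hom_ext fun i x => by
      rw [LinearMap.comp_apply, LinearMap.comp_apply, resOpTot_lof, totMap_lof, totMap_lof,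
        resOpTot_lof, resMap_op]) u

theorem totMap_resMap_resDTot {i : ℕ × ℕ} (x : A.resLie.V i) :
    totMap (resMap f) (A.resDTot i x) = B.resDTot i (resMap f i x) := by
  induction x using res_induction with
  | gen i a => rw [resDTot_gen, totMap_resMap_resGenTot, totMap_dTot, resMap_gen, resDTot_gen]
  | op i x hx =>
    rw [resDTot_op, map_sub, totMap_lof, totMap_resMap_resOpTot, hx, resMap_op, resDTot_op,
      map_sub, resMap_gen, aug_resMap]
  | zero i => simp only [map_zero]
  | add x y hx hy => simp only [map_add, hx, hy]
  | smul c x hx => simp only [map_smul, hx]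
  | br h x y hx hy =>
    rw [resDTot_br, totMap_derBr (resMap f) (resMap_br f), resMap_br, resDTot_br, hx, hy]

/-- The morphism of resolutions induced by a morphism. -/
def resHom : A.res ⟶ B.res :=
  Hom.mk { map := fun p s => resMap f (p, s)
           map_br := fun h k x y => resMap_br f (Prod.ext h k) x y } fun p s x =>
    lof_injective B.resLie (p, s) (by
      refine (totMap_lof (resMap f) (p, s) _).symm.trans ?_
      refine (congrArg (totMap (resMap f)) (lof_resD (A := A) x)).trans ?_
      exact (totMap_resMap_resDTot f x).trans (lof_resD (A := B) _).symm)

theorem hom_ext {f g : A ⟶ B}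
    (h : ∀ p s (x : A.V p s), (Hom.toHom f).map p s x = (Hom.toHom g).map p s x) : f = g :=
  Hom.ext (funext fun p => funext fun s => LinearMap.ext fun x => h p s x)

theorem resMap_id {i : ℕ × ℕ} (x : A.resLie.V i) : resMap (𝟙 A) i x = x := by
  induction x using res_induction with
  | gen i a => rfl
  | op i x hx => rw [resMap_op, hx]
  | zero i => simp only [map_zero]
  | add x y hx hy => simp only [map_add, hx, hy]
  | smul c x hx => simp only [map_smul, hx]
  | br h x y hx hy => rw [resMap_br, hx, hy]

theorem resMap_comp (g : B ⟶ C) {i : ℕ × ℕ} (x : A.resLie.V i) :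
    resMap (f ≫ g) i x = resMap g i (resMap f i x) := by
  induction x using res_induction with
  | gen i a => rfl
  | op i x hx => rw [resMap_op, resMap_op, resMap_op, hx]
  | zero i => simp only [map_zero]
  | add x y hx hy => simp only [map_add, hx, hy]
  | smul c x hx => simp only [map_smul, hx]
  | br h x y hx hy => rw [resMap_br, resMap_br, resMap_br, hx, hy]

/-- The free resolution functor. -/
def resFunctor : ConnDBGL.{u} ⥤ ConnDBGL.{u} where
  obj A := A.res
  map f := resHom f
  map_id _ := hom_ext fun _ _ x => resMap_id x
  map_comp f g := hom_ext fun _ _ x => resMap_comp f g x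

/-- The augmentation of the free resolution functor. -/
def resFunctorAug : resFunctor.{u} ⟶ 𝟭 ConnDBGL.{u} where
  app A := A.resAug
  naturality _ _ f := hom_ext fun _ _ x => aug_resMap f x

/-! #### Freeness -/

/-- The generators of the resolution: bases of the spaces on which it is freely generated. -/
inductive IsResGenerator (A : ConnDBGL.{u}) : ∀ p s : ℕ, A.res.V p s → Prop where
  /-- Generators coming from `A`. -/
  | gen : ∀ (p s : ℕ) (j : Module.Basis.ofVectorSpaceIndex ℚ (A.V p s)),
      IsResGenerator A p s (A.resGen (p, s) (Module.Basis.ofVectorSpace ℚ (A.V p s) j))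
  /-- Generators coming from the operator. -/
  | op : ∀ (p s : ℕ) (j : Module.Basis.ofVectorSpaceIndex ℚ (A.resLie.V (p, s))),
      IsResGenerator A (p + 1) s
        (A.resOp (p, s) (Module.Basis.ofVectorSpace ℚ (A.resLie.V (p, s)) j))

/-- The target of the morphism determined by its values on generators, as a model. -/
def resFreeModel {A : ConnDBGL.{u}} (M : ConnBigrLie.{u}) (g : ∀ p s, A.V p s →ₗ[ℚ] M.V p s)
    (k : ∀ p s, A.resLie.V (p, s) →ₗ[ℚ] M.V (p + 1) s) :
    OpLie.{u} totalDegree (fun i => A.V i.1 i.2) ResOp where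
  V i := A.resLie.V i × M.V i.1 i.2
  br h := LinearMap.mk₂ ℚ (fun x y => (A.resLie.br h x.1 y.1, M.toGrLie.br h x.2 y.2))
    (fun x x' y => Prod.ext (LinearMap.map_add₂ _ _ _ _) (LinearMap.map_add₂ _ _ _ _))
    (fun c x y => Prod.ext (LinearMap.map_smul₂ _ _ _ _) (LinearMap.map_smul₂ _ _ _ _))
    (fun x y y' => Prod.ext (map_add (A.resLie.br h x.1) _ _) (map_add (M.toGrLie.br h x.2) _ _))
    (fun c x y => Prod.ext (map_smul (A.resLie.br h x.1) _ _)
      (map_smul (M.toGrLie.br h x.2) _ _))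
  skew h h' x y := Prod.ext (A.resLie.skew h h' x.1 y.1) (M.toGrLie.skew h h' x.2 y.2)
  jacobi h₁ h₂ h₃ x y z := Prod.ext (A.resLie.jacobi h₁ h₂ h₃ x.1 y.1 z.1)
    (M.toGrLie.jacobi h₁ h₂ h₃ x.2 y.2 z.2)
  gen {i} a := (A.resGen i a, g i.1 i.2 a)
  op {i j} h := ((Universal.opLie (IsResModel A)).op h ∘ₗ LinearMap.fst ℚ _ _).prod
    ((by obtain ⟨rfl⟩ := h; exact k i.1 i.2 : A.resLie.V i →ₗ[ℚ] M.V j.1 j.2) ∘ₗ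
      LinearMap.fst ℚ _ _)

/-- Take as model the product of the resolution with `M`, with an operator that reads only the first
component. The values of `k` may then depend on the full element `x` to which `h` is applied. -/
theorem exists_res_hom (M : ConnBigrLie.{u}) (g : ∀ p s, A.V p s →ₗ[ℚ] M.V p s)
    (k : ∀ p s, A.resLie.V (p, s) →ₗ[ℚ] M.V (p + 1) s) :
    ∃ φ : ConnBigrLie.Hom A.res.toConnBigrLie M,
      (∀ p s a, φ.map p s (A.resGen (p, s) a) = g p s a) ∧
      ∀ p s x, φ.map (p + 1) s (A.resOp (p, s) x) = k p s x := by
  have hM : IsResModel A (resFreeModel M g k) := fun i =>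
    ⟨(A.resGen i).prod (g i.1 i.2), fun _ => rfl⟩
  let e := Universal.eval (resFreeModel M g k) hM
  have he_op : ∀ (i) (x : A.resLie.V i), e _ (A.resOp i x) =
      (A.resOp i (e i x).1, k i.1 i.2 (e i x).1) := fun i x =>
    Universal.eval_op (resFreeModel M g k) hM _ x
  have he_br : ∀ {p q n : ℕ × ℕ} (h : p + q = n) (x : A.resLie.V p) (y : A.resLie.V q),
      e n (A.resLie.br h x y) = (A.resLie.br h (e p x).1 (e q y).1,
        M.toGrLie.br h (e p x).2 (e q y).2) := fun h x y =>
    Universal.eval_br (resFreeModel M g k) hM h x y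
  have fst_e : ∀ {i} (x : A.resLie.V i), (e i x).1 = x := fun {i} x => by
    induction x using res_induction with
    | gen i a => rfl
    | op i x hx => rw [he_op]; exact congrArg _ hx
    | zero i => exact congrArg Prod.fst (map_zero (e i))
    | add x y hx hy => rw [map_add]; exact congrArg₂ (· + ·) hx hy
    | smul c x hx => rw [map_smul]; exact congrArg (c • ·) hx
    | br h x y hx hy => rw [he_br]; exact congrArg₂ (fun a b => A.resLie.br h a b) hx hy
  refine ⟨{ map := fun p s => LinearMap.snd ℚ (A.resLie.V (p, s)) (M.V p s) ∘ₗ e (p, s)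
            map_br := fun h k x y => congrArg Prod.snd (he_br (Prod.ext h k) x y) },
    fun p s a => rfl, fun p s x => ?_⟩
  exact (congrArg Prod.snd (he_op (p, s) x)).trans (congrArg (k p s) (fst_e x))

/-- By `exists_res_hom`, linear maps on `A` and on the image of `h` can be prescribed independently,
hence freely on bases. Uniqueness is an induction over the terms that generate the resolution. -/
theorem isFree_res (A : ConnDBGL.{u}) : A.res.IsFree := by
  refine ⟨fun p s => {x | IsResGenerator A p s x}, fun M f => ?_⟩
  obtain ⟨φ, hg, hk⟩ := exists_res_hom (A := A) M
    (fun p s => (Module.Basis.ofVectorSpace ℚ (A.V p s)).constr ℚ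
      fun j => f p s ⟨_, .gen p s j⟩)
    (fun p s => (Module.Basis.ofVectorSpace ℚ (A.resLie.V (p, s))).constr ℚ
      fun j => f (p + 1) s ⟨_, .op p s j⟩)
  have hφ : ∀ (p s : ℕ) (x : {x | IsResGenerator A p s x}), φ.map p s x = f p s x := by
    rintro p s ⟨_, ⟨p, s, j⟩ | ⟨p, s, j⟩⟩
    · exact (hg _ _ _).trans (Module.Basis.constr_basis _ ℚ _ _)
    · exact (hk _ _ _).trans (Module.Basis.constr_basis _ ℚ _ _)
  refine ⟨φ, hφ, fun ψ hψ => ?_⟩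
  have key : ∀ {i : ℕ × ℕ} (x : A.resLie.V i), ψ.map i.1 i.2 x = φ.map i.1 i.2 x :=
      fun {i} x => by
    induction x using res_induction with
    | gen i a =>
      exact LinearMap.congr_fun (f := ψ.map i.1 i.2 ∘ₗ A.resGen i)
        (g := φ.map i.1 i.2 ∘ₗ A.resGen i)
        ((Module.Basis.ofVectorSpace ℚ (A.V i.1 i.2)).ext fun j =>
          (hψ i.1 i.2 ⟨_, .gen i.1 i.2 j⟩).trans (hφ i.1 i.2 ⟨_, .gen i.1 i.2 j⟩).symm) a
    | op i x hx =>
      exact LinearMap.congr_fun (f := ψ.map (i.1 + 1) i.2 ∘ₗ A.resOp i)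
        (g := φ.map (i.1 + 1) i.2 ∘ₗ A.resOp i)
        ((Module.Basis.ofVectorSpace ℚ (A.resLie.V i)).ext fun j =>
          (hψ (i.1 + 1) i.2 ⟨_, .op i.1 i.2 j⟩).trans
            (hφ (i.1 + 1) i.2 ⟨_, .op i.1 i.2 j⟩).symm) x
    | zero i => exact (map_zero (ψ.map i.1 i.2)).trans (map_zero (φ.map i.1 i.2)).symm
    | add x y hx hy =>
      exact (map_add (ψ.map _ _) _ _).trans ((congrArg₂ (· + ·) hx hy).trans
        (map_add (φ.map _ _) _ _).symm)
    | smul c x hx =>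
      exact (map_smul (ψ.map _ _) _ _).trans ((congrArg (c • ·) hx).trans
        (map_smul (φ.map _ _) _ _).symm)
    | br h x y hx hy =>
      exact (ψ.map_br (congrArg Prod.fst h) (congrArg Prod.snd h) x y).trans
        ((congrArg₂ (fun a b => M.toGrLie.br h a b) hx hy).trans
          (φ.map_br (congrArg Prod.fst h) (congrArg Prod.snd h) x y).symm)
  exact ConnBigrLie.Hom.ext (funext fun p => funext fun s => LinearMap.ext fun x => key x)

end ConnDBGL

/-! ### Assembly -/

theorem mainTheorem7 :
    ∃ (N : SConnGrLie.{u} ⥤ ConnDBGL.{u}) (Nstar : ConnDBGL.{u} ⥤ SConnGrLie.{u})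
      (adj : Nstar ⊣ N)
      (hN : SConnGrLie.weakEquivalences.{u} ≤
        ConnDBGL.weakEquivalences.{u}.inverseImage N),
      -- `N` is the Moore complex functor, with the shuffle bracket
      Nonempty (MooreRealization N) ∧
      -- `N` and `Nstar` induce inverse equivalences of homotopy categories
      (let Φ : LocalizerMorphism SConnGrLie.weakEquivalences.{u} ConnDBGL.weakEquivalences.{u} :=
          ⟨N, hN⟩
        let Qs := SConnGrLie.weakEquivalences.{u}.Q
        let Qd := ConnDBGL.weakEquivalences.{u}.Q
        let RN : HoSConnGrLie.{u} ⥤ HoConnDBGL.{u} := Φ.localizedFunctor Qs Qd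
        let β : N ⋙ Qd ≅ Qs ⋙ RN := (Φ.catCommSq Qs Qd).iso
        ∃ (LN : HoConnDBGL.{u} ⥤ HoSConnGrLie.{u}) (α : Qd ⋙ LN ⟶ Nstar ⋙ Qs)
          (hoAdj : LN ⊣ RN),
          LN.IsLeftDerivedFunctor α ConnDBGL.weakEquivalences.{u} ∧
          (∀ A : ConnDBGL.{u}, hoAdj.unit.app (Qd.obj A) ≫ RN.map (α.app A) =
            Qd.map (adj.unit.app A) ≫ β.hom.app (Nstar.obj A)) ∧
          (∀ B : SConnGrLie.{u}, LN.map (β.hom.app B) ≫ hoAdj.counit.app (Qs.obj B) =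
            α.app (N.obj B) ≫ Qs.map (adj.counit.app B)) ∧
          LN.IsEquivalence ∧ RN.IsEquivalence) ∧
      -- `Nstar` preserves freeness
      ∀ A : ConnDBGL.{u}, A.IsFree → SConnGrLie.IsFree (Nstar.obj A) := by
  refine ⟨SConnGrLie.mooreFunctor, ConnDBGL.nstar, ConnDBGL.nstarAdj,
    fun _ _ f hf => (SConnGrLie.weakEquivalences_iff f).2 hf, ⟨SConnGrLie.mooreRealization⟩, ?_,
    fun _ hA => ConnDBGL.isFree_nstarObj hA⟩
  exact exists_derived_equivalence ConnDBGL.nstarAdj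
    (fun f hf => (SConnGrLie.weakEquivalences_iff f).1 hf) ConnDBGL.resFunctorAug
    ConnDBGL.resAug_weakEquivalence
    (fun A => (ConnDBGL.isFree_res A).nstarUnit_weakEquivalence) _ _ _ _

end
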